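/- Let $M$ be an even integral lattice of signature $(2,n)$ with pairing $\langle\cdot,\cdot\rangle$, dual lattice $M'$, and Weil representation $\rho$ of $\mathrm{Mp}_2(\mathbb Z)$ on $\mathbb C[M'/M]$ given by $$\rho(T)e_x=e^{\pi i\langle x,x\rangle}e_x,\qquad \rho(S)e_x=\frac{e^{-\pi i(2-n)/4}}{\sqrt{|M'/M|}}\sum_{y\in M'/M}e^{-2\pi i\langle x,y\rangle}e_y .$$ **Input.** Let $k\ge 2$ be an integer, $\kappa=k+1-n/2$, $\tau=x+iy$, and $L^{\mathrm{Maa\ss}}=-2iy^2\,\partial/\partial\bar\tau$. Let $F=\sum_\gamma F_\gamma e_\gamma:\mathbb H\to\mathbb C[M'/M]$ be an almost-holomorphic modular form of weight $\kappa$ for $\rho$: $F$ is smooth, $(L^{\mathrm{Maa\ss}})^\ell F=0$ for some $\ell$, $F(\tau+1)=\rho(T)F(\tau)$, $F(-1/\tau)=\sqrt{\tau}^{\,2\kappa}\rho(S)F(\tau)$, and $F$ has at most exponential growth as $y\to\infty$. Write $F_\gamma=\sum_{t}\sum_{m}c^{(t)}(m,\gamma)\,q^m(2\pi y)^{-t}$.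 **Theta lift.** Let $\mathrm{Aff}(\mathcal D)$ be the cone of all $Z\in M_{\mathbb C}$ with $\langle Z,Z\rangle=0$ and $\langle Z,\bar Z\rangle>0$ (both components are allowed), and $|Z|^2=\frac12\langle Z,\bar Z\rangle$. Let $\lambda_Z$ be the orthogonal projection of $\lambda \in M_{\mathbb R}$ to the plane spanned by $\mathrm{Re}\,Z,\mathrm{Im}\,Z$, let $\lambda_Z^\perp=\lambda-\lambda_Z$, and for $j\ge0$ put $$\Theta_j(\tau,Z)=y^{n/2}\sum_{\lambda\in M'}\langle\lambda,Z\rangle^j e^{\pi i\tau\langle\lambda_Z,\lambda_Z\rangle+\pi i\bar\tau\langle\lambda_Z^\perp,\lambda_Z^\perp\rangle}e_{\lambda+M}.$$ For $G$ of weight $\kappa_j=j+1-n/2$ put $$\mathrm{Lift}(G)(Z)=\frac12\Big(\frac i2\langle Z,\bar Z\rangle\Big)^{-j}\int^{\mathrm{reg}}y^{\kappa_j}\sum_{\gamma}G_\gamma\,\overline{\Theta_{j,\gamma}(\tau,Z)}\,\frac{dx\,dy}{y^2}.$$ Here $\int^{\mathrm{reg}}f\,\frac{dx\,dy}{y^2}$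 is Borcherds' regularized integral: the constant term at $s=0$ of the meromorphic continuation to $\mathbb C$ of $\lim_{h\to\infty}\int_{\mathcal F_h}f\,y^{-s}\frac{dx\,dy}{y^2}$, $\mathrm{Re}(s)\gg0$, with $\mathcal F_h=\{|\tau|>1,\ |x|<\frac12,\ 0<y<h\}$. Apply this to $F$ with $j=k$ and to $L^{\mathrm{Maa\ss}}F$ with $j=k-2$. **Operators.** Sections of $\mathcal L^j$ are functions $f$ on the cone with $f(cZ)=c^{-j}f(Z)$. Sections of $\mathcal L^{j}\otimes\mathcal E$, where $\mathcal E_Z=Z^\perp/\mathbb CZ$, are differentials $\sum a_i(Z)\,dZ_i$ with $a_i$ of degree $-j$ that vanish on the vector $Z$, taken modulo $d\langle Z,Z\rangle$; that is, $\mathbb C$-linear functionals on $Z^\perp$ vanishing at $Z$. The orthogonal lowering and raising operators on a section $f$ of $\mathcal L^j$ are $$\mathsf L_j f=|Z|^2\varphi(\bar\partial f),\qquad \mathsf R_j f=|Z|^{-2j}\,\partial\big(|Z|^{2j}f\big),$$ where $\varphi$ replaces $d\bar Z_i$ by $dZ_i-Z_i\,\frac{\langle\bar Z,dZ\rangle}{2|Z|^2}$.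 **Theorem.** Let $U\subset\mathrm{Aff}(\mathcal D)$ be the complement of the hyperplanes $\lambda^\perp$ with $0\ne\lambda\in M'$ and $c^{(t)}(\tfrac12\langle\lambda,\lambda\rangle,\lambda+M)\ne0$ for some $t$. On $U$ the regularized integrals defining $\mathrm{Lift}(F)$ and $\mathrm{Lift}(L^{\mathrm{Maa\ss}}F)$ exist, these lifts are smooth sections of $\mathcal L^k$ and $\mathcal L^{k-2}$, and $$\mathsf L_k[\mathrm{Lift}(F)]=-\frac1{2\pi}\,\mathsf R_{k-2}\big[\mathrm{Lift}(L^{\mathrm{Maa\ss}}F)\big].$$ -/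

import Mathlib

open scoped ContDiff
open Complex Filter Topology MeasureTheory
open UpperHalfPlane hiding I

noncomputable section

namespace ThetaLift

/-! ## Even lattices of signature `(2, n)` -/

/-- The bilinear form with integral Gram matrix `G`, with coefficients extended to a commutative
ring `R`. -/
def gramForm {ι R : Type*} [Fintype ι] [CommRing R] (G : Matrix ι ι ℤ) (x y : ι → R) : R :=
  ∑ i, ∑ j, x i * (G i j : R) * y j

/-- An even lattice of signature `(2, n)`, given through a `ℤ`-basis: the underlying group is
`ℤ ^ (n + 2)` and the pairing is that of the Gram matrix `gram`. The matrix `P` of `signature` is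
automatically invertible, since the right-hand side is. -/
structure EvenLattice (n : ℕ) where
  /-- the Gram matrix `⟨e_i, e_j⟩` -/
  gram : Matrix (Fin (n + 2)) (Fin (n + 2)) ℤ
  symm : gram.transpose = gram
  even : ∀ i, Even (gram i i)
  signature : ∃ P : Matrix (Fin (n + 2)) (Fin (n + 2)) ℝ,
    P.transpose * gram.map (fun a : ℤ => (a : ℝ)) * P =
      Matrix.diagonal (fun i : Fin (n + 2) => if (i : ℕ) < 2 then (1 : ℝ) else -1)

variable {n : ℕ}

/-- The real space `M_ℝ`. -/
abbrev RealSpace (n : ℕ) : Type := Fin (n + 2) → ℝ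

/-- The complex space `M_ℂ`. -/
abbrev CplxSpace (n : ℕ) : Type := Fin (n + 2) → ℂ

/-- The inclusion `M_ℝ ⊆ M_ℂ`. -/
def toCplx (x : RealSpace n) : CplxSpace n := fun i => (x i : ℂ)

/-- Complex conjugation on `M_ℂ` with respect to the real form `M_ℝ`. -/
def cconj (Z : CplxSpace n) : CplxSpace n := fun i => (starRingEnd ℂ) (Z i)

namespace EvenLattice

variable (M : EvenLattice n)

/-- The pairing on `M_ℝ`. -/
def bR (x y : RealSpace n) : ℝ := gramForm M.gram x y

/-- The `ℂ`-bilinear pairing on `M_ℂ`. -/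
def bC (Z W : CplxSpace n) : ℂ := gramForm M.gram Z W

theorem gram_det_ne_zero : M.gram.det ≠ 0 := by
  obtain ⟨P, hP⟩ := M.signature
  intro h
  have h1 := congrArg Matrix.det hP
  have h2 : (M.gram.map (fun a : ℤ => (a : ℝ))).det = 0 := by
    have := (Int.castRingHom ℝ).map_det M.gram
    rw [h] at this
    simpa [RingHom.mapMatrix_apply] using this.symm
  rw [Matrix.det_mul, Matrix.det_mul, h2, Matrix.det_diagonal] at h1
  have h3 : (∏ i : Fin (n + 2), if (i : ℕ) < 2 then (1 : ℝ) else -1) ≠ 0 := by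
    refine Finset.prod_ne_zero_iff.mpr fun i _ => ?_
    split_ifs <;> norm_num
  apply h3
  rw [← h1]
  ring

/-- The lattice `M` inside `M_ℝ`. -/
def lattice (_M : EvenLattice n) : AddSubgroup (RealSpace n) where
  carrier := {x | ∀ i, ∃ a : ℤ, x i = a}
  zero_mem' := fun _ => ⟨0, by simp⟩
  add_mem' := by
    intro x y hx hy i
    obtain ⟨a, ha⟩ := hx i
    obtain ⟨b, hb⟩ := hy i
    exact ⟨a + b, by simp [ha, hb]⟩
  neg_mem' := by
    intro x hx i
    obtain ⟨a, ha⟩ := hx i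
    exact ⟨-a, by simp [ha]⟩

/-- The dual lattice `M'` of all `x ∈ M_ℝ` with `⟨x, m⟩ ∈ ℤ` for all `m ∈ M`. -/
def dual : AddSubgroup (RealSpace n) where
  carrier := {x | ∀ m ∈ M.lattice, ∃ a : ℤ, M.bR x m = a}
  zero_mem' := fun _ _ => ⟨0, by simp [bR, gramForm]⟩
  add_mem' := by
    intro x y hx hy m hm
    obtain ⟨a, ha⟩ := hx m hm
    obtain ⟨b, hb⟩ := hy m hm
    refine ⟨a + b, ?_⟩
    push_cast
    rw [← ha, ← hb]
    simp [bR, gramForm, add_mul, Finset.sum_add_distrib]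
  neg_mem' := by
    intro x hx m hm
    obtain ⟨a, ha⟩ := hx m hm
    refine ⟨-a, ?_⟩
    push_cast
    rw [← ha]
    simp [bR, gramForm, Finset.sum_neg_distrib]

/-- The discriminant group `M' / M`. -/
abbrev Disc : Type := M.dual ⧸ M.lattice.addSubgroupOf M.dual

/-- The class `λ + M ∈ M' / M` of a vector `λ ∈ M'`. -/
abbrev cls (l : M.dual) : M.Disc := QuotientAddGroup.mk l

theorem gram_mulVec_int (x : M.dual) (i : Fin (n + 2)) :
    ∃ a : ℤ, (M.gram.map (fun a : ℤ => (a : ℝ))).mulVec x.1 i = a := by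
  obtain ⟨a, ha⟩ := x.2 (Pi.single i 1) (fun j => by
    by_cases h : j = i
    · subst h; exact ⟨1, by simp⟩
    · exact ⟨0, by simp [h]⟩)
  refine ⟨a, ?_⟩
  rw [← ha]
  have hs : ∀ j, M.gram i j = M.gram j i := fun j => congrFun (congrFun M.symm j) i
  simp [bR, gramForm, Matrix.mulVec, dotProduct, Pi.single_apply, hs, mul_comm]

instance : Finite M.Disc := by
  classical
  choose a ha using M.gram_mulVec_int
  have hd : M.gram.det.natAbs ≠ 0 := Int.natAbs_ne_zero.mpr M.gram_det_ne_zero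
  have : NeZero M.gram.det.natAbs := ⟨hd⟩
  let f : M.Disc → (Fin (n + 2) → ZMod M.gram.det.natAbs) := fun g i => (a g.out i : ZMod _)
  refine Finite.of_injective f ?_
  intro g g' h
  rw [← Quotient.out_eq' g, ← Quotient.out_eq' g']
  apply Quotient.sound'
  rw [QuotientAddGroup.leftRel_apply, AddSubgroup.mem_addSubgroupOf]
  set x := g.out
  set y := g'.out
  have h1 : ∀ i, ∃ m : ℤ, a y i - a x i = M.gram.det * m := by
    intro i
    have h2 : ((a y i - a x i : ℤ) : ZMod M.gram.det.natAbs) = 0 := by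
      push_cast
      rw [sub_eq_zero]
      exact (congrFun h i).symm
    rw [ZMod.intCast_zmod_eq_zero_iff_dvd] at h2
    exact Int.natAbs_dvd.mp h2
  choose m hm using h1
  set GR : Matrix (Fin (n + 2)) (Fin (n + 2)) ℝ := M.gram.map (fun a : ℤ => (a : ℝ)) with hGR
  have hdet : GR.det = (M.gram.det : ℝ) := by
    have := (Int.castRingHom ℝ).map_det M.gram
    simpa [RingHom.mapMatrix_apply] using this.symm
  have hdetR : (M.gram.det : ℝ) ≠ 0 := by exact_mod_cast M.gram_det_ne_zero
  have h3 : GR.mulVec (y.1 - x.1) = (M.gram.det : ℝ) • (fun i => (m i : ℝ)) := by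
    ext i
    rw [Matrix.mulVec_sub, Pi.sub_apply, ha, ha]
    have := hm i
    simp only [Pi.smul_apply, smul_eq_mul]
    exact_mod_cast this
  have h4 : (M.gram.det : ℝ) • (y.1 - x.1) =
      (M.gram.det : ℝ) • (GR.adjugate.mulVec (fun i => (m i : ℝ))) := by
    rw [← Matrix.mulVec_smul, ← h3, Matrix.mulVec_mulVec, Matrix.adjugate_mul, hdet,
      Matrix.smul_mulVec, Matrix.one_mulVec]
  have h5 := smul_right_injective _ hdetR h4
  intro i
  have hadj : GR.adjugate = M.gram.adjugate.map (fun a : ℤ => (a : ℝ)) := by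
    have := (Int.castRingHom ℝ).map_adjugate M.gram
    simpa [RingHom.mapMatrix_apply] using this.symm
  refine ⟨M.gram.adjugate.mulVec m i, ?_⟩
  have h6 : (((-x + y : M.dual) : RealSpace n)) i = (y.1 - x.1) i := by
    simp [sub_eq_add_neg, add_comm]
  rw [h6, h5, hadj]
  simp [Matrix.mulVec, dotProduct]

instance : Fintype M.Disc := Fintype.ofFinite _

/-! ## The finite Weil representation on `ℂ[M' / M]` and modular forms -/

/-- The matrix entry `e ^ (π i ⟨x, x⟩)` of `ρ(T)`. By evenness of `M` it does not depend on the
representative of the class `x`. -/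
def weilT (x : M.Disc) : ℂ :=
  cexp (Real.pi * I * (M.bR (x.out : M.dual) (x.out : M.dual) : ℝ))

/-- The matrix entry of `ρ(S)` at `(x, y)`, for a lattice of signature `σ = 2 - n`:
`e ^ (-π i σ / 4) |M' / M| ^ (-1/2) e ^ (-2 π i ⟨x, y⟩)`. It does not depend on representatives. -/
def weilS (x y : M.Disc) : ℂ :=
  cexp (-(Real.pi * I * (2 - n) / 4)) / (Real.sqrt (Fintype.card M.Disc) : ℂ) *
    cexp (-(2 * Real.pi * I * (M.bR (x.out : M.dual) (y.out : M.dual) : ℝ)))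

end EvenLattice

variable (M : EvenLattice n)

/-- The derivative `∂f/∂τ̄ = (∂f/∂x + i ∂f/∂y) / 2` of a function on the upper half-plane. -/
def dTauBar (f : ℍ → ℂ) (τ : ℍ) : ℂ :=
  (1 / 2) * (fderiv ℝ (fun z : ℂ => f (ofComplex z)) (τ : ℂ) 1 +
    I * fderiv ℝ (fun z : ℂ => f (ofComplex z)) (τ : ℂ) I)

/-- The Maass lowering operator `-2 i y² ∂/∂τ̄`, componentwise on `ℂ[M' / M]`-valued functions. -/
def maassLower (F : ℍ → M.Disc → ℂ) : ℍ → M.Disc → ℂ := fun τ γ =>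
  -2 * I * (τ.im : ℂ) ^ 2 * dTauBar (fun τ' => F τ' γ) τ

/-- `F = ∑_γ F_γ e_γ` is an almost-holomorphic modular form of weight `w / 2` for the Weil
representation of `M`, without poles in `ℍ` and with at most exponential growth at the cusp.
Modularity is stated for the generators `T` and `S = ((0, -1; 1, 0), √τ)` of `Mp₂(ℤ)`. -/
structure IsAlmostHolModularForm (w : ℤ) (F : ℍ → M.Disc → ℂ) : Prop where
  smooth : ∀ γ, ContDiffOn ℝ ∞ (fun z : ℂ => F (ofComplex z) γ) {z : ℂ | 0 < z.im}
  almostHol : ∃ l : ℕ, (maassLower M)^[l] F = 0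
  map_T : ∀ (τ : ℍ) (γ : M.Disc), F (ModularGroup.T • τ) γ = M.weilT γ * F τ γ
  map_S : ∀ (τ : ℍ) (γ : M.Disc), F (ModularGroup.S • τ) γ =
    ((τ : ℂ) ^ (1 / 2 : ℂ)) ^ w * ∑ δ, M.weilS δ γ * F τ δ
  growth : ∃ C A : ℝ, ∀ (τ : ℍ) (γ : M.Disc), 1 ≤ τ.im → ‖F τ γ‖ ≤ C * Real.exp (A * τ.im)

/-! ## The affine cone over the period domain -/

/-- The affine cone `{Z ∈ M_ℂ | Z · Z = 0, Z · Z̄ > 0}` over the period domain. Both connected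
components are kept; each of them is open in this set. -/
def cone : Set (CplxSpace n) := {Z | M.bC Z Z = 0 ∧ 0 < (M.bC Z (cconj Z)).re}

/-- `|Z|² = (Z · Z̄) / 2`. -/
def absSq (Z : CplxSpace n) : ℝ := (M.bC Z (cconj Z)).re / 2

/-- The tangent space `Z^⊥ = {v | v · Z = 0}` of the cone at `Z`. -/
def tangent (Z : CplxSpace n) : Set (CplxSpace n) := {v | M.bC v Z = 0}

/-- A smooth section of `𝓛 ^ k` over the image of `U` in the period domain, where `U` is a subset of
the cone: a smooth function on `U` with `f (c Z) = c ^ (-k) f Z`. -/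
def IsSmoothSection (k : ℤ) (U : Set (CplxSpace n)) (f : CplxSpace n → ℂ) : Prop :=
  ContDiffOn ℝ ∞ f U ∧
    ∀ Z ∈ U, ∀ c : ℂ, c ≠ 0 → c • Z ∈ U ∧ f (c • Z) = c ^ (-k) * f Z

/-! Sections of `𝓔 ⊗ 𝓛 ^ j` are written as differentials `∑ a_i(Z) dZ_i` on the cone, with `a_i` of
degree `-j`, that vanish on `v = Z` and are taken modulo `d(Z · Z)`. Equivalently, at each point `Z`
of the cone they are `ℂ`-linear functionals `v ↦ ∑ a_i(Z) v_i` on `tangent M Z` that vanish at `Z`.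
Two sections agree when these functionals agree on `tangent M Z` for all `Z`. -/

/-- The `(1, 0)`-part `∂f` of the differential of a function on the cone, evaluated at the tangent
vector `v ∈ tangent M Z`. -/
def del (f : CplxSpace n → ℂ) (Z v : CplxSpace n) : ℂ :=
  (1 / 2) * (fderivWithin ℝ f (cone M) Z v - I * fderivWithin ℝ f (cone M) Z (I • v))

/-- The `(0, 1)`-part `∂̄f = ∑ b_i dZ̄_i` of the differential of a function on the cone, evaluated at
the tangent vector `v ∈ tangent M Z`. It is conjugate-linear in `v`. -/
def delBar (f : CplxSpace n → ℂ) (Z v : CplxSpace n) : ℂ :=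
  (1 / 2) * (fderivWithin ℝ f (cone M) Z v + I * fderivWithin ℝ f (cone M) Z (I • v))

/-- `φ : 𝓔̄ → 𝓔`, the contraction with `2|Z|² H`, `H = ∂∂̄ log |Z|²`. In coordinates it sends
`∑ b_k dZ̄_k` to `∑ b_k R̄_{kj} dZ_j` with `R̄_{kj} = δ_{kj} - Z_k ∑_b g_{jb} Z̄_b / (2|Z|²)`. So its
value at `v` is the value of `∑ b_k dZ̄_k` at the conjugate of `v - (⟨v, Z̄⟩ / (2|Z|²)) Z`, which
again lies in `tangent M Z` when `v` does. -/
def phi (b : CplxSpace n → ℂ) (Z v : CplxSpace n) : ℂ :=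
  b (cconj (v - (M.bC v (cconj Z) / (2 * (absSq M Z : ℂ))) • Z))

/-- The orthogonal lowering operator `𝖫 = |Z|² φ ∘ ∂̄` from sections of `𝓛 ^ k` to sections of
`𝓛 ^ (k - 1) ⊗ 𝓔` (the formula does not involve `k`). -/
def lowering (f : CplxSpace n → ℂ) (Z v : CplxSpace n) : ℂ :=
  (absSq M Z : ℂ) * phi M (delBar M f Z) Z v

/-- The orthogonal raising operator `𝖱_k = |Z|^(-2k) ∘ ∂ ∘ |Z|^(2k)` from sections of `𝓛 ^ k` to
sections of `𝓛 ^ (k + 1) ⊗ 𝓔`. -/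
def raising (k : ℤ) (f : CplxSpace n → ℂ) (Z v : CplxSpace n) : ℂ :=
  (absSq M Z : ℂ) ^ (-k) * del M (fun Z' => (absSq M Z' : ℂ) ^ k * f Z') Z v

/-! ## The theta kernel -/

/-- The projection `x_Z = (⟨x, Z⟩ Z̄ + ⟨x, Z̄⟩ Z) / ⟨Z, Z̄⟩` of `x ∈ M_ℝ` to the positive definite
plane spanned by the real and imaginary part of `Z`. -/
def projZ (x : RealSpace n) (Z : CplxSpace n) : CplxSpace n :=
  (M.bC Z (cconj Z))⁻¹ •
    (M.bC (toCplx x) Z • cconj Z + M.bC (toCplx x) (cconj Z) • Z)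

/-- The complementary projection `x - x_Z`. -/
def projPerp (x : RealSpace n) (Z : CplxSpace n) : CplxSpace n := toCplx x - projZ M x Z

/-- The theta kernel `Θ_k(τ, Z)`, with component `Θ_{k, γ}` at `γ ∈ M' / M`. -/
def thetaKernel (k : ℕ) (Z : CplxSpace n) : ℍ → M.Disc → ℂ := fun τ γ =>
  ((τ.im ^ ((n : ℝ) / 2) : ℝ) : ℂ) *
    ∑' l : {l : M.dual // M.cls l = γ},
      M.bC (toCplx (l.1 : RealSpace n)) Z ^ k *
        cexp (Real.pi * I * (τ : ℂ) *
            M.bC (projZ M (l.1 : RealSpace n) Z) (projZ M (l.1 : RealSpace n) Z) +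
          Real.pi * I * (starRingEnd ℂ) (τ : ℂ) *
            M.bC (projPerp M (l.1 : RealSpace n) Z) (projPerp M (l.1 : RealSpace n) Z))

/-- `[F, G] = y ^ κ ∑_γ F_γ(τ) conj (G_γ(τ))` for forms of weight `κ`. -/
def pairing (κ : ℝ) (F G : ℍ → M.Disc → ℂ) : ℍ → ℂ := fun τ =>
  ((τ.im ^ κ : ℝ) : ℂ) * ∑ γ, F τ γ * (starRingEnd ℂ) (G τ γ)

/-! ## The regularized integral and the theta lift -/

/-- The truncated fundamental domain `{|τ| > 1, |x| < 1/2, 0 < y < h}` of `SL₂(ℤ)`. -/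
def truncDomain (h : ℝ) : Set ℂ := {z | 1 < ‖z‖ ∧ |z.re| < 1 / 2 ∧ 0 < z.im ∧ z.im < h}

/-- The integral of `f(τ) y ^ (-s) dx dy / y²` over the truncated fundamental domain. -/
def truncIntegral (f : ℍ → ℂ) (s : ℂ) (h : ℝ) : ℂ :=
  ∫ z in truncDomain h, f (ofComplex z) * (z.im : ℂ) ^ (-s) / (z.im : ℂ) ^ 2

/-- `c` is the constant term of the Laurent expansion of the meromorphic function `Φ` at `0`. -/
def IsConstantTermAtZero (Φ : ℂ → ℂ) (c : ℂ) : Prop :=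
  ∃ (N : ℕ) (a : ℕ → ℂ),
    Tendsto (fun s => Φ s - ∑ j ∈ Finset.Icc 1 N, a j / s ^ j) (𝓝[≠] 0) (𝓝 c)

/-- `c` is the regularized integral of `f dx dy / y²` over `SL₂(ℤ) \ ℍ`: the limit for `h → ∞` of
`truncIntegral f s h` exists for `Re s` large, it continues to a meromorphic function `Φ` on `ℂ`,
and `c` is the constant term of `Φ` at `s = 0`. -/
def IsRegIntegral (f : ℍ → ℂ) (c : ℂ) : Prop :=
  ∃ (σ : ℝ) (Φ : ℂ → ℂ), Meromorphic Φ ∧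
    (∀ s : ℂ, σ < s.re → Tendsto (truncIntegral f s) atTop (𝓝 (Φ s))) ∧
    IsConstantTermAtZero Φ c

open Classical in
/-- The regularized integral of `f dx dy / y²`, and `0` if it does not exist. -/
def regIntegral (f : ℍ → ℂ) : ℂ :=
  if h : ∃ c, IsRegIntegral f c then h.choose else 0

/-- The integrand `[F, Θ_k(·, Z)]` of the theta lift, for `F` of weight `k + 1 - n / 2`. -/
def liftIntegrand (k : ℕ) (F : ℍ → M.Disc → ℂ) (Z : CplxSpace n) : ℍ → ℂ :=
  pairing M ((k : ℝ) + 1 - (n : ℝ) / 2) F (thetaKernel M k Z)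

/-- The theta lift `½ ((i/2) ⟨Z, Z̄⟩) ^ (-k) ∫^reg [F, Θ_k] dx dy / y²` of a form `F` of weight
`k + 1 - n / 2`, as a function on the cone. -/
def lift (k : ℕ) (F : ℍ → M.Disc → ℂ) (Z : CplxSpace n) : ℂ :=
  (1 / 2) * (((I / 2) * M.bC Z (cconj Z)) ^ k)⁻¹ * regIntegral (liftIntegrand M k F Z)

/-- The coefficient of `e ^ (2 π i m x)` in the Fourier expansion of `F_γ(x + i y)` in `x`, as a
function of `y` (for `m ∈ ⟨γ, γ⟩ / 2 + ℤ`). If `F = ∑_t F^(t) (2 π y) ^ (-t)` and `F^(t)_γ` has the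
coefficients `c^(t)(m, γ)`, it equals `∑_t c^(t)(m, γ) (2 π y) ^ (-t) e ^ (-2 π m y)`. -/
def fourierCoeff (F : ℍ → M.Disc → ℂ) (γ : M.Disc) (m y : ℝ) : ℂ :=
  ∫ x in (0 : ℝ)..1, F (ofComplex ((x : ℂ) + (y : ℂ) * I)) γ * cexp (-(2 * Real.pi * I * m * x))

/-- The complement in the cone of the singular hyperplanes of the theta lift of `F`: these are the
`λ^⊥` for nonzero `λ ∈ M'` such that some coefficient `c^(t)(⟨λ, λ⟩ / 2, λ + M)` of `F` is nonzero.
(Only `λ` of negative norm matter, since `λ^⊥` misses the cone for all other `λ ≠ 0`.) -/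
def regularSet (F : ℍ → M.Disc → ℂ) : Set (CplxSpace n) :=
  {Z | Z ∈ cone M ∧ ∀ l : M.dual, l ≠ 0 → M.bC (toCplx (l : RealSpace n)) Z = 0 →
    ∀ y : ℝ, 0 < y → fourierCoeff M F (M.cls l) (M.bR (l : RealSpace n) l / 2) y = 0}

end ThetaLift

end

/-!
The theta lift is unfolded into a sum over `λ ∈ M'`. For `Z` in the cone, the summand of `λ` in the
lift of `F` is `F_λ(τ) e ^ (-π i τ ⟨λ, λ⟩)` times a kernel
`y ^ (k + 1) ⟨λ, Z̄⟩ ^ k e ^ (-2 π y κ)`, `κ = 2 ⟨λ, Z⟩ ⟨λ, Z̄⟩ / ⟨Z, Z̄⟩` (`twist`, `kern`,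
`truncIntegral_eq_tsum`). The kernel stays meaningful when `Z̄` is replaced by an independent
variable `W`, and then depends holomorphically on `(Z, W)`.

*Existence and smoothness.* The fundamental domain is cut at height `2`. Over the compact part the
summands are dominated by a Gaussian in `λ` (`exists_compact_bound`). Over the cusp the integration
in `x` leaves a Fourier coefficient of `F`, which is `e ^ (-π y ⟨λ, λ⟩)` times a polynomial in `1 / y`
because a power of the lowering operator annihilates `F`. For `λ ≠ 0` the resulting integral
converges absolutely and locally uniformly off the singular hyperplanes (`exists_tail_bound`); for
`λ = 0` it is a combination of the functions `2 ^ (-(t + s)) / (t + s)`, independent of `Z`. So the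
regularized integral is a constant plus the value at `s = 0` of a function `liftSum` that is
holomorphic in `(s, Z, W)` (`isRegIntegral_liftIntegrand`). In particular the lifts are smooth, and
their derivatives in `Z` and in `Z̄` are the derivatives of `liftSum` in `Z` and in `W`, computed
termwise under the integral.

*The identity.* For a tangent vector `v` put `u = v - (⟨v, Z̄⟩ / ⟨Z, Z̄⟩) Z`, which is orthogonal to `Z`
and to `Z̄`, and `ψ_λ(y) = y ^ k ⟨λ, Z̄⟩ ^ (k - 1) ⟨λ, u⟩ e ^ (-2 π y κ)` (`bdry`). The derivative of the
kernel of degree `k` in `W` along `u` is `y ^ 2 ψ_λ'(y)`, and the derivative of the kernel of degree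
`k - 2` in `Z` along `v` is `-4 π ψ_λ(y) / ⟨Z, Z̄⟩`. Hence the two sides of the identity differ by
integrals of exact forms, of `d (F_λ e ^ (-π i τ ⟨λ, λ⟩) ψ_λ(y) dτ)`. Stokes' theorem
(`stokes_truncDomain`) leaves boundary terms: those on the vertical sides cancel by periodicity, those
at height `2` cancel against the integrals over the cusp (`IsAdmissible.integral_tail`), and there
remains the integral over the arc `|τ| = 1` of a theta series with polynomial
`⟨λ, Z̄⟩ ^ (k - 1) ⟨λ, u⟩`. This polynomial is harmonic, so Poisson summation gives the series the
transformation law of a form of weight two (`thetaSum_neg_one_div`). On the unit circle `τ ↦ -1 / τ` is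
the reflection `τ ↦ -τ̄`, and the law says that the integrand over the arc is odd
(`hasSum_arcInt`).

Functions on the cone are differentiated along curves in the cone (`fderivWithin_cone`), which
determines `fderivWithin` on tangent vectors.
-/

namespace ThetaLift

/-! ### Holomorphic functions of several variables -/

section Holomorphic

variable {E : Type*} [NormedAddCommGroup E] [NormedSpace ℂ E]

theorem hasDerivAt_line {f : E → ℂ} {z v : E} (hf : DifferentiableAt ℂ f z) :
    HasDerivAt (fun s : ℂ => f (z + s • v)) (fderiv ℂ f z v) 0 := by
  have h1 : HasDerivAt (fun s : ℂ => z + s • v) v 0 := by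
    simpa using ((hasDerivAt_id (0 : ℂ)).smul_const v).const_add z
  have h2 : HasFDerivAt f (fderiv ℂ f z) (z + (0 : ℂ) • v) := by simpa using hf.hasFDerivAt
  exact h2.comp_hasDerivAt (0 : ℂ) h1

/-- Cauchy's estimate for the derivative of a bounded holomorphic function on a ball. -/
theorem norm_fderiv_le_of_bound {f : E → ℂ} {z : E} {r C : ℝ} (hr : 0 < r)
    (hf : DifferentiableOn ℂ f (Metric.ball z r)) (hC : ∀ w ∈ Metric.ball z r, ‖f w‖ ≤ C) :
    ‖fderiv ℂ f z‖ ≤ 2 * C / r := by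
  have hC0 : 0 ≤ C := (norm_nonneg _).trans (hC z (Metric.mem_ball_self hr))
  refine ContinuousLinearMap.opNorm_le_bound _ (by positivity) fun v => ?_
  rcases eq_or_ne v 0 with rfl | hv
  · simp
  have hv' : 0 < ‖v‖ := norm_pos_iff.mpr hv
  have hfz : DifferentiableAt ℂ f z :=
    hf.differentiableAt (Metric.isOpen_ball.mem_nhds (Metric.mem_ball_self hr))
  have hmem : ∀ s ∈ Metric.closedBall (0 : ℂ) (r / (2 * ‖v‖)), z + s • v ∈ Metric.ball z r := by
    intro s hs
    rw [mem_closedBall_zero_iff] at hs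
    rw [mem_ball_iff_norm, add_sub_cancel_left, norm_smul]
    calc ‖s‖ * ‖v‖ ≤ r / (2 * ‖v‖) * ‖v‖ := by gcongr
      _ = r / 2 := by field_simp
      _ < r := by linarith
  have hd : DifferentiableOn ℂ (fun s : ℂ => f (z + s • v))
      (Metric.closedBall (0 : ℂ) (r / (2 * ‖v‖))) :=
    hf.comp (by fun_prop) hmem
  have h1 := Complex.norm_deriv_le_of_forall_mem_sphere_norm_le (c := (0 : ℂ))
    (R := r / (2 * ‖v‖)) (C := C) (f := fun s : ℂ => f (z + s • v)) (by positivity)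
    (hd.diffContOnCl_ball le_rfl) (fun s hs => hC _ (hmem s (Metric.sphere_subset_closedBall hs)))
  rw [(hasDerivAt_line hfz).deriv] at h1
  refine h1.trans (le_of_eq ?_)
  field_simp

theorem aestronglyMeasurable_fderiv {X : Type*} [MeasurableSpace X] {μ : Measure X}
    [FiniteDimensional ℂ E] {U : Set E} (hU : IsOpen U) {f : E → X → ℂ}
    (hmeas : ∀ z ∈ U, AEStronglyMeasurable (f z) μ)
    (hf : ∀ᵐ x ∂μ, DifferentiableOn ℂ (fun z => f z x) U) {z : E} (hz : z ∈ U) :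
    AEStronglyMeasurable (fun x => fderiv ℂ (fun w => f w x) z) μ := by
  have key : ∀ v : E, AEStronglyMeasurable (fun x => fderiv ℂ (fun w => f w x) z v) μ := by
    intro v
    -- the derivative along `v` is a limit of difference quotients
    have hlim : Tendsto (fun m : ℕ => ((1 : ℂ) / (m + 1))) atTop (𝓝[≠] 0) := by
      refine tendsto_nhdsWithin_iff.mpr ⟨tendsto_one_div_add_atTop_nhds_zero_nat, ?_⟩
      refine Eventually.of_forall fun m => ?_
      simp only [Set.mem_compl_iff, Set.mem_singleton_iff]
      have : ((m : ℂ) + 1) ≠ 0 := by exact_mod_cast Nat.succ_ne_zero m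
      simp [this]
    have hU' : ∀ᶠ m : ℕ in atTop, z + ((1 : ℂ) / (m + 1)) • v ∈ U := by
      have h1 : Tendsto (fun m : ℕ => z + ((1 : ℂ) / (m + 1)) • v) atTop (𝓝 z) := by
        have := (tendsto_nhdsWithin_iff.mp hlim).1
        simpa using (this.smul_const v).const_add z
      exact h1.eventually (hU.mem_nhds hz)
    obtain ⟨N, hN⟩ := eventually_atTop.mp hU'
    refine aestronglyMeasurable_of_tendsto_ae atTop
      (f := fun (m : ℕ) x => ((1 : ℂ) / ((m + N : ℕ) + 1))⁻¹ •
        (f (z + ((1 : ℂ) / ((m + N : ℕ) + 1)) • v) x - f z x)) ?_ ?_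
    · intro m
      simp only [smul_eq_mul]
      exact ((hmeas _ (hN _ (Nat.le_add_left N m))).sub (hmeas z hz)).const_mul _
    · filter_upwards [hf] with x hx
      have h2 := hasDerivAt_line (v := v) (hx.differentiableAt (hU.mem_nhds hz))
      have h3 := h2.tendsto_slope_zero.comp (hlim.comp (tendsto_add_atTop_nat N))
      refine h3.congr fun m => ?_
      simp
  let b := Module.finBasis ℂ E
  have h4 : (fun x => fderiv ℂ (fun w => f w x) z) = fun x =>
      ∑ i, fderiv ℂ (fun w => f w x) z (b i) •
        (LinearMap.toContinuousLinearMap (b.coord i) : E →L[ℂ] ℂ) := by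
    funext x
    refine ContinuousLinearMap.coe_injective (b.ext fun j => ?_)
    simp [Finsupp.single_apply]
  rw [h4]
  exact Finset.aestronglyMeasurable_fun_sum _ fun i _ => (key (b i)).smul_const _

/-- A locally dominated integral of holomorphic functions is holomorphic, and may be
differentiated under the integral sign: no bound on the derivatives is needed, by Cauchy's
estimate. -/
theorem hasFDerivAt_integral_of_holomorphic {X : Type*} [MeasurableSpace X] {μ : Measure X}
    [FiniteDimensional ℂ E] {U : Set E} (hU : IsOpen U) {f : E → X → ℂ} {g : X → ℝ}
    (hmeas : ∀ z ∈ U, AEStronglyMeasurable (f z) μ)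
    (hf : ∀ᵐ x ∂μ, DifferentiableOn ℂ (fun z => f z x) U) (hg : Integrable g μ)
    (hb : ∀ᵐ x ∂μ, ∀ z ∈ U, ‖f z x‖ ≤ g x) {z : E} (hz : z ∈ U) :
    HasFDerivAt (fun w => ∫ x, f w x ∂μ) (∫ x, fderiv ℂ (fun w => f w x) z ∂μ) z ∧
      Integrable (fun x => fderiv ℂ (fun w => f w x) z) μ := by
  obtain ⟨r, hr, hrU⟩ := Metric.isOpen_iff.mp hU z hz
  have hsub : ∀ w ∈ Metric.ball z (r / 2), Metric.ball w (r / 2) ⊆ U := fun w hw =>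
    (Metric.ball_subset_ball' (by rw [Metric.mem_ball] at hw; linarith)).trans hrU
  have hbd : ∀ᵐ x ∂μ, ∀ w ∈ Metric.ball z (r / 2),
      ‖fderiv ℂ (fun w => f w x) w‖ ≤ 2 * g x / (r / 2) := by
    filter_upwards [hf, hb] with x hx hbx w hw
    exact norm_fderiv_le_of_bound (by positivity) (hx.mono (hsub w hw))
      (fun u hu => hbx u (hsub w hw hu))
  have hgi : Integrable (fun x => 2 * g x / (r / 2)) μ := (hg.const_mul 2).div_const _
  have hm := aestronglyMeasurable_fderiv hU hmeas hf hz
  refine ⟨hasFDerivAt_integral_of_dominated_of_fderiv_le (s := Metric.ball z (r / 2))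
    (bound := fun x => 2 * g x / (r / 2))
    (F' := fun w x => fderiv ℂ (fun w => f w x) w) (Metric.ball_mem_nhds z (by positivity))
    ?_ ?_ hm hbd hgi ?_, ?_⟩
  · filter_upwards [hU.mem_nhds hz] with w hw using hmeas w hw
  · refine hg.mono' (hmeas z hz) ?_
    filter_upwards [hb] with x hx using hx z hz
  · filter_upwards [hf] with x hx w hw
    exact (hx.differentiableAt (hU.mem_nhds
      (hsub w hw (Metric.mem_ball_self (by positivity))))).hasFDerivAt
  · refine hgi.mono' hm ?_
    filter_upwards [hbd] with x hx using hx z (Metric.mem_ball_self (by positivity))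

theorem differentiableOn_integral_of_holomorphic {X : Type*} [MeasurableSpace X] {μ : Measure X}
    [FiniteDimensional ℂ E] {U : Set E} (hU : IsOpen U) {f : E → X → ℂ} {g : X → ℝ}
    (hmeas : ∀ z ∈ U, AEStronglyMeasurable (f z) μ)
    (hf : ∀ᵐ x ∂μ, DifferentiableOn ℂ (fun z => f z x) U) (hg : Integrable g μ)
    (hb : ∀ᵐ x ∂μ, ∀ z ∈ U, ‖f z x‖ ≤ g x) :
    DifferentiableOn ℂ (fun w => ∫ x, f w x ∂μ) U := fun _ hz =>
  (hasFDerivAt_integral_of_holomorphic hU hmeas hf hg hb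
    hz).1.differentiableAt.differentiableWithinAt

theorem fderiv_integral_of_holomorphic {X : Type*} [MeasurableSpace X] {μ : Measure X}
    [FiniteDimensional ℂ E] {U : Set E} (hU : IsOpen U) {f : E → X → ℂ} {g : X → ℝ}
    (hmeas : ∀ z ∈ U, AEStronglyMeasurable (f z) μ)
    (hf : ∀ᵐ x ∂μ, DifferentiableOn ℂ (fun z => f z x) U) (hg : Integrable g μ)
    (hb : ∀ᵐ x ∂μ, ∀ z ∈ U, ‖f z x‖ ≤ g x) {z : E} (hz : z ∈ U) (v : E) :
    fderiv ℂ (fun w => ∫ x, f w x ∂μ) z v = ∫ x, fderiv ℂ (fun w => f w x) z v ∂μ := by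
  obtain ⟨h1, h2⟩ := hasFDerivAt_integral_of_holomorphic hU hmeas hf hg hb hz
  rw [h1.fderiv, ContinuousLinearMap.integral_apply h2]

/-- The termwise derivative of a locally dominated series of holomorphic functions. -/
theorem hasFDerivAt_tsum_of_holomorphic {ι : Type*} {U : Set E} (hU : IsOpen U)
    {f : ι → E → ℂ} {u : ι → ℝ} (hu : Summable u) (hf : ∀ i, DifferentiableOn ℂ (f i) U)
    (hb : ∀ i, ∀ z ∈ U, ‖f i z‖ ≤ u i) {z : E} (hz : z ∈ U) :
    HasFDerivAt (fun w => ∑' i, f i w) (∑' i, fderiv ℂ (f i) z) z ∧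
      Summable (fun i => fderiv ℂ (f i) z) := by
  obtain ⟨r, hr, hrU⟩ := Metric.isOpen_iff.mp hU z hz
  have hsub : ∀ w ∈ Metric.ball z (r / 2), Metric.ball w (r / 2) ⊆ U := fun w hw =>
    (Metric.ball_subset_ball' (by rw [Metric.mem_ball] at hw; linarith)).trans hrU
  have hbd : ∀ i, ∀ w ∈ Metric.ball z (r / 2), ‖fderiv ℂ (f i) w‖ ≤ 2 * u i / (r / 2) :=
    fun i w hw => norm_fderiv_le_of_bound (by positivity) ((hf i).mono (hsub w hw))
      (fun x hx => hb i x (hsub w hw hx))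
  have hu' : Summable fun i => 2 * u i / (r / 2) := (hu.mul_left 2).div_const _
  have hz' : z ∈ Metric.ball z (r / 2) := Metric.mem_ball_self (by positivity)
  have : NormedSpace ℝ E := NormedSpace.restrictScalars ℝ ℂ E
  refine ⟨hasFDerivAt_tsum_of_isPreconnected hu' Metric.isOpen_ball
    (convex_ball z (r / 2)).isPreconnected (f' := fun i w => fderiv ℂ (f i) w) ?_ hbd hz' ?_ hz', ?_⟩
  · intro i w hw
    exact ((hf i).differentiableAt (hU.mem_nhds
      (hsub w hw (Metric.mem_ball_self (by positivity))))).hasFDerivAt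
  · exact Summable.of_norm_bounded hu fun i => hb i z hz
  · exact Summable.of_norm_bounded hu' fun i => hbd i z hz'

theorem differentiableOn_tsum_of_holomorphic {ι : Type*} {U : Set E} (hU : IsOpen U)
    {f : ι → E → ℂ} {u : ι → ℝ} (hu : Summable u) (hf : ∀ i, DifferentiableOn ℂ (f i) U)
    (hb : ∀ i, ∀ z ∈ U, ‖f i z‖ ≤ u i) :
    DifferentiableOn ℂ (fun w => ∑' i, f i w) U := fun _ hz =>
  (hasFDerivAt_tsum_of_holomorphic hU hu hf hb hz).1.differentiableAt.differentiableWithinAt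

theorem fderiv_tsum_of_holomorphic {ι : Type*} {U : Set E} (hU : IsOpen U)
    {f : ι → E → ℂ} {u : ι → ℝ} (hu : Summable u) (hf : ∀ i, DifferentiableOn ℂ (f i) U)
    (hb : ∀ i, ∀ z ∈ U, ‖f i z‖ ≤ u i) {z : E} (hz : z ∈ U) (v : E) :
    HasSum (fun i => fderiv ℂ (f i) z v) (fderiv ℂ (fun w => ∑' i, f i w) z v) := by
  obtain ⟨h1, h2⟩ := hasFDerivAt_tsum_of_holomorphic hU hu hf hb hz
  rw [h1.fderiv]
  exact h2.hasSum.mapL (ContinuousLinearMap.apply ℂ ℂ v)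

/-- Directional derivatives of holomorphic functions are holomorphic, since they are given by
Cauchy's integral over a small circle in the direction of the derivative. -/
theorem differentiableOn_fderiv_apply [FiniteDimensional ℂ E] {U : Set E} (hU : IsOpen U)
    {f : E → ℂ} (hf : DifferentiableOn ℂ f U) (v : E) :
    DifferentiableOn ℂ (fun z => fderiv ℂ f z v) U := by
  intro z hz
  obtain ⟨r, hr, hrU⟩ := Metric.isOpen_iff.mp hU z hz
  set ρ : ℝ := r / (4 * (‖v‖ + 1)) with hρ
  have hv1 : 0 < ‖v‖ + 1 := by positivity
  have hρ0 : 0 < ρ := by positivity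
  have hρv : ρ * ‖v‖ ≤ r / 4 := by
    rw [hρ, div_mul_eq_mul_div, div_le_div_iff₀ (by positivity) (by norm_num)]
    nlinarith [norm_nonneg v]
  have hmem : ∀ w ∈ Metric.ball z (r / 4), ∀ s ∈ Metric.closedBall (0 : ℂ) ρ,
      w + s • v ∈ Metric.closedBall z (r / 2) := by
    intro w hw s hs
    rw [mem_closedBall_zero_iff] at hs
    rw [mem_ball_iff_norm] at hw
    rw [mem_closedBall_iff_norm]
    calc ‖w + s • v - z‖ = ‖(w - z) + s • v‖ := by congr 1; abel
      _ ≤ ‖w - z‖ + ‖s‖ * ‖v‖ := (norm_add_le _ _).trans (by rw [norm_smul])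
      _ ≤ r / 4 + ρ * ‖v‖ := by gcongr
      _ ≤ r / 2 := by linarith
  have hcl : Metric.closedBall z (r / 2) ⊆ U :=
    (Metric.closedBall_subset_ball (by linarith)).trans hrU
  have : ProperSpace E := FiniteDimensional.proper ℂ E
  obtain ⟨C, hC⟩ := (isCompact_closedBall z (r / 2)).exists_bound_of_continuousOn
    (hf.continuousOn.mono hcl)
  have hformula : ∀ w ∈ Metric.ball z (r / 4), fderiv ℂ f w v = (2 * Real.pi * I : ℂ)⁻¹ •
      ∫ θ in (0 : ℝ)..2 * Real.pi, deriv (circleMap 0 ρ) θ •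
        (((circleMap 0 ρ θ - 0) ^ 2)⁻¹ • f (w + circleMap 0 ρ θ • v)) := by
    intro w hw
    have hd : DifferentiableOn ℂ (fun s : ℂ => f (w + s • v)) (Metric.closedBall 0 ρ) :=
      (hf.mono hcl).comp (by fun_prop) (hmem w hw)
    have hw' : DifferentiableAt ℂ f w := hf.differentiableAt (hU.mem_nhds
      (hcl (by simpa using hmem w hw 0 (by simp [hρ0.le]))))
    rw [← (hasDerivAt_line (v := v) hw').deriv]
    have := (hd.diffContOnCl_ball le_rfl).deriv_eq_smul_circleIntegral hρ0
    simp only [circleIntegral, one_div] at this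
    rw [this, smul_smul, inv_mul_cancel₀ (by simp [Real.pi_ne_zero]), one_smul]
  have hd : DifferentiableOn ℂ (fun w => ∫ θ in Set.Ioc (0 : ℝ) (2 * Real.pi),
      deriv (circleMap 0 ρ) θ •
        (((circleMap 0 ρ θ - 0) ^ 2)⁻¹ • f (w + circleMap 0 ρ θ • v))) (Metric.ball z (r / 4)) := by
    have hsph : ∀ θ, circleMap 0 ρ θ ∈ Metric.closedBall (0 : ℂ) ρ := fun θ =>
      circleMap_mem_closedBall 0 hρ0.le θ
    refine differentiableOn_integral_of_holomorphic Metric.isOpen_ball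
      (g := fun _ => ρ * ((ρ ^ 2)⁻¹ * C)) ?_ ?_ ?_ ?_
    · intro w hw
      refine Continuous.aestronglyMeasurable ?_
      have h1 : Continuous fun θ => f (w + circleMap 0 ρ θ • v) := by
        refine ContinuousOn.comp_continuous (hf.continuousOn.mono hcl) ?_
          (fun θ => hmem w hw _ (hsph θ))
        exact continuous_const.add ((continuous_circleMap 0 ρ).smul continuous_const)
      have h2 : Continuous fun θ => ((circleMap 0 ρ θ - 0) ^ 2)⁻¹ := by
        refine Continuous.inv₀ (((continuous_circleMap 0 ρ).sub continuous_const).pow 2) fun θ => ?_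
        simp [circleMap, hρ0.ne']
      have h3 : Continuous (deriv (circleMap 0 ρ)) := by
        have : deriv (circleMap 0 ρ) = fun θ => circleMap 0 ρ θ * I := by
          funext θ; rw [deriv_circleMap]
        rw [this]
        exact (continuous_circleMap 0 ρ).mul continuous_const
      exact h3.smul (h2.smul h1)
    · refine Eventually.of_forall fun θ => ?_
      have h1 : DifferentiableOn ℂ (fun w => f (w + circleMap 0 ρ θ • v))
          (Metric.ball z (r / 4)) := DifferentiableOn.comp (g := f) (hf.mono hcl)
        (t := Metric.closedBall z (r / 2)) (by fun_prop) (fun w hw => hmem w hw _ (hsph θ))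
      simp only [smul_eq_mul]
      exact (h1.const_mul _).const_mul _
    · exact integrable_const _
    · refine Eventually.of_forall fun θ w hw => ?_
      rw [norm_smul, norm_smul, deriv_circleMap]
      simp only [sub_zero, norm_mul, norm_circleMap_zero, norm_I, mul_one, norm_inv, norm_pow,
        abs_of_pos hρ0]
      gcongr
      exact hC _ (hmem w hw _ (hsph θ))
  have hz4 : Metric.ball z (r / 4) ∈ 𝓝 z := Metric.ball_mem_nhds z (by positivity)
  refine DifferentiableAt.differentiableWithinAt ?_
  refine (((hd z (Metric.mem_ball_self (by positivity))).differentiableAt hz4).const_smul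
    ((2 * Real.pi * I : ℂ)⁻¹)).congr_of_eventuallyEq ?_
  filter_upwards [hz4] with w hw
  rw [hformula w hw, intervalIntegral.integral_of_le (by positivity)]
  rfl

/-- Holomorphic functions of several variables are smooth. -/
theorem contDiffOn_of_differentiableOn [FiniteDimensional ℂ E] {U : Set E} (hU : IsOpen U)
    {f : E → ℂ} (hf : DifferentiableOn ℂ f U) : ContDiffOn ℂ ∞ f U := by
  rw [contDiffOn_infty]
  intro m
  induction m generalizing f with
  | zero => exact contDiffOn_zero.mpr hf.continuousOn
  | succ m ih =>
    push_cast
    rw [contDiffOn_succ_iff_fderiv_of_isOpen hU]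
    refine ⟨hf, by simp, contDiffOn_clm_apply.mpr fun v => ?_⟩
    exact ih (differentiableOn_fderiv_apply hU hf v)

end Holomorphic

/-! ### Constant terms and the regularized integral -/

/-- The constant term of a Laurent expansion is unique: a difference of two principal parts is a
polynomial in `1 / s` without constant coefficient, and it converges only if it vanishes. -/
theorem IsConstantTermAtZero.unique {Φ Φ' : ℂ → ℂ} {c c' : ℂ} (h : IsConstantTermAtZero Φ c)
    (h' : IsConstantTermAtZero Φ' c') (hΦ : Φ =ᶠ[𝓝[≠] 0] Φ') : c = c' := by
  obtain ⟨N, a, ha⟩ := h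
  obtain ⟨N', a', ha'⟩ := h'
  let p : Polynomial ℂ := ∑ j ∈ Finset.Icc 1 N, Polynomial.C (a j) * Polynomial.X ^ j -
    ∑ j ∈ Finset.Icc 1 N', Polynomial.C (a' j) * Polynomial.X ^ j
  have hp : ∀ s : ℂ, p.eval s⁻¹ = ∑ j ∈ Finset.Icc 1 N, a j / s ^ j -
      ∑ j ∈ Finset.Icc 1 N', a' j / s ^ j := by
    intro s
    simp [p, Polynomial.eval_finsetSum, div_eq_mul_inv]
  have hlim : Tendsto (fun s : ℂ => p.eval s⁻¹) (𝓝[≠] 0) (𝓝 (c' - c)) := by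
    refine (ha'.sub ha).congr' ?_
    filter_upwards [hΦ] with s hs
    rw [hp, hs]
    ring
  have hseq : Tendsto (fun m : ℕ => ((m : ℂ) + 1)⁻¹) atTop (𝓝[≠] 0) := by
    refine tendsto_nhdsWithin_iff.mpr ⟨?_, Eventually.of_forall fun m => ?_⟩
    · simpa using tendsto_one_div_add_atTop_nhds_zero_nat (𝕜 := ℂ)
    · have : ((m : ℂ) + 1) ≠ 0 := by exact_mod_cast Nat.succ_ne_zero m
      simp [this]
  have hlim2 : Tendsto (fun m : ℕ => p.eval ((m : ℂ) + 1)) atTop (𝓝 (c' - c)) := by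
    refine (hlim.comp hseq).congr fun m => ?_
    simp
  have hp0 : p.coeff 0 = 0 := by
    have h0 : ∀ j ∈ Finset.Icc 1 N, (0 : ℕ) ≠ j := fun j hj => by
      have := Finset.mem_Icc.mp hj; omega
    have h0' : ∀ j ∈ Finset.Icc 1 N', (0 : ℕ) ≠ j := fun j hj => by
      have := Finset.mem_Icc.mp hj; omega
    simp only [p, Polynomial.coeff_sub, Polynomial.finsetSum_coeff, Polynomial.coeff_C_mul_X_pow]
    rw [Finset.sum_eq_zero fun j hj => if_neg (h0 j hj),
      Finset.sum_eq_zero fun j hj => if_neg (h0' j hj), sub_zero]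
  have hdeg : p.degree ≤ 0 := by
    by_contra hcon
    have h1 : Tendsto (fun m : ℕ => ‖((m : ℂ) + 1)‖) atTop atTop := by
      have : Tendsto (fun m : ℕ => (m : ℝ) + 1) atTop atTop :=
        tendsto_atTop_add_const_right _ _ tendsto_natCast_atTop_atTop
      refine this.congr fun m => ?_
      have : ((m : ℂ) + 1) = ((m + 1 : ℕ) : ℂ) := by push_cast; rfl
      rw [this, Complex.norm_natCast]
      push_cast
      rfl
    exact not_tendsto_nhds_of_tendsto_atTop (p.tendsto_norm_atTop (not_le.mp hcon) h1) _
      hlim2.norm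
  have hpz : p = 0 := by rw [Polynomial.eq_C_of_degree_le_zero hdeg, hp0, Polynomial.C_0]
  have hz : Tendsto (fun m : ℕ => p.eval ((m : ℂ) + 1)) atTop (𝓝 0) := by simp [hpz]
  have := tendsto_nhds_unique hlim2 hz
  exact (sub_eq_zero.mp this).symm

/-- Two meromorphic continuations from a half-plane agree near `0`, so the regularized integral is
well defined. -/
theorem IsRegIntegral.unique {f : ℍ → ℂ} {c c' : ℂ} (h : IsRegIntegral f c)
    (h' : IsRegIntegral f c') : c = c' := by
  obtain ⟨σ, Φ, hΦ, hlim, hc⟩ := h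
  obtain ⟨σ', Φ', hΦ', hlim', hc'⟩ := h'
  refine hc.unique hc' ?_
  have heq : ∀ s : ℂ, max σ σ' < s.re → Φ s = Φ' s := fun s hs =>
    tendsto_nhds_unique (hlim s ((le_max_left _ _).trans_lt hs))
      (hlim' s ((le_max_right _ _).trans_lt hs))
  have hmer : MeromorphicOn (Φ - Φ') Set.univ := fun s _ => (hΦ s).sub (hΦ' s)
  set s₀ : ℂ := ((max σ σ' + 1 : ℝ) : ℂ) with hs₀
  have htop : meromorphicOrderAt (Φ - Φ') s₀ = ⊤ := by
    rw [meromorphicOrderAt_eq_top_iff]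
    have hopen : IsOpen {s : ℂ | max σ σ' < s.re} := isOpen_lt continuous_const continuous_re
    have : {s : ℂ | max σ σ' < s.re} ∈ 𝓝 s₀ := hopen.mem_nhds (by
      simp only [hs₀, Set.mem_ofPred_eq, ofReal_re]; linarith)
    filter_upwards [nhdsWithin_le_nhds this] with s hs
    simp [heq s hs]
  have h0 : meromorphicOrderAt (Φ - Φ') 0 = ⊤ := by
    by_contra hcon
    exact hmer.meromorphicOrderAt_ne_top_of_isPreconnected (x := 0) isPreconnected_univ
      (Set.mem_univ _) (Set.mem_univ s₀) hcon htop
  rw [meromorphicOrderAt_eq_top_iff] at h0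
  filter_upwards [h0] with s hs
  exact sub_eq_zero.mp hs

theorem IsRegIntegral.regIntegral_eq {f : ℍ → ℂ} {c : ℂ} (h : IsRegIntegral f c) :
    regIntegral f = c := by
  have hex : ∃ c, IsRegIntegral f c := ⟨c, h⟩
  rw [regIntegral, dif_pos hex]
  exact hex.choose_spec.unique h

theorem IsRegIntegral.const_mul {f : ℍ → ℂ} {c : ℂ} (h : IsRegIntegral f c) (a : ℂ) :
    IsRegIntegral (fun τ => a * f τ) (a * c) := by
  obtain ⟨σ, Φ, hΦ, hlim, N, b, hb⟩ := h
  refine ⟨σ, fun s => a * Φ s, fun s => (MeromorphicAt.const a s).mul (hΦ s), fun s hs => ?_, N,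
    fun j => a * b j, ?_⟩
  · refine ((hlim s hs).const_mul a).congr fun t => ?_
    simp only [truncIntegral]
    rw [← integral_const_mul]
    congr 1
    funext z
    ring
  · refine (hb.const_mul a).congr fun s => ?_
    rw [mul_sub, Finset.mul_sum]
    simp only [mul_div_assoc]

/-- The constant term at `s = 0` of `∑ t < l, c t * 2 ^ (-(t + s)) / (t + s)`. -/
noncomputable def polarConstant (l : ℕ) (c : ℕ → ℂ) : ℂ :=
  ∑ t ∈ Finset.range l, c t * (if t = 0 then -(Real.log 2 : ℂ) else (2 : ℂ) ^ (-(t : ℂ)) / t)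

theorem tendsto_polar_term (t : ℕ) :
    Tendsto (fun s : ℂ => (2 : ℂ) ^ (-((t : ℂ) + s)) / (t + s) - (if t = 0 then 1 else 0) / s)
      (𝓝[≠] 0) (𝓝 (if t = 0 then -(Real.log 2 : ℂ) else (2 : ℂ) ^ (-(t : ℂ)) / t)) := by
  by_cases ht : t = 0
  · subst ht
    have h1 : HasDerivAt (fun s : ℂ => (2 : ℂ) ^ (-s)) (-(Real.log 2 : ℂ)) 0 := by
      have := (hasDerivAt_neg (0 : ℂ)).const_cpow (c := 2) (Or.inl two_ne_zero)
      simpa [Complex.ofReal_log] using this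
    -- for `t = 0` the constant term of `2 ^ (-s) / s` is a difference quotient at `0`
    refine (h1.tendsto_slope_zero).congr fun s => ?_
    simp only [zero_add, neg_zero, cpow_zero, smul_eq_mul, Nat.cast_zero, if_true]
    ring
  · simp only [ht, if_false, zero_div, sub_zero]
    refine Tendsto.mono_left ?_ nhdsWithin_le_nhds
    have ht' : (t : ℂ) ≠ 0 := by exact_mod_cast ht
    have h1 : ContinuousAt (fun s : ℂ => (2 : ℂ) ^ (-((t : ℂ) + s)) / (t + s)) 0 := by
      refine ContinuousAt.div ?_ (by fun_prop) (by simpa using ht')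
      exact ContinuousAt.const_cpow (by fun_prop) (Or.inl two_ne_zero)
    simpa [ContinuousAt] using h1

/-- The regularized integral of an integrand whose truncated integrals converge to an entire function
plus the integral of a polynomial in `1 / y` over `y > 2`. -/
theorem isRegIntegral_of_tendsto {f : ℍ → ℂ} {Ψ : ℂ → ℂ} (hΨ : Differentiable ℂ Ψ) (l : ℕ)
    (c : ℕ → ℂ) (h : ∀ s : ℂ, 0 < s.re → Tendsto (truncIntegral f s) atTop
      (𝓝 (Ψ s + ∑ t ∈ Finset.range l, c t * ((2 : ℂ) ^ (-((t : ℂ) + s)) / (t + s))))) :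
    IsRegIntegral f (Ψ 0 + polarConstant l c) := by
  refine ⟨0, _, ?_, h, 1, fun _ => ∑ t ∈ Finset.range l, c t * (if t = 0 then 1 else 0), ?_⟩
  · intro s
    refine ((hΨ.analyticAt s).meromorphicAt).add ?_
    refine MeromorphicAt.fun_sum fun t _ => (MeromorphicAt.const _ _).mul (MeromorphicAt.div ?_ ?_)
    · have : Differentiable ℂ fun s : ℂ => (2 : ℂ) ^ (-((t : ℂ) + s)) := fun s =>
        DifferentiableAt.const_cpow (by fun_prop) (Or.inl two_ne_zero)
      exact (this.analyticAt s).meromorphicAt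
    · have : Differentiable ℂ fun s : ℂ => (t : ℂ) + s := by fun_prop
      exact (this.analyticAt s).meromorphicAt
  · have h1 : Tendsto Ψ (𝓝[≠] 0) (𝓝 (Ψ 0)) := hΨ.continuous.continuousAt.mono_left nhdsWithin_le_nhds
    have h2 := tendsto_finsetSum (Finset.range l)
      fun t _ => (tendsto_polar_term t).const_mul (c t)
    refine (h1.add h2).congr fun s => ?_
    simp only [mul_sub, Finset.sum_sub_distrib, Finset.Icc_self, Finset.sum_singleton, pow_one,
      Finset.sum_div, mul_div_assoc]
    ring

/-! ### Poisson summation on `ℤ ^ d` -/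

section Poisson

variable {d : ℕ}

theorem summable_gaussian_int {ε : ℝ} (hε : 0 < ε) :
    Summable fun m : ℤ => Real.exp (-ε * (m : ℝ) ^ 2) := by
  have h : Summable fun m : ℕ => Real.exp (-ε * ((m : ℤ) : ℝ) ^ 2) := by
    refine Summable.of_nonneg_of_le (fun _ => (Real.exp_pos _).le) (fun m => ?_)
      (Real.summable_exp_nat_mul_iff.mpr (neg_lt_zero.mpr hε))
    apply Real.exp_le_exp.mpr
    have : (m : ℝ) ≤ (m : ℝ) ^ 2 := by
      have : m ≤ m ^ 2 := Nat.le_self_pow two_ne_zero m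
      exact_mod_cast this
    push_cast
    nlinarith
  refine Summable.of_nat_of_neg h ?_
  simpa using h

theorem summable_gaussian_pi {ε : ℝ} (hε : 0 < ε) (d : ℕ) :
    Summable fun m : Fin d → ℤ => Real.exp (-ε * ∑ i, (m i : ℝ) ^ 2) := by
  induction d with
  | zero => exact (hasSum_fintype _).summable
  | succ d ih =>
    rw [← (Fin.consEquiv fun _ => ℤ).summable_iff]
    refine ((summable_gaussian_int hε).mul_of_nonneg ih (fun _ => (Real.exp_pos _).le)
      (fun _ => (Real.exp_pos _).le)).congr fun p => ?_
    simp [Fin.sum_univ_succ, ← Real.exp_add, mul_add, Fin.consEquiv]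

theorem integrable_gaussian_pi {ε : ℝ} (hε : 0 < ε) (d : ℕ) :
    Integrable fun x : Fin d → ℝ => Real.exp (-ε * ∑ i, (x i) ^ 2) := by
  have := Integrable.fintype_prod (ι := Fin d) (f := fun _ (t : ℝ) => Real.exp (-ε * t ^ 2))
    (μ := fun _ => volume) (fun _ => integrable_exp_neg_mul_sq hε)
  refine this.congr (Eventually.of_forall fun x => ?_)
  simp [← Real.exp_sum, Finset.mul_sum]

/-- The embedding `ℤ ^ d ⊆ ℝ ^ d`. -/
def intVec (m : Fin d → ℤ) : Fin d → ℝ := fun i => (m i : ℝ)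

/-- The exponential `x ↦ e ^ (2 π i ξ · x)`. -/
noncomputable def dotExp (ξ : Fin d → ℤ) (x : Fin d → ℝ) : ℂ :=
  cexp (2 * Real.pi * I * ∑ i, (ξ i : ℂ) * (x i : ℂ))

theorem norm_dotExp (ξ : Fin d → ℤ) (x : Fin d → ℝ) : ‖dotExp ξ x‖ = 1 := by
  have : 2 * Real.pi * I * ∑ i, (ξ i : ℂ) * (x i : ℂ) =
      ((2 * Real.pi * ∑ i, (ξ i : ℝ) * x i : ℝ) : ℂ) * I := by push_cast; ring
  rw [dotExp, this, norm_exp_ofReal_mul_I]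

theorem continuous_dotExp (ξ : Fin d → ℤ) : Continuous (dotExp ξ) := by
  unfold dotExp; fun_prop

theorem dotExp_add_intVec (ξ m : Fin d → ℤ) (x : Fin d → ℝ) :
    dotExp ξ (x + intVec m) = dotExp ξ x := by
  have : 2 * Real.pi * I * ∑ i, (ξ i : ℂ) * ((x + intVec m) i : ℂ) =
      2 * Real.pi * I * ∑ i, (ξ i : ℂ) * (x i : ℂ) +
        ((∑ i, ξ i * m i : ℤ) : ℂ) * (2 * Real.pi * I) := by
    simp only [Pi.add_apply, intVec, ofReal_add, mul_add, Finset.sum_add_distrib]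
    push_cast
    ring
  rw [dotExp, this, Complex.exp_add, Complex.exp_int_mul_two_pi_mul_I, mul_one, dotExp]

variable {f : (Fin d → ℝ) → ℂ} {C ε : ℝ}

theorem norm_translate_le (hε : 0 < ε)
    (hb : ∀ x, ‖f x‖ ≤ C * Real.exp (-ε * ∑ i, (x i) ^ 2)) (x : Fin d → ℝ) (m : Fin d → ℤ) :
    ‖f (x + intVec m)‖ ≤
      C * Real.exp (ε * ∑ i, (x i) ^ 2) * Real.exp (-(ε / 2) * ∑ i, (m i : ℝ) ^ 2) := by
  have hC : 0 ≤ C := by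
    have := (norm_nonneg _).trans (hb 0)
    simpa using this
  refine (hb _).trans ?_
  rw [mul_assoc, ← Real.exp_add]
  refine mul_le_mul_of_nonneg_left (Real.exp_le_exp.mpr ?_) hC
  rw [Finset.mul_sum, Finset.mul_sum, Finset.mul_sum, ← Finset.sum_add_distrib]
  refine Finset.sum_le_sum fun i _ => ?_
  simp only [Pi.add_apply, intVec]
  nlinarith [mul_nonneg hε.le (sq_nonneg (2 * x i + (m i : ℝ)))]

theorem continuous_periodization (hf : Continuous f) (hε : 0 < ε)
    (hb : ∀ x, ‖f x‖ ≤ C * Real.exp (-ε * ∑ i, (x i) ^ 2)) :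
    Continuous fun x => ∑' m : Fin d → ℤ, f (x + intVec m) := by
  have hC : 0 ≤ C := by
    have := (norm_nonneg _).trans (hb 0)
    simpa using this
  refine continuous_iff_continuousAt.mpr fun x₀ => ?_
  have hs : IsOpen {x : Fin d → ℝ | ∑ i, (x i) ^ 2 < ∑ i, (x₀ i) ^ 2 + 1} :=
    isOpen_lt (continuous_finsetSum _ fun i _ => (continuous_apply i).pow 2) continuous_const
  have hx₀ : {x : Fin d → ℝ | ∑ i, (x i) ^ 2 < ∑ i, (x₀ i) ^ 2 + 1} ∈ 𝓝 x₀ :=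
    hs.mem_nhds (by rw [Set.mem_ofPred_eq]; exact lt_add_one _)
  refine ContinuousOn.continuousAt ?_ hx₀
  have hu : Summable fun m : Fin d → ℤ => C * Real.exp (ε * (∑ i, (x₀ i) ^ 2 + 1)) *
      Real.exp (-(ε / 2) * ∑ i, (m i : ℝ) ^ 2) :=
    (summable_gaussian_pi (half_pos hε) d).mul_left _
  have hcm : ∀ m : Fin d → ℤ, Continuous fun x => f (x + intVec m) := fun m =>
    hf.comp (continuous_add_const (intVec m))
  refine continuousOn_tsum (f := fun (m : Fin d → ℤ) x => f (x + intVec m))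
    (fun m => (hcm m).continuousOn) hu fun m x hx => ?_
  refine (norm_translate_le hε hb x m).trans ?_
  rw [Set.mem_ofPred_eq] at hx
  have : ∑ i, (x i) ^ 2 ≤ ∑ i, (x₀ i) ^ 2 + 1 := hx.le
  refine mul_le_mul_of_nonneg_right (mul_le_mul_of_nonneg_left (Real.exp_le_exp.mpr ?_) hC)
    (Real.exp_pos _).le
  exact mul_le_mul_of_nonneg_left this hε.le

theorem integrable_of_gaussian_bound (hf : Continuous f) (hε : 0 < ε)
    (hb : ∀ x, ‖f x‖ ≤ C * Real.exp (-ε * ∑ i, (x i) ^ 2)) : Integrable f :=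
  ((integrable_gaussian_pi hε d).const_mul C).mono' hf.aestronglyMeasurable
    (Eventually.of_forall hb)

/-- The half-open unit cube. -/
def unitCube (d : ℕ) : Set (Fin d → ℝ) := {x | ∀ i, x i ∈ Set.Ioc ((0 : Fin d → ℝ) i) ((0 : Fin d → ℝ) i + 1)}

/-- The integral over `ℝ ^ d` unfolds to the translates of the unit cube. -/
theorem tsum_integral_unitCube (hfi : Integrable f) :
    ∑' m : Fin d → ℤ, ∫ x in unitCube d, f (x + intVec m) = ∫ x, f x := by
  let b := Pi.basisFun ℝ (Fin d)
  have hfd := ZSpan.isAddFundamentalDomain' b (volume : Measure (Fin d → ℝ))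
  have hset : unitCube d =ᵐ[volume] ZSpan.fundamentalDomain b := by
    have h1 : unitCube d = Set.univ.pi fun i : Fin d => Set.Ioc ((0 : Fin d → ℝ) i) ((1 : Fin d → ℝ) i) := by
      ext x; simp [unitCube, Set.mem_pi]
    have h2 : ZSpan.fundamentalDomain b =
        Set.univ.pi fun i : Fin d => Set.Ico ((0 : Fin d → ℝ) i) ((1 : Fin d → ℝ) i) := by
      ext x; simp [ZSpan.mem_fundamentalDomain, b, Set.mem_pi]
    rw [h1, h2]
    exact Measure.univ_pi_Ioc_ae_eq_Icc.trans Measure.univ_pi_Ico_ae_eq_Icc.symm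
  let e : (Fin d → ℤ) ≃ (Submodule.span ℤ (Set.range b)).toAddSubgroup :=
    (b.restrictScalars ℤ).equivFun.symm.toEquiv
  have he : ∀ m, ((e m : (Submodule.span ℤ (Set.range b)).toAddSubgroup) : Fin d → ℝ) =
      intVec m := by
    intro m
    have : ((e m : (Submodule.span ℤ (Set.range b)).toAddSubgroup) : Fin d → ℝ) =
        ∑ i, m i • b i := by
      change (((b.restrictScalars ℤ).equivFun.symm m : Submodule.span ℤ (Set.range b)) :
        Fin d → ℝ) = _
      simp [Module.Basis.equivFun_symm_apply]
    rw [this]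
    funext j
    simp [b, intVec, Finset.sum_apply, Pi.single_apply]
  have : Countable (Submodule.span ℤ (Set.range b)).toAddSubgroup := e.symm.injective.countable
  rw [hfd.integral_eq_tsum'' f hfi, ← e.tsum_eq]
  refine tsum_congr fun m => ?_
  rw [setIntegral_congr_set hset]
  refine integral_congr_ae (Eventually.of_forall fun x => ?_)
  change f (x + intVec m) = f ((e m : Fin d → ℝ) + x)
  rw [he, add_comm]

/-- Poisson summation on `ℤ ^ d` for continuous functions of Gaussian decay with summable Fourier
transform. -/
theorem poisson_summation (hf : Continuous f) (hε : 0 < ε)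
    (hb : ∀ x, ‖f x‖ ≤ C * Real.exp (-ε * ∑ i, (x i) ^ 2))
    (hsum : Summable fun ξ : Fin d → ℤ => ∫ x, f x * dotExp (-ξ) x) (x : Fin d → ℝ) :
    ∑' m : Fin d → ℤ, f (x + intVec m) =
      ∑' ξ : Fin d → ℤ, (∫ u, f u * dotExp (-ξ) u) * dotExp ξ x := by
  set S : (Fin d → ℝ) → ℂ := fun x => ∑' m : Fin d → ℤ, f (x + intVec m) with hS
  have hScont : Continuous S := continuous_periodization hf hε hb
  have hSper : ∀ (x : Fin d → ℝ) (m : Fin d → ℤ), S (x + intVec m) = S x := by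
    intro x m
    rw [hS]
    simp only
    rw [← (Equiv.addLeft m).tsum_eq (fun k => f (x + intVec k))]
    refine tsum_congr fun k => congrArg f ?_
    funext i
    simp [intVec, add_assoc]
  let q : (Fin d → ℝ) → UnitAddTorus (Fin d) := fun x i => (x i : UnitAddCircle)
  have hq : IsOpenQuotientMap q :=
    IsOpenQuotientMap.piMap fun _ => QuotientAddGroup.isOpenQuotientMap_mk
  have hrep : ∀ t : UnitAddTorus (Fin d), ∃ x, q x = t := hq.surjective
  choose r hr using hrep
  have hSq : ∀ x, S (r (q x)) = S x := by
    intro x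
    have h1 : ∀ i, ∃ m : ℤ, r (q x) i = x i + m := by
      intro i
      have h2 : ((r (q x) i : ℝ) : UnitAddCircle) = (x i : UnitAddCircle) := congrFun (hr (q x)) i
      rw [← sub_eq_zero, ← AddCircle.coe_sub, AddCircle.coe_eq_zero_iff] at h2
      obtain ⟨m, hm⟩ := h2
      refine ⟨m, ?_⟩
      simp only [zsmul_eq_mul, mul_one] at hm
      linarith
    choose m hm using h1
    have : r (q x) = x + intVec m := funext hm
    rw [this, hSper]
  -- the periodization descends to a continuous function on the torus
  let P : C(UnitAddTorus (Fin d), ℂ) := ⟨fun t => S (r t), by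
    rw [hq.isQuotientMap.continuous_iff]
    refine hScont.congr fun x => (hSq x).symm⟩
  have hPq : ∀ x, P (q x) = S x := hSq
  have hmF : ∀ (ξ : Fin d → ℤ) (x : Fin d → ℝ), UnitAddTorus.mFourier ξ (q x) = dotExp ξ x := by
    intro ξ x
    simp only [UnitAddTorus.mFourier, ContinuousMap.coe_mk, q, fourier_coe_apply, dotExp,
      ← Complex.exp_sum, Finset.mul_sum]
    congr 1
    refine Finset.sum_congr rfl fun i _ => ?_
    push_cast
    ring
  -- its Fourier coefficients are the values of the Fourier transform of `f`
  have hcoef : ∀ ξ, UnitAddTorus.mFourierCoeff P ξ = ∫ u, f u * dotExp (-ξ) u := by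
    intro ξ
    rw [UnitAddTorus.mFourierCoeff_eq_integral _ _ 0]
    have hfe : Continuous fun u => f u * dotExp (-ξ) u := hf.mul (continuous_dotExp _)
    have hbe : ∀ u, ‖f u * dotExp (-ξ) u‖ ≤ C * Real.exp (-ε * ∑ i, (u i) ^ 2) := fun u => by
      rw [norm_mul, norm_dotExp, mul_one]; exact hb u
    rw [← tsum_integral_unitCube (integrable_of_gaussian_bound hfe hε hbe)]
    have hcube : volume (unitCube d) < ⊤ := by
      refine (measure_mono (t := Set.Icc (0 : Fin d → ℝ) 1) fun x hx => ?_).trans_lt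
        isCompact_Icc.measure_lt_top
      refine ⟨fun i => (hx i).1.le, fun i => ?_⟩
      simpa using (hx i).2
    have hbox : ∀ x ∈ unitCube d, ∑ i, (x i) ^ 2 ≤ d := by
      intro x hx
      calc ∑ i, (x i) ^ 2 ≤ ∑ i : Fin d, (1 : ℝ) := Finset.sum_le_sum fun i _ => by
            have h1 := (hx i).1
            have h2 := (hx i).2
            simp only [Pi.zero_apply, zero_add] at h1 h2
            nlinarith
        _ = d := by simp
    have hmeas : MeasurableSet (unitCube d) := by
      have : unitCube d = Set.univ.pi fun i : Fin d =>
          Set.Ioc ((0 : Fin d → ℝ) i) ((1 : Fin d → ℝ) i) := by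
        ext x; simp [unitCube, Set.mem_pi]
      rw [this]
      exact MeasurableSet.univ_pi fun i => measurableSet_Ioc
    have hC : 0 ≤ C := by
      have := (norm_nonneg _).trans (hb 0)
      simpa using this
    have hbm : ∀ m : Fin d → ℤ, ∀ x ∈ unitCube d,
        ‖f (x + intVec m) * dotExp (-ξ) (x + intVec m)‖ ≤
          C * Real.exp (ε * d) * Real.exp (-(ε / 2) * ∑ i, (m i : ℝ) ^ 2) := by
      intro m x hx
      refine (norm_translate_le hε hbe x m).trans ?_
      have := hbox x hx
      gcongr
    have hint : ∀ m : Fin d → ℤ, Integrable (fun x => f (x + intVec m) *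
        dotExp (-ξ) (x + intVec m)) (volume.restrict (unitCube d)) := by
      intro m
      refine Integrable.mono' (g := fun _ => C * Real.exp (ε * d) *
        Real.exp (-(ε / 2) * ∑ i, (m i : ℝ) ^ 2)) ?_ ?_ ?_
      · exact integrableOn_const hcube.ne
      · exact (hfe.comp (by fun_prop : Continuous fun x => x + intVec m)).aestronglyMeasurable
      · exact (ae_restrict_iff' hmeas).mpr (Eventually.of_forall (hbm m))
    have hsw := hasSum_integral_of_summable_integral_norm hint (by
      refine Summable.of_nonneg_of_le (fun m => integral_nonneg fun _ => norm_nonneg _)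
        (fun m => ?_) (((summable_gaussian_pi (half_pos hε) d).mul_left
          (C * Real.exp (ε * d))).mul_left (volume.real (unitCube d)))
      refine (integral_mono_ae (hint m).norm (integrableOn_const hcube.ne)
        ((ae_restrict_iff' hmeas).mpr (Eventually.of_forall (hbm m)))).trans ?_
      simp)
    rw [hsw.tsum_eq]
    refine setIntegral_congr_fun hmeas fun x hx => ?_
    change UnitAddTorus.mFourier (-ξ) (q x) • P (q x) = _
    rw [hmF, hPq, smul_eq_mul, mul_comm, hS]
    simp only [dotExp_add_intVec]
    rw [tsum_mul_right]
  have hsum' : Summable (UnitAddTorus.mFourierCoeff P) := by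
    refine hsum.congr fun ξ => (hcoef ξ).symm
  have := (UnitAddTorus.hasSum_mFourier_series_apply_of_summable hsum' (q x)).tsum_eq
  rw [hPq] at this
  refine this.symm.trans (tsum_congr fun ξ => ?_)
  rw [hcoef, hmF, smul_eq_mul]

end Poisson

/-! ### The pairing and its majorant -/

section GramForm

variable {ι R : Type*} [Fintype ι] [CommRing R] (G : Matrix ι ι ℤ)

theorem gramForm_add_left (x x' y : ι → R) :
    gramForm G (x + x') y = gramForm G x y + gramForm G x' y := by
  simp [gramForm, add_mul, Finset.sum_add_distrib]

theorem gramForm_smul_left (c : R) (x y : ι → R) :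
    gramForm G (c • x) y = c * gramForm G x y := by
  simp [gramForm, Finset.mul_sum, mul_assoc]

theorem gramForm_add_right (x y y' : ι → R) :
    gramForm G x (y + y') = gramForm G x y + gramForm G x y' := by
  simp [gramForm, mul_add, Finset.sum_add_distrib]

theorem gramForm_smul_right (c : R) (x y : ι → R) :
    gramForm G x (c • y) = c * gramForm G x y := by
  simp only [gramForm, Finset.mul_sum, Pi.smul_apply, smul_eq_mul]
  exact Finset.sum_congr rfl fun i _ => Finset.sum_congr rfl fun j _ => by ring

theorem gramForm_comm (hG : G.transpose = G) (x y : ι → R) :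
    gramForm G x y = gramForm G y x := by
  rw [gramForm, gramForm, Finset.sum_comm]
  refine Finset.sum_congr rfl fun i _ => Finset.sum_congr rfl fun j _ => ?_
  have : G j i = G i j := congrFun (congrFun hG i) j
  rw [this]
  ring

end GramForm

/-- The squared Euclidean norm in the coordinates of the chosen basis. -/
def nrm2 {d : ℕ} (x : Fin d → ℝ) : ℝ := ∑ i, (x i) ^ 2

theorem nrm2_nonneg {d : ℕ} (x : Fin d → ℝ) : 0 ≤ nrm2 x :=
  Finset.sum_nonneg fun i _ => sq_nonneg (x i)

theorem nrm2_smul {d : ℕ} (r : ℝ) (x : Fin d → ℝ) : nrm2 (r • x) = r ^ 2 * nrm2 x := by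
  simp [nrm2, Finset.mul_sum, mul_pow]

theorem nrm2_eq_zero {d : ℕ} {x : Fin d → ℝ} : nrm2 x = 0 ↔ x = 0 := by
  rw [nrm2, Finset.sum_eq_zero_iff_of_nonneg fun i _ => sq_nonneg (x i)]
  simp [funext_iff]

theorem continuous_nrm2 {d : ℕ} : Continuous (nrm2 : (Fin d → ℝ) → ℝ) :=
  continuous_finsetSum _ fun i _ => (continuous_apply i).pow 2

theorem abs_apply_le {d : ℕ} (x : Fin d → ℝ) (i : Fin d) : |x i| ≤ 1 + nrm2 x := by
  have h : (x i) ^ 2 ≤ nrm2 x :=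
    Finset.single_le_sum (f := fun i => (x i) ^ 2) (fun i _ => sq_nonneg _) (Finset.mem_univ i)
  nlinarith [sq_abs (x i), sq_nonneg (|x i| - 1)]

variable {n : ℕ} (M : EvenLattice n)

@[simp] theorem toCplx_smul (r : ℝ) (x : RealSpace n) : toCplx (r • x) = (r : ℂ) • toCplx x := by
  funext i; simp [toCplx]

@[simp] theorem cconj_cconj (Z : CplxSpace n) : cconj (cconj Z) = Z := by
  funext i; simp [cconj]

@[simp] theorem cconj_toCplx (x : RealSpace n) : cconj (toCplx x) = toCplx x := by
  funext i; simp [cconj, toCplx]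

theorem cconj_smul (c : ℂ) (Z : CplxSpace n) :
    cconj (c • Z) = (starRingEnd ℂ) c • cconj Z := by
  funext i; simp [cconj]

theorem cconj_add (Z W : CplxSpace n) : cconj (Z + W) = cconj Z + cconj W := by
  funext i; simp [cconj]

namespace EvenLattice

theorem bC_add_left (x x' y : CplxSpace n) : M.bC (x + x') y = M.bC x y + M.bC x' y :=
  gramForm_add_left _ _ _ _

theorem bC_smul_left (c : ℂ) (x y : CplxSpace n) : M.bC (c • x) y = c * M.bC x y :=
  gramForm_smul_left _ _ _ _

theorem bC_add_right (x y y' : CplxSpace n) : M.bC x (y + y') = M.bC x y + M.bC x y' :=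
  gramForm_add_right _ _ _ _

theorem bC_smul_right (c : ℂ) (x y : CplxSpace n) : M.bC x (c • y) = c * M.bC x y :=
  gramForm_smul_right _ _ _ _

theorem bC_comm (x y : CplxSpace n) : M.bC x y = M.bC y x := gramForm_comm _ M.symm _ _

theorem bC_sub_left (x x' y : CplxSpace n) : M.bC (x - x') y = M.bC x y - M.bC x' y := by
  rw [sub_eq_add_neg, ← neg_one_smul ℂ x', bC_add_left, bC_smul_left]; ring

theorem bC_sub_right (x y y' : CplxSpace n) : M.bC x (y - y') = M.bC x y - M.bC x y' := by
  rw [bC_comm, bC_sub_left, bC_comm, M.bC_comm y']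

theorem bC_zero_left (x : CplxSpace n) : M.bC 0 x = 0 := by
  simp [bC, gramForm]

theorem bR_add_left (x x' y : RealSpace n) : M.bR (x + x') y = M.bR x y + M.bR x' y :=
  gramForm_add_left _ _ _ _

theorem bR_smul_left (c : ℝ) (x y : RealSpace n) : M.bR (c • x) y = c * M.bR x y :=
  gramForm_smul_left _ _ _ _

theorem bR_add_right (x y y' : RealSpace n) : M.bR x (y + y') = M.bR x y + M.bR x y' :=
  gramForm_add_right _ _ _ _

theorem bR_smul_right (c : ℝ) (x y : RealSpace n) : M.bR x (c • y) = c * M.bR x y :=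
  gramForm_smul_right _ _ _ _

theorem bR_comm (x y : RealSpace n) : M.bR x y = M.bR y x := gramForm_comm _ M.symm _ _

theorem bC_toCplx (x y : RealSpace n) : M.bC (toCplx x) (toCplx y) = (M.bR x y : ℂ) := by
  simp [bC, bR, gramForm, toCplx]

theorem conj_bC (Z W : CplxSpace n) :
    (starRingEnd ℂ) (M.bC Z W) = M.bC (cconj Z) (cconj W) := by
  simp [bC, gramForm, cconj, map_sum]

theorem bC_cconj_right (x : RealSpace n) (Z : CplxSpace n) :
    M.bC (toCplx x) (cconj Z) = (starRingEnd ℂ) (M.bC (toCplx x) Z) := by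
  rw [conj_bC, cconj_toCplx]

theorem bC_self_cconj (Z : CplxSpace n) :
    M.bC Z (cconj Z) = ((M.bC Z (cconj Z)).re : ℂ) := by
  have : (starRingEnd ℂ) (M.bC Z (cconj Z)) = M.bC Z (cconj Z) := by
    rw [conj_bC, cconj_cconj, bC_comm]
  exact (Complex.conj_eq_iff_re.mp this).symm

theorem continuous_bC : Continuous fun p : CplxSpace n × CplxSpace n => M.bC p.1 p.2 := by
  unfold bC gramForm; fun_prop

theorem continuous_bC_comp {α : Type*} [TopologicalSpace α] {f g : α → CplxSpace n}
    (hf : Continuous f) (hg : Continuous g) : Continuous fun a => M.bC (f a) (g a) := by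
  unfold bC gramForm
  fun_prop

theorem continuous_bR : Continuous fun p : RealSpace n × RealSpace n => M.bR p.1 p.2 := by
  unfold bR gramForm; fun_prop

theorem continuous_toCplx : Continuous (toCplx : RealSpace n → CplxSpace n) := by
  unfold toCplx; fun_prop

/-- In coordinates that diagonalize the form, a vector whose first two coordinates vanish has
negative norm. -/
theorem exists_coords : ∃ c : RealSpace n →ₗ[ℝ] (Fin (n + 2) → ℝ),
    (∀ x, c x = 0 → x = 0) ∧ ∀ x, M.bR x x =
      ∑ i : Fin (n + 2), (if (i : ℕ) < 2 then (1 : ℝ) else -1) * (c x i) ^ 2 := by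
  obtain ⟨P, hP⟩ := M.signature
  set GR : Matrix (Fin (n + 2)) (Fin (n + 2)) ℝ := M.gram.map (fun a : ℤ => (a : ℝ)) with hGR
  have hdet : IsUnit P.det := by
    rw [isUnit_iff_ne_zero]
    intro h
    have h1 := congrArg Matrix.det hP
    rw [Matrix.det_mul, h, mul_zero, Matrix.det_diagonal] at h1
    refine Finset.prod_ne_zero_iff.mpr (fun (i : Fin (n + 2)) _ => ?_) h1.symm
    split_ifs <;> norm_num
  refine ⟨P⁻¹.mulVecLin, fun x hx => ?_, fun x => ?_⟩
  · have : P.mulVec (P⁻¹.mulVec x) = x := by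
      rw [Matrix.mulVec_mulVec, Matrix.mul_nonsing_inv _ hdet, Matrix.one_mulVec]
    rw [← this]
    have hx' : P⁻¹.mulVec x = 0 := hx
    rw [hx', Matrix.mulVec_zero]
  · set u := P⁻¹.mulVec x with hu
    have hx : x = P.mulVec u := by
      rw [hu, Matrix.mulVec_mulVec, Matrix.mul_nonsing_inv _ hdet, Matrix.one_mulVec]
    have h1 : M.bR x x = x ⬝ᵥ GR.mulVec x := by
      simp only [bR, gramForm, dotProduct, Matrix.mulVec, hGR, Matrix.map_apply, Finset.mul_sum]
      exact Finset.sum_congr rfl fun i _ => Finset.sum_congr rfl fun j _ => by ring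
    have h3 : ∀ u, P.mulVec u ⬝ᵥ GR.mulVec (P.mulVec u) =
        u ⬝ᵥ (P.transpose * GR * P).mulVec u := by
      intro u
      rw [← Matrix.mulVec_mulVec, ← Matrix.mulVec_mulVec, Matrix.dotProduct_mulVec u,
        Matrix.vecMul_transpose]
    have h2 : x ⬝ᵥ GR.mulVec x = u ⬝ᵥ (P.transpose * GR * P).mulVec u := by
      rw [← h3, ← hx]
    rw [h1, h2, hP]
    simp only [Matrix.mulVec_diagonal, dotProduct, Matrix.mulVecLin_apply, ← hu]
    exact Finset.sum_congr rfl fun i _ => by ring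

end EvenLattice

open EvenLattice

-- unfolding the pairing into its defining double sum makes unification expensive
attribute [local irreducible] EvenLattice.bC EvenLattice.bR

/-- Real and imaginary part of a vector of the cone span a positive definite plane. -/
theorem exists_real_imag {Z : CplxSpace n} (hZ : Z ∈ cone M) :
    ∃ X Y : RealSpace n, Z = toCplx X + I • toCplx Y ∧ cconj Z = toCplx X - I • toCplx Y ∧
      M.bR X Y = 0 ∧ M.bR X X = absSq M Z ∧ M.bR Y Y = absSq M Z := by
  refine ⟨fun i => (Z i).re, fun i => (Z i).im, ?_, ?_, ?_⟩
  · funext i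
    simp only [toCplx, Pi.add_apply, Pi.smul_apply, smul_eq_mul]
    rw [mul_comm, Complex.re_add_im]
  · funext i
    simp only [toCplx, cconj, Pi.sub_apply, Pi.smul_apply, smul_eq_mul]
    apply Complex.ext <;> simp
  set X : RealSpace n := fun i => (Z i).re with hX
  set Y : RealSpace n := fun i => (Z i).im with hY
  have hZ1 : Z = toCplx X + I • toCplx Y := by
    funext i
    simp only [hX, hY, toCplx, Pi.add_apply, Pi.smul_apply, smul_eq_mul]
    rw [mul_comm, Complex.re_add_im]
  have hZ2 : cconj Z = toCplx X - I • toCplx Y := by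
    funext i
    simp only [hX, hY, toCplx, cconj, Pi.sub_apply, Pi.smul_apply, smul_eq_mul]
    apply Complex.ext <;> simp
  have h1 : M.bC Z Z = ((M.bR X X - M.bR Y Y : ℝ) : ℂ) + ((2 * M.bR X Y : ℝ) : ℂ) * I := by
    rw [hZ1]
    simp only [bC_add_left, bC_add_right, bC_smul_left, bC_smul_right, bC_toCplx, M.bR_comm Y X]
    push_cast
    ring_nf
    rw [I_sq]
    ring
  have h2 : M.bC Z (cconj Z) = ((M.bR X X + M.bR Y Y : ℝ) : ℂ) := by
    rw [hZ2, hZ1]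
    simp only [bC_add_left, bC_sub_right, bC_smul_left, bC_smul_right, bC_toCplx, M.bR_comm Y X]
    push_cast
    ring_nf
    rw [I_sq]
    ring
  have h3 := hZ.1
  rw [h1] at h3
  have h4 := congrArg Complex.re h3
  have h5 := congrArg Complex.im h3
  simp only [add_re, ofReal_re, mul_re, Complex.I_re, mul_zero, ofReal_im, Complex.I_im, zero_re,
    add_im, mul_im, mul_one, zero_im] at h4 h5
  have h6 : absSq M Z = (M.bR X X + M.bR Y Y) / 2 := by rw [absSq, h2, ofReal_re]
  refine ⟨by linarith, by rw [h6]; linarith, by rw [h6]; linarith⟩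

theorem absSq_pos {Z : CplxSpace n} (hZ : Z ∈ cone M) : 0 < absSq M Z := half_pos hZ.2

theorem bC_self_cconj_eq (Z : CplxSpace n) : M.bC Z (cconj Z) = 2 * (absSq M Z : ℂ) := by
  rw [bC_self_cconj, absSq]; push_cast; ring

/-- A vector orthogonal to a positive definite plane has negative norm. -/
theorem neg_of_orthogonal {X Y w : RealSpace n} {N : ℝ} (hN : 0 < N) (hXY : M.bR X Y = 0)
    (hX : M.bR X X = N) (hY : M.bR Y Y = N) (hwX : M.bR w X = 0) (hwY : M.bR w Y = 0)
    (hw : w ≠ 0) : M.bR w w < 0 := by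
  by_contra hcon
  rw [not_lt] at hcon
  obtain ⟨c, hc0, hc⟩ := M.exists_coords
  let T : (Fin 3 → ℝ) →ₗ[ℝ] RealSpace n :=
    Fintype.linearCombination ℝ ![X, Y, w]
  let L : (Fin 3 → ℝ) →ₗ[ℝ] (Fin 2 → ℝ) :=
    (LinearMap.funLeft ℝ ℝ (Fin.castLE (by omega : 2 ≤ n + 2))) ∘ₗ c ∘ₗ T
  have hker : LinearMap.ker L ≠ ⊥ := LinearMap.ker_ne_bot_of_finrank_lt (by simp)
  obtain ⟨a, haL, ha0⟩ := (Submodule.ne_bot_iff _).mp hker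
  have hT : T a = a 0 • X + a 1 • Y + a 2 • w := by
    simp [T, Fintype.linearCombination_apply, Fin.sum_univ_three]
  have hcoord : ∀ i : Fin (n + 2), (i : ℕ) < 2 → c (T a) i = 0 := by
    intro i hi
    have := congrFun (LinearMap.mem_ker.mp haL) ⟨i, hi⟩
    simpa [L, LinearMap.funLeft_apply] using this
  have h1 : M.bR (T a) (T a) = -∑ i, (c (T a) i) ^ 2 := by
    rw [hc, ← Finset.sum_neg_distrib]
    refine Finset.sum_congr rfl fun i _ => ?_
    split_ifs with hi
    · rw [hcoord i hi]; ring
    · ring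
  have h2 : M.bR (T a) (T a) = N * (a 0 ^ 2 + a 1 ^ 2) + a 2 ^ 2 * M.bR w w := by
    rw [hT]
    simp only [bR_add_left, bR_add_right, bR_smul_left, bR_smul_right, hX, hY, hXY, hwX, hwY,
      M.bR_comm Y X, M.bR_comm X w, M.bR_comm Y w]
    ring
  have h3 : 0 ≤ ∑ i, (c (T a) i) ^ 2 := Finset.sum_nonneg fun i _ => sq_nonneg _
  have h4 : 0 ≤ a 2 ^ 2 * M.bR w w := mul_nonneg (sq_nonneg _) hcon
  have h5 : N * (a 0 ^ 2 + a 1 ^ 2) = 0 := by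
    have : 0 ≤ N * (a 0 ^ 2 + a 1 ^ 2) := by positivity
    linarith
  have h6 : ∑ i, (c (T a) i) ^ 2 = 0 := by linarith
  have h7 : T a = 0 := hc0 _ (by
    funext i
    have := (Finset.sum_eq_zero_iff_of_nonneg fun i _ => sq_nonneg _).mp h6 i (Finset.mem_univ i)
    simpa using this)
  have h8 : a 0 ^ 2 + a 1 ^ 2 = 0 := by
    rcases mul_eq_zero.mp h5 with h | h
    · exact absurd h hN.ne'
    · exact h
  have ha0' : a 0 = 0 := by nlinarith [sq_nonneg (a 0), sq_nonneg (a 1)]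
  have ha1' : a 1 = 0 := by nlinarith [sq_nonneg (a 0), sq_nonneg (a 1)]
  rw [hT, ha0', ha1', zero_smul, zero_smul, zero_add, zero_add] at h7
  have ha2 : a 2 = 0 := (smul_eq_zero.mp h7).resolve_right hw
  apply ha0
  funext i
  fin_cases i <;> simp [ha0', ha1', ha2]

/-- The positive part `λ ↦ ⟨λ_Z, λ_Z⟩` of the quadratic form, extended holomorphically: `W` stands
for the conjugate of `Z`. -/
noncomputable def kap (x : RealSpace n) (Z W : CplxSpace n) : ℂ :=
  2 * M.bC (toCplx x) Z * M.bC (toCplx x) W / M.bC Z W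

theorem kap_cconj (x : RealSpace n) (Z : CplxSpace n) :
    kap M x Z (cconj Z) = ((normSq (M.bC (toCplx x) Z) / absSq M Z : ℝ) : ℂ) := by
  rw [kap, bC_self_cconj_eq, bC_cconj_right, mul_assoc, mul_conj]
  push_cast
  rw [mul_div_mul_left _ _ two_ne_zero]

theorem kap_smul (r : ℝ) (x : RealSpace n) (Z W : CplxSpace n) :
    kap M (r • x) Z W = ((r ^ 2 : ℝ) : ℂ) * kap M x Z W := by
  rw [kap, kap, toCplx_smul, bC_smul_left, bC_smul_left]
  push_cast
  ring

/-- The majorant `⟨x_Z, x_Z⟩ - ⟨x - x_Z, x - x_Z⟩ = 2 ⟨x_Z, x_Z⟩ - ⟨x, x⟩` is positive definite. -/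
theorem majorant_pos {Z : CplxSpace n} (hZ : Z ∈ cone M) {x : RealSpace n} (hx : x ≠ 0) :
    0 < 2 * (kap M x Z (cconj Z)).re - M.bR x x := by
  obtain ⟨X, Y, hZ1, hZ2, hXY, hX, hY⟩ := exists_real_imag M hZ
  set N := absSq M Z with hN
  have hN0 : 0 < N := absSq_pos M hZ
  rw [kap_cconj, ofReal_re, ← hN]
  have ha : M.bC (toCplx x) Z = (M.bR x X : ℂ) + (M.bR x Y : ℂ) * I := by
    rw [hZ1, bC_add_right, bC_smul_right, bC_toCplx, bC_toCplx]; ring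
  rw [ha, normSq_add_mul_I]
  set α := M.bR x X
  set β := M.bR x Y
  set w : RealSpace n := x + (-(α / N)) • X + (-(β / N)) • Y with hw
  have hwX : M.bR w X = 0 := by
    rw [hw]
    simp only [bR_add_left, bR_smul_left, hX, M.bR_comm Y X, hXY]
    change α + _ + _ = 0
    field_simp
    ring
  have hwY : M.bR w Y = 0 := by
    rw [hw]
    simp only [bR_add_left, bR_smul_left, hY, hXY]
    change β + _ + _ = 0
    field_simp
    ring
  have hxw : x = w + (α / N) • X + (β / N) • Y := by
    rw [hw]; module
  have hxx : M.bR x x = M.bR w w + (α ^ 2 + β ^ 2) / N := by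
    conv_lhs => rw [hxw]
    simp only [bR_add_left, bR_add_right, bR_smul_left, bR_smul_right, hX, hY, hXY,
      M.bR_comm Y X, M.bR_comm X w, M.bR_comm Y w, hwX, hwY]
    field_simp
    ring
  rw [hxx]
  have h0 : 0 ≤ (α ^ 2 + β ^ 2) / N := by positivity
  rcases eq_or_ne w 0 with hw0 | hw0
  · have h1 : 0 < (α ^ 2 + β ^ 2) / N := by
      refine div_pos ?_ hN0
      by_contra hcon
      have hα : α = 0 := by nlinarith [sq_nonneg α, sq_nonneg β]
      have hβ : β = 0 := by nlinarith [sq_nonneg α, sq_nonneg β]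
      apply hx
      rw [hxw, hw0, hα, hβ]
      simp
    have : M.bR w w = 0 := by rw [hw0]; simp [bR, gramForm]
    rw [this]
    linarith
  · have := neg_of_orthogonal M hN0 hXY hX hY hwX hwY hw0
    linarith

theorem continuousAt_kap {x : RealSpace n} {Z W : CplxSpace n} (h : M.bC Z W ≠ 0) :
    ContinuousAt (fun q : RealSpace n × (CplxSpace n × CplxSpace n) =>
      kap M q.1 q.2.1 q.2.2) (x, (Z, W)) := by
  unfold kap
  have hx : Continuous fun q : RealSpace n × (CplxSpace n × CplxSpace n) => toCplx q.1 :=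
    continuous_toCplx.comp continuous_fst
  have h1 := M.continuous_bC_comp hx (continuous_fst.comp continuous_snd)
  have h2 := M.continuous_bC_comp hx (continuous_snd.comp continuous_snd)
  have h3 : Continuous fun q : RealSpace n × (CplxSpace n × CplxSpace n) =>
      M.bC q.2.1 q.2.2 :=
    M.continuous_bC_comp (continuous_fst.comp continuous_snd) (continuous_snd.comp continuous_snd)
  exact ((continuousAt_const.mul h1.continuousAt).mul h2.continuousAt).div h3.continuousAt h

/-- The majorant is positive definite uniformly in a neighbourhood of a point of the cone, in the
space of all pairs `(Z, W)`. -/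
theorem eventually_majorant {Z : CplxSpace n} (hZ : Z ∈ cone M) :
    ∃ ε > 0, ∀ᶠ p : CplxSpace n × CplxSpace n in 𝓝 (Z, cconj Z),
      M.bC p.1 p.2 ≠ 0 ∧ ∀ x : RealSpace n,
        M.bR x x + ε * nrm2 x ≤ 2 * (kap M x p.1 p.2).re := by
  have hne : M.bC Z (cconj Z) ≠ 0 := fun h => by
    have := hZ.2
    rw [h] at this
    simp at this
  set S : Set (RealSpace n) := nrm2 ⁻¹' {1} with hS
  have hmemS : ∀ x, x ∈ S ↔ nrm2 x = 1 := fun x => by simp [hS]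
  have hSc : IsCompact S := by
    refine Metric.isCompact_of_isClosed_isBounded
      (isClosed_singleton.preimage continuous_nrm2) ?_
    refine (Metric.isBounded_iff_subset_closedBall 0).mpr ⟨2, fun x hx => ?_⟩
    rw [mem_closedBall_zero_iff, pi_norm_le_iff_of_nonneg (by norm_num)]
    intro i
    have := abs_apply_le x i
    have hx' : nrm2 x = 1 := (hmemS x).mp hx
    rw [hx'] at this
    rw [Real.norm_eq_abs]
    linarith
  have hcont : ∀ x : RealSpace n, ContinuousAt
      (fun q : RealSpace n × (CplxSpace n × CplxSpace n) =>
        2 * (kap M q.1 q.2.1 q.2.2).re - M.bR q.1 q.1) (x, (Z, cconj Z)) := by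
    intro x
    have h1 := continuous_re.continuousAt.comp (continuousAt_kap M (x := x) hne)
    have h2 : Continuous fun q : RealSpace n × (CplxSpace n × CplxSpace n) => M.bR q.1 q.1 :=
      M.continuous_bR.comp (continuous_fst.prodMk continuous_fst)
    exact (continuousAt_const.mul h1).sub h2.continuousAt
  have hS0 : ∀ x ∈ S, 0 < 2 * (kap M x Z (cconj Z)).re - M.bR x x := by
    intro x hx
    refine majorant_pos M hZ fun h => ?_
    have hx' : nrm2 x = 1 := (hmemS x).mp hx
    rw [nrm2_eq_zero.mpr h] at hx'
    exact zero_ne_one hx'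
  have hcS : ContinuousOn (fun x => 2 * (kap M x Z (cconj Z)).re - M.bR x x) S := fun x _ =>
    ((hcont x).comp (f := fun x => (x, (Z, cconj Z)))
      (by fun_prop : ContinuousAt _ x)).continuousWithinAt
  obtain ⟨ε, hε, hεS⟩ := hSc.exists_forall_le' hcS hS0
  refine ⟨ε / 2, half_pos hε, ?_⟩
  have hev : ∀ᶠ p : CplxSpace n × CplxSpace n in 𝓝 (Z, cconj Z), ∀ x ∈ S,
      ε / 2 < 2 * (kap M x p.1 p.2).re - M.bR x x := by
    refine hSc.eventually_forall_of_forall_eventually fun x hx => ?_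
    have hlt : ε / 2 < 2 * (kap M x Z (cconj Z)).re - M.bR x x := by
      linarith [hεS x hx]
    have h1 := (hcont x).eventually (lt_mem_nhds hlt)
    exact (continuous_swap.tendsto ((Z, cconj Z), x)).eventually h1
  have hev2 : ∀ᶠ p : CplxSpace n × CplxSpace n in 𝓝 (Z, cconj Z), M.bC p.1 p.2 ≠ 0 :=
    M.continuous_bC.continuousAt.eventually_ne hne
  filter_upwards [hev, hev2] with p hp hp2
  refine ⟨hp2, fun x => ?_⟩
  rcases eq_or_ne x 0 with rfl | hx
  · have h1 : kap M 0 p.1 p.2 = 0 := by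
      have : toCplx (0 : RealSpace n) = 0 := by funext i; simp [toCplx]
      simp [kap, this, bC_zero_left]
    rw [h1]
    simp [bR, gramForm, nrm2]
  · have hr : 0 < nrm2 x := lt_of_le_of_ne (nrm2_nonneg x) fun h => hx (nrm2_eq_zero.mp h.symm)
    set r := Real.sqrt (nrm2 x) with hr'
    have hr0 : 0 < r := Real.sqrt_pos.mpr hr
    have hr2 : r ^ 2 = nrm2 x := Real.sq_sqrt hr.le
    have hu : r⁻¹ • x ∈ S := by
      rw [hmemS, nrm2_smul, ← hr2]
      field_simp
    have h1 := hp _ hu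
    rw [kap_smul, re_ofReal_mul, bR_smul_left, bR_smul_right] at h1
    have h2 : r ^ 2 * (ε / 2) < r ^ 2 * (2 * ((r⁻¹ ^ 2) * (kap M x p.1 p.2).re) -
        r⁻¹ * (r⁻¹ * M.bR x x)) := mul_lt_mul_of_pos_left h1 (by positivity)
    have h3 : r ^ 2 * (2 * ((r⁻¹ ^ 2) * (kap M x p.1 p.2).re) - r⁻¹ * (r⁻¹ * M.bR x x)) =
        2 * (kap M x p.1 p.2).re - M.bR x x := by
      field_simp
    rw [h3, hr2] at h2
    linarith

theorem norm_bC_le (W : CplxSpace n) : ∃ K > 0, ∀ᶠ W' in 𝓝 W, ∀ x : RealSpace n,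
    ‖M.bC (toCplx x) W'‖ ≤ K * (1 + nrm2 x) := by
  refine ⟨∑ i, ∑ j, |(M.gram i j : ℝ)| * (‖W j‖ + 1) + 1, by positivity, ?_⟩
  have hev : ∀ᶠ W' : CplxSpace n in 𝓝 W, ∀ j, ‖W' j‖ < ‖W j‖ + 1 := by
    rw [eventually_all]
    intro j
    have : Continuous fun W' : CplxSpace n => ‖W' j‖ := by fun_prop
    exact this.continuousAt.eventually (gt_mem_nhds (lt_add_one _))
  filter_upwards [hev] with W' hW' x
  have h0 := nrm2_nonneg x
  calc ‖M.bC (toCplx x) W'‖ ≤ ∑ i, ∑ j, ‖toCplx x i * (M.gram i j : ℂ) * W' j‖ := by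
        rw [bC, gramForm]
        exact (norm_sum_le _ _).trans (Finset.sum_le_sum fun i _ => norm_sum_le _ _)
    _ ≤ ∑ i, ∑ j, (|(M.gram i j : ℝ)| * (‖W j‖ + 1)) * (1 + nrm2 x) := by
        refine Finset.sum_le_sum fun i _ => Finset.sum_le_sum fun j _ => ?_
        rw [norm_mul, norm_mul, toCplx, Complex.norm_real, Real.norm_eq_abs,
          Complex.norm_intCast]
        have h1 := abs_apply_le x i
        have h2 := (hW' j).le
        calc |x i| * |(M.gram i j : ℝ)| * ‖W' j‖
            ≤ (1 + nrm2 x) * |(M.gram i j : ℝ)| * (‖W j‖ + 1) := by gcongr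
          _ = _ := by ring
    _ = (∑ i, ∑ j, |(M.gram i j : ℝ)| * (‖W j‖ + 1)) * (1 + nrm2 x) := by
        simp only [Finset.sum_mul]
    _ ≤ _ := by
        apply mul_le_mul_of_nonneg_right _ (by positivity)
        linarith

/-! ### The dual lattice -/

/-- The integral vector `(⟨λ, e_i⟩)_i` of an element `λ` of the dual lattice. -/
noncomputable def dualCoord (l : M.dual) : Fin (n + 2) → ℤ := fun i =>
  (M.gram_mulVec_int l i).choose

theorem dualCoord_spec (l : M.dual) (i : Fin (n + 2)) :
    (M.gram.map (fun a : ℤ => (a : ℝ))).mulVec l.1 i = dualCoord M l i :=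
  (M.gram_mulVec_int l i).choose_spec

theorem isUnit_gram_det : IsUnit (M.gram.map (fun a : ℤ => (a : ℝ))).det := by
  have h1 := (Int.castRingHom ℝ).map_det M.gram
  have h2 : (M.gram.map (fun a : ℤ => (a : ℝ))).det = (M.gram.det : ℝ) := by
    simpa [RingHom.mapMatrix_apply] using h1.symm
  rw [h2, isUnit_iff_ne_zero]
  exact_mod_cast M.gram_det_ne_zero

theorem bR_eq_dot (x y : RealSpace n) :
    M.bR x y = ∑ j, (M.gram.map (fun a : ℤ => (a : ℝ))).mulVec x j * y j := by
  rw [bR_comm]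
  simp only [bR, gramForm, Matrix.mulVec, dotProduct, Matrix.map_apply, Finset.sum_mul]
  exact Finset.sum_congr rfl fun i _ => Finset.sum_congr rfl fun j _ => by ring

theorem bR_dual (l : M.dual) (y : RealSpace n) :
    M.bR l y = ∑ j, (dualCoord M l j : ℝ) * y j := by
  rw [bR_eq_dot]
  simp only [dualCoord_spec]

/-- The dual lattice is identified with `ℤ ^ (n + 2)` by the pairing with the basis vectors. -/
noncomputable def dualEquiv : M.dual ≃ (Fin (n + 2) → ℤ) :=
  Equiv.ofBijective (dualCoord M) (by
    constructor
    · intro l l' h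
      apply Subtype.ext
      have h1 : (M.gram.map (fun a : ℤ => (a : ℝ))).mulVec l.1 =
          (M.gram.map (fun a : ℤ => (a : ℝ))).mulVec l'.1 := by
        funext i; rw [dualCoord_spec, dualCoord_spec, h]
      have := congrArg ((M.gram.map (fun a : ℤ => (a : ℝ)))⁻¹.mulVec) h1
      simpa [Matrix.mulVec_mulVec, Matrix.nonsing_inv_mul _ (isUnit_gram_det M)] using this
    · intro m
      set x : RealSpace n := (M.gram.map (fun a : ℤ => (a : ℝ)))⁻¹.mulVec (intVec m) with hx
      have hGx : (M.gram.map (fun a : ℤ => (a : ℝ))).mulVec x = intVec m := by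
        rw [hx, Matrix.mulVec_mulVec, Matrix.mul_nonsing_inv _ (isUnit_gram_det M),
          Matrix.one_mulVec]
      have hxd : x ∈ M.dual := by
        intro y hy
        choose a ha using hy
        refine ⟨∑ j, m j * a j, ?_⟩
        rw [bR_eq_dot, hGx]
        push_cast
        exact Finset.sum_congr rfl fun j _ => by rw [ha]; rfl
      refine ⟨⟨x, hxd⟩, funext fun i => ?_⟩
      have := dualCoord_spec M ⟨x, hxd⟩ i
      rw [hGx, intVec] at this
      exact_mod_cast this.symm)

theorem dualEquiv_apply (l : M.dual) : dualEquiv M l = dualCoord M l := rfl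

instance countable_dual : Countable M.dual := (dualEquiv M).injective.countable

theorem summable_dual {ε : ℝ} (hε : 0 < ε) :
    Summable fun l : M.dual => Real.exp (-ε * nrm2 (l : RealSpace n)) := by
  -- Euclidean norms of a vector and of its image under the Gram matrix are comparable
  obtain ⟨K, hK, hKb⟩ : ∃ K > 0, ∀ l : M.dual,
      nrm2 (intVec (dualCoord M l)) ≤ K * nrm2 (l : RealSpace n) := by
    refine ⟨∑ i, ∑ j, (M.gram i j : ℝ) ^ 2 + 1, by positivity, fun l => ?_⟩
    have h0 := nrm2_nonneg (l : RealSpace n)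
    calc nrm2 (intVec (dualCoord M l)) =
          ∑ i, (∑ j, (M.gram i j : ℝ) * (l : RealSpace n) j) ^ 2 := by
          refine Finset.sum_congr rfl fun i _ => ?_
          rw [intVec, ← dualCoord_spec]
          rfl
      _ ≤ ∑ i, (∑ j, (M.gram i j : ℝ) ^ 2) * nrm2 (l : RealSpace n) :=
          Finset.sum_le_sum fun i _ => Finset.sum_mul_sq_le_sq_mul_sq _ _ _
      _ = (∑ i, ∑ j, (M.gram i j : ℝ) ^ 2) * nrm2 (l : RealSpace n) := by rw [Finset.sum_mul]
      _ ≤ _ := mul_le_mul_of_nonneg_right (by linarith) h0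
  have h1 := (dualEquiv M).summable_iff.mpr (summable_gaussian_pi (div_pos hε hK) (n + 2))
  refine Summable.of_nonneg_of_le (fun _ => (Real.exp_pos _).le) (fun l => ?_) h1
  simp only [Function.comp_apply]
  refine Real.exp_le_exp.mpr ?_
  have h2 := hKb l
  have h3 : ∑ i, ((dualEquiv M l) i : ℝ) ^ 2 = nrm2 (intVec (dualCoord M l)) := rfl
  rw [h3, neg_mul, neg_mul, neg_le_neg_iff, div_mul_eq_mul_div, div_le_iff₀ hK]
  nlinarith

theorem finite_dual_of_nrm2_lt (R : ℝ) : {l : M.dual | nrm2 (l : RealSpace n) < R}.Finite := by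
  have h := (summable_dual M one_pos).tendsto_cofinite_zero.eventually
    (gt_mem_nhds (Real.exp_pos (-1 * R)))
  refine (Filter.eventually_cofinite.mp h).subset fun l hl => ?_
  rw [Set.mem_ofPred_eq] at hl ⊢
  rw [not_lt, Real.exp_le_exp]
  linarith

/-! ### Means of periodic functions and the lowering operator -/

theorem isOpen_uhp : IsOpen {z : ℂ | 0 < z.im} := isOpen_lt continuous_const continuous_im

/-- The Maass lowering operator `-2 i y² ∂/∂τ̄` on functions of a complex variable. -/
noncomputable def lowerOp (g : ℂ → ℂ) (z : ℂ) : ℂ :=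
  -2 * I * (z.im : ℂ) ^ 2 * ((1 / 2) * (fderiv ℝ g z 1 + I * fderiv ℝ g z I))

/-- The mean over a period of a periodic function at height `y`. -/
noncomputable def xMean (g : ℂ → ℂ) (y : ℝ) : ℂ := ∫ x in (0 : ℝ)..1, g ((x : ℂ) + (y : ℂ) * I)

/-- Smooth `1`-periodic functions on the upper half-plane. -/
structure IsPeriodicSmooth (g : ℂ → ℂ) : Prop where
  smooth : ContDiffOn ℝ ∞ g {z : ℂ | 0 < z.im}
  periodic : ∀ z : ℂ, 0 < z.im → g (z + 1) = g z

section Periodic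

variable {g : ℂ → ℂ}

theorem im_add_mul_I (x y : ℝ) : ((x : ℂ) + (y : ℂ) * I).im = y := by simp

theorem re_add_mul_I (x y : ℝ) : ((x : ℂ) + (y : ℂ) * I).re = x := by simp

theorem IsPeriodicSmooth.contDiffOn_fderiv (hg : IsPeriodicSmooth g) :
    ContDiffOn ℝ ∞ (fderiv ℝ g) {z : ℂ | 0 < z.im} :=
  hg.smooth.fderiv_of_isOpen isOpen_uhp (by simp)

theorem IsPeriodicSmooth.hasFDerivAt (hg : IsPeriodicSmooth g) {z : ℂ} (hz : 0 < z.im) :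
    HasFDerivAt g (fderiv ℝ g z) z :=
  ((hg.smooth.differentiableOn (by simp)).differentiableAt (isOpen_uhp.mem_nhds hz)).hasFDerivAt

theorem IsPeriodicSmooth.lower (hg : IsPeriodicSmooth g) : IsPeriodicSmooth (lowerOp g) where
  smooth := by
    have h1 : ContDiffOn ℝ ∞ (fun z => fderiv ℝ g z 1) {z : ℂ | 0 < z.im} :=
      hg.contDiffOn_fderiv.clm_apply contDiffOn_const
    have h2 : ContDiffOn ℝ ∞ (fun z => fderiv ℝ g z I) {z : ℂ | 0 < z.im} :=
      hg.contDiffOn_fderiv.clm_apply contDiffOn_const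
    have h3 : ContDiff ℝ ∞ fun z : ℂ => (z.im : ℂ) :=
      ofRealCLM.contDiff.comp imCLM.contDiff
    unfold lowerOp
    exact (contDiffOn_const.mul (h3.contDiffOn.pow 2)).mul
      (contDiffOn_const.mul (h1.add (contDiffOn_const.mul h2)))
  periodic := by
    intro z hz
    have h1 : fderiv ℝ g (z + 1) = fderiv ℝ g z := by
      rw [← fderiv_comp_add_right]
      refine Filter.EventuallyEq.fderiv_eq ?_
      filter_upwards [isOpen_uhp.mem_nhds hz] with w hw using hg.periodic w hw
    simp [lowerOp, h1]

theorem xMean_congr {g₁ g₂ : ℂ → ℂ} (h : Set.EqOn g₁ g₂ {z : ℂ | 0 < z.im}) {y : ℝ} (hy : 0 < y) :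
    xMean g₁ y = xMean g₂ y := by
  refine intervalIntegral.integral_congr fun x _ => h ?_
  simpa using hy

theorem IsPeriodicSmooth.continuous_row (hg : IsPeriodicSmooth g) {y : ℝ} (hy : 0 < y) :
    Continuous fun x : ℝ => g ((x : ℂ) + (y : ℂ) * I) :=
  hg.smooth.continuousOn.comp_continuous (by fun_prop) fun x => by simpa using hy

/-- The lowering operator acts on means as `y² d/dy`: the `x`-derivative integrates to zero. -/
theorem IsPeriodicSmooth.hasDerivAt_xMean (hg : IsPeriodicSmooth g) {y : ℝ} (hy : 0 < y) :
    HasDerivAt (xMean g) (xMean (lowerOp g) y / (y : ℂ) ^ 2) y := by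
  have hcf : ContinuousOn (fderiv ℝ g) {z : ℂ | 0 < z.im} := hg.contDiffOn_fderiv.continuousOn
  have hrow : ∀ v : ℂ, Continuous fun x : ℝ => fderiv ℝ g ((x : ℂ) + (y : ℂ) * I) v := fun v =>
    (hcf.comp_continuous (by fun_prop) fun x => by simpa using hy).clm_apply continuous_const
  have hparam : HasDerivAt (xMean g)
      (∫ x in (0 : ℝ)..1, fderiv ℝ g ((x : ℂ) + (y : ℂ) * I) I) y := by
    have hK : IsCompact ((fun q : ℝ × ℝ => (q.1 : ℂ) + (q.2 : ℂ) * I) ''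
        (Set.Icc 0 1 ×ˢ Set.Icc (y / 2) (2 * y))) :=
      (isCompact_Icc.prod isCompact_Icc).image (by fun_prop)
    have hKsub : ((fun q : ℝ × ℝ => (q.1 : ℂ) + (q.2 : ℂ) * I) ''
        (Set.Icc 0 1 ×ˢ Set.Icc (y / 2) (2 * y))) ⊆ {z : ℂ | 0 < z.im} := by
      rintro _ ⟨q, hq, rfl⟩
      have := hq.2.1
      rw [Set.mem_ofPred_eq, im_add_mul_I]
      linarith
    obtain ⟨C, hC⟩ := hK.exists_bound_of_continuousOn
      ((hcf.clm_apply (continuousOn_const (c := I))).mono hKsub)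
    refine (intervalIntegral.hasDerivAt_integral_of_dominated_loc_of_deriv_le
      (F := fun (t : ℝ) (x : ℝ) => g ((x : ℂ) + (t : ℂ) * I))
      (F' := fun (t : ℝ) (x : ℝ) => fderiv ℝ g ((x : ℂ) + (t : ℂ) * I) I)
      (s := Set.Ioo (y / 2) (2 * y)) (bound := fun _ => C)
      (Ioo_mem_nhds (by linarith) (by linarith)) ?_ ?_ ?_ ?_ ?_ ?_).2
    · filter_upwards [lt_mem_nhds hy] with t ht
      exact (hg.continuous_row ht).aestronglyMeasurable
    · exact (hg.continuous_row hy).intervalIntegrable _ _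
    · exact (hrow I).aestronglyMeasurable
    · refine Eventually.of_forall fun x hx t ht => hC _ ⟨(x, t), ⟨?_, ?_⟩, rfl⟩
      · rw [Set.uIoc_of_le zero_le_one] at hx
        exact ⟨hx.1.le, hx.2⟩
      · exact ⟨ht.1.le, ht.2.le⟩
    · exact intervalIntegrable_const
    · refine Eventually.of_forall fun x _ t ht => ?_
      have ht0 : 0 < t := by linarith [ht.1]
      have h1 : HasDerivAt (fun t : ℝ => (x : ℂ) + (t : ℂ) * I) I t := by
        simpa using ((ofRealCLM.hasDerivAt (x := t)).mul_const I).const_add (x : ℂ)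
      exact (hg.hasFDerivAt (by simpa using ht0)).comp_hasDerivAt t h1
  have hx0 : ∫ x in (0 : ℝ)..1, fderiv ℝ g ((x : ℂ) + (y : ℂ) * I) 1 = 0 := by
    rw [intervalIntegral.integral_eq_sub_of_hasDerivAt
      (f := fun x : ℝ => g ((x : ℂ) + (y : ℂ) * I))]
    · have := hg.periodic ((0 : ℝ) + (y : ℂ) * I) (by simpa using hy)
      rw [sub_eq_zero, ← this]
      congr 1
      push_cast
      ring
    · intro x _
      have h1 : HasDerivAt (fun t : ℝ => (t : ℂ) + (y : ℂ) * I) 1 x := by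
        simpa using (ofRealCLM.hasDerivAt (x := x)).add_const ((y : ℂ) * I)
      exact (hg.hasFDerivAt (by simpa using hy)).comp_hasDerivAt x h1
    · exact (hrow 1).intervalIntegrable _ _
  convert hparam using 1
  have hy' : (y : ℂ) ≠ 0 := by exact_mod_cast hy.ne'
  have h2 : xMean (lowerOp g) y = ∫ x in (0 : ℝ)..1,
      (-I * (y : ℂ) ^ 2 * fderiv ℝ g ((x : ℂ) + (y : ℂ) * I) 1 +
        (y : ℂ) ^ 2 * fderiv ℝ g ((x : ℂ) + (y : ℂ) * I) I) := by
    refine intervalIntegral.integral_congr fun x _ => ?_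
    simp only [lowerOp, im_add_mul_I]
    linear_combination (-(y : ℂ) ^ 2 * fderiv ℝ g ((x : ℂ) + (y : ℂ) * I) I) * I_sq
  rw [h2, intervalIntegral.integral_add (((hrow 1).const_mul _).intervalIntegrable _ _)
    (((hrow I).const_mul _).intervalIntegrable _ _), intervalIntegral.integral_const_mul,
    intervalIntegral.integral_const_mul, hx0, mul_zero, zero_add, mul_div_cancel_left₀]
  exact pow_ne_zero 2 hy'

theorem hasDerivAt_eval_inv (Q : Polynomial ℂ) {y : ℝ} (hy : 0 < y) :
    HasDerivAt (fun y : ℝ => Q.eval ((y : ℂ)⁻¹))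
      (-(Q.derivative.eval ((y : ℂ)⁻¹)) / (y : ℂ) ^ 2) y := by
  have hy' : (y : ℂ) ≠ 0 := by exact_mod_cast hy.ne'
  have h1 : HasDerivAt (fun y : ℝ => ((y : ℂ)⁻¹)) (-((y : ℂ) ^ 2)⁻¹) y :=
    (hasDerivAt_inv hy').comp_ofReal
  have h2 := (Q.hasDerivAt ((y : ℂ)⁻¹)).comp y h1
  exact h2.congr_deriv (by ring)

theorem exists_antiderivative (P : Polynomial ℂ) {m : ℕ} (hP : P.natDegree ≤ m) :
    ∃ Q : Polynomial ℂ, Q.derivative = P ∧ Q.natDegree ≤ m + 1 := by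
  refine ⟨∑ i ∈ Finset.range (m + 1), Polynomial.C (P.coeff i / (i + 1)) * Polynomial.X ^ (i + 1),
    ?_, ?_⟩
  · rw [Polynomial.derivative_sum]
    conv_rhs => rw [P.as_sum_range' (m + 1) (Nat.lt_succ_of_le hP)]
    refine Finset.sum_congr rfl fun i _ => ?_
    have hi : ((i : ℂ) + 1) ≠ 0 := by exact_mod_cast Nat.succ_ne_zero i
    rw [Polynomial.derivative_C_mul_X_pow, ← Polynomial.C_mul_X_pow_eq_monomial]
    simp only [Nat.cast_add, Nat.cast_one, add_tsub_cancel_right]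
    rw [div_mul_cancel₀ _ hi]
  · refine Polynomial.natDegree_sum_le_of_forall_le _ _ fun i hi => ?_
    refine (Polynomial.natDegree_C_mul_X_pow_le _ _).trans ?_
    have := Finset.mem_range.mp hi
    omega

/-- If the mean of the lowered function is a polynomial in `1 / y`, so is the mean itself. -/
theorem IsPeriodicSmooth.exists_xMean_eq (hg : IsPeriodicSmooth g) {P : Polynomial ℂ} {m : ℕ}
    (hP : P.natDegree ≤ m) (h : ∀ y : ℝ, 0 < y → xMean (lowerOp g) y = P.eval ((y : ℂ)⁻¹)) :
    ∃ Q : Polynomial ℂ, Q.natDegree ≤ m + 1 ∧ ∀ y : ℝ, 0 < y → xMean g y = Q.eval ((y : ℂ)⁻¹) := by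
  obtain ⟨Q, hQ, hQd⟩ := exists_antiderivative (-P) (m := m) (by
    rwa [Polynomial.natDegree_neg])
  have hd : ∀ y ∈ Set.Ioi (0 : ℝ), HasDerivAt (fun y : ℝ => xMean g y - Q.eval ((y : ℂ)⁻¹)) 0 y := by
    intro y hy
    have h1 := (hg.hasDerivAt_xMean hy).sub (hasDerivAt_eval_inv Q hy)
    rw [h y hy, hQ, Polynomial.eval_neg, neg_neg, sub_self] at h1
    exact h1
  obtain ⟨c, hc⟩ := isOpen_Ioi.exists_is_const_of_deriv_eq_zero isPreconnected_Ioi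
    (fun y hy => (hd y hy).differentiableAt.differentiableWithinAt) (fun y hy => (hd y hy).deriv)
  refine ⟨Q + Polynomial.C c, ?_, fun y hy => ?_⟩
  · exact (Polynomial.natDegree_add_le _ _).trans (max_le hQd (by simp))
  · rw [Polynomial.eval_add, Polynomial.eval_C, ← hc y hy]
    ring

theorem IsPeriodicSmooth.xMean_lower (hg : IsPeriodicSmooth g) {Q : Polynomial ℂ}
    (h : ∀ y : ℝ, 0 < y → xMean g y = Q.eval ((y : ℂ)⁻¹)) {y : ℝ} (hy : 0 < y) :
    xMean (lowerOp g) y = (-Q.derivative).eval ((y : ℂ)⁻¹) := by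
  have h1 := hg.hasDerivAt_xMean hy
  have h2 : HasDerivAt (xMean g) (-(Q.derivative.eval ((y : ℂ)⁻¹)) / (y : ℂ) ^ 2) y := by
    refine (hasDerivAt_eval_inv Q hy).congr_of_eventuallyEq ?_
    filter_upwards [lt_mem_nhds hy] with t ht using h t ht
  have hy' : (y : ℂ) ^ 2 ≠ 0 := pow_ne_zero 2 (by exact_mod_cast hy.ne')
  have h3 := h1.unique h2
  rw [div_left_inj' hy'] at h3
  rw [h3, Polynomial.eval_neg]

end Periodic

/-! ### Two estimates for polynomials -/

/-- A polynomial in `1 / y` of exponential decay vanishes. -/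
theorem eq_zero_of_exp_decay {P : Polynomial ℂ} {C δ : ℝ} (hδ : 0 < δ)
    (h : ∀ y : ℝ, 1 ≤ y → ‖P.eval ((y : ℂ)⁻¹)‖ ≤ C * Real.exp (-δ * y)) : P = 0 := by
  by_contra hP
  -- the reversed polynomial has a nonzero constant coefficient or grows; in any case it does not
  -- tend to zero at infinity
  set R := P.reverse with hR
  have hR0 : R ≠ 0 := by rwa [hR, Ne, Polynomial.reverse_eq_zero]
  have hev : ∀ y : ℝ, 1 ≤ y → R.eval (y : ℂ) = (y : ℂ) ^ P.natDegree * P.eval ((y : ℂ)⁻¹) := by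
    intro y hy
    have hy' : (y : ℂ) ≠ 0 := by
      have : y ≠ 0 := by linarith
      exact_mod_cast this
    have : Invertible ((y : ℂ)⁻¹) := invertibleOfNonzero (inv_ne_zero hy')
    have := Polynomial.eval₂_reverse_mul_pow (RingHom.id ℂ) ((y : ℂ)⁻¹) P
    simp only [invOf_eq_inv, inv_inv, Polynomial.eval₂_id] at this
    rw [← this, inv_pow]
    field_simp
    rfl
  have hlim : Tendsto (fun m : ℕ => R.eval ((m : ℂ) + 1)) atTop (𝓝 0) := by
    have h1 : Tendsto (fun y : ℝ => C * (y ^ P.natDegree * Real.exp (-δ * y))) atTop (𝓝 0) := by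
      have := (Real.tendsto_pow_mul_exp_neg_atTop_nhds_zero P.natDegree).comp
        (tendsto_id.const_mul_atTop hδ)
      have h2 := this.const_mul (C * (δ ^ P.natDegree)⁻¹)
      rw [mul_zero] at h2
      refine h2.congr fun y => ?_
      simp only [Function.comp_apply, id, mul_pow]
      rw [neg_mul]
      field_simp
    have h2 : Tendsto (fun m : ℕ => (m : ℝ) + 1) atTop atTop :=
      tendsto_atTop_add_const_right _ _ tendsto_natCast_atTop_atTop
    refine squeeze_zero_norm (fun m => ?_) (h1.comp h2)
    have hm : (1 : ℝ) ≤ (m : ℝ) + 1 := by linarith [Nat.cast_nonneg (α := ℝ) m]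
    have h3 := hev ((m : ℝ) + 1) hm
    have h4 := h _ hm
    push_cast at h3 h4
    rw [h3, norm_mul, norm_pow]
    have h5 : ‖((m : ℂ) + 1)‖ = (m : ℝ) + 1 := by
      have : ((m : ℂ) + 1) = ((m + 1 : ℕ) : ℂ) := by push_cast; rfl
      rw [this, Complex.norm_natCast]
      push_cast
      rfl
    rw [h5]
    simp only [Function.comp_apply]
    calc ((m : ℝ) + 1) ^ P.natDegree * ‖P.eval ((m : ℂ) + 1)⁻¹‖
        ≤ ((m : ℝ) + 1) ^ P.natDegree * (C * Real.exp (-δ * (m + 1))) := by gcongr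
      _ = _ := by ring
  rcases le_or_gt R.degree 0 with hdeg | hdeg
  · have hRc := Polynomial.eq_C_of_degree_le_zero hdeg
    rw [hRc] at hlim
    simp only [Polynomial.eval_C] at hlim
    have := tendsto_nhds_unique hlim tendsto_const_nhds
    exact hR0 (by rw [hRc, ← this, Polynomial.C_0])
  · have h1 : Tendsto (fun m : ℕ => ‖((m : ℂ) + 1)‖) atTop atTop := by
      have : Tendsto (fun m : ℕ => (m : ℝ) + 1) atTop atTop :=
        tendsto_atTop_add_const_right _ _ tendsto_natCast_atTop_atTop
      refine this.congr fun m => ?_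
      have : ((m : ℂ) + 1) = ((m + 1 : ℕ) : ℂ) := by push_cast; rfl
      rw [this, Complex.norm_natCast]
      push_cast
      rfl
    exact not_tendsto_nhds_of_tendsto_atTop (R.tendsto_norm_atTop hdeg h1) _ hlim.norm

/-- The derivative of a polynomial of bounded degree on `[0, 1]` is controlled by its values on
`[1/2, 1]`, by Lagrange interpolation. -/
theorem exists_derivative_bound (N : ℕ) : ∃ K > 0, ∀ P : Polynomial ℂ, P.natDegree ≤ N → ∀ B : ℝ,
    (∀ u ∈ Set.Icc (1 / 2 : ℝ) 1, ‖P.eval (u : ℂ)‖ ≤ B) →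
      ∀ u ∈ Set.Icc (0 : ℝ) 1, ‖P.derivative.eval (u : ℂ)‖ ≤ K * B := by
  set v : ℕ → ℂ := fun i => ((1 / 2 + i / (2 * (N + 1)) : ℝ) : ℂ) with hv
  set s := Finset.range (N + 1) with hs
  have hvs : Set.InjOn v s := by
    intro i _ j _ hij
    simp only [hv, ofReal_inj] at hij
    have hN : (0 : ℝ) < 2 * (N + 1) := by positivity
    have : (i : ℝ) / (2 * (N + 1)) = j / (2 * (N + 1)) := by linarith
    rw [div_left_inj' hN.ne'] at this
    exact_mod_cast this
  have hbd : ∀ i, ∃ c, ∀ u ∈ Set.Icc (0 : ℝ) 1,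
      ‖(Lagrange.basis s v i).derivative.eval (u : ℂ)‖ ≤ c := fun i =>
    isCompact_Icc.exists_bound_of_continuousOn
      (((Lagrange.basis s v i).derivative.continuous.comp continuous_ofReal).continuousOn)
  choose c hc using hbd
  have hc0 : ∀ i, 0 ≤ c i := fun i => (norm_nonneg _).trans (hc i 0 (by simp))
  refine ⟨∑ i ∈ s, c i + 1, by
    have := Finset.sum_nonneg fun i (_ : i ∈ s) => hc0 i
    linarith, fun P hP B hB u hu => ?_⟩
  have hB0 : 0 ≤ B := (norm_nonneg _).trans (hB 1 (by norm_num))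
  have hdeg : P.degree < s.card := by
    rw [hs, Finset.card_range]
    exact (Polynomial.degree_le_natDegree).trans_lt (by exact_mod_cast Nat.lt_succ_of_le hP)
  have hP' := Lagrange.eq_interpolate hvs hdeg
  rw [hP', Lagrange.interpolate_apply, Polynomial.derivative_sum, Polynomial.eval_finsetSum]
  calc ‖∑ i ∈ s, (Polynomial.C (P.eval (v i)) * Lagrange.basis s v i).derivative.eval (u : ℂ)‖
      ≤ ∑ i ∈ s, B * c i := by
        refine (norm_sum_le _ _).trans (Finset.sum_le_sum fun i hi => ?_)
        rw [Polynomial.derivative_C_mul, Polynomial.eval_mul, Polynomial.eval_C, norm_mul]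
        refine mul_le_mul (hB _ ⟨?_, ?_⟩) (hc i u hu) (norm_nonneg _) hB0
        · have : (0 : ℝ) ≤ i / (2 * (N + 1)) := by positivity
          linarith
        · have hi' : (i : ℝ) ≤ N := by
            have := Finset.mem_range.mp hi
            exact_mod_cast Nat.le_of_lt_succ this
          have : (i : ℝ) / (2 * (N + 1)) ≤ 1 / 2 := by
            rw [div_le_div_iff₀ (by positivity) (by norm_num)]
            linarith
          linarith
    _ = (∑ i ∈ s, c i) * B := by rw [← Finset.mul_sum, mul_comm]
    _ ≤ (∑ i ∈ s, c i + 1) * B := mul_le_mul_of_nonneg_right (by linarith) hB0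

/-! ### Fourier coefficients of almost-holomorphic modular forms -/

theorem bR_mem_lattice_int {x y : RealSpace n} (hx : x ∈ M.lattice) (hy : y ∈ M.lattice) :
    ∃ a : ℤ, M.bR x y = a := by
  choose a ha using hx
  choose b hb using hy
  refine ⟨∑ i, ∑ j, a i * M.gram i j * b j, ?_⟩
  rw [bR, gramForm]
  push_cast
  simp only [ha, hb]

theorem even_gramForm_int (a : Fin (n + 2) → ℤ) : Even (gramForm M.gram a a : ℤ) := by
  have hsum : ∀ s : Finset (Fin (n + 2)), Even (∑ i ∈ s, ∑ j ∈ s, a i * M.gram i j * a j) := by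
    intro s
    induction s using Finset.induction_on with
    | empty => simp
    | insert i s hi ih =>
      rw [Finset.sum_insert hi, Finset.sum_insert hi]
      simp only [Finset.sum_insert hi]
      rw [Finset.sum_add_distrib]
      have hsym : ∑ j ∈ s, a j * M.gram j i * a i = ∑ j ∈ s, a i * M.gram i j * a j := by
        refine Finset.sum_congr rfl fun j _ => ?_
        have : M.gram j i = M.gram i j := congrFun (congrFun M.symm i) j
        rw [this]; ring
      rw [hsym]
      have h1 : Even (a i * M.gram i i * a i) := ((M.even i).mul_left _).mul_right _
      have h2 : Even (∑ j ∈ s, a i * M.gram i j * a j + ∑ j ∈ s, a i * M.gram i j * a j) := ⟨_, rfl⟩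
      have := (h1.add h2).add ih
      exact Eq.mpr (congrArg Even (by ring)) this
  simpa [gramForm] using hsum Finset.univ

theorem bR_self_lattice {x : RealSpace n} (hx : x ∈ M.lattice) : ∃ a : ℤ, M.bR x x = 2 * a := by
  choose a ha using hx
  obtain ⟨c, hc⟩ := even_gramForm_int M a
  refine ⟨c, ?_⟩
  have h1 : M.bR x x = ((gramForm M.gram a a : ℤ) : ℝ) := by
    rw [bR, gramForm, gramForm]
    push_cast
    simp only [ha]
  rw [h1, hc]
  push_cast
  ring

theorem exists_lattice_out (l : M.dual) :
    ∃ m ∈ M.lattice, (((M.cls l).out : M.dual) : RealSpace n) = l + m := by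
  obtain ⟨h, hh⟩ := QuotientAddGroup.mk_out_eq_add (M.lattice.addSubgroupOf M.dual) l
  refine ⟨(h : M.dual), AddSubgroup.mem_addSubgroupOf.mp h.2, ?_⟩
  rw [hh]
  rfl

/-- By evenness, the entries of `ρ(T)` may be computed with any representative. -/
theorem weilT_cls (l : M.dual) :
    M.weilT (M.cls l) = cexp (Real.pi * I * (M.bR (l : RealSpace n) l : ℝ)) := by
  obtain ⟨m, hm, hout⟩ := exists_lattice_out M l
  obtain ⟨a, ha⟩ := l.2 m hm
  obtain ⟨b, hb⟩ := bR_self_lattice M hm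
  have h1 : M.bR ((l : RealSpace n) + m) ((l : RealSpace n) + m) =
      M.bR (l : RealSpace n) l + 2 * ((a + b : ℤ) : ℝ) := by
    simp only [bR_add_left, bR_add_right, M.bR_comm m l, ha, hb]
    push_cast
    ring
  rw [weilT, hout, h1]
  have h2 : (Real.pi * I * ((M.bR (l : RealSpace n) l + 2 * ((a + b : ℤ) : ℝ) : ℝ) : ℂ)) =
      Real.pi * I * (M.bR (l : RealSpace n) l : ℝ) + ((a + b : ℤ) : ℂ) * (2 * Real.pi * I) := by
    push_cast; ring
  rw [h2, Complex.exp_add, Complex.exp_int_mul_two_pi_mul_I, mul_one]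

/-- The entries of `ρ(S)` may be computed with any representatives. -/
theorem exp_bR_cls (l l' : M.dual) :
    cexp (-(2 * Real.pi * I * (M.bR ((M.cls l).out : M.dual) ((M.cls l').out : M.dual) : ℝ))) =
      cexp (-(2 * Real.pi * I * (M.bR (l : RealSpace n) l' : ℝ))) := by
  obtain ⟨m, hm, hout⟩ := exists_lattice_out M l
  obtain ⟨m', hm', hout'⟩ := exists_lattice_out M l'
  obtain ⟨a, ha⟩ := l.2 m' hm'
  obtain ⟨b, hb⟩ := l'.2 m hm
  obtain ⟨c, hc⟩ := bR_mem_lattice_int M hm hm'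
  have h1 : M.bR ((l : RealSpace n) + m) ((l' : RealSpace n) + m') =
      M.bR (l : RealSpace n) l' + ((a + b + c : ℤ) : ℝ) := by
    simp only [bR_add_left, bR_add_right, M.bR_comm m l', ha, hb, hc]
    push_cast
    ring
  rw [hout, hout', h1]
  have h2 : (-(2 * Real.pi * I * ((M.bR (l : RealSpace n) l' + ((a + b + c : ℤ) : ℝ) : ℝ) : ℂ))) =
      -(2 * Real.pi * I * (M.bR (l : RealSpace n) l' : ℝ)) +
        ((-(a + b + c) : ℤ) : ℂ) * (2 * Real.pi * I) := by
    push_cast; ring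
  rw [h2, Complex.exp_add, Complex.exp_int_mul_two_pi_mul_I, mul_one]

/-- The function `F_{λ + M}(z) e ^ (-π i z ⟨λ, λ⟩)` on the upper half-plane, for `λ ∈ M'`. It is
periodic, and its mean is the coefficient of `q ^ (⟨λ, λ⟩ / 2)` in `F_{λ + M}`, a polynomial in
`1 / y`. -/
noncomputable def twist (F : ℍ → M.Disc → ℂ) (l : M.dual) (z : ℂ) : ℂ :=
  F (ofComplex z) (M.cls l) * cexp (-(Real.pi * I * z * (M.bR (l : RealSpace n) l : ℝ)))

theorem norm_exp_neg_pi (z : ℂ) (a : ℝ) :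
    ‖cexp (-(Real.pi * I * z * (a : ℝ)))‖ = Real.exp (Real.pi * z.im * a) := by
  rw [Complex.norm_exp]
  congr 1
  simp [mul_assoc]

theorem ofComplex_add_one {z : ℂ} (hz : 0 < z.im) :
    ofComplex (z + 1) = ModularGroup.T • ofComplex z := by
  have hz1 : 0 < (z + 1).im := by simpa using hz
  rw [modular_T_smul]
  apply UpperHalfPlane.ext
  rw [ofComplex_apply_of_im_pos hz1, ofComplex_apply_of_im_pos hz, coe_vadd]
  push_cast
  rw [add_comm]

section Twist

variable {M}
variable {F : ℍ → M.Disc → ℂ}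

theorem isPeriodicSmooth_twist
    (hs : ∀ γ, ContDiffOn ℝ ∞ (fun z : ℂ => F (ofComplex z) γ) {z : ℂ | 0 < z.im})
    (hT : ∀ (τ : ℍ) (γ : M.Disc), F (ModularGroup.T • τ) γ = M.weilT γ * F τ γ) (l : M.dual) :
    IsPeriodicSmooth (twist M F l) where
  smooth := by
    refine (hs _).mul (ContDiff.contDiffOn ?_)
    have : ContDiff ℂ ∞ fun z : ℂ => cexp (-(Real.pi * I * z * (M.bR (l : RealSpace n) l : ℝ))) := by
      fun_prop
    exact this.restrict_scalars ℝ
  periodic := by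
    intro z hz
    rw [twist, twist, ofComplex_add_one hz, hT, weilT_cls, mul_right_comm, mul_comm, mul_right_comm,
      ← Complex.exp_add, mul_comm, mul_comm (cexp _)]
    congr 2
    ring_nf

/-- Twisting commutes with the lowering operator, since the exponential factor is holomorphic. -/
theorem twist_maassLower
    (hs : ∀ γ, ContDiffOn ℝ ∞ (fun z : ℂ => F (ofComplex z) γ) {z : ℂ | 0 < z.im}) (l : M.dual) :
    Set.EqOn (twist M (maassLower M F) l) (lowerOp (twist M F l)) {z : ℂ | 0 < z.im} := by
  intro z hz
  rw [Set.mem_ofPred_eq] at hz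
  have hcoe : ((ofComplex z : ℍ) : ℂ) = z := by rw [ofComplex_apply_of_im_pos hz]
  have him : (ofComplex z : ℍ).im = z.im := by rw [← UpperHalfPlane.coe_im, hcoe]
  set c : ℂ := -(Real.pi * I * (M.bR (l : RealSpace n) l : ℝ)) with hc
  have he : HasDerivAt (fun z : ℂ => cexp (-(Real.pi * I * z * (M.bR (l : RealSpace n) l : ℝ))))
      (cexp (-(Real.pi * I * z * (M.bR (l : RealSpace n) l : ℝ))) * c) z := by
    have h1 : HasDerivAt (fun z : ℂ => -(Real.pi * I * z * (M.bR (l : RealSpace n) l : ℝ))) c z := by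
      have := (hasDerivAt_id z).const_mul c
      rw [mul_one] at this
      refine this.congr_of_eventuallyEq (Eventually.of_forall fun w => ?_)
      simp only [hc, id]
      ring
    exact h1.cexp
  have he' := he.hasFDerivAt.restrictScalars ℝ
  have hf : HasFDerivAt (fun z : ℂ => F (ofComplex z) (M.cls l))
      (fderiv ℝ (fun z : ℂ => F (ofComplex z) (M.cls l)) z) z :=
    (((hs (M.cls l)).differentiableOn (by simp)).differentiableAt
      (isOpen_uhp.mem_nhds hz)).hasFDerivAt
  have hfd := (hf.mul he').fderiv
  have hfd' : fderiv ℝ (twist M F l) z = _ := hfd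
  rw [lowerOp, hfd', twist, maassLower, dTauBar, hcoe, him]
  simp only [_root_.add_apply, _root_.smul_apply, smul_eq_mul,
    ContinuousLinearMap.coe_restrictScalars', ContinuousLinearMap.toSpanSingleton_apply]
  linear_combination (2 * I * (z.im : ℂ) ^ 2 * (1 / 2) * F (ofComplex z) (M.cls l) * c *
    cexp (-(Real.pi * I * z * (M.bR (l : RealSpace n) l : ℝ)))) * I_sq

theorem maassLower_smooth
    (hs : ∀ γ, ContDiffOn ℝ ∞ (fun z : ℂ => F (ofComplex z) γ) {z : ℂ | 0 < z.im}) (γ : M.Disc) :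
    ContDiffOn ℝ ∞ (fun z : ℂ => maassLower M F (ofComplex z) γ) {z : ℂ | 0 < z.im} := by
  have h1 : ContDiffOn ℝ ∞ (fderiv ℝ (fun z : ℂ => F (ofComplex z) γ)) {z : ℂ | 0 < z.im} :=
    (hs γ).fderiv_of_isOpen isOpen_uhp (by simp)
  have h3 : ContDiff ℝ ∞ fun z : ℂ => (z.im : ℂ) := ofRealCLM.contDiff.comp imCLM.contDiff
  have h2 : ContDiffOn ℝ ∞ (lowerOp fun z : ℂ => F (ofComplex z) γ) {z : ℂ | 0 < z.im} := by
    unfold lowerOp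
    exact (contDiffOn_const.mul (h3.contDiffOn.pow 2)).mul
      (contDiffOn_const.mul ((h1.clm_apply contDiffOn_const).add
        (contDiffOn_const.mul (h1.clm_apply contDiffOn_const))))
  refine h2.congr fun z hz => ?_
  have hcoe : ((ofComplex z : ℍ) : ℂ) = z := by rw [ofComplex_apply_of_im_pos hz]
  have him : (ofComplex z : ℍ).im = z.im := by rw [← UpperHalfPlane.coe_im, hcoe]
  rw [maassLower, dTauBar, hcoe, him, lowerOp]

theorem maassLower_map_T
    (hs : ∀ γ, ContDiffOn ℝ ∞ (fun z : ℂ => F (ofComplex z) γ) {z : ℂ | 0 < z.im})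
    (hT : ∀ (τ : ℍ) (γ : M.Disc), F (ModularGroup.T • τ) γ = M.weilT γ * F τ γ)
    (τ : ℍ) (γ : M.Disc) :
    maassLower M F (ModularGroup.T • τ) γ = M.weilT γ * maassLower M F τ γ := by
  obtain ⟨l, rfl⟩ := QuotientAddGroup.mk_surjective γ
  have hz : 0 < (τ : ℂ).im := τ.im_pos
  have hz1 : 0 < ((τ : ℂ) + 1).im := by simpa using hz
  have hl := (isPeriodicSmooth_twist hs hT l).lower.periodic τ hz
  rw [← twist_maassLower hs l hz, ← twist_maassLower hs l hz1, twist, twist, ofComplex_add_one hz,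
    ofComplex_apply] at hl
  have hne := Complex.exp_ne_zero (-(Real.pi * I * ((τ : ℂ) + 1) * (M.bR (l : RealSpace n) l : ℝ)))
  refine mul_right_cancel₀ hne (hl.trans ?_)
  change _ = M.weilT (M.cls l) * maassLower M F τ (M.cls l) * _
  have hexp : cexp (-(Real.pi * I * (τ : ℂ) * (M.bR (l : RealSpace n) l : ℝ))) =
      cexp (Real.pi * I * (M.bR (l : RealSpace n) l : ℝ)) *
        cexp (-(Real.pi * I * ((τ : ℂ) + 1) * (M.bR (l : RealSpace n) l : ℝ))) := by
    rw [← Complex.exp_add]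
    congr 1
    ring
  rw [weilT_cls, hexp]
  ring

theorem xMean_twist (l : M.dual) (y : ℝ) :
    xMean (twist M F l) y = fourierCoeff M F (M.cls l) (M.bR (l : RealSpace n) l / 2) y *
      (Real.exp (Real.pi * y * M.bR (l : RealSpace n) l) : ℂ) := by
  rw [xMean, fourierCoeff, ← intervalIntegral.integral_mul_const]
  refine intervalIntegral.integral_congr fun x _ => ?_
  simp only [twist]
  have hexp : cexp (-(Real.pi * I * ((x : ℂ) + (y : ℂ) * I) * (M.bR (l : RealSpace n) l : ℝ))) =
      cexp (-(2 * Real.pi * I * ((M.bR (l : RealSpace n) l / 2 : ℝ) : ℂ) * x)) *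
        (Real.exp (Real.pi * y * M.bR (l : RealSpace n) l) : ℂ) := by
    rw [ofReal_exp, ← Complex.exp_add]
    congr 1
    push_cast
    linear_combination (-(Real.pi : ℂ) * y * (M.bR (l : RealSpace n) l : ℝ)) * I_sq
  rw [hexp]
  ring

/-- If a power of the lowering operator annihilates the form, its Fourier coefficients are
`e ^ (-2 π m y)` times polynomials in `1 / y` of bounded degree. -/
theorem exists_poly_xMean (m : ℕ)
    (hs : ∀ γ, ContDiffOn ℝ ∞ (fun z : ℂ => F (ofComplex z) γ) {z : ℂ | 0 < z.im})
    (hT : ∀ (τ : ℍ) (γ : M.Disc), F (ModularGroup.T • τ) γ = M.weilT γ * F τ γ)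
    (h0 : (maassLower M)^[m] F = 0) (l : M.dual) :
    ∃ P : Polynomial ℂ, P.natDegree ≤ m ∧
      ∀ y : ℝ, 0 < y → xMean (twist M F l) y = P.eval ((y : ℂ)⁻¹) := by
  induction m generalizing F with
  | zero =>
    rw [Function.iterate_zero, id] at h0
    refine ⟨0, by simp, fun y _ => ?_⟩
    simp [xMean, twist, h0]
  | succ m ih =>
    rw [Function.iterate_succ_apply] at h0
    obtain ⟨P, hP, hPy⟩ := ih (maassLower_smooth hs) (maassLower_map_T hs hT) h0
    refine (isPeriodicSmooth_twist hs hT l).exists_xMean_eq hP fun y hy => ?_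
    rw [← hPy y hy, xMean_congr (twist_maassLower hs l) hy]

end Twist

/-- The properties of a `ℂ[M' / M]`-valued function on which the convergence of its theta lift
rests: smoothness, equivariance under translations, Fourier coefficients that are polynomials in
`1 / y` times `e ^ (-2 π m y)`, and a bound for them that is uniform in `m`. -/
structure LiftInput (F : ℍ → M.Disc → ℂ) : Prop where
  smooth : ∀ γ, ContDiffOn ℝ ∞ (fun z : ℂ => F (ofComplex z) γ) {z : ℂ | 0 < z.im}
  periodic : ∀ l, IsPeriodicSmooth (twist M F l)
  poly : ∀ l, ∃ P : Polynomial ℂ, ∀ y : ℝ, 0 < y → xMean (twist M F l) y = P.eval ((y : ℂ)⁻¹)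
  bound : ∃ C A : ℝ, ∀ l : M.dual, ∀ y : ℝ, 2 ≤ y →
    ‖xMean (twist M F l) y‖ ≤ C * Real.exp (A * y + Real.pi * y * M.bR (l : RealSpace n) l)

section Input

variable {M} {F : ℍ → M.Disc → ℂ}

theorem exists_xMean_bound (hC : ∃ C A : ℝ, ∀ (τ : ℍ) (γ : M.Disc), 1 ≤ τ.im →
    ‖F τ γ‖ ≤ C * Real.exp (A * τ.im)) :
    ∃ C A : ℝ, 0 ≤ C ∧ 0 ≤ A ∧ ∀ l : M.dual, ∀ y : ℝ, 1 ≤ y →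
      ‖xMean (twist M F l) y‖ ≤ C * Real.exp (A * y + Real.pi * y * M.bR (l : RealSpace n) l) := by
  obtain ⟨C, A, h⟩ := hC
  refine ⟨|C|, |A|, abs_nonneg _, abs_nonneg _, fun l y hy => ?_⟩
  have := intervalIntegral.norm_integral_le_of_norm_le_const (a := 0) (b := 1)
    (f := fun x : ℝ => twist M F l ((x : ℂ) + (y : ℂ) * I))
    (C := |C| * Real.exp (|A| * y + Real.pi * y * M.bR (l : RealSpace n) l)) (fun x _ => ?_)
  · simpa [xMean] using this
  · have hz : 0 < ((x : ℂ) + (y : ℂ) * I).im := by rw [im_add_mul_I]; linarith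
    have him : (ofComplex ((x : ℂ) + (y : ℂ) * I) : ℍ).im = y := by
      rw [← UpperHalfPlane.coe_im, ofComplex_apply_of_im_pos hz]
      exact im_add_mul_I x y
    have h1 := h (ofComplex ((x : ℂ) + (y : ℂ) * I)) (M.cls l) (by rw [him]; exact hy)
    rw [him] at h1
    rw [twist, norm_mul, norm_exp_neg_pi, im_add_mul_I, Real.exp_add, ← mul_assoc]
    refine mul_le_mul_of_nonneg_right (h1.trans ?_) (Real.exp_pos _).le
    have : A * y ≤ |A| * y := mul_le_mul_of_nonneg_right (le_abs_self A) (by linarith)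
    calc C * Real.exp (A * y) ≤ |C| * Real.exp (A * y) :=
          mul_le_mul_of_nonneg_right (le_abs_self C) (Real.exp_pos _).le
      _ ≤ |C| * Real.exp (|A| * y) := by gcongr

variable {w : ℤ}

theorem IsAlmostHolModularForm.liftInput (hF : IsAlmostHolModularForm M w F) : LiftInput M F where
  smooth := hF.smooth
  periodic := isPeriodicSmooth_twist hF.smooth hF.map_T
  poly := by
    obtain ⟨m, hm⟩ := hF.almostHol
    intro l
    obtain ⟨P, -, hP⟩ := exists_poly_xMean m hF.smooth hF.map_T hm l
    exact ⟨P, hP⟩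
  bound := by
    obtain ⟨C, A, -, -, h⟩ := exists_xMean_bound hF.growth
    exact ⟨C, A, fun l y hy => h l y (by linarith)⟩

/-- The bound for the Fourier coefficients of `F` carries over to the lowered form: the growth
condition forces the coefficients of very negative index to vanish, and the others are
controlled by interpolation. -/
theorem IsAlmostHolModularForm.liftInput_lower (hF : IsAlmostHolModularForm M w F) :
    LiftInput M (maassLower M F) where
  smooth := maassLower_smooth hF.smooth
  periodic := isPeriodicSmooth_twist (maassLower_smooth hF.smooth)
    (maassLower_map_T hF.smooth hF.map_T)
  poly := by
    intro l
    obtain ⟨m, hm⟩ := hF.almostHol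
    obtain ⟨P, -, hP⟩ := exists_poly_xMean m hF.smooth hF.map_T hm l
    refine ⟨-P.derivative, fun y hy => ?_⟩
    rw [xMean_congr (twist_maassLower hF.smooth l) hy]
    exact (isPeriodicSmooth_twist hF.smooth hF.map_T l).xMean_lower hP hy
  bound := by
    obtain ⟨m, hm⟩ := hF.almostHol
    obtain ⟨C, A, hC0, hA0, hb⟩ := exists_xMean_bound hF.growth
    obtain ⟨K, hK, hKb⟩ := exists_derivative_bound m
    refine ⟨K * (C * Real.exp (4 * A)), 2 * A, fun l y hy => ?_⟩
    obtain ⟨P, hPd, hP⟩ := exists_poly_xMean m hF.smooth hF.map_T hm l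
    have hy0 : 0 < y := by linarith
    set β := Real.pi * M.bR (l : RealSpace n) l with hβ
    have hb' : ∀ t : ℝ, 1 ≤ t → ‖P.eval ((t : ℂ)⁻¹)‖ ≤ C * Real.exp ((A + β) * t) := by
      intro t ht
      rw [← hP t (by linarith)]
      refine (hb l t ht).trans (le_of_eq ?_)
      rw [hβ]
      ring_nf
    rw [xMean_congr (twist_maassLower hF.smooth l) hy0,
      (isPeriodicSmooth_twist hF.smooth hF.map_T l).xMean_lower hP hy0, Polynomial.eval_neg,
      norm_neg]
    have hexp : Real.pi * y * M.bR (l : RealSpace n) l = β * y := by rw [hβ]; ring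
    rw [hexp]
    rcases lt_or_ge (A + β) 0 with hneg | hpos
    · have hP0 : P = 0 := by
        refine eq_zero_of_exp_decay (δ := -(A + β)) (C := C) (by linarith) fun t ht => ?_
        rw [neg_neg]
        exact hb' t ht
      rw [hP0]
      simp only [Polynomial.derivative_zero, Polynomial.eval_zero, norm_zero]
      positivity
    · have hB : ∀ u ∈ Set.Icc (1 / 2 : ℝ) 1, ‖P.eval (u : ℂ)‖ ≤ C * Real.exp ((A + β) * 2) := by
        intro u hu
        have hu0 : 0 < u := by linarith [hu.1]
        have h1 := hb' u⁻¹ ((one_le_inv₀ hu0).mpr hu.2)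
        rw [ofReal_inv, inv_inv] at h1
        refine h1.trans ?_
        have h2 : u⁻¹ ≤ 2 := by
          rw [inv_le_comm₀ hu0 (by norm_num)]
          linarith [hu.1]
        gcongr
      have h2 := hKb P hPd _ hB y⁻¹ ⟨by positivity, inv_le_one_of_one_le₀ (by linarith)⟩
      rw [ofReal_inv] at h2
      refine h2.trans ?_
      rw [mul_assoc K, mul_assoc C, ← Real.exp_add]
      refine mul_le_mul_of_nonneg_left (mul_le_mul_of_nonneg_left (Real.exp_le_exp.mpr ?_) hC0) hK.le
      nlinarith

end Input

/-! ### The unfolded theta kernel and its domination -/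

/-- The factor `y ^ (j + 1) ⟨x, W⟩ ^ j e ^ (-2 π y ⟨x_Z, x_Z⟩)` of the summand of index `x` in the
integrand of the theta lift, as a function of the pair `p = (Z, W)`. The integrand itself is
obtained for `W = Z̄`. -/
noncomputable def kern (j : ℕ) (x : RealSpace n) (y : ℝ) (p : CplxSpace n × CplxSpace n) : ℂ :=
  (y : ℂ) ^ (j + 1) * M.bC (toCplx x) p.2 ^ j * cexp (-(2 * Real.pi * y * kap M x p.1 p.2))

/-- The kernel with the factor `y ^ (-s)` of the regularization and the density of the invariant
measure. -/
noncomputable def kernReg (j : ℕ) (x : RealSpace n) (y : ℝ)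
    (q : ℂ × (CplxSpace n × CplxSpace n)) : ℂ :=
  kern M j x y q.2 * (y : ℂ) ^ (-q.1) / (y : ℂ) ^ 2

theorem exists_pow_le_exp (m : ℕ) {δ : ℝ} (hδ : 0 < δ) :
    ∃ C > 0, ∀ r : ℝ, 0 ≤ r → (1 + r) ^ m ≤ C * Real.exp (δ * r) := by
  refine ⟨(Nat.factorial m : ℝ) / δ ^ m * Real.exp δ, by positivity, fun r hr => ?_⟩
  have h := Real.pow_div_factorial_le_exp (δ * (1 + r)) (by positivity) m
  rw [div_le_iff₀ (by positivity), mul_pow] at h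
  have h2 : (1 + r) ^ m ≤ (Real.exp (δ * (1 + r)) * (Nat.factorial m : ℝ)) / δ ^ m := by
    rw [le_div_iff₀ (by positivity)]
    linarith
  refine h2.trans (le_of_eq ?_)
  rw [mul_add, Real.exp_add, mul_one]
  ring

theorem truncDomain_bounds {h : ℝ} {z : ℂ} (hz : z ∈ truncDomain h) :
    |z.re| ≤ 1 / 2 ∧ 1 / 2 ≤ z.im ∧ z.im ≤ h := by
  obtain ⟨h1, h2, h3, h4⟩ := hz
  refine ⟨h2.le, ?_, h4.le⟩
  have h5 : 1 < ‖z‖ ^ 2 := by nlinarith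
  rw [← normSq_eq_norm_sq, normSq_apply] at h5
  have h6 := abs_lt.mp h2
  by_contra hcon
  rw [not_le] at hcon
  nlinarith

theorem isOpen_truncDomain (h : ℝ) : IsOpen (truncDomain h) := by
  have : truncDomain h = {z | 1 < ‖z‖} ∩ ({z | |z.re| < 1 / 2} ∩ ({z | 0 < z.im} ∩ {z | z.im < h})) := by
    ext z; simp [truncDomain]
  rw [this]
  exact (isOpen_lt continuous_const continuous_norm).inter
    ((isOpen_lt (continuous_abs.comp Complex.continuous_re) continuous_const).inter
      (isOpen_uhp.inter (isOpen_lt Complex.continuous_im continuous_const)))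

theorem volume_truncDomain_lt_top (h : ℝ) : volume (truncDomain h) < ⊤ := by
  refine (measure_mono (t := Metric.closedBall (0 : ℂ) (1 / 2 + |h|)) fun z hz => ?_).trans_lt
    measure_closedBall_lt_top
  obtain ⟨h1, h2, h3⟩ := truncDomain_bounds hz
  rw [mem_closedBall_zero_iff]
  refine (Complex.norm_le_abs_re_add_abs_im z).trans (add_le_add h1 ?_)
  rw [abs_of_nonneg (by linarith)]
  exact h3.trans (le_abs_self h)

theorem norm_exp_kap_le {x : RealSpace n} {p : CplxSpace n × CplxSpace n} {ε y : ℝ} (hy : 0 ≤ y)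
    (h : M.bR x x + ε * nrm2 x ≤ 2 * (kap M x p.1 p.2).re) :
    ‖cexp (-(2 * Real.pi * y * kap M x p.1 p.2))‖ ≤
      Real.exp (-(Real.pi * y * M.bR x x) - Real.pi * y * (ε * nrm2 x)) := by
  rw [Complex.norm_exp]
  refine Real.exp_le_exp.mpr ?_
  have : (-(2 * Real.pi * y * kap M x p.1 p.2)).re =
      -(Real.pi * y * (2 * (kap M x p.1 p.2).re)) := by
    have h1 : (2 * Real.pi * y * kap M x p.1 p.2) =
        ((2 * Real.pi * y : ℝ) : ℂ) * kap M x p.1 p.2 := by push_cast; ring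
    rw [neg_re, h1, re_ofReal_mul]
    ring
  rw [this]
  have h2 : 0 ≤ Real.pi * y := by positivity
  nlinarith [mul_le_mul_of_nonneg_left h h2]

section Domination

variable {M} {F : ℍ → M.Disc → ℂ}

theorem exists_twist_bound (hF : LiftInput M F) (H : ℝ) : ∃ C, 0 ≤ C ∧ ∀ (l : M.dual) (z : ℂ),
    |z.re| ≤ 1 / 2 → 1 / 2 ≤ z.im → z.im ≤ H →
      ‖twist M F l z‖ ≤ C * Real.exp (Real.pi * z.im * M.bR (l : RealSpace n) l) := by
  set K : Set ℂ := (fun q : ℝ × ℝ => (q.1 : ℂ) + (q.2 : ℂ) * I) ''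
    (Set.Icc (-(1 / 2)) (1 / 2) ×ˢ Set.Icc (1 / 2) H) with hKdef
  have hK : IsCompact K := (isCompact_Icc.prod isCompact_Icc).image (by fun_prop)
  have hKsub : K ⊆ {z : ℂ | 0 < z.im} := by
    rintro _ ⟨q, hq, rfl⟩
    have := hq.2.1
    rw [Set.mem_ofPred_eq, im_add_mul_I]
    linarith
  have hb : ∀ γ, ∃ C, ∀ z ∈ K, ‖F (ofComplex z) γ‖ ≤ C := fun γ =>
    hK.exists_bound_of_continuousOn ((hF.smooth γ).continuousOn.mono hKsub)
  choose C hC using hb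
  refine ⟨∑ γ, |C γ|, Finset.sum_nonneg fun _ _ => abs_nonneg _, fun l z h1 h2 h3 => ?_⟩
  have hz : z ∈ K := ⟨(z.re, z.im), ⟨⟨(abs_le.mp h1).1, (abs_le.mp h1).2⟩, ⟨h2, h3⟩⟩,
    Complex.re_add_im z⟩
  rw [twist, norm_mul, norm_exp_neg_pi]
  refine mul_le_mul_of_nonneg_right ?_ (Real.exp_pos _).le
  refine ((hC _ z hz).trans (le_abs_self _)).trans ?_
  exact Finset.single_le_sum (f := fun γ => |C γ|) (fun _ _ => abs_nonneg _) (Finset.mem_univ _)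

/-- On a bounded part of the fundamental domain, the summands of the integrand have Gaussian decay
in `λ`, also after multiplication with a factor of polynomial growth. -/
theorem exists_compact_bound (hF : LiftInput M F) {ε : ℝ} (hε : 0 < ε) (H K : ℝ) (m : ℕ) :
    ∃ C, 0 ≤ C ∧ ∀ (p : CplxSpace n × CplxSpace n) (l : M.dual) (z a : ℂ),
      M.bR (l : RealSpace n) l + ε * nrm2 (l : RealSpace n) ≤ 2 * (kap M l p.1 p.2).re →
      |z.re| ≤ 1 / 2 → 1 / 2 ≤ z.im → z.im ≤ H → ‖a‖ ≤ K * (1 + nrm2 (l : RealSpace n)) ^ m →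
      ‖twist M F l z * (a * cexp (-(2 * Real.pi * z.im * kap M l p.1 p.2)))‖ ≤
        C * Real.exp (-(ε / 2) * nrm2 (l : RealSpace n)) := by
  obtain ⟨C, hC0, hC⟩ := exists_twist_bound hF H
  obtain ⟨C', hC'0, hC'⟩ := exists_pow_le_exp m (half_pos hε)
  refine ⟨C * |K| * C', by positivity, fun p l z a hp h1 h2 h3 ha => ?_⟩
  set r := nrm2 (l : RealSpace n) with hr
  have hr0 : 0 ≤ r := nrm2_nonneg _
  have hk := norm_exp_kap_le M (y := z.im) (by linarith) hp
  have hpi : 1 ≤ Real.pi * z.im := by nlinarith [Real.pi_gt_three]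
  rw [norm_mul, norm_mul]
  calc ‖twist M F l z‖ * (‖a‖ * ‖cexp (-(2 * Real.pi * z.im * kap M l p.1 p.2))‖)
      ≤ (C * Real.exp (Real.pi * z.im * M.bR (l : RealSpace n) l)) * ((|K| * (1 + r) ^ m) *
          Real.exp (-(Real.pi * z.im * M.bR (l : RealSpace n) l) -
            Real.pi * z.im * (ε * r))) := by
        refine mul_le_mul (hC l z h1 h2 h3) (mul_le_mul (ha.trans ?_) hk (norm_nonneg _)
          (by positivity)) (by positivity) (by positivity)
        exact mul_le_mul_of_nonneg_right (le_abs_self K) (by positivity)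
    _ = C * |K| * (1 + r) ^ m * Real.exp (-(Real.pi * z.im * (ε * r))) := by
        have : Real.exp (-(Real.pi * z.im * (ε * r))) =
            Real.exp (Real.pi * z.im * M.bR (l : RealSpace n) l) *
            Real.exp (-(Real.pi * z.im * M.bR (l : RealSpace n) l) -
            Real.pi * z.im * (ε * r)) := by
          rw [← Real.exp_add]; congr 1; ring
        rw [this]; ring
    _ ≤ C * |K| * (C' * Real.exp (ε / 2 * r)) * Real.exp (-(ε * r)) := by
        refine mul_le_mul (mul_le_mul_of_nonneg_left (hC' r hr0) (by positivity))
          (Real.exp_le_exp.mpr ?_) (Real.exp_pos _).le (by positivity)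
        have : 0 ≤ ε * r := by positivity
        nlinarith
    _ = C * |K| * C' * Real.exp (-(ε / 2) * r) := by
        have : Real.exp (-(ε / 2) * r) = Real.exp (ε / 2 * r) * Real.exp (-(ε * r)) := by
          rw [← Real.exp_add]; congr 1; ring
        rw [this]; ring

theorem norm_kern_coeff_le {K H y : ℝ} {j : ℕ} {b : ℂ} {r : ℝ} (hy : 0 ≤ y) (hyH : y ≤ H)
    (hb : ‖b‖ ≤ K * (1 + r)) :
    ‖(y : ℂ) ^ (j + 1) * b ^ j‖ ≤ H ^ (j + 1) * K ^ j * (1 + r) ^ j := by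
  rw [norm_mul, norm_pow, norm_pow, Complex.norm_real, Real.norm_eq_abs, abs_of_nonneg hy,
    mul_assoc, ← mul_pow]
  have hH : 0 ≤ H := hy.trans hyH
  gcongr

/-- Exponential decay of the constant terms of the summands with `λ ≠ 0` in the cusp, locally
uniformly in `Z`. For all but finitely many `λ` this follows from the uniform growth of the
coefficients; for the others, the coefficient vanishes if `λ` is orthogonal to `Z`. -/
theorem exists_tail_bound (hF : LiftInput M F) (j : ℕ) {Z : CplxSpace n} (hZ : Z ∈ cone M)
    (hreg : ∀ l : M.dual, l ≠ 0 → M.bC (toCplx (l : RealSpace n)) Z = 0 →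
      ∀ y : ℝ, 0 < y → xMean (twist M F l) y = 0) :
    ∃ C δ : ℝ, 0 ≤ C ∧ 0 < δ ∧ ∀ᶠ p : CplxSpace n × CplxSpace n in 𝓝 (Z, cconj Z),
      ∀ (l : M.dual) (y : ℝ), l ≠ 0 → 2 ≤ y →
        ‖xMean (twist M F l) y * kern M j l y p‖ ≤
          C * Real.exp (-δ * nrm2 (l : RealSpace n)) * Real.exp (-δ * y) := by
  obtain ⟨ε, hε, hev⟩ := eventually_majorant M hZ
  obtain ⟨K, hK, hKev⟩ := norm_bC_le M (cconj Z)
  obtain ⟨C, A, hCA⟩ := hF.bound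
  have hKev' : ∀ᶠ p : CplxSpace n × CplxSpace n in 𝓝 (Z, cconj Z), ∀ x : RealSpace n,
      ‖M.bC (toCplx x) p.2‖ ≤ K * (1 + nrm2 x) := by
    have : Tendsto (fun p : CplxSpace n × CplxSpace n => p.2) (𝓝 (Z, cconj Z)) (𝓝 (cconj Z)) :=
      continuous_snd.tendsto _
    exact this.eventually hKev
  -- lattice vectors of norm at least `R` are treated uniformly
  set R : ℝ := (|A| + 2) / ε with hR
  have hfin : {l : M.dual | nrm2 (l : RealSpace n) < R}.Finite := finite_dual_of_nrm2_lt M R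
  obtain ⟨Cj, hCj0, hCj⟩ := exists_pow_le_exp j (half_pos hε)
  obtain ⟨Cy, hCy0, hCy⟩ := exists_pow_le_exp (j + 1) one_pos
  have hlarge : ∃ C₁, 0 ≤ C₁ ∧ ∀ᶠ p : CplxSpace n × CplxSpace n in 𝓝 (Z, cconj Z),
      ∀ (l : M.dual) (y : ℝ), R ≤ nrm2 (l : RealSpace n) → 2 ≤ y →
        ‖xMean (twist M F l) y * kern M j l y p‖ ≤
          C₁ * Real.exp (-(ε / 2) * nrm2 (l : RealSpace n)) * Real.exp (-1 * y) := by
    refine ⟨|C| * (K ^ j * Cj) * Cy, by positivity, ?_⟩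
    filter_upwards [hev, hKev'] with p hp hpK l y hl hy
    set r := nrm2 (l : RealSpace n) with hr
    have hr0 : 0 ≤ r := nrm2_nonneg _
    have hk := norm_exp_kap_le M (y := y) (by linarith) (hp.2 l)
    have h1 : ‖xMean (twist M F l) y‖ ≤
        |C| * Real.exp (|A| * y + Real.pi * y * M.bR (l : RealSpace n) l) := by
      refine (hCA l y hy).trans (mul_le_mul (le_abs_self C) (Real.exp_le_exp.mpr ?_)
        (Real.exp_pos _).le (abs_nonneg _))
      have := mul_le_mul_of_nonneg_right (le_abs_self A) (by linarith : 0 ≤ y)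
      linarith
    have h2 : ‖(y : ℂ) ^ (j + 1) * M.bC (toCplx (l : RealSpace n)) p.2 ^ j‖ ≤
        (Cy * Real.exp (1 * y)) * (K ^ j * (Cj * Real.exp (ε / 2 * r))) := by
      refine (norm_kern_coeff_le (j := j) (by linarith : 0 ≤ y) le_rfl (hpK l)).trans ?_
      rw [mul_assoc]
      refine mul_le_mul ?_ (mul_le_mul_of_nonneg_left (hCj r hr0) (by positivity))
        (by positivity) (by positivity)
      refine le_trans ?_ (hCy y (by linarith))
      gcongr
      linarith
    rw [norm_mul, kern, norm_mul]
    calc ‖xMean (twist M F l) y‖ * (‖(y : ℂ) ^ (j + 1) * M.bC (toCplx (l : RealSpace n)) p.2 ^ j‖ *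
          ‖cexp (-(2 * Real.pi * y * kap M l p.1 p.2))‖)
        ≤ (|C| * Real.exp (|A| * y + Real.pi * y * M.bR (l : RealSpace n) l)) *
          (((Cy * Real.exp (1 * y)) * (K ^ j * (Cj * Real.exp (ε / 2 * r)))) *
          Real.exp (-(Real.pi * y * M.bR (l : RealSpace n) l) - Real.pi * y * (ε * r))) := by
          gcongr
      _ = |C| * (K ^ j * Cj) * Cy *
            Real.exp (|A| * y + 1 * y + ε / 2 * r - Real.pi * y * (ε * r)) := by
          have : Real.exp (|A| * y + 1 * y + ε / 2 * r - Real.pi * y * (ε * r)) =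
              Real.exp (|A| * y + Real.pi * y * M.bR (l : RealSpace n) l) * Real.exp (1 * y) *
              Real.exp (ε / 2 * r) * Real.exp (-(Real.pi * y * M.bR (l : RealSpace n) l) -
                Real.pi * y * (ε * r)) := by
            rw [← Real.exp_add, ← Real.exp_add, ← Real.exp_add]; congr 1; ring
          rw [this]; ring
      _ ≤ |C| * (K ^ j * Cj) * Cy * Real.exp (-(ε / 2) * r + -1 * y) := by
          refine mul_le_mul_of_nonneg_left (Real.exp_le_exp.mpr ?_) (by positivity)
          have h3 : |A| + 2 ≤ ε * r := by
            rw [hR, div_le_iff₀ hε] at hl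
            linarith
          have h4 : 0 ≤ ε * r := by positivity
          have h5 : (|A| + 2) * y ≤ ε * r * y := mul_le_mul_of_nonneg_right h3 (by linarith)
          have h6 : 2 * (ε * r) ≤ y * (ε * r) := mul_le_mul_of_nonneg_right hy h4
          have h7 : 3 * (y * (ε * r)) ≤ Real.pi * (y * (ε * r)) :=
            mul_le_mul_of_nonneg_right Real.pi_gt_three.le (by positivity)
          nlinarith
      _ = _ := by rw [Real.exp_add]; ring
  -- the finitely many remaining lattice vectors, one at a time
  have hsmall : ∀ l : M.dual, ∃ C₂ δ : ℝ, 0 ≤ C₂ ∧ 0 < δ ∧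
      ∀ᶠ p : CplxSpace n × CplxSpace n in 𝓝 (Z, cconj Z), ∀ y : ℝ, l ≠ 0 → 2 ≤ y →
        ‖xMean (twist M F l) y * kern M j l y p‖ ≤ C₂ * Real.exp (-δ * y) := by
    intro l
    by_cases hl : l ≠ 0 ∧ M.bC (toCplx (l : RealSpace n)) Z = 0
    · refine ⟨0, 1, le_rfl, one_pos, Eventually.of_forall fun p y _ hy => ?_⟩
      rw [hreg l hl.1 hl.2 y (by linarith)]
      simp
    by_cases hl0 : l = 0
    · exact ⟨0, 1, le_rfl, one_pos, Eventually.of_forall fun p y h0 _ => absurd hl0 h0⟩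
    have ha : M.bC (toCplx (l : RealSpace n)) Z ≠ 0 := fun h => hl ⟨hl0, h⟩
    have hκ : 0 < (kap M l Z (cconj Z)).re := by
      rw [kap_cconj, ofReal_re]
      exact div_pos (normSq_pos.mpr ha) (absSq_pos M hZ)
    set κ := (kap M l Z (cconj Z)).re with hκdef
    obtain ⟨P, hP⟩ := hF.poly l
    obtain ⟨B, hB⟩ := (isCompact_Icc (a := (0 : ℝ)) (b := 1)).exists_bound_of_continuousOn
      (f := fun u : ℝ => P.eval (u : ℂ)) (P.continuous.comp continuous_ofReal).continuousOn
    have hB0 : 0 ≤ B := (norm_nonneg _).trans (hB 0 (by simp))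
    obtain ⟨Cκ, hCκ0, hCκ⟩ := exists_pow_le_exp (j + 1) hκ
    set r := nrm2 (l : RealSpace n) with hr
    have hr0 : 0 ≤ r := nrm2_nonneg _
    refine ⟨B * (Cκ * (K ^ j * (1 + r) ^ j)), κ, by positivity, hκ, ?_⟩
    have hne : M.bC Z (cconj Z) ≠ 0 := by
      rw [bC_self_cconj_eq]
      have := absSq_pos M hZ
      simp [this.ne']
    have hκev : ∀ᶠ p : CplxSpace n × CplxSpace n in 𝓝 (Z, cconj Z),
        2 * κ / 3 < (kap M l p.1 p.2).re := by
      have h1 : ContinuousAt (fun p : CplxSpace n × CplxSpace n =>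
          (kap M l p.1 p.2).re) (Z, cconj Z) :=
        Complex.continuous_re.continuousAt.comp ((continuousAt_kap M (x := (l : RealSpace n)) hne).comp
          (f := fun p => ((l : RealSpace n), p)) (by fun_prop : ContinuousAt _ (Z, cconj Z)))
      exact h1.eventually (lt_mem_nhds (by linarith))
    filter_upwards [hκev, hKev'] with p hp hpK y _ hy
    have h1 : ‖xMean (twist M F l) y‖ ≤ B := by
      rw [hP y (by linarith)]
      have := hB y⁻¹ ⟨by positivity, inv_le_one_of_one_le₀ (by linarith)⟩
      rwa [ofReal_inv] at this
    have h2 : ‖(y : ℂ) ^ (j + 1) * M.bC (toCplx (l : RealSpace n)) p.2 ^ j‖ ≤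
        (Cκ * Real.exp (κ * y)) * (K ^ j * (1 + r) ^ j) := by
      refine (norm_kern_coeff_le (j := j) (by linarith : 0 ≤ y) le_rfl (hpK l)).trans ?_
      rw [mul_assoc]
      refine mul_le_mul_of_nonneg_right ?_ (by positivity)
      refine le_trans ?_ (hCκ y (by linarith))
      gcongr
      linarith
    have h3 : ‖cexp (-(2 * Real.pi * y * kap M l p.1 p.2))‖ ≤ Real.exp (-2 * κ * y) := by
      rw [Complex.norm_exp]
      refine Real.exp_le_exp.mpr ?_
      have h4 : (2 * Real.pi * y * kap M l p.1 p.2) =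
          ((2 * Real.pi * y : ℝ) : ℂ) * kap M l p.1 p.2 := by push_cast; ring
      rw [neg_re, h4, re_ofReal_mul]
      have h5 : 2 * Real.pi * y * (2 * κ / 3) ≤ 2 * Real.pi * y * (kap M l p.1 p.2).re := by
        have : 0 ≤ 2 * Real.pi * y := by positivity
        exact mul_le_mul_of_nonneg_left hp.le this
      have h6 : 3 * (y * κ) ≤ Real.pi * (y * κ) :=
        mul_le_mul_of_nonneg_right Real.pi_gt_three.le (by positivity)
      nlinarith
    rw [norm_mul, kern, norm_mul]
    calc ‖xMean (twist M F l) y‖ * (‖(y : ℂ) ^ (j + 1) * M.bC (toCplx (l : RealSpace n)) p.2 ^ j‖ *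
          ‖cexp (-(2 * Real.pi * y * kap M l p.1 p.2))‖)
        ≤ B * (((Cκ * Real.exp (κ * y)) * (K ^ j * (1 + r) ^ j)) * Real.exp (-2 * κ * y)) := by
          gcongr
      _ = _ := by
          have : Real.exp (-κ * y) = Real.exp (κ * y) * Real.exp (-2 * κ * y) := by
            rw [← Real.exp_add]; congr 1; ring
          rw [this]; ring
  obtain ⟨C₁, hC₁0, hC₁⟩ := hlarge
  choose C₂ δ₂ hC₂0 hδ₂ hC₂ using hsmall
  obtain ⟨δ, hδ0, hδε, hδ1, hδl⟩ : ∃ δ : ℝ, 0 < δ ∧ δ ≤ ε / 2 ∧ δ ≤ 1 ∧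
      ∀ l ∈ hfin.toFinset, δ ≤ δ₂ l := by
    have : ∀ s : Finset M.dual, ∃ δ : ℝ, 0 < δ ∧ δ ≤ ε / 2 ∧ δ ≤ 1 ∧ ∀ l ∈ s, δ ≤ δ₂ l := by
      intro s
      classical
      induction s using Finset.induction_on with
      | empty => exact ⟨min (ε / 2) 1, lt_min (half_pos hε) one_pos, min_le_left _ _,
          min_le_right _ _, by simp⟩
      | insert l s _ ih =>
        obtain ⟨δ, h0, h1, h2, h3⟩ := ih
        refine ⟨min δ (δ₂ l), lt_min h0 (hδ₂ l), (min_le_left _ _).trans h1,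
          (min_le_left _ _).trans h2, fun l' hl' => ?_⟩
        rcases Finset.mem_insert.mp hl' with rfl | h
        · exact min_le_right _ _
        · exact (min_le_left _ _).trans (h3 l' h)
    exact this _
  refine ⟨C₁ + (∑ l ∈ hfin.toFinset, C₂ l) * Real.exp (δ * R), δ, ?_, hδ0, ?_⟩
  · have := Finset.sum_nonneg fun l (_ : l ∈ hfin.toFinset) => hC₂0 l
    positivity
  have hall : ∀ᶠ p : CplxSpace n × CplxSpace n in 𝓝 (Z, cconj Z), ∀ l ∈ hfin.toFinset,
      ∀ y : ℝ, l ≠ 0 → 2 ≤ y →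
        ‖xMean (twist M F l) y * kern M j l y p‖ ≤ C₂ l * Real.exp (-δ₂ l * y) :=
    (eventually_all_finset _).mpr fun l _ => hC₂ l
  filter_upwards [hC₁, hall] with p hp1 hp2 l y hl0 hy
  have hsum0 := Finset.sum_nonneg fun l (_ : l ∈ hfin.toFinset) => hC₂0 l
  have hr0 : 0 ≤ nrm2 (l : RealSpace n) := nrm2_nonneg _
  rcases le_or_gt R (nrm2 (l : RealSpace n)) with hl | hl
  · refine (hp1 l y hl hy).trans ?_
    refine mul_le_mul (mul_le_mul ?_ (Real.exp_le_exp.mpr ?_) (Real.exp_pos _).le (by positivity))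
      (Real.exp_le_exp.mpr ?_) (Real.exp_pos _).le (by positivity)
    · have : 0 ≤ (∑ l ∈ hfin.toFinset, C₂ l) * Real.exp (δ * R) := by positivity
      linarith
    · nlinarith
    · nlinarith
  · have hmem : l ∈ hfin.toFinset := hfin.mem_toFinset.mpr hl
    refine (hp2 l hmem y hl0 hy).trans ?_
    refine mul_le_mul ?_ (Real.exp_le_exp.mpr ?_) (Real.exp_pos _).le (by positivity)
    · have h1 : C₂ l ≤ ∑ l ∈ hfin.toFinset, C₂ l :=
        Finset.single_le_sum (fun l _ => hC₂0 l) hmem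
      have h2 : 1 ≤ Real.exp (δ * R) * Real.exp (-δ * nrm2 (l : RealSpace n)) := by
        rw [← Real.exp_add, Real.one_le_exp_iff]
        nlinarith
      have h3 : 0 ≤ C₁ * Real.exp (-δ * nrm2 (l : RealSpace n)) := by positivity
      nlinarith [mul_le_mul_of_nonneg_left h2 hsum0]
    · have := hδl l hmem
      nlinarith

end Domination

/-! ### Holomorphic continuation of the summands in `(s, Z, Z̄)` -/

theorem differentiableAt_bC_comp {E : Type*} [NormedAddCommGroup E] [NormedSpace ℂ E]
    {f g : E → CplxSpace n} {z : E} (hf : DifferentiableAt ℂ f z) (hg : DifferentiableAt ℂ g z) :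
    DifferentiableAt ℂ (fun a => M.bC (f a) (g a)) z := by
  unfold EvenLattice.bC gramForm
  have hf' := fun i => (differentiableAt_pi.mp hf) i
  have hg' := fun i => (differentiableAt_pi.mp hg) i
  refine DifferentiableAt.fun_sum fun i _ => DifferentiableAt.fun_sum fun j _ => ?_
  exact ((hf' i).mul_const _).mul (hg' j)

theorem differentiableAt_kern {j : ℕ} {x : RealSpace n} {y : ℝ}
    {p : CplxSpace n × CplxSpace n} (h : M.bC p.1 p.2 ≠ 0) :
    DifferentiableAt ℂ (kern M j x y) p := by
  have h1 : DifferentiableAt ℂ (fun p : CplxSpace n × CplxSpace n => M.bC (toCplx x) p.1) p :=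
    differentiableAt_bC_comp M (differentiableAt_const _) differentiableAt_fst
  have h2 : DifferentiableAt ℂ (fun p : CplxSpace n × CplxSpace n => M.bC (toCplx x) p.2) p :=
    differentiableAt_bC_comp M (differentiableAt_const _) differentiableAt_snd
  have h3 : DifferentiableAt ℂ (fun p : CplxSpace n × CplxSpace n => M.bC p.1 p.2) p :=
    differentiableAt_bC_comp M differentiableAt_fst differentiableAt_snd
  unfold kern kap
  fun_prop (disch := assumption)

theorem differentiableAt_kernReg {j : ℕ} {x : RealSpace n} {y : ℝ} (hy : 0 < y)
    {q : ℂ × (CplxSpace n × CplxSpace n)} (h : M.bC q.2.1 q.2.2 ≠ 0) :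
    DifferentiableAt ℂ (fun q => kernReg M j x y q) q := by
  have h1 : DifferentiableAt ℂ (fun q : ℂ × (CplxSpace n × CplxSpace n) => kern M j x y q.2) q :=
    (differentiableAt_kern M h).comp q differentiableAt_snd
  have h2 : DifferentiableAt ℂ (fun q : ℂ × (CplxSpace n × CplxSpace n) => (y : ℂ) ^ (-q.1)) q :=
    differentiableAt_fst.neg.const_cpow (Or.inl (by simpa using hy.ne'))
  simp only [kernReg, div_eq_mul_inv]
  exact (h1.mul h2).mul_const _

theorem continuousOn_kernReg (j : ℕ) (x : RealSpace n) (q : ℂ × (CplxSpace n × CplxSpace n)) :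
    ContinuousOn (fun y : ℝ => kernReg M j x y q) (Set.Ioi 0) := by
  intro y hy
  have hy' : (y : ℂ) ≠ 0 := by simpa using (ne_of_gt hy)
  have h1 : ContinuousAt (fun y : ℝ => (y : ℂ) ^ (-q.1)) y :=
    (continuousAt_cpow_const (Or.inl (by simpa using hy))).comp continuous_ofReal.continuousAt
  refine ContinuousAt.continuousWithinAt ?_
  unfold kernReg kern
  refine ContinuousAt.div (ContinuousAt.mul ?_ h1) ?_ (pow_ne_zero _ hy')
  · fun_prop
  · fun_prop

/-- The integral of the summand of index `l` over the compact part `Im τ < 2` of the fundamental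
domain. -/
noncomputable def cuspTerm (F : ℍ → M.Disc → ℂ) (j : ℕ) (l : M.dual)
    (q : ℂ × (CplxSpace n × CplxSpace n)) : ℂ :=
  ∫ z in truncDomain 2, twist M F l z * kernReg M j l z.im q

open Classical in
/-- The integral of the summand of index `l ≠ 0` over the part `Im τ > 2` of the fundamental
domain, where the integration over the real part has been carried out. -/
noncomputable def tailTerm (F : ℍ → M.Disc → ℂ) (j : ℕ) (l : M.dual)
    (q : ℂ × (CplxSpace n × CplxSpace n)) : ℂ :=
  if l = 0 then 0 else ∫ y in Set.Ioi (2 : ℝ), xMean (twist M F l) y * kernReg M j l y q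

/-- An open set of pairs `(Z, W)` on which the summands of the theta lift and their integrals are
dominated uniformly. -/
structure IsAdmissible (F : ℍ → M.Disc → ℂ) (j : ℕ) (V : Set (CplxSpace n × CplxSpace n)) :
    Prop where
  isOpen : IsOpen V
  majorant : ∃ ε > 0, ∀ p ∈ V, M.bC p.1 p.2 ≠ 0 ∧ ∀ x : RealSpace n,
    M.bR x x + ε * nrm2 x ≤ 2 * (kap M x p.1 p.2).re
  growth : ∃ K > 0, ∀ p ∈ V, ∀ x : RealSpace n, ‖M.bC (toCplx x) p.2‖ ≤ K * (1 + nrm2 x)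
  tail : ∃ C δ : ℝ, 0 ≤ C ∧ 0 < δ ∧ ∀ p ∈ V, ∀ (l : M.dual) (y : ℝ), l ≠ 0 → 2 ≤ y →
    ‖xMean (twist M F l) y * kern M j l y p‖ ≤
      C * Real.exp (-δ * nrm2 (l : RealSpace n)) * Real.exp (-δ * y)

section Continuation

variable {M} {F : ℍ → M.Disc → ℂ}

theorem exists_isAdmissible (hF : LiftInput M F) (j : ℕ) {Z : CplxSpace n} (hZ : Z ∈ cone M)
    (hreg : ∀ l : M.dual, l ≠ 0 → M.bC (toCplx (l : RealSpace n)) Z = 0 →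
      ∀ y : ℝ, 0 < y → xMean (twist M F l) y = 0) :
    ∃ V, (Z, cconj Z) ∈ V ∧ IsAdmissible M F j V := by
  obtain ⟨ε, hε, h1⟩ := eventually_majorant M hZ
  obtain ⟨K, hK, h2⟩ := norm_bC_le M (cconj Z)
  obtain ⟨C, δ, hC, hδ, h3⟩ := exists_tail_bound hF j hZ hreg
  have h2' : ∀ᶠ p : CplxSpace n × CplxSpace n in 𝓝 (Z, cconj Z), ∀ x : RealSpace n,
      ‖M.bC (toCplx x) p.2‖ ≤ K * (1 + nrm2 x) := by
    have : Tendsto (fun p : CplxSpace n × CplxSpace n => p.2) (𝓝 (Z, cconj Z)) (𝓝 (cconj Z)) :=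
      continuous_snd.tendsto _
    exact this.eventually h2
  obtain ⟨V, hV, hVo, hVZ⟩ := eventually_nhds_iff.mp (h1.and (h2'.and h3))
  exact ⟨V, hVZ, hVo, ⟨ε, hε, fun p hp => (hV p hp).1⟩, ⟨K, hK, fun p hp => (hV p hp).2.1⟩,
    ⟨C, δ, hC, hδ, fun p hp => (hV p hp).2.2⟩⟩

theorem norm_cpow_div_sq_le {y H R : ℝ} {s : ℂ} (hy : 1 / 2 ≤ y) (hyH : y ≤ H) (hs : ‖s‖ ≤ R) :
    ‖(y : ℂ) ^ (-s) / (y : ℂ) ^ 2‖ ≤ Real.exp (R * (H + 2)) * 4 := by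
  have hy0 : 0 < y := by linarith
  rw [norm_div, norm_cpow_eq_rpow_re_of_pos hy0, norm_pow, Complex.norm_real, Real.norm_eq_abs,
    abs_of_pos hy0, div_le_iff₀ (by positivity), Real.rpow_def_of_pos hy0]
  have h1 : Real.log y * (-s).re ≤ R * (H + 2) := by
    have h2 : |Real.log y| ≤ H + 2 := by
      rw [abs_le]
      have h3 := Real.log_le_sub_one_of_pos hy0
      have h4 := Real.log_le_sub_one_of_pos (inv_pos.mpr hy0)
      rw [Real.log_inv] at h4
      have h5 : y⁻¹ ≤ 2 := by
        rw [inv_le_comm₀ hy0 two_pos]; linarith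
      constructor <;> linarith
    have h3 : |(-s).re| ≤ R := (abs_re_le_norm _).trans (by simpa using hs)
    calc Real.log y * (-s).re ≤ |Real.log y * (-s).re| := le_abs_self _
      _ = |(-s).re| * |Real.log y| := by rw [abs_mul, mul_comm]
      _ ≤ R * (H + 2) := mul_le_mul h3 h2 (abs_nonneg _) ((abs_nonneg _).trans h3)
  calc Real.exp (Real.log y * (-s).re) ≤ Real.exp (R * (H + 2)) := Real.exp_le_exp.mpr h1
    _ ≤ Real.exp (R * (H + 2)) * 4 * y ^ 2 := by
      have : 0 < Real.exp (R * (H + 2)) := Real.exp_pos _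
      have h4 : 1 ≤ 4 * y ^ 2 := by nlinarith
      rw [mul_assoc]
      exact le_mul_of_one_le_right this.le h4

theorem IsAdmissible.exists_kernReg_bound (hF : LiftInput M F) {j : ℕ}
    {V : Set (CplxSpace n × CplxSpace n)} (hV : IsAdmissible M F j V) (H R : ℝ) :
    ∃ C ε : ℝ, 0 ≤ C ∧ 0 < ε ∧ ∀ (q : ℂ × (CplxSpace n × CplxSpace n)), ‖q.1‖ ≤ R → q.2 ∈ V →
      ∀ (l : M.dual) (z : ℂ), |z.re| ≤ 1 / 2 → 1 / 2 ≤ z.im → z.im ≤ H →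
        ‖twist M F l z * kernReg M j l z.im q‖ ≤ C * Real.exp (-ε * nrm2 (l : RealSpace n)) := by
  obtain ⟨ε, hε, hmaj⟩ := hV.majorant
  obtain ⟨K, hK, hgr⟩ := hV.growth
  obtain ⟨C, hC0, hC⟩ := exists_compact_bound hF hε H
    (|H| ^ (j + 1) * K ^ j * (Real.exp (R * (H + 2)) * 4)) j
  refine ⟨C, ε / 2, hC0, half_pos hε, fun q hq1 hq2 l z h1 h2 h3 => ?_⟩
  have hz : 0 ≤ z.im := by linarith
  have := hC q.2 l z (((z.im : ℂ) ^ (j + 1) * M.bC (toCplx (l : RealSpace n)) q.2.2 ^ j) *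
    ((z.im : ℂ) ^ (-q.1) / (z.im : ℂ) ^ 2)) ((hmaj q.2 hq2).2 l) h1 h2 h3 ?_
  · refine le_trans (le_of_eq ?_) this
    congr 2
    rw [kernReg, kern]
    ring
  · rw [norm_mul]
    have h4 := norm_kern_coeff_le (j := j) hz (h3.trans (le_abs_self H)) (hgr q.2 hq2 l)
    have h5 := norm_cpow_div_sq_le h2 h3 hq1
    refine (mul_le_mul h4 h5 (norm_nonneg _) ?_).trans (le_of_eq (by ring))
    have := nrm2_nonneg (l : RealSpace n)
    positivity

theorem continuousOn_twist_mul_kernReg (hF : LiftInput M F) (j : ℕ) (l : M.dual)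
    (q : ℂ × (CplxSpace n × CplxSpace n)) :
    ContinuousOn (fun z : ℂ => twist M F l z * kernReg M j l z.im q) {z : ℂ | 0 < z.im} :=
  (hF.periodic l).smooth.continuousOn.mul
    ((continuousOn_kernReg M j l q).comp Complex.continuous_im.continuousOn fun _ hz => hz)

theorem truncDomain_subset_uhp (h : ℝ) : truncDomain h ⊆ {z : ℂ | 0 < z.im} := fun _ hz => hz.2.2.1

theorem aestronglyMeasurable_twist_mul_kernReg (hF : LiftInput M F) (j : ℕ) (l : M.dual)
    (q : ℂ × (CplxSpace n × CplxSpace n)) (h : ℝ) :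
    AEStronglyMeasurable (fun z : ℂ => twist M F l z * kernReg M j l z.im q)
      (volume.restrict (truncDomain h)) :=
  ((continuousOn_twist_mul_kernReg hF j l q).mono
    (truncDomain_subset_uhp h)).aestronglyMeasurable (isOpen_truncDomain h).measurableSet

theorem continuousOn_xMean (hF : LiftInput M F) (l : M.dual) :
    ContinuousOn (xMean (twist M F l)) (Set.Ioi 0) := fun _ hy =>
  ((hF.periodic l).hasDerivAt_xMean hy).continuousAt.continuousWithinAt

theorem aestronglyMeasurable_xMean_mul_kernReg (hF : LiftInput M F) (j : ℕ) (l : M.dual)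
    (q : ℂ × (CplxSpace n × CplxSpace n)) :
    AEStronglyMeasurable (fun y : ℝ => xMean (twist M F l) y * kernReg M j l y q)
      (volume.restrict (Set.Ioi 2)) :=
  (((continuousOn_xMean hF l).mul (continuousOn_kernReg M j l q)).mono
    (Set.Ioi_subset_Ioi (by norm_num))).aestronglyMeasurable measurableSet_Ioi

/-- The domain of the continued summands: `s` in a disc, `(Z, W)` in an admissible set. -/
def contDomain (R : ℕ) (V : Set (CplxSpace n × CplxSpace n)) :
    Set (ℂ × (CplxSpace n × CplxSpace n)) := Metric.ball 0 R ×ˢ V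

theorem isOpen_contDomain (R : ℕ) {V : Set (CplxSpace n × CplxSpace n)} (hV : IsOpen V) :
    IsOpen (contDomain R V) := Metric.isOpen_ball.prod hV

theorem IsAdmissible.exists_cusp_bound (hF : LiftInput M F) {j : ℕ}
    {V : Set (CplxSpace n × CplxSpace n)} (hV : IsAdmissible M F j V) (R : ℕ) :
    ∃ u : M.dual → ℝ, Summable u ∧ ∀ l, ∀ q ∈ contDomain R V, ∀ z ∈ truncDomain 2,
      ‖twist M F l z * kernReg M j l z.im q‖ ≤ u l := by
  obtain ⟨C, ε, hC, hε, h⟩ := hV.exists_kernReg_bound hF 2 R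
  refine ⟨fun l => C * Real.exp (-ε * nrm2 (l : RealSpace n)), (summable_dual M hε).mul_left C,
    fun l q hq z hz => ?_⟩
  obtain ⟨h1, h2, h3⟩ := truncDomain_bounds hz
  have hq1 : ‖q.1‖ ≤ R := by simpa using (Metric.mem_ball.mp hq.1).le
  exact h q hq1 hq.2 l z h1 h2 h3

theorem IsAdmissible.exists_tail_bound (hV : IsAdmissible M F j V) (R : ℕ) :
    ∃ (u : M.dual → ℝ) (δ : ℝ), Summable u ∧ 0 < δ ∧ ∀ l : M.dual, l ≠ 0 →
      ∀ q ∈ contDomain R V, ∀ y : ℝ, 2 ≤ y →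
      ‖xMean (twist M F l) y * kernReg M j l y q‖ ≤ u l * Real.exp (-δ * y) := by
  obtain ⟨C, δ, hC, hδ, h⟩ := hV.tail
  obtain ⟨C', hC', h'⟩ := exists_pow_le_exp R (half_pos hδ)
  refine ⟨fun l => C * C' * Real.exp (-δ * nrm2 (l : RealSpace n)), δ / 2,
    (summable_dual M hδ).mul_left _, half_pos hδ, fun l hl q hq y hy => ?_⟩
  have hy0 : 0 < y := by linarith
  have hq1 : ‖q.1‖ ≤ R := by simpa using (Metric.mem_ball.mp hq.1).le
  have h1 : ‖(y : ℂ) ^ (-q.1) / (y : ℂ) ^ 2‖ ≤ C' * Real.exp (δ / 2 * y) := by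
    rw [norm_div, norm_cpow_eq_rpow_re_of_pos hy0, norm_pow, Complex.norm_real, Real.norm_eq_abs,
      abs_of_pos hy0]
    have h2 : y ^ (-q.1).re ≤ y ^ (R : ℝ) := by
      refine Real.rpow_le_rpow_of_exponent_le (by linarith) ?_
      exact (le_abs_self _).trans ((abs_re_le_norm _).trans (by simpa using hq1))
    rw [Real.rpow_natCast] at h2
    have h3 : y ^ R ≤ (1 + y) ^ R := by gcongr; linarith
    refine (div_le_self (by positivity) (by nlinarith)).trans (h2.trans (h3.trans (h' y hy0.le)))
  have h4 : xMean (twist M F l) y * kernReg M j l y q = (xMean (twist M F l) y * kern M j l y q.2) *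
      ((y : ℂ) ^ (-q.1) / (y : ℂ) ^ 2) := by rw [kernReg]; ring
  rw [h4, norm_mul]
  refine (mul_le_mul (h q.2 hq.2 l y hl hy) h1 (norm_nonneg _) (by positivity)).trans (le_of_eq ?_)
  have : Real.exp (-(δ / 2) * y) = Real.exp (-δ * y) * Real.exp (δ / 2 * y) := by
    rw [← Real.exp_add]; congr 1; ring
  rw [this]; ring

theorem differentiableOn_integrand {j : ℕ} {V : Set (CplxSpace n × CplxSpace n)}
    (hV : IsAdmissible M F j V) (R : ℕ) (c : ℂ) (x : RealSpace n) {y : ℝ} (hy : 0 < y) :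
    DifferentiableOn ℂ (fun q => c * kernReg M j x y q) (contDomain R V) := fun q hq => by
  obtain ⟨ε, _, h⟩ := hV.majorant
  exact ((differentiableAt_kernReg M hy (h q.2 hq.2).1).const_mul c).differentiableWithinAt

/-- The integral over the compact part is holomorphic in `(s, Z, W)` and may be differentiated under
the integral sign. -/
theorem IsAdmissible.holomorphic_cuspTerm (hF : LiftInput M F) {j : ℕ}
    {V : Set (CplxSpace n × CplxSpace n)} (hV : IsAdmissible M F j V) (R : ℕ) (l : M.dual) :
    DifferentiableOn ℂ (cuspTerm M F j l) (contDomain R V) ∧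
    ∀ q ∈ contDomain R V, ∀ v, fderiv ℂ (cuspTerm M F j l) q v =
      ∫ z in truncDomain 2, twist M F l z * fderiv ℂ (kernReg M j l z.im) q v := by
  obtain ⟨u, _, hu⟩ := hV.exists_cusp_bound hF R
  have hd : ∀ᵐ z ∂(volume.restrict (truncDomain 2)),
      DifferentiableOn ℂ (fun q => twist M F l z * kernReg M j l z.im q) (contDomain R V) := by
    filter_upwards [ae_restrict_mem (isOpen_truncDomain 2).measurableSet] with z hz
    exact differentiableOn_integrand hV R _ _ hz.2.2.1
  have hb : ∀ᵐ z ∂(volume.restrict (truncDomain 2)), ∀ q ∈ contDomain R V,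
      ‖twist M F l z * kernReg M j l z.im q‖ ≤ u l := by
    filter_upwards [ae_restrict_mem (isOpen_truncDomain 2).measurableSet] with z hz q hq
    exact hu l q hq z hz
  have hint : Integrable (fun _ : ℂ => u l) (volume.restrict (truncDomain 2)) := by
    have : Fact (volume (truncDomain 2) < ⊤) := ⟨volume_truncDomain_lt_top 2⟩
    exact integrable_const _
  have hm : ∀ q ∈ contDomain R V, AEStronglyMeasurable
      (fun z : ℂ => twist M F l z * kernReg M j l z.im q) (volume.restrict (truncDomain 2)) :=
    fun q _ => aestronglyMeasurable_twist_mul_kernReg hF j l q 2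
  refine ⟨differentiableOn_integral_of_holomorphic (isOpen_contDomain R hV.isOpen) hm hd hint hb,
    fun q hq v => ?_⟩
  have := fderiv_integral_of_holomorphic (isOpen_contDomain R hV.isOpen) hm hd hint hb hq v
  unfold cuspTerm
  rw [this]
  refine setIntegral_congr_fun (isOpen_truncDomain 2).measurableSet fun z hz => ?_
  obtain ⟨ε, _, h⟩ := hV.majorant
  have h1 : DifferentiableAt ℂ (kernReg M j l z.im) q :=
    differentiableAt_kernReg M hz.2.2.1 (h q.2 hq.2).1
  have h2 := (h1.hasFDerivAt.const_mul (twist M F l z)).fderiv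
  simp only [h2, _root_.smul_apply, smul_eq_mul]

theorem IsAdmissible.holomorphic_tailTerm (hF : LiftInput M F) {j : ℕ}
    {V : Set (CplxSpace n × CplxSpace n)} (hV : IsAdmissible M F j V) (R : ℕ) (l : M.dual) :
    DifferentiableOn ℂ (tailTerm M F j l) (contDomain R V) ∧
    (l ≠ 0 → ∀ q ∈ contDomain R V, ∀ v, fderiv ℂ (tailTerm M F j l) q v =
      ∫ y in Set.Ioi 2, xMean (twist M F l) y * fderiv ℂ (kernReg M j l y) q v) := by
  by_cases hl : l = 0
  · refine ⟨?_, fun h => absurd hl h⟩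
    have : tailTerm M F j l = fun _ => 0 := by
      funext q; rw [tailTerm, if_pos hl]
    rw [this]
    exact differentiableOn_const _
  obtain ⟨u, δ, _, hδ, hu⟩ := hV.exists_tail_bound R
  have hpos : ∀ y ∈ Set.Ioi (2 : ℝ), (0 : ℝ) < y := fun y hy => two_pos.trans hy
  have hd : ∀ᵐ y ∂(volume.restrict (Set.Ioi (2 : ℝ))),
      DifferentiableOn ℂ (fun q => xMean (twist M F l) y * kernReg M j l y q)
        (contDomain R V) := by
    filter_upwards [ae_restrict_mem measurableSet_Ioi] with y hy
    exact differentiableOn_integrand hV R _ _ (hpos y hy)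
  have hb : ∀ᵐ y ∂(volume.restrict (Set.Ioi (2 : ℝ))), ∀ q ∈ contDomain R V,
      ‖xMean (twist M F l) y * kernReg M j l y q‖ ≤ u l * Real.exp (-δ * y) := by
    filter_upwards [ae_restrict_mem measurableSet_Ioi] with y hy q hq
    exact hu l hl q hq y (le_of_lt hy)
  have hint : Integrable (fun y : ℝ => u l * Real.exp (-δ * y))
      (volume.restrict (Set.Ioi (2 : ℝ))) :=
    (integrableOn_exp_mul_Ioi (neg_lt_zero.mpr hδ) 2).const_mul _
  have hm : ∀ q ∈ contDomain R V, AEStronglyMeasurable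
      (fun y : ℝ => xMean (twist M F l) y * kernReg M j l y q)
        (volume.restrict (Set.Ioi (2 : ℝ))) :=
    fun q _ => aestronglyMeasurable_xMean_mul_kernReg hF j l q
  have heq : tailTerm M F j l = fun q =>
      ∫ y in Set.Ioi (2 : ℝ), xMean (twist M F l) y * kernReg M j l y q := by
    funext q; rw [tailTerm, if_neg hl]
  rw [heq]
  refine ⟨differentiableOn_integral_of_holomorphic (isOpen_contDomain R hV.isOpen) hm hd hint hb,
    fun _ q hq v => ?_⟩
  have := fderiv_integral_of_holomorphic (isOpen_contDomain R hV.isOpen) hm hd hint hb hq v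
  rw [this]
  refine setIntegral_congr_fun measurableSet_Ioi fun y hy => ?_
  obtain ⟨ε, _, h⟩ := hV.majorant
  have h1 : DifferentiableAt ℂ (kernReg M j l y) q :=
    differentiableAt_kernReg M (hpos y hy) (h q.2 hq.2).1
  have h2 := (h1.hasFDerivAt.const_mul (xMean (twist M F l) y)).fderiv
  simp only [h2, _root_.smul_apply, smul_eq_mul]

/-- The entire part of the regularized integral, continued to independent `Z` and `W = Z̄`. -/
noncomputable def liftSum (M : EvenLattice n) (F : ℍ → M.Disc → ℂ) (j : ℕ)
    (q : ℂ × (CplxSpace n × CplxSpace n)) : ℂ :=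
  ∑' l, (cuspTerm M F j l q + tailTerm M F j l q)

/-- The integrals of the summands are dominated by a summable sequence, uniformly on bounded sets of
`s`. -/
theorem IsAdmissible.exists_term_bound (hF : LiftInput M F) {j : ℕ}
    {V : Set (CplxSpace n × CplxSpace n)} (hV : IsAdmissible M F j V) (R : ℕ) :
    ∃ u : M.dual → ℝ, Summable u ∧ ∀ l, ∀ q ∈ contDomain R V,
      ‖cuspTerm M F j l q‖ ≤ u l ∧ ‖tailTerm M F j l q‖ ≤ u l := by
  obtain ⟨u, hus, hu⟩ := hV.exists_cusp_bound hF R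
  obtain ⟨u', δ, hus', hδ, hu'⟩ := hV.exists_tail_bound R
  set c₁ := volume.real (truncDomain 2)
  set c₂ := ∫ y in Set.Ioi (2 : ℝ), Real.exp (-δ * y)
  have hc₂ : 0 ≤ c₂ := integral_nonneg fun _ => (Real.exp_pos _).le
  refine ⟨fun l => |u l| * c₁ + |u' l| * c₂, (hus.abs.mul_right _).add (hus'.abs.mul_right _),
    fun l q hq => ⟨?_, ?_⟩⟩
  · have h := norm_setIntegral_le_of_norm_le_const (volume_truncDomain_lt_top 2)
      (fun z hz => (hu l q hq z hz).trans (le_abs_self _))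
    refine h.trans (le_add_of_nonneg_right (by positivity))
  · rw [tailTerm]
    split_ifs with hl
    · simp only [norm_zero]
      positivity
    · have h := norm_integral_le_of_norm_le (μ := volume.restrict (Set.Ioi (2 : ℝ)))
        (f := fun y => xMean (twist M F l) y * kernReg M j l y q)
        ((integrableOn_exp_mul_Ioi (neg_lt_zero.mpr hδ) 2).const_mul |u' l|) (by
          filter_upwards [ae_restrict_mem measurableSet_Ioi] with y hy
          refine (hu' l hl q hq y (le_of_lt hy)).trans ?_
          exact mul_le_mul_of_nonneg_right (le_abs_self _) (Real.exp_pos _).le)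
      rw [integral_const_mul] at h
      exact h.trans (le_add_of_nonneg_left (by positivity))

/-- The series of the continued summands is holomorphic and may be differentiated termwise. -/
theorem IsAdmissible.holomorphic_liftSum (hF : LiftInput M F) {j : ℕ}
    {V : Set (CplxSpace n × CplxSpace n)} (hV : IsAdmissible M F j V) (R : ℕ) :
    DifferentiableOn ℂ (liftSum M F j) (contDomain R V) ∧
    ∀ q ∈ contDomain R V, ∀ v, HasSum (fun l =>
        fderiv ℂ (cuspTerm M F j l) q v + fderiv ℂ (tailTerm M F j l) q v)
      (fderiv ℂ (liftSum M F j) q v) := by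
  obtain ⟨u, hus, hu⟩ := hV.exists_term_bound hF R
  have hd : ∀ l, DifferentiableOn ℂ (fun q => cuspTerm M F j l q +
      tailTerm M F j l q) (contDomain R V) := fun l =>
    (hV.holomorphic_cuspTerm hF R l).1.add (hV.holomorphic_tailTerm hF R l).1
  have hb : ∀ l, ∀ q ∈ contDomain R V, ‖cuspTerm M F j l q +
      tailTerm M F j l q‖ ≤ u l + u l := fun l q hq =>
    (norm_add_le _ _).trans (add_le_add (hu l q hq).1 (hu l q hq).2)
  have ho := isOpen_contDomain R hV.isOpen
  refine ⟨differentiableOn_tsum_of_holomorphic ho (hus.add hus) hd hb, fun q hq v => ?_⟩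
  have := fderiv_tsum_of_holomorphic ho (hus.add hus) hd hb hq v
  have hfun : (fun l => fderiv ℂ (cuspTerm M F j l) q v + fderiv ℂ (tailTerm M F j l) q v) =
      fun l => fderiv ℂ (fun q => cuspTerm M F j l q + tailTerm M F j l q) q v := by
    funext l
    have h1 := ((hV.holomorphic_cuspTerm hF R l).1.differentiableAt (ho.mem_nhds hq)).hasFDerivAt
    have h2 := ((hV.holomorphic_tailTerm hF R l).1.differentiableAt (ho.mem_nhds hq)).hasFDerivAt
    exact (congrArg (fun L => L v) (h1.add h2).fderiv).symm
  rw [hfun]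
  exact this

end Continuation

/-! ### Unfolding the regularized integral -/

section Exponents

variable {Z : CplxSpace n} (x : RealSpace n)

theorem bC_projZ_right :
    M.bC (toCplx x) (projZ M x Z) = kap M x Z (cconj Z) := by
  rw [projZ, bC_smul_right, bC_add_right, bC_smul_right, bC_smul_right, kap]
  ring

theorem bC_projZ_self (hZ : Z ∈ cone M) :
    M.bC (projZ M x Z) (projZ M x Z) = kap M x Z (cconj Z) := by
  have hN : M.bC Z (cconj Z) ≠ 0 := by
    rw [bC_self_cconj_eq]
    have := absSq_pos M hZ
    simp [this.ne']
  have h1 : M.bC (cconj Z) (cconj Z) = 0 := by rw [← conj_bC, hZ.1, map_zero]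
  rw [projZ, kap]
  simp only [bC_smul_right, bC_smul_left, bC_add_right, bC_add_left, h1, hZ.1,
    bC_comm M (cconj Z) Z]
  field_simp
  ring

/-- The conjugate exponent of the theta kernel, split into the factor that is absorbed by `twist`
and the factor of `kern`. -/
theorem conj_theta_exponent (hZ : Z ∈ cone M) (τ : ℂ) :
    (starRingEnd ℂ) (Real.pi * I * τ * M.bC (projZ M x Z) (projZ M x Z) +
        Real.pi * I * (starRingEnd ℂ) τ * M.bC (projPerp M x Z) (projPerp M x Z)) =
      -(Real.pi * I * τ * (M.bR x x : ℝ)) + -(2 * Real.pi * τ.im * kap M x Z (cconj Z)) := by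
  have h1 : M.bC (projPerp M x Z) (projPerp M x Z) = (M.bR x x : ℂ) - kap M x Z (cconj Z) := by
    rw [projPerp, bC_sub_left, bC_sub_right, bC_sub_right, bC_comm M (projZ M x Z) (toCplx x),
      bC_projZ_right M x, bC_projZ_self M x hZ, bC_toCplx]
    ring
  rw [h1, bC_projZ_self M x hZ, kap_cconj]
  simp only [map_add, map_mul, map_sub, conj_I, conj_ofReal, conj_conj]
  have h2 : (starRingEnd ℂ) τ = τ - 2 * τ.im * I := by
    apply Complex.ext
    · simp
    · simp; ring
  rw [h2]
  ring_nf
  simp only [I_sq]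
  ring

end Exponents

section Unfolding

variable {M} {F : ℍ → M.Disc → ℂ}

theorem summable_twist_mul_kern (hF : LiftInput M F) {j : ℕ} {Z : CplxSpace n} (hZ : Z ∈ cone M)
    {z : ℂ} (h1 : |z.re| ≤ 1 / 2) (h2 : 1 / 2 ≤ z.im) :
    Summable fun l : M.dual => twist M F l z * kern M j l z.im (Z, cconj Z) := by
  obtain ⟨ε, hε, hev⟩ := eventually_majorant M hZ
  obtain ⟨K, hK, hKev⟩ := norm_bC_le M (cconj Z)
  obtain ⟨C, _, hC⟩ := exists_compact_bound hF hε z.im (z.im ^ (j + 1) * K ^ j) j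
  refine Summable.of_norm_bounded ((summable_dual M (half_pos hε)).mul_left C) fun l => ?_
  exact hC (Z, cconj Z) l z _ (hev.self_of_nhds.2 l) h1 h2 le_rfl
    (norm_kern_coeff_le (by linarith) le_rfl (hKev.self_of_nhds l))

/-- The integrand of the theta lift as a sum over the dual lattice. -/
theorem liftIntegrand_eq_tsum (hF : LiftInput M F) {j : ℕ} {Z : CplxSpace n} (hZ : Z ∈ cone M)
    {z : ℂ} (h1 : |z.re| ≤ 1 / 2) (h2 : 1 / 2 ≤ z.im) :
    liftIntegrand M j F Z (ofComplex z) =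
      ∑' l : M.dual, twist M F l z * kern M j l z.im (Z, cconj Z) := by
  have hy : 0 < z.im := by linarith
  have hτ : ((ofComplex z : ℍ) : ℂ) = z := by rw [ofComplex_apply_of_im_pos hy]
  have him : (ofComplex z : ℍ).im = z.im := by rw [← UpperHalfPlane.coe_im, hτ]
  set G : M.dual → ℂ := fun l => twist M F l z * kern M j l z.im (Z, cconj Z) with hG
  have hs : Summable G := summable_twist_mul_kern hF hZ h1 h2
  have hterm : ∀ γ : M.Disc, ((z.im ^ ((j : ℝ) + 1 - (n : ℝ) / 2) : ℝ) : ℂ) *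
      (F (ofComplex z) γ * (starRingEnd ℂ) (thetaKernel M j Z (ofComplex z) γ)) =
      ∑' l : {l : M.dual // M.cls l = γ}, G l := by
    intro γ
    rw [thetaKernel, map_mul, conj_ofReal, Complex.conj_tsum, him, hτ, ← mul_assoc, ← mul_assoc,
      ← tsum_mul_left]
    refine tsum_congr fun l => ?_
    obtain ⟨l, rfl⟩ := l
    rw [map_mul, map_pow, ← Complex.exp_conj, conj_theta_exponent M _ hZ, Complex.exp_add,
      ← bC_cconj_right]
    simp only [hG, twist, kern]
    have hpow : ((z.im ^ ((j : ℝ) + 1 - (n : ℝ) / 2) : ℝ) : ℂ) *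
        ((z.im ^ ((n : ℝ) / 2) : ℝ) : ℂ) = (z.im : ℂ) ^ (j + 1) := by
      rw [← ofReal_mul, ← Real.rpow_add hy]
      have : (j : ℝ) + 1 - (n : ℝ) / 2 + (n : ℝ) / 2 = ((j + 1 : ℕ) : ℝ) := by push_cast; ring
      rw [this, Real.rpow_natCast, ofReal_pow]
    rw [← hpow]
    ring
  rw [liftIntegrand, pairing, him, Finset.mul_sum, Finset.sum_congr rfl fun γ _ => hterm γ,
    ← tsum_fintype (L := .unconditional _), ← (Equiv.sigmaFiberEquiv M.cls).tsum_eq G]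
  have hs' : Summable fun p : (Σ γ : M.Disc, {l : M.dual // M.cls l = γ}) =>
      G (Equiv.sigmaFiberEquiv M.cls p) := (Equiv.sigmaFiberEquiv M.cls).summable_iff.mpr hs
  rw [hs'.tsum_sigma]
  rfl

/-- Termwise integration over the truncated fundamental domain. -/
theorem truncIntegral_eq_tsum (hF : LiftInput M F) {j : ℕ} {Z : CplxSpace n} (hZ : Z ∈ cone M)
    {V : Set (CplxSpace n × CplxSpace n)} (hV : IsAdmissible M F j V) (hZV : (Z, cconj Z) ∈ V)
    (s : ℂ) (h : ℝ) :
    HasSum (fun l : M.dual => ∫ z in truncDomain h,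
        twist M F l z * kernReg M j l z.im (s, (Z, cconj Z)))
      (truncIntegral (liftIntegrand M j F Z) s h) := by
  obtain ⟨C, ε, hC, hε, hb⟩ := hV.exists_kernReg_bound hF h ‖s‖
  have hb' : ∀ (l : M.dual), ∀ z ∈ truncDomain h,
      ‖twist M F l z * kernReg M j l z.im (s, (Z, cconj Z))‖ ≤
        C * Real.exp (-ε * nrm2 (l : RealSpace n)) := fun l z hz => by
    obtain ⟨h1, h2, h3⟩ := truncDomain_bounds hz
    exact hb (s, (Z, cconj Z)) le_rfl hZV l z h1 h2 h3
  have hfact : Fact (volume (truncDomain h) < ⊤) := ⟨volume_truncDomain_lt_top h⟩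
  have hint : ∀ l : M.dual, Integrable (fun z : ℂ =>
      twist M F l z * kernReg M j l z.im (s, (Z, cconj Z))) (volume.restrict (truncDomain h)) :=
    fun l => Integrable.mono' (integrable_const (C * Real.exp (-ε * nrm2 (l : RealSpace n))))
      (aestronglyMeasurable_twist_mul_kernReg hF j l _ h) (by
        filter_upwards [ae_restrict_mem (isOpen_truncDomain h).measurableSet] with z hz
        exact hb' l z hz)
  have hsum : Summable fun l : M.dual => ∫ z in truncDomain h,
      ‖twist M F l z * kernReg M j l z.im (s, (Z, cconj Z))‖ := by
    refine Summable.of_nonneg_of_le (fun l => integral_nonneg fun _ => norm_nonneg _) (fun l => ?_)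
      (((summable_dual M hε).mul_left C).mul_right (volume.real (truncDomain h)))
    refine (setIntegral_mono_on (hint l).norm (integrable_const _)
      (isOpen_truncDomain h).measurableSet (hb' l)).trans (le_of_eq ?_)
    rw [setIntegral_const, smul_eq_mul, mul_comm]
  have := hasSum_integral_of_summable_integral_norm hint hsum
  have heq : truncIntegral (liftIntegrand M j F Z) s h = ∫ z in truncDomain h, ∑' l : M.dual,
      twist M F l z * kernReg M j l z.im (s, (Z, cconj Z)) := by
    unfold truncIntegral
    refine setIntegral_congr_fun (isOpen_truncDomain h).measurableSet fun z hz => ?_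
    obtain ⟨h1, h2, h3⟩ := truncDomain_bounds hz
    simp only [liftIntegrand_eq_tsum hF hZ h1 h2, kernReg]
    rw [← tsum_mul_right, ← tsum_div_const]
    exact tsum_congr fun l => by ring
  rw [heq]
  exact this

/-- Integration over a horizontal strip of width one. -/
theorem setIntegral_strip {g : ℂ → ℂ} (hg : IsPeriodicSmooth g) {φ : ℝ → ℂ}
    (hφ : ContinuousOn φ (Set.Ioi 0)) {a h : ℝ} (ha : 0 < a) (hah : a ≤ h) :
    IntegrableOn (fun z : ℂ => g z * φ z.im) {z : ℂ | |z.re| < 1 / 2 ∧ a ≤ z.im ∧ z.im < h} ∧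
    ∫ z in {z : ℂ | |z.re| < 1 / 2 ∧ a ≤ z.im ∧ z.im < h}, g z * φ z.im =
      ∫ y in a..h, xMean g y * φ y := by
  set f : ℝ × ℝ → ℂ := fun q => g ((q.1 : ℂ) + (q.2 : ℂ) * I) * φ q.2 with hf
  set S : Set (ℝ × ℝ) := Set.Ioo (-(1 / 2)) (1 / 2) ×ˢ Set.Ico a h with hS
  have hfc : ContinuousOn f (Set.univ ×ˢ Set.Ioi 0) := by
    refine ContinuousOn.mul (hg.smooth.continuousOn.comp (by fun_prop) fun q hq => ?_)
      (hφ.comp continuousOn_snd fun q hq => hq.2)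
    rw [Set.mem_ofPred_eq, im_add_mul_I]
    exact hq.2
  have hSm : MeasurableSet S := measurableSet_Ioo.prod measurableSet_Ico
  have hint : IntegrableOn f S := by
    have hc : ContinuousOn f (Set.Icc (-(1 / 2)) (1 / 2) ×ˢ Set.Icc a h) :=
      hfc.mono (Set.prod_mono (Set.subset_univ _) fun y hy => ha.trans_le hy.1)
    exact (hc.integrableOn_compact (isCompact_Icc.prod isCompact_Icc)).mono_set
      (Set.prod_mono Set.Ioo_subset_Icc_self Set.Ico_subset_Icc_self)
  have hpre : {z : ℂ | |z.re| < 1 / 2 ∧ a ≤ z.im ∧ z.im < h} = measurableEquivRealProd ⁻¹' S := by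
    ext z
    rw [Set.mem_ofPred_eq, abs_lt]
    simp [hS, Complex.measurableEquivRealProd_apply, and_assoc]
  have hfun : (fun z : ℂ => g z * φ z.im) = f ∘ measurableEquivRealProd := by
    funext z
    simp [hf, Complex.measurableEquivRealProd_apply, Complex.re_add_im]
  rw [hpre, hfun]
  refine ⟨(volume_preserving_equiv_real_prod.integrableOn_comp_preimage
    measurableEquivRealProd.measurableEmbedding).mpr hint, ?_⟩
  have h1 : ∫ z in measurableEquivRealProd ⁻¹' S, (f ∘ measurableEquivRealProd) z =
      ∫ q in S, f q :=
    volume_preserving_equiv_real_prod.setIntegral_preimage_emb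
      measurableEquivRealProd.measurableEmbedding f S
  rw [h1, hS, Measure.volume_eq_prod, ← setIntegral_prod_swap, setIntegral_prod,
    intervalIntegral.integral_of_le hah, integral_Ico_eq_integral_Ioc]
  · refine setIntegral_congr_fun measurableSet_Ioc fun y hy => ?_
    have hy0 : 0 < y := ha.trans hy.1
    simp only [Prod.fst_swap, Prod.snd_swap, hf, integral_mul_const]
    congr 1
    rw [← integral_Ioc_eq_integral_Ioo, ← intervalIntegral.integral_of_le (by norm_num), xMean]
    have hper : Function.Periodic (fun x : ℝ => g ((x : ℂ) + (y : ℂ) * I)) 1 := fun x => by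
      have := hg.periodic ((x : ℂ) + (y : ℂ) * I) (by rw [im_add_mul_I]; exact hy0)
      simp only [ofReal_add, ofReal_one]
      rw [← this]
      congr 1
      ring
    have := hper.intervalIntegral_add_eq (-(1 / 2)) 0
    norm_num at this ⊢
    exact this
  · have := hint.swap
    exact this

end Unfolding

/-! ### Existence of the regularized integral -/

section RegularizedIntegral

variable {M} {F : ℍ → M.Disc → ℂ}

theorem truncDomain_eq_union {h : ℝ} (hh : 2 ≤ h) :
    truncDomain h = truncDomain 2 ∪ {z : ℂ | |z.re| < 1 / 2 ∧ 2 ≤ z.im ∧ z.im < h} ∧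
      Disjoint (truncDomain 2) {z : ℂ | |z.re| < 1 / 2 ∧ 2 ≤ z.im ∧ z.im < h} := by
  constructor
  · ext z
    simp only [truncDomain, Set.mem_union, Set.mem_ofPred_eq]
    constructor
    · rintro ⟨h1, h2, h3, h4⟩
      rcases lt_or_ge z.im 2 with h5 | h5
      · exact Or.inl ⟨h1, h2, h3, h5⟩
      · exact Or.inr ⟨h2, h5, h4⟩
    · rintro (⟨h1, h2, h3, h4⟩ | ⟨h2, h3, h4⟩)
      · exact ⟨h1, h2, h3, h4.trans_le hh⟩
      · refine ⟨?_, h2, by linarith, h4⟩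
        have := (le_abs_self z.im).trans (abs_im_le_norm z)
        linarith
  · rw [Set.disjoint_left]
    rintro z hz hz'
    rw [Set.mem_ofPred_eq] at hz'
    exact absurd hz.2.2.2 (not_lt.mpr hz'.2.1)

theorem integrableOn_truncDomain (hF : LiftInput M F) {j : ℕ}
    {V : Set (CplxSpace n × CplxSpace n)} (hV : IsAdmissible M F j V)
    {q : ℂ × (CplxSpace n × CplxSpace n)} (hq : q.2 ∈ V) (l : M.dual) (h : ℝ) :
    IntegrableOn (fun z : ℂ => twist M F l z * kernReg M j l z.im q) (truncDomain h) := by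
  obtain ⟨C, ε, hC, hε, hb⟩ := hV.exists_kernReg_bound hF h ‖q.1‖
  have hfact : Fact (volume (truncDomain h) < ⊤) := ⟨volume_truncDomain_lt_top h⟩
  refine Integrable.mono' (integrable_const (C * Real.exp (-ε * nrm2 (l : RealSpace n))))
    (aestronglyMeasurable_twist_mul_kernReg hF j l _ h) ?_
  filter_upwards [ae_restrict_mem (isOpen_truncDomain h).measurableSet] with z hz
  obtain ⟨h1, h2, h3⟩ := truncDomain_bounds hz
  exact hb q le_rfl hq l z h1 h2 h3

theorem setIntegral_truncDomain (hF : LiftInput M F) {j : ℕ}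
    {V : Set (CplxSpace n × CplxSpace n)} (hV : IsAdmissible M F j V)
    {q : ℂ × (CplxSpace n × CplxSpace n)} (hq : q.2 ∈ V) (l : M.dual) {h : ℝ} (hh : 2 ≤ h) :
    ∫ z in truncDomain h, twist M F l z * kernReg M j l z.im q =
      cuspTerm M F j l q + ∫ y in (2 : ℝ)..h, xMean (twist M F l) y * kernReg M j l y q := by
  obtain ⟨h1, h2⟩ := truncDomain_eq_union hh
  obtain ⟨h3, h4⟩ := setIntegral_strip (hF.periodic l) (continuousOn_kernReg M j l q)
    two_pos hh
  have hm : MeasurableSet {z : ℂ | |z.re| < 1 / 2 ∧ 2 ≤ z.im ∧ z.im < h} := by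
    have : {z : ℂ | |z.re| < 1 / 2 ∧ 2 ≤ z.im ∧ z.im < h} =
        truncDomain h \ truncDomain 2 := by
      rw [h1, Set.union_sdiff_left]
      exact (sdiff_eq_left.mpr h2.symm).symm
    rw [this]
    exact (isOpen_truncDomain h).measurableSet.diff (isOpen_truncDomain 2).measurableSet
  rw [h1, setIntegral_union h2 hm (integrableOn_truncDomain hF hV hq l 2) h3, h4]
  rfl

/-- The contribution of `λ = 0` at the cusp is a sum of powers of `y`; the factor `0 ^ j` kills it
unless `j = 0`. -/
theorem mean_mul_kernReg_zero {j N : ℕ} {P : Polynomial ℂ} (hN : P.natDegree < N) {y : ℝ} (hy : 0 < y)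
    (s : ℂ) (p : CplxSpace n × CplxSpace n) :
    P.eval ((y : ℂ)⁻¹) * kernReg M j ((0 : M.dual) : RealSpace n) y (s, p) =
      ∑ t ∈ Finset.range N, P.coeff t * 0 ^ j * (y : ℂ) ^ (-((t : ℂ) + s) - 1) := by
  have hy' : (y : ℂ) ≠ 0 := by simpa using hy.ne'
  have h0 : toCplx ((0 : M.dual) : RealSpace n) = 0 := by
    funext i; simp [toCplx]
  have hpow : ∀ t : ℕ, (y : ℂ) ^ (-((t : ℂ) + s) - 1) = (y : ℂ)⁻¹ ^ t * (y : ℂ) ^ (-s) * (y : ℂ)⁻¹ := by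
    intro t
    rw [cpow_sub _ _ hy', neg_add, cpow_add _ _ hy', cpow_neg, cpow_natCast, cpow_one, inv_pow]
    rfl
  have hkern : kernReg M j ((0 : M.dual) : RealSpace n) y (s, p) =
      0 ^ j * ((y : ℂ) ^ (-s) * (y : ℂ)⁻¹) := by
    rw [kernReg, kern, kap, h0, bC_zero_left, bC_zero_left]
    rcases j with _ | j
    · simp
      field_simp
    · simp
  rw [Polynomial.eval_eq_sum_range' hN, hkern, Finset.sum_mul]
  refine Finset.sum_congr rfl fun t _ => ?_
  rw [hpow]
  ring

theorem tendsto_zero_term (hF : LiftInput M F) (j : ℕ) : ∃ (N : ℕ) (c : ℕ → ℂ),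
    (0 < j → ∀ t, c t = 0) ∧ ∀ (s : ℂ) (p : CplxSpace n × CplxSpace n), 0 < s.re →
      Tendsto (fun h : ℝ => ∫ y in (2 : ℝ)..h, xMean (twist M F 0) y *
        kernReg M j ((0 : M.dual) : RealSpace n) y (s, p)) atTop
        (𝓝 (∑ t ∈ Finset.range N, c t * ((2 : ℂ) ^ (-((t : ℂ) + s)) / (t + s)))) := by
  obtain ⟨P, hP⟩ := hF.poly 0
  refine ⟨P.natDegree + 1, fun t => P.coeff t * 0 ^ j, fun hj t => by simp [hj.ne'],
    fun s p hs => ?_⟩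
  have hre : ∀ t : ℕ, (-((t : ℂ) + s) - 1).re < -1 := fun t => by
    have : (0 : ℝ) ≤ t := Nat.cast_nonneg t
    simp
    linarith
  have hint : ∀ t : ℕ, IntegrableOn (fun y : ℝ => P.coeff t * 0 ^ j *
      (y : ℂ) ^ (-((t : ℂ) + s) - 1)) (Set.Ioi 2) := fun t =>
    (integrableOn_Ioi_cpow_of_lt (hre t) two_pos).const_mul _
  have hlim := intervalIntegral_tendsto_integral_Ioi (μ := volume) (2 : ℝ)
    (integrable_finsetSum (Finset.range (P.natDegree + 1)) fun t _ => hint t) tendsto_id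
  rw [integral_finsetSum _ fun t _ => hint t] at hlim
  have hval : ∑ t ∈ Finset.range (P.natDegree + 1), ∫ y in Set.Ioi (2 : ℝ), P.coeff t * 0 ^ j *
      (y : ℂ) ^ (-((t : ℂ) + s) - 1) = ∑ t ∈ Finset.range (P.natDegree + 1),
        P.coeff t * 0 ^ j * ((2 : ℂ) ^ (-((t : ℂ) + s)) / (t + s)) := by
    refine Finset.sum_congr rfl fun t _ => ?_
    rw [integral_const_mul, integral_Ioi_cpow_of_lt (hre t) two_pos]
    congr 1
    rw [sub_add_cancel, neg_div_neg_eq]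
    norm_num
  rw [hval] at hlim
  refine hlim.congr' ?_
  filter_upwards [eventually_ge_atTop 2] with h hh
  refine intervalIntegral.integral_congr fun y hy => ?_
  rw [id, Set.uIcc_of_le hh] at hy
  have hy0 : 0 < y := two_pos.trans_le hy.1
  simp only [hP y hy0]
  exact (mean_mul_kernReg_zero (Nat.lt_succ_self _) hy0 s p).symm

/-- The regularized integral of the theta lift. Only the summand with `λ = 0` contributes to the
polar part, and this contribution does not depend on `Z`. -/
theorem isRegIntegral_liftIntegrand (hF : LiftInput M F) (j : ℕ) : ∃ c : ℂ, (0 < j → c = 0) ∧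
    ∀ (Z : CplxSpace n) (V : Set (CplxSpace n × CplxSpace n)), Z ∈ cone M → IsAdmissible M F j V →
      (Z, cconj Z) ∈ V →
      IsRegIntegral (liftIntegrand M j F Z) (liftSum M F j (0, (Z, cconj Z)) + c) := by
  classical
  obtain ⟨N, c, hc0, hc⟩ := tendsto_zero_term hF j
  refine ⟨polarConstant N c, fun hj => by simp [polarConstant, hc0 hj], fun Z V hZ hV hZV => ?_⟩
  set p : CplxSpace n × CplxSpace n := (Z, cconj Z) with hp
  refine isRegIntegral_of_tendsto (Ψ := fun s => liftSum M F j (s, p)) ?_ N c fun s hs => ?_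
  · intro s
    obtain ⟨R, hR⟩ := exists_nat_gt ‖s‖
    have hmem : ((s, p) : ℂ × (CplxSpace n × CplxSpace n)) ∈ contDomain R V :=
      ⟨by simpa using hR, hZV⟩
    have h1 := (hV.holomorphic_liftSum hF R).1.differentiableAt
      ((isOpen_contDomain R hV.isOpen).mem_nhds hmem)
    have h2 : DifferentiableAt ℂ (fun s : ℂ => (s, p)) s := by fun_prop
    exact DifferentiableAt.comp (f := fun s : ℂ => (s, p)) s h1 h2
  obtain ⟨R, hR⟩ := exists_nat_gt ‖s‖
  have hmem : ((s, p) : ℂ × (CplxSpace n × CplxSpace n)) ∈ contDomain R V :=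
    ⟨by simpa using hR, hZV⟩
  obtain ⟨u, hus, hu⟩ := hV.exists_term_bound hF R
  obtain ⟨u', δ, hus', hδ, hu'⟩ := hV.exists_tail_bound R
  set E := ∫ y in Set.Ioi (2 : ℝ), Real.exp (-δ * y) with hE
  have hexp : IntegrableOn (fun y : ℝ => Real.exp (-δ * y)) (Set.Ioi 2) :=
    integrableOn_exp_mul_Ioi (neg_lt_zero.mpr hδ) 2
  set G : M.dual → ℝ → ℂ := fun l h =>
    if l = 0 then 0 else ∫ y in (2 : ℝ)..h, xMean (twist M F l) y * kernReg M j l y (s, p) with hG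
  have hbound : ∀ l : M.dual, l ≠ 0 → ∀ᵐ y ∂(volume.restrict (Set.Ioi (2 : ℝ))),
      ‖xMean (twist M F l) y * kernReg M j l y (s, p)‖ ≤ |u' l| * Real.exp (-δ * y) := by
    intro l hl
    filter_upwards [ae_restrict_mem measurableSet_Ioi] with y hy
    exact (hu' l hl _ hmem y (le_of_lt hy)).trans
      (mul_le_mul_of_nonneg_right (le_abs_self _) (Real.exp_pos _).le)
  have hGlim : ∀ l, Tendsto (G l) atTop (𝓝 (tailTerm M F j l (s, p))) := by
    intro l
    by_cases hl : l = 0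
    · simp only [hG, tailTerm, if_pos hl]
      exact tendsto_const_nhds
    · simp only [hG, tailTerm, if_neg hl]
      refine intervalIntegral_tendsto_integral_Ioi _ ?_ tendsto_id
      exact Integrable.mono' (hexp.const_mul |u' l|)
        (aestronglyMeasurable_xMean_mul_kernReg hF j l _) (hbound l hl)
  have hGb : ∀ h : ℝ, 2 ≤ h → ∀ l, ‖G l h‖ ≤ |u' l| * E := by
    intro h hh l
    have hE0 : 0 ≤ E := integral_nonneg fun _ => (Real.exp_pos _).le
    by_cases hl : l = 0
    · simp only [hG, if_pos hl, norm_zero]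
      positivity
    · simp only [hG, if_neg hl]
      rw [intervalIntegral.integral_of_le hh]
      have h1 := norm_integral_le_of_norm_le (μ := volume.restrict (Set.Ioc (2 : ℝ) h))
        (f := fun y => xMean (twist M F l) y * kernReg M j l y (s, p))
        ((hexp.mono_set Set.Ioc_subset_Ioi_self).const_mul |u' l|)
        (ae_restrict_of_ae_restrict_of_subset Set.Ioc_subset_Ioi_self (hbound l hl))
      refine h1.trans ?_
      rw [integral_const_mul]
      exact mul_le_mul_of_nonneg_left (setIntegral_mono_set hexp
        (Eventually.of_forall fun _ => (Real.exp_pos _).le)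
        Set.Ioc_subset_Ioi_self.eventuallyLE) (abs_nonneg _)
  -- the summands with `λ ≠ 0` converge for all `s`, dominated uniformly in the height `h`
  have hdom : Tendsto (fun h : ℝ => ∑' l, (cuspTerm M F j l (s, p) + G l h)) atTop
      (𝓝 (liftSum M F j (s, p))) := by
    refine tendsto_tsum_of_dominated_convergence (hus.add (hus'.abs.mul_right E))
      (fun l => (hGlim l).const_add _) ?_
    filter_upwards [eventually_ge_atTop 2] with h hh l
    exact (norm_add_le _ _).trans (add_le_add (hu l _ hmem).1 (hGb h hh l))
  refine (hdom.add (hc s p hs)).congr' ?_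
  filter_upwards [eventually_ge_atTop 2] with h hh
  -- the contribution `G₀` of `λ = 0` from the cusp is separated from the series
  have hsum := truncIntegral_eq_tsum hF hZ hV hZV s h
  set G₀ := ∫ y in (2 : ℝ)..h, xMean (twist M F 0) y *
        kernReg M j ((0 : M.dual) : RealSpace n) y (s, p) with hG₀
  have hsum' := hsum.sub (hasSum_ite_eq (0 : M.dual) G₀)
  have heq : (fun l : M.dual => (∫ z in truncDomain h, twist M F l z *
      kernReg M j l z.im (s, (Z, cconj Z))) - if l = 0 then G₀ else 0) =
      fun l => cuspTerm M F j l (s, p) + G l h := by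
    funext l
    rw [setIntegral_truncDomain hF hV (q := (s, (Z, cconj Z))) hZV l hh]
    by_cases hl : l = 0
    · subst hl
      simp [hG, hG₀, hp]
    · simp [hG, hl, hp]
  rw [heq] at hsum'
  rw [hsum'.tsum_eq]
  ring

end RegularizedIntegral

/-! ### Bases adapted to a point of the cone -/

/-- Two vectors that are orthonormal for a positive definite symmetric form extend to an orthonormal
basis. -/
theorem exists_orthonormal_extension {V : Type*} [AddCommGroup V] [Module ℝ V]
    [FiniteDimensional ℝ V] {d : ℕ} (hd : Module.finrank ℝ V = d + 2) (S : V → V → ℝ)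
    (hadd : ∀ x y z, S (x + y) z = S x z + S y z) (hsmul : ∀ (r : ℝ) x y, S (r • x) y = r * S x y)
    (hsymm : ∀ x y, S x y = S y x) (hpos : ∀ x, x ≠ 0 → 0 < S x x) {e₀ e₁ : V}
    (h00 : S e₀ e₀ = 1) (h11 : S e₁ e₁ = 1) (h01 : S e₀ e₁ = 0) :
    ∃ b : Module.Basis (Fin (d + 2)) ℝ V, b 0 = e₀ ∧ b 1 = e₁ ∧
      ∀ i j, S (b i) (b j) = if i = j then 1 else 0 := by
  have hzero : S 0 0 = 0 := by
    have := hsmul 0 0 0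
    simpa using this
  let core : InnerProductSpace.Core ℝ V :=
    { inner := S
      conj_inner_symm := fun x y => by simpa using hsymm y x
      re_inner_nonneg := fun x => by
        rcases eq_or_ne x 0 with rfl | hx
        · simp [hzero]
        · simpa using (hpos x hx).le
      add_left := hadd
      smul_left := fun x y r => by simpa using hsmul r x y
      definite := fun x hx => by
        by_contra h
        exact (hpos x h).ne' hx }
  let : NormedAddCommGroup V := core.toNormedAddCommGroup
  let : InnerProductSpace ℝ V := InnerProductSpace.ofCore core.toCore
  have hinner : ∀ x y : V, inner ℝ x y = S x y := fun _ _ => rfl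
  let v : Fin (d + 2) → V := fun i => if i = 0 then e₀ else e₁
  have hv0 : v 0 = e₀ := rfl
  have h10 : (1 : Fin (d + 2)) ≠ 0 := by simp
  have hv1 : v 1 = e₁ := if_neg h10
  have hv : Orthonormal ℝ (({0, 1} : Set (Fin (d + 2))).domRestrict v) := by
    rw [orthonormal_iff_ite]
    rintro ⟨i, hi⟩ ⟨j, hj⟩
    have hval : S (v i) (v j) = if i = j then 1 else 0 := by
      rcases hi with rfl | hi <;> rcases hj with rfl | hj
      · rw [hv0, h00, if_pos rfl]
      · rw [Set.mem_singleton_iff] at hj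
        rw [hj, hv0, hv1, h01, if_neg h10.symm]
      · rw [Set.mem_singleton_iff] at hi
        rw [hi, hv0, hv1, hsymm, h01, if_neg h10]
      · rw [Set.mem_singleton_iff] at hi hj
        rw [hi, hj, hv1, h11, if_pos rfl]
    simp only [Subtype.mk.injEq]
    exact hval
  obtain ⟨b, hb⟩ := hv.exists_orthonormalBasis_extension_of_card_eq (by simpa using hd)
  refine ⟨b.toBasis, by simp [hb 0 (by simp), hv0], by simp [hb 1 (by simp), hv1], fun i j => ?_⟩
  rw [← hinner, OrthonormalBasis.coe_toBasis]
  exact orthonormal_iff_ite.mp b.orthonormal i j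

/-- The sign of the `i`-th vector of an orthogonal basis of signature `(2, n)`. -/
def signVec (n : ℕ) (i : Fin (n + 2)) : ℝ := if (i : ℕ) < 2 then 1 else -1

theorem signVec_mul_self (i : Fin (n + 2)) : signVec n i * signVec n i = 1 := by
  unfold signVec; split_ifs <;> norm_num

/-- Every point of the cone spans, with its conjugate, the plane of the first two vectors of an
orthogonal basis in which the form is diagonal with entries `1, 1, -1, …, -1`. -/
theorem exists_adapted_basis {Z : CplxSpace n} (hZ : Z ∈ cone M) :
    ∃ b : Module.Basis (Fin (n + 2)) ℝ (RealSpace n),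
      (∀ i j, M.bR (b i) (b j) = if i = j then signVec n i else 0) ∧
      Z = (Real.sqrt (absSq M Z) : ℂ) • (toCplx (b 0) + I • toCplx (b 1)) := by
  obtain ⟨X, Y, hZXY, -, hXY, hXX, hYY⟩ := exists_real_imag M hZ
  have hN := absSq_pos M hZ
  set N := absSq M Z with hNdef
  set r := Real.sqrt N with hr
  have hr0 : 0 < r := Real.sqrt_pos.mpr hN
  have hrr : r * r = N := Real.mul_self_sqrt hN.le
  -- the majorant `2 ⟨x_Z, y_Z⟩ - ⟨x, y⟩`
  set S : RealSpace n → RealSpace n → ℝ := fun x y =>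
    2 * (M.bR x X * M.bR y X + M.bR x Y * M.bR y Y) / N - M.bR x y with hS
  have hpos : ∀ x, x ≠ 0 → 0 < S x x := fun x hx => by
    have h1 := majorant_pos M hZ hx
    have h2 : M.bC (toCplx x) Z = (M.bR x X : ℂ) + (M.bR x Y : ℂ) * I := by
      rw [hZXY, bC_add_right, bC_smul_right, bC_toCplx, bC_toCplx, mul_comm]
    rw [kap_cconj, ofReal_re, h2, normSq_add_mul_I] at h1
    simp only [hS]
    have h3 : 2 * (M.bR x X * M.bR x X + M.bR x Y * M.bR x Y) / N =
        2 * ((M.bR x X ^ 2 + M.bR x Y ^ 2) / absSq M Z) := by rw [← hNdef]; ring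
    rw [h3]
    exact h1
  have hYX : M.bR Y X = 0 := by rw [bR_comm, hXY]
  obtain ⟨b, hb0, hb1, hb⟩ := exists_orthonormal_extension (V := RealSpace n) (d := n)
    (e₀ := r⁻¹ • X) (e₁ := r⁻¹ • Y)
    (by simp) S (fun x y z => by simp only [hS, bR_add_left]; ring)
    (fun c x y => by simp only [hS, bR_smul_left]; ring)
    (fun x y => by simp only [hS]; rw [bR_comm M x y]; ring) hpos
    (by
      simp only [hS, bR_smul_left, bR_smul_right, hXX, hXY]
      rw [← hrr]; field_simp; ring)
    (by
      simp only [hS, bR_smul_left, bR_smul_right, hYY, hYX]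
      rw [← hrr]; field_simp; ring)
    (by
      simp only [hS, bR_smul_left, bR_smul_right, hYX, hXY, hYY, hXX]
      ring)
  have hX : X = r • b 0 := by rw [hb0, smul_smul, mul_inv_cancel₀ hr0.ne', one_smul]
  have hY : Y = r • b 1 := by rw [hb1, smul_smul, mul_inv_cancel₀ hr0.ne', one_smul]
  have h10 : (1 : Fin (n + 2)) ≠ 0 := by simp [Fin.ext_iff]
  -- pairing with the plane is the same for `S` and the given form
  have hSX : ∀ x, S x X = M.bR x X := fun x => by
    simp only [hS, hXX, hXY]
    field_simp
    ring
  have hSY : ∀ x, S x Y = M.bR x Y := fun x => by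
    simp only [hS, hYY, hYX]
    field_simp
    ring
  have hSr : ∀ (c : ℝ) x y, S x (c • y) = c * S x y := fun c x y => by
    simp only [hS, bR_smul_left, bR_smul_right]; ring
  have hbX : ∀ i, M.bR (b i) X = r * if i = 0 then 1 else 0 := fun i => by
    rw [← hSX]
    have : S (b i) X = r * S (b i) (b 0) := (congrArg (S (b i)) hX).trans (hSr r _ _)
    rw [this, hb]
  have hbY : ∀ i, M.bR (b i) Y = r * if i = 1 then 1 else 0 := fun i => by
    rw [← hSY]
    have : S (b i) Y = r * S (b i) (b 1) := (congrArg (S (b i)) hY).trans (hSr r _ _)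
    rw [this, hb]
  refine ⟨b, fun i j => ?_, ?_⟩
  · have h1 : M.bR (b i) (b j) = 2 * (M.bR (b i) X * M.bR (b j) X +
        M.bR (b i) Y * M.bR (b j) Y) / N - if i = j then 1 else 0 := by
      rw [← hb i j]; simp only [hS]; ring
    rw [h1, hbX, hbX, hbY, hbY, ← hrr]
    by_cases hij : i = j
    · subst hij
      simp only [if_true]
      by_cases hi0 : i = 0
      · subst hi0
        simp only [h10.symm, if_true, if_false, signVec]
        field_simp
        norm_num
      · by_cases hi1 : i = 1
        · subst hi1
          simp only [h10, if_true, if_false, signVec]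
          field_simp
          norm_num
        · have : ¬ (i : ℕ) < 2 := by
            intro h
            have h0 : (i : ℕ) ≠ 0 := fun h => hi0 (Fin.ext h)
            have h1 : (i : ℕ) ≠ 1 := fun h => hi1 (Fin.ext (by simpa using h))
            omega
          simp [signVec, hi0, hi1, this]
    · simp only [hij, if_false]
      have h2 : ¬ (i = 0 ∧ j = 0) := fun h => hij (h.1.trans h.2.symm)
      have h3 : ¬ (i = 1 ∧ j = 1) := fun h => hij (h.1.trans h.2.symm)
      have e1 : (if i = 0 then (1 : ℝ) else 0) * (if j = 0 then 1 else 0) = 0 := by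
        by_cases a : i = 0
        · rw [if_neg fun h => h2 ⟨a, h⟩, mul_zero]
        · rw [if_neg a, zero_mul]
      have e2 : (if i = 1 then (1 : ℝ) else 0) * (if j = 1 then 1 else 0) = 0 := by
        by_cases a : i = 1
        · rw [if_neg fun h => h3 ⟨a, h⟩, mul_zero]
        · rw [if_neg a, zero_mul]
      linear_combination (2 * (r * r) / (r * r)) * e1 + (2 * (r * r) / (r * r)) * e2
  · conv_lhs => rw [hZXY, hX, hY]
    rw [toCplx_smul, toCplx_smul, smul_add, smul_comm I]

theorem bR_sum_left {ι : Type*} (s : Finset ι) (t : ι → ℝ) (v : ι → RealSpace n) (y : RealSpace n) :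
    M.bR (∑ i ∈ s, t i • v i) y = ∑ i ∈ s, t i * M.bR (v i) y := by
  classical
  induction s using Finset.induction_on with
  | empty =>
    have := bR_smul_left M 0 0 y
    simpa using this
  | insert a s ha ih =>
    rw [Finset.sum_insert ha, Finset.sum_insert ha, bR_add_left, bR_smul_left, ih]

theorem bR_parseval {b : Module.Basis (Fin (n + 2)) ℝ (RealSpace n)}
    (hb : ∀ i j, M.bR (b i) (b j) = if i = j then signVec n i else 0) (x y : RealSpace n) :
    M.bR x y = ∑ i, signVec n i * (M.bR x (b i) * M.bR y (b i)) := by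
  have hx : ∀ i, M.bR x (b i) = b.repr x i * signVec n i := fun i => by
    conv_lhs => rw [← b.sum_repr x, bR_sum_left]
    simp [hb]
  conv_lhs => rw [← b.sum_repr x, bR_sum_left]
  refine Finset.sum_congr rfl fun i _ => ?_
  rw [hx, bR_comm M (b i) y]
  have := signVec_mul_self i
  linear_combination (-(b.repr x i * M.bR y (b i))) * this

theorem exists_re_im (η : CplxSpace n) : ∃ x y : RealSpace n, η = toCplx x + I • toCplx y :=
  ⟨fun i => (η i).re, fun i => (η i).im, by
    funext i
    simp only [toCplx, Pi.add_apply, Pi.smul_apply, smul_eq_mul]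
    rw [mul_comm, Complex.re_add_im]⟩

theorem bC_parseval {b : Module.Basis (Fin (n + 2)) ℝ (RealSpace n)}
    (hb : ∀ i j, M.bR (b i) (b j) = if i = j then signVec n i else 0) (η : CplxSpace n) :
    M.bC η η = ∑ i, (signVec n i : ℂ) * M.bC η (toCplx (b i)) ^ 2 := by
  obtain ⟨x, y, rfl⟩ := exists_re_im η
  have h : ∀ x y : RealSpace n, M.bC (toCplx x) (toCplx y) =
      ∑ i, (signVec n i : ℂ) * (M.bC (toCplx x) (toCplx (b i)) * M.bC (toCplx y) (toCplx (b i))) := by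
    intro x y
    simp only [bC_toCplx]
    rw [bR_parseval M hb]
    push_cast
    rfl
  simp only [bC_add_left, bC_add_right, bC_smul_left, bC_smul_right]
  rw [h x x, h x y, h y x, h y y]
  simp only [Finset.mul_sum, ← Finset.sum_add_distrib]
  refine Finset.sum_congr rfl fun i _ => ?_
  ring

/-- The order of the discriminant group is the absolute value of the discriminant. -/
theorem card_disc : (Fintype.card M.Disc : ℝ) = |(M.gram.det : ℝ)| := by
  classical
  have hadd : ∀ x y : M.dual, dualEquiv M (x + y) = dualEquiv M x + dualEquiv M y := by
    intro x y
    funext i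
    have h1 := dualCoord_spec M (x + y) i
    have h2 := dualCoord_spec M x i
    have h3 := dualCoord_spec M y i
    have h4 : ((x + y : M.dual) : RealSpace n) = x + y := rfl
    rw [h4, Matrix.mulVec_add, Pi.add_apply, h2, h3] at h1
    simp only [dualEquiv_apply, Pi.add_apply]
    exact_mod_cast h1.symm
  let e : M.dual ≃+ (Fin (n + 2) → ℤ) := { dualEquiv M with map_add' := hadd }
  let bE : Module.Basis (Fin (n + 2)) ℤ M.dual := Module.Basis.ofEquivFun e.toIntLinearEquiv
  let N : AddSubgroup M.dual := M.lattice.addSubgroupOf M.dual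
  have hmem : ∀ m : Fin (n + 2) → ℤ, intVec m ∈ M.lattice := fun m i => ⟨m i, rfl⟩
  have hdual : M.lattice ≤ M.dual := fun x hx m hm => bR_mem_lattice_int M hx hm
  let g : (Fin (n + 2) → ℤ) ≃+ N :=
    { toFun := fun m => ⟨⟨intVec m, hdual (hmem m)⟩, AddSubgroup.mem_addSubgroupOf.mpr (hmem m)⟩
      invFun := fun x i => ((AddSubgroup.mem_addSubgroupOf.mp x.2) i).choose
      left_inv := fun m => by
        funext i
        have := ((hmem m) i).choose_spec
        exact Int.cast_injective (α := ℝ) this.symm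
      right_inv := fun x => by
        apply Subtype.ext
        apply Subtype.ext
        funext i
        exact ((AddSubgroup.mem_addSubgroupOf.mp x.2) i).choose_spec.symm
      map_add' := fun m m' => by
        apply Subtype.ext
        apply Subtype.ext
        funext i
        simp [intVec] }
  let bN : Module.Basis (Fin (n + 2)) ℤ N := Module.Basis.ofEquivFun g.symm.toIntLinearEquiv
  have hidx := AddSubgroup.index_eq_natAbs_det bE N bN
  have hcard : N.index = Fintype.card M.Disc := by
    rw [AddSubgroup.index, Nat.card_eq_fintype_card]
  have hdet : bE.det (fun i => (bN i : M.dual)) = M.gram.det := by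
    rw [Module.Basis.det_apply]
    congr 1
    ext i j
    have h1 : (bN j : M.dual) = ⟨intVec (Pi.single j 1), hdual (hmem _)⟩ := by
      simp [bN, g]
    rw [Module.Basis.toMatrix_apply, h1]
    have h2 := dualCoord_spec M ⟨intVec (Pi.single j 1), hdual (hmem _)⟩ i
    have h3 : bE.repr ⟨intVec (Pi.single j 1), hdual (hmem _)⟩ i =
        dualCoord M ⟨intVec (Pi.single j 1), hdual (hmem _)⟩ i := rfl
    rw [h3]
    have h4 : (M.gram.map (fun a : ℤ => (a : ℝ))).mulVec (intVec (Pi.single j 1)) i =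
        M.gram i j := by
      simp [Matrix.mulVec, dotProduct, intVec, Pi.single_apply]
    rw [h4] at h2
    exact_mod_cast h2.symm
  rw [hdet, hcard] at hidx
  rw [hidx, Nat.cast_natAbs, Int.cast_abs]

/-- The change of variables to the coordinates of an adapted basis. -/
theorem integral_eq_integral_basis {b : Module.Basis (Fin (n + 2)) ℝ (RealSpace n)}
    (hb : ∀ i j, M.bR (b i) (b j) = if i = j then signVec n i else 0) (f : RealSpace n → ℂ) :
    ∫ u, f u = ((Real.sqrt (Fintype.card M.Disc))⁻¹ : ℂ) *
      ∫ t : Fin (n + 2) → ℝ, f (∑ i, t i • b i) := by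
  classical
  set B : Matrix (Fin (n + 2)) (Fin (n + 2)) ℝ := Matrix.of fun r i => b i r with hB
  set G : Matrix (Fin (n + 2)) (Fin (n + 2)) ℝ := M.gram.map (fun a : ℤ => (a : ℝ)) with hG
  have hGdet : G.det = (M.gram.det : ℝ) := by
    have := (Int.castRingHom ℝ).map_det M.gram
    simpa [RingHom.mapMatrix_apply] using this.symm
  have hBGB : B.transpose * G * B = Matrix.diagonal (signVec n) := by
    ext i j
    rw [Matrix.diagonal_apply, ← hb i j, bR_eq_dot, Matrix.mul_apply]
    refine Finset.sum_congr rfl fun r _ => ?_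
    congr 1
    rw [Matrix.mul_apply, Matrix.mulVec, dotProduct]
    refine Finset.sum_congr rfl fun s _ => ?_
    have hs : M.gram s r = M.gram r s := congrFun (congrFun M.symm r) s
    simp [hB, hG, hs, mul_comm]
  have hdet := congrArg Matrix.det hBGB
  rw [Matrix.det_mul, Matrix.det_mul, Matrix.det_transpose, hGdet, Matrix.det_diagonal] at hdet
  have habs : |B.det| ^ 2 * Fintype.card M.Disc = 1 := by
    have h1 := congrArg abs hdet
    rw [abs_mul, abs_mul, Finset.abs_prod] at h1
    have h2 : ∏ i, |signVec n i| = 1 := Finset.prod_eq_one fun i _ => by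
      unfold signVec; split_ifs <;> norm_num
    rw [h2] at h1
    rw [card_disc, ← h1]
    ring
  have hD : (0 : ℝ) < Fintype.card M.Disc := by
    have : 0 < Fintype.card M.Disc := Fintype.card_pos
    exact_mod_cast this
  have hBdet : B.det ≠ 0 := by
    intro h
    rw [h] at habs
    norm_num at habs
  have hBabs : |B.det| = (Real.sqrt (Fintype.card M.Disc))⁻¹ := by
    refine eq_inv_of_mul_eq_one_left ?_
    have h1 : (|B.det| * Real.sqrt (Fintype.card M.Disc)) ^ 2 = 1 := by
      rw [mul_pow, Real.sq_sqrt hD.le, habs]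
    exact (pow_eq_one_iff_of_nonneg (by positivity) two_ne_zero).mp h1
  have hmap := Real.map_matrix_volume_pi_eq_smul_volume_pi hBdet
  have hemb : MeasurableEmbedding (Matrix.toLin' B) := by
    refine (LinearMap.continuous_of_finiteDimensional _).measurableEmbedding ?_
    have h1 : IsUnit B := (Matrix.isUnit_iff_isUnit_det B).mpr (isUnit_iff_ne_zero.mpr hBdet)
    exact Matrix.mulVec_injective_iff_isUnit.mpr h1
  have h1 := hemb.integral_map (μ := volume) f
  rw [hmap, integral_smul_measure, ENNReal.toReal_ofReal (abs_nonneg _)] at h1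
  have h2 : ∀ t : Fin (n + 2) → ℝ, Matrix.toLin' B t = ∑ i, t i • b i := by
    intro t
    funext r
    simp [Matrix.toLin'_apply, Matrix.mulVec, dotProduct, hB, mul_comm]
  simp only [h2] at h1
  rw [← h1, abs_inv, hBabs, inv_inv, real_smul, ← mul_assoc, inv_mul_cancel₀, one_mul]
  simp

/-! ### The Fourier transform of the Gaussian of a point of the cone -/

/-- The quadratic form `⟨η_Z, η_Z⟩` on `M_ℂ`. -/
noncomputable def planeForm (Z η : CplxSpace n) : ℂ :=
  M.bC η Z * M.bC η (cconj Z) / (absSq M Z : ℂ)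

/-- The exponent `π i (z q(η) - w p(η))`, where `p` and `-q` are the restrictions of the quadratic
form to the plane of `Z` and to its complement. The theta kernel has `w = z̄`. -/
noncomputable def gaussExp (Z : CplxSpace n) (z w : ℂ) (η : CplxSpace n) : ℂ :=
  Real.pi * I * (z * (planeForm M Z η - M.bC η η) - w * planeForm M Z η)

theorem planeForm_toCplx (Z : CplxSpace n) (x : RealSpace n) :
    planeForm M Z (toCplx x) = kap M x Z (cconj Z) := by
  rw [planeForm, kap, bC_self_cconj_eq, mul_assoc, mul_div_mul_left _ _ two_ne_zero]

theorem norm_exp_gaussExp (Z : CplxSpace n) (z : ℂ) (x : RealSpace n) :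
    ‖cexp (gaussExp M Z z ((starRingEnd ℂ) z) (toCplx x))‖ =
      Real.exp (-(Real.pi * z.im * (2 * (kap M x Z (cconj Z)).re - M.bR x x))) := by
  rw [Complex.norm_exp, gaussExp, planeForm_toCplx, bC_toCplx, kap_cconj, ofReal_re]
  congr 1
  set κ : ℝ := normSq (M.bC (toCplx x) Z) / absSq M Z
  have h1 : (starRingEnd ℂ) z = (z.re : ℂ) - (z.im : ℂ) * I := by
    apply Complex.ext <;> simp
  have h2 : z = (z.re : ℂ) + (z.im : ℂ) * I := (Complex.re_add_im z).symm
  have h3 : (Real.pi : ℂ) * I * (z * ((κ : ℂ) - (M.bR x x : ℂ)) - (starRingEnd ℂ) z * (κ : ℂ)) =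
      ((-(Real.pi * z.im * (2 * κ - M.bR x x)) : ℝ) : ℂ) +
        ((-(Real.pi * z.re * M.bR x x) : ℝ) : ℂ) * I := by
    rw [h1]
    push_cast
    linear_combination (Real.pi * I * ((κ : ℂ) - (M.bR x x : ℂ))) * h2 +
      (Real.pi * z.im * (2 * (κ : ℂ) - (M.bR x x : ℂ))) * I_sq
  rw [h3]
  simp

theorem exists_norm_gaussExp_le {Z : CplxSpace n} (hZ : Z ∈ cone M) {z : ℂ} (hz : 0 < z.im) :
    ∃ ε > 0, ∀ x : RealSpace n,
      ‖cexp (gaussExp M Z z ((starRingEnd ℂ) z) (toCplx x))‖ ≤ Real.exp (-ε * nrm2 x) := by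
  obtain ⟨ε, hε, hev⟩ := eventually_majorant M hZ
  refine ⟨Real.pi * z.im * ε, by positivity, fun x => ?_⟩
  rw [norm_exp_gaussExp]
  refine Real.exp_le_exp.mpr ?_
  have h := hev.self_of_nhds.2 x
  have h2 : 0 ≤ Real.pi * z.im := by positivity
  nlinarith [mul_le_mul_of_nonneg_left h h2]

theorem exists_norm_bC_le (η : CplxSpace n) {ε : ℝ} (hε : 0 < ε) :
    ∃ C : ℝ, ∀ x : RealSpace n, ‖2 * Real.pi * I * M.bC η (toCplx x)‖ ≤ ε * nrm2 x + C := by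
  set K : ℝ := 2 * Real.pi * (∑ i, ∑ j, ‖η i‖ * ‖((M.gram i j : ℤ) : ℂ)‖) + 1 with hK
  have hK0 : 0 < K := by positivity
  have hS : ∀ x : RealSpace n, ‖2 * Real.pi * I * M.bC η (toCplx x)‖ ≤ K * ∑ j, |x j| := by
    intro x
    have h0 : 0 ≤ ∑ j, |x j| := Finset.sum_nonneg fun _ _ => abs_nonneg _
    have h1 : ‖M.bC η (toCplx x)‖ ≤ (∑ i, ∑ j, ‖η i‖ * ‖((M.gram i j : ℤ) : ℂ)‖) * ∑ j, |x j| := by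
      rw [bC, gramForm, Finset.sum_mul]
      refine (norm_sum_le _ _).trans (Finset.sum_le_sum fun i _ => ?_)
      rw [Finset.sum_mul]
      refine (norm_sum_le _ _).trans (Finset.sum_le_sum fun j _ => ?_)
      rw [norm_mul, norm_mul]
      refine mul_le_mul_of_nonneg_left ?_ (by positivity)
      rw [toCplx, Complex.norm_real, Real.norm_eq_abs]
      exact Finset.single_le_sum (f := fun j => |x j|) (fun _ _ => abs_nonneg _)
        (Finset.mem_univ j)
    have h2 : ‖(2 * Real.pi * I : ℂ)‖ = 2 * Real.pi := by
      simp [abs_of_pos Real.pi_pos]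
    rw [norm_mul, h2, hK, add_mul, mul_assoc]
    have := mul_le_mul_of_nonneg_left h1 (by positivity : 0 ≤ 2 * Real.pi)
    linarith
  refine ⟨∑ _j : Fin (n + 2), K ^ 2 / (4 * ε), fun x => (hS x).trans ?_⟩
  rw [nrm2, Finset.mul_sum, Finset.mul_sum, ← Finset.sum_add_distrib]
  refine Finset.sum_le_sum fun j _ => ?_
  -- `K r ≤ ε r² + K² / (4 ε)`
  have h3 : ε * x j ^ 2 + K ^ 2 / (4 * ε) - K * |x j| = (2 * ε * |x j| - K) ^ 2 / (4 * ε) := by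
    rw [← sq_abs (x j)]
    field_simp
    ring
  have h4 : 0 ≤ (2 * ε * |x j| - K) ^ 2 / (4 * ε) := by positivity
  linarith

theorem continuous_gaussExp (Z : CplxSpace n) (z w : ℂ) :
    Continuous fun x : RealSpace n => gaussExp M Z z w (toCplx x) := by
  have h1 : Continuous fun x : RealSpace n => M.bC (toCplx x) Z :=
    M.continuous_bC_comp continuous_toCplx continuous_const
  have h2 : Continuous fun x : RealSpace n => M.bC (toCplx x) (cconj Z) :=
    M.continuous_bC_comp continuous_toCplx continuous_const
  have h3 : Continuous fun x : RealSpace n => M.bC (toCplx x) (toCplx x) :=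
    M.continuous_bC_comp continuous_toCplx continuous_toCplx
  unfold gaussExp planeForm
  fun_prop

/-- Differentiation of a Gaussian integral with respect to the frequency. -/
theorem hasDerivAt_gaussInt {Z : CplxSpace n} (hZ : Z ∈ cone M) {z : ℂ} (hz : 0 < z.im)
    {P : RealSpace n → ℂ} (hP : Continuous P) {K : ℝ} {m : ℕ}
    (hPb : ∀ x, ‖P x‖ ≤ K * (1 + nrm2 x) ^ m) (η W : CplxSpace n) :
    HasDerivAt (fun s : ℂ => ∫ x : RealSpace n, P x *
        cexp (gaussExp M Z z ((starRingEnd ℂ) z) (toCplx x) +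
          2 * Real.pi * I * M.bC (η + s • W) (toCplx x)))
      (∫ x : RealSpace n, P x * (2 * Real.pi * I * M.bC W (toCplx x)) *
        cexp (gaussExp M Z z ((starRingEnd ℂ) z) (toCplx x) +
          2 * Real.pi * I * M.bC η (toCplx x))) 0 := by
  obtain ⟨ε, hε, hG⟩ := exists_norm_gaussExp_le M hZ hz
  obtain ⟨C₁, hC₁⟩ := exists_norm_bC_le M η (ε := ε / 4) (by positivity)
  obtain ⟨C₂, hC₂⟩ := exists_norm_bC_le M W (ε := ε / 4) (by positivity)
  obtain ⟨C₃, hC₃, hm⟩ := exists_pow_le_exp m (δ := ε / 4) (by positivity)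
  set f : ℂ → RealSpace n → ℂ := fun s x => P x *
        cexp (gaussExp M Z z ((starRingEnd ℂ) z) (toCplx x) +
          2 * Real.pi * I * M.bC (η + s • W) (toCplx x)) with hf
  have hlin : ∀ (s : ℂ) x, 2 * Real.pi * I * M.bC (η + s • W) (toCplx x) =
      2 * Real.pi * I * M.bC η (toCplx x) + s * (2 * Real.pi * I * M.bC W (toCplx x)) := by
    intro s x
    rw [bC_add_left, bC_smul_left]
    ring
  have hcont : ∀ s, Continuous (f s) := fun s => by
    have h1 := continuous_gaussExp M Z z ((starRingEnd ℂ) z)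
    have h2 : Continuous fun x : RealSpace n => M.bC (η + s • W) (toCplx x) :=
      M.continuous_bC_comp continuous_const continuous_toCplx
    exact hP.mul (continuous_exp.comp (h1.add (continuous_const.mul h2)))
  have hder : ∀ x s, HasDerivAt (fun s => f s x) (P x * (2 * Real.pi * I * M.bC W (toCplx x)) *
      cexp (gaussExp M Z z ((starRingEnd ℂ) z) (toCplx x) +
          2 * Real.pi * I * M.bC (η + s • W) (toCplx x))) s := by
    intro x s
    simp only [hf, hlin]
    have h1 : HasDerivAt (fun s : ℂ => gaussExp M Z z ((starRingEnd ℂ) z) (toCplx x) +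
        (2 * Real.pi * I * M.bC η (toCplx x) + s * (2 * Real.pi * I * M.bC W (toCplx x))))
        (2 * Real.pi * I * M.bC W (toCplx x)) s := by
      have := (((hasDerivAt_id s).mul_const (2 * Real.pi * I * M.bC W (toCplx x))).const_add
        (2 * Real.pi * I * M.bC η (toCplx x))).const_add
          (gaussExp M Z z ((starRingEnd ℂ) z) (toCplx x))
      simpa using this
    exact (h1.cexp.const_mul (P x)).congr_deriv (by ring)
  have hbound : ∀ x, ∀ s ∈ Metric.ball (0 : ℂ) 1, ‖f s x‖ ≤
      |K| * C₃ * Real.exp (C₁ + C₂) * Real.exp (-(ε / 4) * ∑ i, x i ^ 2) := by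
    intro x s hs
    have hs1 : ‖s‖ ≤ 1 := by simpa using (Metric.mem_ball.mp hs).le
    have hr := nrm2_nonneg x
    have h1 : ‖P x‖ ≤ |K| * (C₃ * Real.exp (ε / 4 * nrm2 x)) := by
      refine (hPb x).trans ?_
      calc K * (1 + nrm2 x) ^ m ≤ |K| * (1 + nrm2 x) ^ m :=
            mul_le_mul_of_nonneg_right (le_abs_self K) (by positivity)
        _ ≤ _ := mul_le_mul_of_nonneg_left (hm _ hr) (abs_nonneg _)
    have h2 : ‖cexp (2 * Real.pi * I * M.bC (η + s • W) (toCplx x))‖ ≤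
        Real.exp (ε / 4 * nrm2 x + C₁ + (ε / 4 * nrm2 x + C₂)) := by
      refine (Complex.norm_exp_le_exp_norm _).trans (Real.exp_le_exp.mpr ?_)
      rw [hlin]
      refine (norm_add_le _ _).trans (add_le_add (hC₁ x) ?_)
      rw [norm_mul]
      exact (mul_le_of_le_one_left (norm_nonneg _) hs1).trans (hC₂ x)
    simp only [hf]
    rw [norm_mul, Complex.exp_add, norm_mul]
    calc ‖P x‖ * (‖cexp (gaussExp M Z z ((starRingEnd ℂ) z) (toCplx x))‖ *
          ‖cexp (2 * Real.pi * I * M.bC (η + s • W) (toCplx x))‖)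
        ≤ (|K| * (C₃ * Real.exp (ε / 4 * nrm2 x))) * (Real.exp (-ε * nrm2 x) *
          Real.exp (ε / 4 * nrm2 x + C₁ + (ε / 4 * nrm2 x + C₂))) := by
          refine mul_le_mul h1 (mul_le_mul (hG x) h2 (norm_nonneg _) (Real.exp_pos _).le)
            (by positivity) (by positivity)
      _ = |K| * C₃ * (Real.exp (ε / 4 * nrm2 x) * (Real.exp (-ε * nrm2 x) *
          Real.exp (ε / 4 * nrm2 x + C₁ + (ε / 4 * nrm2 x + C₂)))) := by ring
      _ = |K| * C₃ * (Real.exp (C₁ + C₂) * Real.exp (-(ε / 4) * nrm2 x)) := by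
          rw [← Real.exp_add, ← Real.exp_add, ← Real.exp_add]
          congr 2
          ring
      _ = _ := by rw [nrm2]; ring
  have hmain := (hasFDerivAt_integral_of_holomorphic (μ := volume) (f := f)
    (U := Metric.ball (0 : ℂ) 1) Metric.isOpen_ball
    (fun s _ => (hcont s).aestronglyMeasurable)
    (Eventually.of_forall fun x s _ => (hder x s).differentiableAt.differentiableWithinAt)
    ((integrable_gaussian_pi (by positivity : 0 < ε / 4) (n + 2)).const_mul _)
    (Eventually.of_forall hbound) (Metric.mem_ball_self one_pos))
  have h1 := hmain.1.hasDerivAt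
  refine h1.congr_deriv ?_
  have h2 := ContinuousLinearMap.integral_apply hmain.2 (1 : ℂ)
  rw [h2]
  refine integral_congr_ae (Eventually.of_forall fun x => ?_)
  have h3 := (hder x 0).hasFDerivAt.fderiv
  simp only [h3, zero_smul, add_zero]
  simp

section Transform

variable {M} {Z : CplxSpace n}

/-- The coefficients of the exponent in the coordinates of an adapted basis. -/
noncomputable def gaussCoeff (n : ℕ) (z w : ℂ) (i : Fin (n + 2)) : ℂ :=
  if (i : ℕ) < 2 then Real.pi * I * w else -(Real.pi * I * z)

/-- In the coordinates of an adapted basis the exponent of the theta series is diagonal. -/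
theorem gaussExp_eq_sum (hZ : Z ∈ cone M) {b : Module.Basis (Fin (n + 2)) ℝ (RealSpace n)}
    (hb : ∀ i j, M.bR (b i) (b j) = if i = j then signVec n i else 0)
    (hbZ : Z = (Real.sqrt (absSq M Z) : ℂ) • (toCplx (b 0) + I • toCplx (b 1)))
    (z w : ℂ) (η : CplxSpace n) :
    gaussExp M Z z w η = -∑ i, gaussCoeff n z w i * M.bC η (toCplx (b i)) ^ 2 := by
  have hN := absSq_pos M hZ
  set r : ℂ := (Real.sqrt (absSq M Z) : ℂ) with hr
  have hrr : r * r = (absSq M Z : ℂ) := by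
    rw [hr, ← ofReal_mul, Real.mul_self_sqrt hN.le]
  have hr0 : (absSq M Z : ℂ) ≠ 0 := by simpa using hN.ne'
  have hcr : ∀ x : RealSpace n, cconj (toCplx x) = toCplx x := fun x => by
    funext i; simp [cconj, toCplx]
  have hbZ' : cconj Z = r • (toCplx (b 0) - I • toCplx (b 1)) := by
    conv_lhs => rw [hbZ]
    rw [cconj_smul, cconj_add, cconj_smul, hcr, hcr, conj_I, hr, conj_ofReal,
      sub_eq_add_neg]
    congr 2
    exact neg_smul _ _
  have h1 : M.bC η Z = r * (M.bC η (toCplx (b 0)) + I * M.bC η (toCplx (b 1))) := by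
    conv_lhs => rw [hbZ]
    rw [bC_smul_right, bC_add_right, bC_smul_right]
  have h2 : M.bC η (cconj Z) = r * (M.bC η (toCplx (b 0)) - I * M.bC η (toCplx (b 1))) := by
    rw [hbZ', bC_smul_right, bC_sub_right, bC_smul_right]
  have h3 : planeForm M Z η = M.bC η (toCplx (b 0)) ^ 2 + M.bC η (toCplx (b 1)) ^ 2 := by
    rw [planeForm, h1, h2, div_eq_iff hr0, ← hrr]
    ring_nf
    simp only [I_sq]
    ring
  have h4 := bC_parseval M hb η
  rw [gaussExp, h3, h4]
  rw [Fin.sum_univ_succ, Fin.sum_univ_succ, Fin.sum_univ_succ (n := n + 1),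
    Fin.sum_univ_succ (n := n)]
  have h5 : ∀ i : Fin n, signVec n i.succ.succ = -1 := fun i => by simp [signVec]
  have h6 : ∀ i : Fin n, gaussCoeff n z w i.succ.succ = -(Real.pi * I * z) := fun i => by
    simp [gaussCoeff]
  have h7 : signVec n 0 = 1 ∧ signVec n 1 = 1 := by simp [signVec]
  have h8 : gaussCoeff n z w 0 = Real.pi * I * w ∧
      gaussCoeff n z w 1 = Real.pi * I * w := by simp [gaussCoeff]
  have h9 : (Fin.succ 0 : Fin (n + 2)) = 1 := rfl
  simp only [h9, h5, h6, h7.1, h7.2, h8.1, h8.2]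
  rw [← Finset.mul_sum, ← Finset.mul_sum]
  push_cast
  ring

/-- The constant in the Fourier transform of the Gaussian. -/
noncomputable def gaussConst (M : EvenLattice n) (z : ℂ) : ℂ :=
  ((Real.sqrt (Fintype.card M.Disc))⁻¹ : ℂ) *
    ((1 / (I * (starRingEnd ℂ) z)) * ((1 / (-I * z)) ^ (1 / 2 : ℂ)) ^ n)

/-- The Fourier transform of the Gaussian of the theta series is the Gaussian at `-1 / z`. -/
theorem integral_gaussExp (hZ : Z ∈ cone M) {z : ℂ} (hz : 0 < z.im) (η : CplxSpace n) :
    ∫ x : RealSpace n, cexp (gaussExp M Z z ((starRingEnd ℂ) z) (toCplx x) +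
          2 * Real.pi * I * M.bC η (toCplx x)) =
      gaussConst M z * cexp (gaussExp M Z (-1 / z) (-1 / (starRingEnd ℂ) z) η) := by
  obtain ⟨b, hb, hbZ⟩ := exists_adapted_basis M hZ
  set w := (starRingEnd ℂ) z with hw
  have hz0 : z ≠ 0 := fun h => by simp [h] at hz
  have hw0 : w ≠ 0 := by simpa [hw] using hz0
  have hpi : (Real.pi : ℂ) ≠ 0 := by simpa using Real.pi_pos.ne'
  have hre : ∀ i, 0 < (gaussCoeff n z w i).re := fun i => by
    unfold gaussCoeff
    split_ifs
    · have : (Real.pi * I * w).re = Real.pi * z.im := by simp [hw]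
      rw [this]; positivity
    · have : (-(Real.pi * I * z)).re = Real.pi * z.im := by simp
      rw [this]; positivity
  rw [integral_eq_integral_basis M hb]
  have hfun : ∀ t : Fin (n + 2) → ℝ,
      gaussExp M Z z w (toCplx (∑ i, t i • b i)) +
        2 * Real.pi * I * M.bC η (toCplx (∑ i, t i • b i)) =
      -∑ i, gaussCoeff n z w i * (t i : ℂ) ^ 2 +
        ∑ i, (2 * Real.pi * I * M.bC η (toCplx (b i))) * (t i : ℂ) := by
    intro t
    have h1 : ∀ i, M.bC (toCplx (∑ i, t i • b i)) (toCplx (b i)) = (t i * signVec n i : ℝ) := by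
      intro i
      rw [bC_toCplx, bR_sum_left]
      simp [hb]
    have h2 : M.bC η (toCplx (∑ i, t i • b i)) = ∑ i, M.bC η (toCplx (b i)) * (t i : ℂ) := by
      obtain ⟨x, y, rfl⟩ := exists_re_im η
      have h3 : ∀ x : RealSpace n, M.bC (toCplx x) (toCplx (∑ i, t i • b i)) =
          ∑ i, M.bC (toCplx x) (toCplx (b i)) * (t i : ℂ) := by
        intro x
        rw [bC_toCplx, bR_comm, bR_sum_left]
        push_cast
        refine Finset.sum_congr rfl fun i _ => ?_
        rw [bC_toCplx, bR_comm M (b i) x, mul_comm]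
      rw [bC_add_left, bC_smul_left, h3, h3, Finset.mul_sum, ← Finset.sum_add_distrib]
      refine Finset.sum_congr rfl fun i _ => ?_
      rw [bC_add_left, bC_smul_left]
      ring
    rw [gaussExp_eq_sum hZ hb hbZ, h2, Finset.mul_sum]
    congr 1
    · congr 1
      refine Finset.sum_congr rfl fun i _ => ?_
      rw [h1, ofReal_mul, mul_pow]
      have : (signVec n i : ℂ) ^ 2 = 1 := by
        rw [sq]; exact_mod_cast signVec_mul_self i
      rw [this, mul_one]
    · exact Finset.sum_congr rfl fun i _ => by ring
  simp only [hfun]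
  rw [GaussianFourier.integral_cexp_neg_sum_mul_add hre, Finset.prod_mul_distrib, gaussConst,
    ← mul_assoc]
  congr 1
  · congr 1
    rw [Fin.prod_univ_succ, Fin.prod_univ_succ]
    have h6 : ∀ i : Fin n, gaussCoeff n z w i.succ.succ = -(Real.pi * I * z) := fun i => by
      simp [gaussCoeff]
    have h8 : gaussCoeff n z w 0 = Real.pi * I * w ∧
      gaussCoeff n z w (Fin.succ 0) = Real.pi * I * w := by simp [gaussCoeff]
    simp only [h6, h8.1, h8.2, Finset.prod_const, Finset.card_univ, Fintype.card_fin]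
    have e1 : (Real.pi : ℂ) / (Real.pi * I * w) = 1 / (I * w) := by
      rw [mul_assoc, ← div_div, div_self hpi]
    have e2 : (Real.pi : ℂ) / (-(Real.pi * I * z)) = 1 / (-I * z) := by
      have : -(Real.pi * I * z : ℂ) = Real.pi * (-I * z) := by ring
      rw [this, ← div_div, div_self hpi]
    rw [e1, e2, ← mul_assoc, ← sq]
    congr 1
    have := cpow_nat_inv_pow (1 / (I * w)) (n := 2) two_ne_zero
    norm_num at this ⊢
    exact this
  · rw [← Complex.exp_sum, gaussExp_eq_sum hZ hb hbZ]
    congr 1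
    rw [← Finset.sum_neg_distrib]
    refine Finset.sum_congr rfl fun i _ => ?_
    unfold gaussCoeff
    split_ifs
    · field_simp
      ring_nf
    · field_simp
      ring_nf

theorem exists_norm_bC_pow_le (W : CplxSpace n) (m : ℕ) : ∃ K : ℝ, 0 ≤ K ∧ ∀ x : RealSpace n,
    ‖M.bC (toCplx x) W ^ m‖ ≤ K * (1 + nrm2 x) ^ m := by
  obtain ⟨K, hK, hev⟩ := norm_bC_le M W
  refine ⟨K ^ m, by positivity, fun x => ?_⟩
  rw [norm_pow, ← mul_pow]
  exact pow_le_pow_left₀ (norm_nonneg _) (hev.self_of_nhds x) m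

theorem continuous_bC_toCplx (W : CplxSpace n) :
    Continuous fun x : RealSpace n => M.bC (toCplx x) W :=
  M.continuous_bC_comp continuous_toCplx continuous_const

theorem bC_cconj_cconj (hZ : Z ∈ cone M) : M.bC (cconj Z) (cconj Z) = 0 := by
  rw [← conj_bC, hZ.1, map_zero]

theorem gaussExp_add_cconj (hZ : Z ∈ cone M) (z w : ℂ) (η : CplxSpace n) (s : ℂ) :
    gaussExp M Z z w (η + s • cconj Z) =
      gaussExp M Z z w η + s * (-(2 * Real.pi * I * w) * M.bC η (cconj Z)) := by
  have hN : (absSq M Z : ℂ) ≠ 0 := by simpa using (absSq_pos M hZ).ne'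
  have h1 : M.bC (cconj Z) Z = 2 * (absSq M Z : ℂ) := by rw [bC_comm, bC_self_cconj_eq]
  have h2 : planeForm M Z (η + s • cconj Z) = planeForm M Z η + s * (2 * M.bC η (cconj Z)) := by
    simp only [planeForm, bC_add_left, bC_smul_left, bC_cconj_cconj hZ, h1]
    field_simp
    ring
  have h3 : M.bC (η + s • cconj Z) (η + s • cconj Z) =
      M.bC η η + s * (2 * M.bC η (cconj Z)) := by
    simp only [bC_add_left, bC_smul_left, bC_add_right, bC_smul_right, bC_cconj_cconj hZ,
      bC_comm M (cconj Z) η]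
    ring
  rw [gaussExp, gaussExp, h2, h3]
  ring

theorem gaussExp_add_orthogonal {v : CplxSpace n} (hv : M.bC v Z = 0)
    (hv' : M.bC v (cconj Z) = 0) (z w : ℂ) (η : CplxSpace n) (s : ℂ) :
    gaussExp M Z z w (η + s • v) = gaussExp M Z z w η +
      (s * (-(2 * Real.pi * I * z) * M.bC η v) + s * s * (-(Real.pi * I * z) * M.bC v v)) := by
  have h2 : planeForm M Z (η + s • v) = planeForm M Z η := by
    simp only [planeForm, bC_add_left, bC_smul_left, hv, hv']
    ring
  have h3 : M.bC (η + s • v) (η + s • v) =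
      M.bC η η + s * (2 * M.bC η v) + s * s * M.bC v v := by
    simp only [bC_add_left, bC_smul_left, bC_add_right, bC_smul_right, bC_comm M v η]
    ring
  rw [gaussExp, gaussExp, h2, h3]
  ring

/-- The factor `⟨x, Z̄⟩ ^ m` is produced by differentiating in the direction of the isotropic vector
`Z̄`, in which the exponent is linear. -/
theorem integral_pow_mul_gaussExp (hZ : Z ∈ cone M) {z : ℂ} (hz : 0 < z.im) (m : ℕ)
    (η : CplxSpace n) :
    ∫ x : RealSpace n, M.bC (toCplx x) (cconj Z) ^ m *
        cexp (gaussExp M Z z ((starRingEnd ℂ) z) (toCplx x) +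
          2 * Real.pi * I * M.bC η (toCplx x)) =
      gaussConst M z * (M.bC η (cconj Z) / (starRingEnd ℂ) z) ^ m *
        cexp (gaussExp M Z (-1 / z) (-1 / (starRingEnd ℂ) z) η) := by
  have hpi : (2 * Real.pi * I : ℂ) ≠ 0 := by simp [Real.pi_pos.ne']
  induction m generalizing η with
  | zero => simpa using integral_gaussExp hZ hz η
  | succ m ih =>
    obtain ⟨K, hK, hKb⟩ := exists_norm_bC_pow_le (M := M) (cconj Z) m
    have h1 := hasDerivAt_gaussInt M hZ hz ((continuous_bC_toCplx (M := M) (cconj Z)).pow m) hKb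
      η (cconj Z)
    simp only [Pi.pow_apply] at h1
    simp only [ih] at h1
    have h2 : HasDerivAt (fun s : ℂ => gaussConst M z *
        (M.bC (η + s • cconj Z) (cconj Z) / (starRingEnd ℂ) z) ^ m *
        cexp (gaussExp M Z (-1 / z) (-1 / (starRingEnd ℂ) z) (η + s • cconj Z)))
        (2 * Real.pi * I * (gaussConst M z * (M.bC η (cconj Z) / (starRingEnd ℂ) z) ^ (m + 1) *
        cexp (gaussExp M Z (-1 / z) (-1 / (starRingEnd ℂ) z) η))) 0 := by
      simp only [gaussExp_add_cconj hZ, bC_add_left, bC_smul_left, bC_cconj_cconj hZ, mul_zero,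
        add_zero]
      have h3 := ((hasDerivAt_id (0 : ℂ)).mul_const (-(2 * Real.pi * I *
        (-1 / (starRingEnd ℂ) z)) * M.bC η (cconj Z))).const_add
          (gaussExp M Z (-1 / z) (-1 / (starRingEnd ℂ) z) η)
      refine (h3.cexp.const_mul (gaussConst M z *
        (M.bC η (cconj Z) / (starRingEnd ℂ) z) ^ m)).congr_deriv ?_
      simp only [id, zero_mul, add_zero, one_mul]
      ring
    have h4 := h1.unique h2
    refine mul_left_cancel₀ hpi (Eq.trans ?_ h4)
    rw [← integral_const_mul]
    refine integral_congr_ae (Eventually.of_forall fun x => ?_)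
    simp only [bC_comm M (cconj Z) (toCplx x)]
    ring

/-- The Fourier transform of `⟨x, Z̄⟩ ^ m ⟨x, v⟩ e ^ (π i (z q(x) - z̄ p(x)))`, for `v` orthogonal to
`Z` and `Z̄`. -/
theorem integral_pow_mul_linear_mul_gaussExp (hZ : Z ∈ cone M) {v : CplxSpace n}
    (hv : M.bC v Z = 0) (hv' : M.bC v (cconj Z) = 0) {z : ℂ} (hz : 0 < z.im) (m : ℕ)
    (η : CplxSpace n) :
    ∫ x : RealSpace n, M.bC (toCplx x) (cconj Z) ^ m * M.bC (toCplx x) v *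
        cexp (gaussExp M Z z ((starRingEnd ℂ) z) (toCplx x) +
          2 * Real.pi * I * M.bC η (toCplx x)) =
      gaussConst M z * (M.bC η (cconj Z) / (starRingEnd ℂ) z) ^ m * (M.bC η v / z) *
        cexp (gaussExp M Z (-1 / z) (-1 / (starRingEnd ℂ) z) η) := by
  have hpi : (2 * Real.pi * I : ℂ) ≠ 0 := by simp [Real.pi_pos.ne']
  obtain ⟨K, hK, hKb⟩ := exists_norm_bC_pow_le (M := M) (cconj Z) m
  have h1 := hasDerivAt_gaussInt M hZ hz ((continuous_bC_toCplx (M := M) (cconj Z)).pow m) hKb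
    η v
  simp only [Pi.pow_apply] at h1
  simp only [integral_pow_mul_gaussExp hZ hz] at h1
  have h2 : HasDerivAt (fun s : ℂ => gaussConst M z *
      (M.bC (η + s • v) (cconj Z) / (starRingEnd ℂ) z) ^ m *
      cexp (gaussExp M Z (-1 / z) (-1 / (starRingEnd ℂ) z) (η + s • v)))
      (2 * Real.pi * I * (gaussConst M z * (M.bC η (cconj Z) / (starRingEnd ℂ) z) ^ m *
        (M.bC η v / z) * cexp (gaussExp M Z (-1 / z) (-1 / (starRingEnd ℂ) z) η))) 0 := by
    simp only [gaussExp_add_orthogonal hv hv', bC_add_left, bC_smul_left, hv', mul_zero,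
      add_zero]
    have h3 := (((hasDerivAt_id (0 : ℂ)).mul_const (-(2 * Real.pi * I *
      (-1 / z)) * M.bC η v)).add (((hasDerivAt_id (0 : ℂ)).mul (hasDerivAt_id (0 : ℂ))).mul_const
        (-(Real.pi * I * (-1 / z)) * M.bC v v))).const_add
        (gaussExp M Z (-1 / z) (-1 / (starRingEnd ℂ) z) η)
    refine (h3.cexp.const_mul (gaussConst M z *
      (M.bC η (cconj Z) / (starRingEnd ℂ) z) ^ m)).congr_deriv ?_
    simp [id]
    ring
  have h4 := h1.unique h2
  refine mul_left_cancel₀ hpi (Eq.trans ?_ h4)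
  rw [← integral_const_mul]
  refine integral_congr_ae (Eventually.of_forall fun x => ?_)
  simp only [bC_comm M v (toCplx x)]
  ring

end Transform

/-! ### Inversion of the theta series -/

/-- Poisson summation over a translate of the lattice, with the frequencies in the dual lattice. -/
theorem poisson_lattice {f : RealSpace n → ℂ} (hf : Continuous f) {C ε : ℝ} (hε : 0 < ε)
    (hb : ∀ x, ‖f x‖ ≤ C * Real.exp (-ε * nrm2 x))
    (hsum : Summable fun l : M.dual => ∫ u, f u * cexp (2 * Real.pi * I * (M.bR l u : ℝ)))
    (x : RealSpace n) :
    ∑' m : Fin (n + 2) → ℤ, f (x + intVec m) =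
      ∑' l : M.dual, (∫ u, f u * cexp (2 * Real.pi * I * (M.bR l u : ℝ))) *
        cexp (-(2 * Real.pi * I * (M.bR l x : ℝ))) := by
  have hdot : ∀ (l : M.dual) (u : RealSpace n),
      dotExp (dualEquiv M l) u = cexp (2 * Real.pi * I * (M.bR l u : ℝ)) := by
    intro l u
    rw [dotExp, bR_dual, dualEquiv_apply]
    push_cast
    rfl
  have hneg : ∀ (ξ : Fin (n + 2) → ℤ) (u : RealSpace n), dotExp (-ξ) u = (dotExp ξ u)⁻¹ := by
    intro ξ u
    rw [dotExp, dotExp, ← Complex.exp_neg]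
    congr 1
    simp
  set e : M.dual ≃ (Fin (n + 2) → ℤ) := (dualEquiv M).trans (Equiv.neg _) with he
  have he1 : ∀ (l : M.dual) (u : RealSpace n),
      dotExp (-(e l)) u = cexp (2 * Real.pi * I * (M.bR l u : ℝ)) := by
    intro l u
    simp [he, hdot]
  have he2 : ∀ (l : M.dual) (u : RealSpace n),
      dotExp (e l) u = cexp (-(2 * Real.pi * I * (M.bR l u : ℝ))) := by
    intro l u
    have := hneg (dualEquiv M l) u
    rw [hdot, ← Complex.exp_neg] at this
    simpa [he] using this
  have hsum' : Summable fun ξ : Fin (n + 2) → ℤ => ∫ u, f u * dotExp (-ξ) u := by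
    rw [← e.summable_iff]
    refine hsum.congr fun l => ?_
    simp only [Function.comp_apply, he1]
  rw [poisson_summation hf hε hb hsum' x, ← e.tsum_eq]
  simp only [he1, he2]

/-- The vectors of a coset of the lattice in its dual. -/
noncomputable def cosetEquiv (γ : M.Disc) : (Fin (n + 2) → ℤ) ≃ {l : M.dual // M.cls l = γ} :=
  Equiv.ofBijective (fun m => ⟨γ.out + ⟨intVec m, fun y hy =>
      bR_mem_lattice_int M (fun i => ⟨m i, rfl⟩) hy⟩, by
        conv_rhs => rw [← QuotientAddGroup.out_eq' γ]
        rw [EvenLattice.cls, QuotientAddGroup.eq, AddSubgroup.mem_addSubgroupOf]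
        intro i
        refine ⟨-m i, ?_⟩
        simp [intVec]⟩) (by
    constructor
    · intro m m' h
      have h1 := congrArg (fun l : {l : M.dual // M.cls l = γ} => ((l : M.dual) : RealSpace n)) h
      funext i
      have h2 := congrFun h1 i
      simp only [AddSubgroup.coe_add, Pi.add_apply, intVec, add_right_inj, Int.cast_inj] at h2
      exact h2
    · rintro ⟨l, hl⟩
      have h1 : M.cls γ.out = M.cls l := by
        rw [hl]; exact QuotientAddGroup.out_eq' γ
      rw [EvenLattice.cls, EvenLattice.cls, QuotientAddGroup.eq,
        AddSubgroup.mem_addSubgroupOf] at h1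
      choose m hm using h1
      refine ⟨m, ?_⟩
      apply Subtype.ext
      apply Subtype.ext
      funext i
      have := hm i
      simp only [AddSubgroup.coe_add, AddSubgroup.coe_neg, Pi.add_apply, Pi.neg_apply, intVec]
        at this ⊢
      linarith)

theorem cosetEquiv_apply (γ : M.Disc) (m : Fin (n + 2) → ℤ) :
    (((cosetEquiv M γ m : {l : M.dual // M.cls l = γ}) : M.dual) : RealSpace n) =
      ((γ.out : M.dual) : RealSpace n) + intVec m := rfl

/-- The Schwartz function `⟨x, Z̄⟩ ^ m ⟨x, v⟩ e ^ (-π i (z ⟨x_Z^⊥, x_Z^⊥⟩ + z̄ ⟨x_Z, x_Z⟩))`, where `x_Z`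
and `x_Z^⊥` are the projections of `x` to the plane of `Z` and to its complement. -/
noncomputable def thetaFun (Z v : CplxSpace n) (m : ℕ) (z : ℂ) (x : RealSpace n) : ℂ :=
  M.bC (toCplx x) (cconj Z) ^ m * M.bC (toCplx x) v *
    cexp (gaussExp M Z z ((starRingEnd ℂ) z) (toCplx x))

theorem continuous_thetaFun (Z v : CplxSpace n) (m : ℕ) (z : ℂ) :
    Continuous (thetaFun M Z v m z) :=
  (((continuous_bC_toCplx (M := M) (cconj Z)).pow m).mul (continuous_bC_toCplx (M := M) v)).mul
    (continuous_exp.comp (continuous_gaussExp M Z z ((starRingEnd ℂ) z)))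

theorem exists_thetaFun_bound {Z : CplxSpace n} (hZ : Z ∈ cone M) (v : CplxSpace n) (m : ℕ) {z : ℂ}
    (hz : 0 < z.im) :
    ∃ C ε : ℝ, 0 ≤ C ∧ 0 < ε ∧ ∀ x, ‖thetaFun M Z v m z x‖ ≤ C * Real.exp (-ε * nrm2 x) := by
  obtain ⟨ε, hε, hG⟩ := exists_norm_gaussExp_le M hZ hz
  obtain ⟨K, hK, hKb⟩ := exists_norm_bC_pow_le (M := M) (cconj Z) m
  obtain ⟨K', hK', hKb'⟩ := exists_norm_bC_pow_le (M := M) v 1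
  obtain ⟨C, hC, hCb⟩ := exists_pow_le_exp (m + 1) (half_pos hε)
  refine ⟨K * K' * C, ε / 2, by positivity, half_pos hε, fun x => ?_⟩
  have hr := nrm2_nonneg x
  have h1 := hKb' x
  rw [pow_one] at h1
  rw [thetaFun, norm_mul, norm_mul]
  calc ‖M.bC (toCplx x) (cconj Z) ^ m‖ * ‖M.bC (toCplx x) v‖ *
        ‖cexp (gaussExp M Z z ((starRingEnd ℂ) z) (toCplx x))‖
      ≤ (K * (1 + nrm2 x) ^ m) * (K' * (1 + nrm2 x) ^ 1) * Real.exp (-ε * nrm2 x) := by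
        refine mul_le_mul (mul_le_mul (hKb x) h1 (norm_nonneg _) (by positivity)) (hG x)
          (norm_nonneg _) (by positivity)
    _ = K * K' * (1 + nrm2 x) ^ (m + 1) * Real.exp (-ε * nrm2 x) := by ring
    _ ≤ K * K' * (C * Real.exp (ε / 2 * nrm2 x)) * Real.exp (-ε * nrm2 x) := by
        refine mul_le_mul_of_nonneg_right (mul_le_mul_of_nonneg_left (hCb _ hr) (by positivity))
          (Real.exp_pos _).le
    _ = K * K' * C * (Real.exp (ε / 2 * nrm2 x) * Real.exp (-ε * nrm2 x)) := by ring
    _ = K * K' * C * Real.exp (-(ε / 2) * nrm2 x) := by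
        rw [← Real.exp_add]
        congr 2
        ring

theorem summable_thetaFun {Z : CplxSpace n} (hZ : Z ∈ cone M) (v : CplxSpace n) (m : ℕ) {z : ℂ}
    (hz : 0 < z.im) : Summable fun l : M.dual => thetaFun M Z v m z l := by
  obtain ⟨C, ε, hC, hε, h⟩ := exists_thetaFun_bound M hZ v m hz
  exact Summable.of_norm_bounded ((summable_dual M hε).mul_left C) fun l => h l

theorem neg_one_div_im {z : ℂ} (hz : 0 < z.im) : 0 < (-1 / z).im := by
  have hz0 : z ≠ 0 := fun h => by simp [h] at hz
  rw [neg_div, one_div, neg_im, inv_im]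
  have : 0 < normSq z := normSq_pos.mpr hz0
  rw [neg_div, neg_neg]
  positivity

section Inversion

variable {M}

theorem fourier_thetaFun {Z v : CplxSpace n} (hZ : Z ∈ cone M) (hv : M.bC v Z = 0)
    (hv' : M.bC v (cconj Z) = 0) (m : ℕ) {z : ℂ} (hz : 0 < z.im) (x : RealSpace n) :
    ∫ u, thetaFun M Z v m z u * cexp (2 * Real.pi * I * (M.bR x u : ℝ)) =
      gaussConst M z / ((starRingEnd ℂ) z ^ m * z) * thetaFun M Z v m (-1 / z) x := by
  have h := integral_pow_mul_linear_mul_gaussExp hZ hv hv' hz m (toCplx x)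
  have hc : (starRingEnd ℂ) (-1 / z) = -1 / (starRingEnd ℂ) z := by simp
  have h2 : ∀ u : RealSpace n, thetaFun M Z v m z u * cexp (2 * Real.pi * I * (M.bR x u : ℝ)) =
      M.bC (toCplx u) (cconj Z) ^ m * M.bC (toCplx u) v *
        cexp (gaussExp M Z z ((starRingEnd ℂ) z) (toCplx u) +
          2 * Real.pi * I * M.bC (toCplx x) (toCplx u)) := by
    intro u
    rw [thetaFun, mul_assoc, ← Complex.exp_add, bC_toCplx]
  simp only [h2]
  rw [h, thetaFun, hc]
  have hz0 : z ≠ 0 := fun h => by simp [h] at hz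
  have hz1 : (starRingEnd ℂ) z ≠ 0 := by simpa using hz0
  rw [div_pow]
  field_simp

/-- Poisson summation for the theta function of a coset. -/
theorem tsum_coset_thetaFun {Z v : CplxSpace n} (hZ : Z ∈ cone M) (hv : M.bC v Z = 0)
    (hv' : M.bC v (cconj Z) = 0) (m : ℕ) {z : ℂ} (hz : 0 < z.im) (γ : M.Disc) :
    ∑' l : {l : M.dual // M.cls l = γ}, thetaFun M Z v m z (l : M.dual) =
      gaussConst M z / ((starRingEnd ℂ) z ^ m * z) *
        ∑' l : M.dual, cexp (-(2 * Real.pi * I * (M.bR l (γ.out : M.dual) : ℝ))) *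
          thetaFun M Z v m (-1 / z) l := by
  obtain ⟨C, ε, hC, hε, hb⟩ := exists_thetaFun_bound M hZ v m hz
  have hsum : Summable fun l : M.dual =>
      ∫ u, thetaFun M Z v m z u * cexp (2 * Real.pi * I * (M.bR l u : ℝ)) := by
    simp only [fourier_thetaFun hZ hv hv' m hz]
    exact (summable_thetaFun M hZ v m (neg_one_div_im hz)).mul_left _
  have h := poisson_lattice M (continuous_thetaFun M Z v m z) hε hb hsum
    ((γ.out : M.dual) : RealSpace n)
  rw [← (cosetEquiv M γ).tsum_eq]
  simp only [cosetEquiv_apply]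
  rw [h, ← tsum_mul_left]
  refine tsum_congr fun l => ?_
  rw [fourier_thetaFun hZ hv hv' m hz]
  ring

/-- The theta series on which the boundary terms of the partial integration depend. -/
noncomputable def thetaSum (M : EvenLattice n) (F : ℍ → M.Disc → ℂ) (Z v : CplxSpace n) (m : ℕ)
    (z : ℂ) : ℂ :=
  ∑' l : M.dual, F (ofComplex z) (M.cls l) * thetaFun M Z v m z l

/-- Comparison of the branch of `√z` in the transformation law of the form with the branch that
occurs in the Gaussian integral. -/
theorem sqrt_mul_sqrt {z : ℂ} (hz : 0 < z.im) :
    z ^ (1 / 2 : ℂ) * (1 / (-I * z)) ^ (1 / 2 : ℂ) = cexp (Real.pi * I / 4) := by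
  have hz0 : z ≠ 0 := fun h => by simp [h] at hz
  have h1 : 1 / (-I * z) ≠ 0 := by simp [hz0]
  have harg : 0 < z.arg ∧ z.arg < Real.pi := by
    refine ⟨?_, ?_⟩
    · have h2 := Complex.arg_nonneg_iff.mpr hz.le
      rcases h2.lt_or_eq with h | h
      · exact h
      · exact absurd (Complex.arg_eq_zero_iff.mp h.symm).2 hz.ne'
    · rcases (Complex.arg_le_pi z).lt_or_eq with h | h
      · exact h
      · exact absurd (Complex.arg_eq_pi_iff.mp h).2 hz.ne'
  have hlog : Complex.log (1 / (-I * z)) = -Complex.log z + Real.pi / 2 * I := by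
    have h2 : 1 / (-I * z) = cexp (-Complex.log z + Real.pi / 2 * I) := by
      rw [Complex.exp_add, Complex.exp_neg, Complex.exp_log hz0, Complex.exp_pi_div_two_mul_I]
      field_simp
      rw [I_sq]
    have him : (-Complex.log z + Real.pi / 2 * I).im = -z.arg + Real.pi / 2 := by
      simp [Complex.log_im]
    rw [h2, Complex.log_exp]
    · rw [him]; linarith [Real.pi_pos]
    · rw [him]; linarith [Real.pi_pos]
  rw [cpow_def_of_ne_zero hz0, cpow_def_of_ne_zero h1, hlog, ← Complex.exp_add]
  congr 1
  ring

/-- The root of unity in the Weil representation is the one that arises from the Gaussian integral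
in signature `(2, n)`. -/
theorem inversion_constant {z : ℂ} (hz : 0 < z.im) (k : ℕ) :
    (z ^ (1 / 2 : ℂ)) ^ (2 * ((k + 1 : ℕ) : ℤ) + 2 - (n : ℤ)) *
      (cexp (-(Real.pi * I * (2 - n) / 4)) / (Real.sqrt (Fintype.card M.Disc) : ℂ)) =
      ((starRingEnd ℂ) z ^ (k + 1) * z ^ (k + 3)) *
        (gaussConst M z / ((starRingEnd ℂ) z ^ k * z)) := by
  have hz0 : z ≠ 0 := fun h => by simp [h] at hz
  have hw0 : (starRingEnd ℂ) z ≠ 0 := by simpa using hz0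
  set w := (starRingEnd ℂ) z
  set r := z ^ (1 / 2 : ℂ) with hr
  set g := (1 / (-I * z)) ^ (1 / 2 : ℂ) with hg
  have hrg : r * g = cexp (Real.pi * I / 4) := sqrt_mul_sqrt hz
  have hr0 : r ≠ 0 := fun h => by
    rw [h, zero_mul] at hrg
    exact (Complex.exp_ne_zero _) hrg.symm
  have hrr : r ^ 2 = z := by
    have := cpow_nat_inv_pow z (n := 2) two_ne_zero
    norm_num at this
    rw [hr]
    norm_num
    exact this
  have he : cexp (-(Real.pi * I * (2 - n) / 4)) = -I * (r * g) ^ n := by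
    rw [hrg, ← Complex.exp_nat_mul]
    have h1 : (-I : ℂ) = cexp (-Real.pi / 2 * I) := by
      rw [Complex.exp_neg_pi_div_two_mul_I]
    rw [h1, ← Complex.exp_add]
    congr 1
    ring
  have hpow : r ^ (2 * ((k + 1 : ℕ) : ℤ) + 2 - (n : ℤ)) = z ^ (k + 2) / r ^ n := by
    rw [zpow_sub₀ hr0, zpow_natCast]
    congr 1
    rw [← hrr, ← pow_mul, ← zpow_natCast]
    congr 1
  have hD : (Real.sqrt (Fintype.card M.Disc) : ℂ) ≠ 0 := by
    have : 0 < Fintype.card M.Disc := Fintype.card_pos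
    simp
  have hgc : gaussConst M z =
      ((Real.sqrt (Fintype.card M.Disc))⁻¹ : ℂ) * ((1 / (I * w)) * g ^ n) := rfl
  rw [hpow, he, hgc, mul_pow]
  have hrn : r ^ n ≠ 0 := pow_ne_zero _ hr0
  field_simp
  ring_nf
  simp only [I_sq]
  ring

theorem ofComplex_neg_one_div {z : ℂ} (hz : 0 < z.im) :
    ofComplex (-1 / z) = ModularGroup.S • ofComplex z := by
  apply UpperHalfPlane.ext
  rw [UpperHalfPlane.modular_S_smul, ofComplex_apply_of_im_pos (neg_one_div_im hz),
    ofComplex_apply_of_im_pos hz]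
  change -1 / z = (-z)⁻¹
  rw [neg_div, one_div, inv_neg]

/-- The theta series of an almost-holomorphic form of weight `k + 1 - n / 2` is modular of
weight two, up to the factor `|z| ^ (2 k)`. -/
theorem thetaSum_neg_one_div {F : ℍ → M.Disc → ℂ} {k : ℕ}
    (hF : IsAlmostHolModularForm M (2 * ((k + 1 : ℕ) : ℤ) + 2 - (n : ℤ)) F) {Z v : CplxSpace n}
    (hZ : Z ∈ cone M) (hv : M.bC v Z = 0) (hv' : M.bC v (cconj Z) = 0) {z : ℂ} (hz : 0 < z.im) :
    thetaSum M F Z v k (-1 / z) =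
      (starRingEnd ℂ) z ^ (k + 1) * z ^ (k + 3) * thetaSum M F Z v k z := by
  have hz0 : z ≠ 0 := fun h => by simp [h] at hz
  have hw0 : (starRingEnd ℂ) z ≠ 0 := by simpa using hz0
  set c₀ : ℂ := cexp (-(Real.pi * I * (2 - n) / 4)) / (Real.sqrt (Fintype.card M.Disc) : ℂ)
    with hc₀
  set f : M.dual → ℂ := fun l => thetaFun M Z v k (-1 / z) l with hf
  have hfs : Summable f := summable_thetaFun M hZ v k (neg_one_div_im hz)
  have hweil : ∀ (γ : M.Disc) (l : M.dual), M.weilS γ (M.cls l) =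
      c₀ * cexp (-(2 * Real.pi * I * (M.bR l (γ.out : M.dual) : ℝ))) := by
    intro γ l
    have h1 := exp_bR_cls M γ.out l
    have h2 : M.cls γ.out = γ := QuotientAddGroup.out_eq' γ
    rw [h2, bR_comm M (γ.out : M.dual) l] at h1
    rw [EvenLattice.weilS, h1]
  have hτ : ((ofComplex z : ℍ) : ℂ) = z := by rw [ofComplex_apply_of_im_pos hz]
  have hexp : ∀ γ : M.Disc, Summable fun l : M.dual =>
      cexp (-(2 * Real.pi * I * (M.bR l (γ.out : M.dual) : ℝ))) * f l := by
    intro γ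
    refine Summable.of_norm_bounded hfs.norm fun l => ?_
    rw [norm_mul]
    have : -(2 * Real.pi * I * (M.bR l (γ.out : M.dual) : ℝ)) =
        ((-(2 * Real.pi * M.bR l (γ.out : M.dual)) : ℝ) : ℂ) * I := by push_cast; ring
    rw [this, Complex.norm_exp_ofReal_mul_I, one_mul]
  -- the series at `-1 / z`, expanded by the transformation law of `F`
  have h1 : thetaSum M F Z v k (-1 / z) = ∑ γ : M.Disc,
      ((z ^ (1 / 2 : ℂ)) ^ (2 * ((k + 1 : ℕ) : ℤ) + 2 - (n : ℤ)) * c₀ * F (ofComplex z) γ) *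
        ∑' l : M.dual, cexp (-(2 * Real.pi * I * (M.bR l (γ.out : M.dual) : ℝ))) * f l := by
    rw [thetaSum]
    simp only [← tsum_mul_left]
    rw [← Summable.tsum_finsetSum fun γ _ => (hexp γ).mul_left _]
    refine tsum_congr fun l => ?_
    rw [ofComplex_neg_one_div hz, hF.map_S, hτ, Finset.mul_sum, Finset.sum_mul]
    refine Finset.sum_congr rfl fun γ _ => ?_
    rw [hweil]
    simp only [hf]
    ring
  have h2 : thetaSum M F Z v k z = ∑ γ : M.Disc, F (ofComplex z) γ *
      ∑' l : {l : M.dual // M.cls l = γ}, thetaFun M Z v k z (l : M.dual) := by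
    have hs : Summable fun l : M.dual => F (ofComplex z) (M.cls l) * thetaFun M Z v k z l := by
      refine Summable.of_norm_bounded ((summable_thetaFun M hZ v k hz).norm.mul_left
        (∑ γ, ‖F (ofComplex z) γ‖)) fun l => ?_
      rw [norm_mul]
      exact mul_le_mul_of_nonneg_right (Finset.single_le_sum
        (f := fun γ => ‖F (ofComplex z) γ‖) (fun _ _ => norm_nonneg _) (Finset.mem_univ _))
        (norm_nonneg _)
    have hs' := (Equiv.sigmaFiberEquiv M.cls).summable_iff.mpr hs
    rw [thetaSum, ← (Equiv.sigmaFiberEquiv M.cls).tsum_eq]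
    refine (Summable.tsum_sigma hs').trans ?_
    rw [tsum_fintype (L := .unconditional _)]
    refine Finset.sum_congr rfl fun γ _ => ?_
    rw [← tsum_mul_left]
    refine tsum_congr fun l => ?_
    obtain ⟨l, rfl⟩ := l
    rfl
  rw [h1, h2, Finset.mul_sum]
  refine Finset.sum_congr rfl fun γ _ => ?_
  rw [tsum_coset_thetaFun hZ hv hv' k hz, inversion_constant hz k]
  simp only [hf]
  ring

end Inversion

/-! ### Partial integration over the fundamental domain -/

/-- The height `√(1 - x²)` of the unit circle. -/
noncomputable def circ (x : ℝ) : ℝ := Real.sqrt (1 - x ^ 2)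

theorem circ_pos {x : ℝ} (hx : |x| < 1) : 0 < circ x := by
  have := abs_lt.mp hx
  exact Real.sqrt_pos.mpr (by nlinarith)

theorem circ_sq {x : ℝ} (hx : |x| < 1) : circ x ^ 2 = 1 - x ^ 2 := by
  have := abs_lt.mp hx
  exact Real.sq_sqrt (by nlinarith)

theorem hasDerivAt_circ {x : ℝ} (hx : |x| < 1) : HasDerivAt circ (-x / circ x) x := by
  have hx' := abs_lt.mp hx
  have h1 : HasDerivAt (fun x : ℝ => 1 - x ^ 2) (-(2 * x)) x := by
    simpa using ((hasDerivAt_id x).pow 2).const_sub 1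
  have h2 := h1.sqrt (by nlinarith)
  refine h2.congr_deriv ?_
  have := (circ_pos hx).ne'
  unfold circ at this ⊢
  field_simp

theorem circ_lt_two (x : ℝ) : circ x < 2 := by
  unfold circ
  rw [Real.sqrt_lt' two_pos]
  nlinarith [sq_nonneg x]

/-- The ordinate at parameter `t` on the vertical segment from the unit circle to height two. -/
noncomputable def fillHeight (p : ℝ × ℝ) : ℝ := (1 - p.2) * circ p.1 + 2 * p.2

/-- The point with ordinate `fillHeight`. -/
noncomputable def fillPoint (p : ℝ × ℝ) : ℂ := (p.1 : ℂ) + (fillHeight p : ℂ) * I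

/-- The integral of `g dz` over the arc of the unit circle between `-1/2` and `1/2`. -/
noncomputable def arcInt (g : ℂ → ℂ) : ℂ :=
  ∫ x in (-(1 / 2) : ℝ)..(1 / 2), g ((x : ℂ) + (circ x : ℂ) * I) * (1 - I * (x / circ x : ℝ))

/-- The integrand of the lowered function is the exterior derivative of `g dz`. -/
theorem lowerOp_div (g : ℂ → ℂ) {z : ℂ} (hz : 0 < z.im) :
    lowerOp g z / (z.im : ℂ) ^ 2 = fderiv ℝ g z I - I * fderiv ℝ g z 1 := by
  have : (z.im : ℂ) ≠ 0 := by simpa using hz.ne'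
  unfold lowerOp
  field_simp
  ring_nf
  simp only [I_sq]
  ring

section Stokes

variable {g : ℂ → ℂ}

theorem continuousOn_lowerOp_div (hg : IsPeriodicSmooth g) :
    ContinuousOn (fun z : ℂ => lowerOp g z / (z.im : ℂ) ^ 2) {z : ℂ | 0 < z.im} :=
  hg.lower.smooth.continuousOn.div
    (Continuous.continuousOn (by fun_prop)) fun z (hz : 0 < z.im) => pow_ne_zero _ (by simpa using hz.ne')

theorem integrableOn_of_continuousOn_uhp {h : ℂ → ℂ} (hh : ContinuousOn h {z : ℂ | 0 < z.im})
    (H : ℝ) : IntegrableOn h (truncDomain H) := by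
  have hK : IsCompact (Set.Icc (-(1 / 2) : ℝ) (1 / 2) ×ℂ Set.Icc (1 / 2 : ℝ) H) :=
    isCompact_Icc.reProdIm isCompact_Icc
  refine ((hh.mono fun z hz => ?_).integrableOn_compact hK).mono_set fun z hz => ?_
  · have : (1 / 2 : ℝ) ≤ z.im := (Complex.mem_reProdIm.mp hz).2.1
    rw [Set.mem_ofPred_eq]
    linarith
  · obtain ⟨h1, h2, h3⟩ := truncDomain_bounds hz
    exact Complex.mem_reProdIm.mpr ⟨abs_le.mp h1, h2, h3⟩

/-- The fundamental domain of height two as the region between the unit circle and the line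
`Im z = 2`. -/
theorem setIntegral_truncDomain_two {h : ℂ → ℂ} (hh : ContinuousOn h {z : ℂ | 0 < z.im}) :
    ∫ z in truncDomain 2, h z =
      ∫ x in (-(1 / 2) : ℝ)..(1 / 2), ∫ y in (circ x)..2, h ((x : ℂ) + (y : ℂ) * I) := by
  set S : Set (ℝ × ℝ) := {q | |q.1| < 1 / 2 ∧ circ q.1 < q.2 ∧ q.2 < 2} with hS
  set f : ℝ × ℝ → ℂ := fun q => h ((q.1 : ℂ) + (q.2 : ℂ) * I) with hf
  have hpre : truncDomain 2 = measurableEquivRealProd ⁻¹' S := by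
    ext z
    simp only [truncDomain, Set.mem_ofPred_eq, hS, Set.mem_preimage,
      Complex.measurableEquivRealProd_apply]
    constructor
    · rintro ⟨h1, h2, h3, h4⟩
      refine ⟨h2, ?_, h4⟩
      rw [circ, Real.sqrt_lt' h3]
      have h5 : 1 < ‖z‖ ^ 2 := by nlinarith
      rw [← normSq_eq_norm_sq, normSq_apply] at h5
      linarith
    · rintro ⟨h2, h3, h4⟩
      have h5 : 0 < z.im := (Real.sqrt_nonneg _).trans_lt h3
      refine ⟨?_, h2, h5, h4⟩
      rw [circ, Real.sqrt_lt' h5] at h3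
      have h6 : 1 < ‖z‖ ^ 2 := by
        rw [← normSq_eq_norm_sq, normSq_apply]
        linarith
      nlinarith [norm_nonneg z]
  have hfun : h = f ∘ measurableEquivRealProd := by
    funext z
    simp [hf, Complex.measurableEquivRealProd_apply, Complex.re_add_im]
  have hint := integrableOn_of_continuousOn_uhp hh 2
  have hemb := measurableEquivRealProd.measurableEmbedding
  rw [hpre, hfun] at hint
  have hint' : IntegrableOn f S :=
    (volume_preserving_equiv_real_prod.integrableOn_comp_preimage hemb).mp hint
  have hSm : MeasurableSet S := by
    have h1 : Measurable circ := by
      unfold circ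
      fun_prop
    have e : S = {q : ℝ × ℝ | |q.1| < 1 / 2} ∩ ({q | circ q.1 < q.2} ∩ {q | q.2 < 2}) := by
      ext q; simp [hS]
    rw [e]
    refine MeasurableSet.inter ?_ (MeasurableSet.inter ?_ ?_)
    · exact measurableSet_lt (by fun_prop) measurable_const
    · exact measurableSet_lt (h1.comp measurable_fst) measurable_snd
    · exact measurableSet_lt measurable_snd measurable_const
  rw [hpre]
  conv_lhs => rw [hfun]
  have h1 : ∫ z in measurableEquivRealProd ⁻¹' S, (f ∘ measurableEquivRealProd) z =
      ∫ q in S, f q := volume_preserving_equiv_real_prod.setIntegral_preimage_emb hemb f S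
  rw [h1, ← integral_indicator hSm, Measure.volume_eq_prod,
    integral_prod _ ((integrable_indicator_iff hSm).mpr hint')]
  rw [intervalIntegral.integral_of_le (by norm_num), integral_Ioc_eq_integral_Ioo,
    ← integral_indicator measurableSet_Ioo]
  refine integral_congr_ae (Eventually.of_forall fun x => ?_)
  by_cases hx : x ∈ Set.Ioo (-(1 / 2) : ℝ) (1 / 2)
  · simp only [Set.indicator_of_mem hx]
    have hx' : |x| < 1 / 2 := abs_lt.mpr ⟨hx.1, hx.2⟩
    rw [intervalIntegral.integral_of_le (circ_lt_two x).le, integral_Ioc_eq_integral_Ioo,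
      ← integral_indicator measurableSet_Ioo]
    refine integral_congr_ae (Eventually.of_forall fun y => ?_)
    by_cases hy : y ∈ Set.Ioo (circ x) 2
    · have : ((x, y) : ℝ × ℝ) ∈ S := ⟨hx', hy.1, hy.2⟩
      simp only [Set.indicator_of_mem this, Set.indicator_of_mem hy, hf]
    · have : ((x, y) : ℝ × ℝ) ∉ S := fun h => hy ⟨h.2.1, h.2.2⟩
      simp only [Set.indicator_of_notMem this, Set.indicator_of_notMem hy]
  · simp only [Set.indicator_of_notMem hx]
    have : ∀ y, ((x, y) : ℝ × ℝ) ∉ S := fun y h => hx ⟨(abs_lt.mp h.1).1, (abs_lt.mp h.1).2⟩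
    simp only [Set.indicator_of_notMem (this _), integral_zero]

theorem fillHeight_pos {p : ℝ × ℝ} (hx : |p.1| < 1) (h0 : 0 ≤ p.2) (h1 : p.2 ≤ 1) :
    0 < fillHeight p := by
  have h2 := circ_pos hx
  unfold fillHeight
  rcases h0.lt_or_eq with h | h
  · have : 0 ≤ (1 - p.2) * circ p.1 := mul_nonneg (by linarith) h2.le
    linarith
  · rw [← h]
    simpa using h2

theorem im_fillPoint (p : ℝ × ℝ) : (fillPoint p).im = fillHeight p := im_add_mul_I _ _

/-- Stokes' theorem on the fundamental domain truncated at height two, for a periodic function: the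
vertical sides cancel. -/
theorem stokes_truncDomain (hg : IsPeriodicSmooth g) :
    ∫ z in truncDomain 2, lowerOp g z / (z.im : ℂ) ^ 2 = xMean g 2 - arcInt g := by
  have hcirc : ∀ x : ℝ, |x| < 1 → DifferentiableAt ℝ circ x := fun x hx =>
    (hasDerivAt_circ hx).differentiableAt
  -- the two components of the pullback of `g dz` to the parameter square
  set f : ℝ × ℝ → ℂ := fun p => -I * g (fillPoint p) * (2 - circ p.1 : ℝ) with hf
  set k : ℝ × ℝ → ℂ := fun p =>
    g (fillPoint p) * (1 + I * ((1 - p.2) * (-p.1 / circ p.1) : ℝ)) with hk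
  have hdfill : ∀ p : ℝ × ℝ, |p.1| < 1 → DifferentiableAt ℝ fillPoint p := by
    intro p hp
    have h1 : DifferentiableAt ℝ (fun p : ℝ × ℝ => circ p.1) p :=
      (hcirc p.1 hp).comp p differentiableAt_fst
    have h2 : DifferentiableAt ℝ fillHeight p := by
      unfold fillHeight
      fun_prop
    have h3 : DifferentiableAt ℝ (fun p : ℝ × ℝ => ((fillHeight p : ℝ) : ℂ)) p :=
      ofRealCLM.differentiableAt.comp p h2
    have h4 : DifferentiableAt ℝ (fun p : ℝ × ℝ => ((p.1 : ℝ) : ℂ)) p :=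
      ofRealCLM.differentiableAt.comp p differentiableAt_fst
    exact h4.add (h3.mul_const I)
  have hdg : ∀ p : ℝ × ℝ, |p.1| < 1 → 0 < fillHeight p →
      DifferentiableAt ℝ (fun p => g (fillPoint p)) p := by
    intro p hp hp'
    have := (hg.hasFDerivAt (z := fillPoint p) (by rw [im_fillPoint]; exact hp')).differentiableAt
    exact this.comp p (hdfill p hp)
  have hdf : ∀ p : ℝ × ℝ, |p.1| < 1 → 0 < fillHeight p → DifferentiableAt ℝ f p := by
    intro p hp hp'
    have h1 : DifferentiableAt ℝ (fun p : ℝ × ℝ => (2 - circ p.1 : ℝ)) p :=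
      ((hcirc p.1 hp).comp p differentiableAt_fst).const_sub 2
    have h2 : DifferentiableAt ℝ (fun p : ℝ × ℝ => ((2 - circ p.1 : ℝ) : ℂ)) p :=
      ofRealCLM.differentiableAt.comp p h1
    exact ((hdg p hp hp').const_mul (-I)).mul h2
  have hdk : ∀ p : ℝ × ℝ, |p.1| < 1 → 0 < fillHeight p → DifferentiableAt ℝ k p := by
    intro p hp hp'
    have hc : circ p.1 ≠ 0 := (circ_pos hp).ne'
    have h0 : DifferentiableAt ℝ (fun p : ℝ × ℝ => circ p.1) p :=
      (hcirc p.1 hp).comp p differentiableAt_fst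
    have h3 : DifferentiableAt ℝ (fun p : ℝ × ℝ => -p.1) p := differentiableAt_fst.fun_neg
    have h4 : DifferentiableAt ℝ (fun p : ℝ × ℝ => -p.1 / circ p.1) p := by
      simp only [div_eq_mul_inv]
      exact h3.fun_mul (h0.fun_inv hc)
    have h1 : DifferentiableAt ℝ (fun p : ℝ × ℝ => (1 - p.2) * (-p.1 / circ p.1)) p :=
      (differentiableAt_snd.const_sub 1).fun_mul h4
    have h2 : DifferentiableAt ℝ
        (fun p : ℝ × ℝ => (((1 - p.2) * (-p.1 / circ p.1) : ℝ) : ℂ)) p :=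
      ofRealCLM.differentiableAt.comp p h1
    exact (hdg p hp hp').mul ((h2.const_mul I).const_add 1)
  have hdiv : ∀ p : ℝ × ℝ, |p.1| < 1 → 0 < fillHeight p →
      fderiv ℝ f p (1, 0) + fderiv ℝ k p (0, 1) =
        (2 - circ p.1 : ℝ) * (lowerOp g (fillPoint p) / ((fillPoint p).im : ℂ) ^ 2) := by
    rintro ⟨x, t⟩ hp hp'
    have hz : 0 < (fillPoint (x, t)).im := by rw [im_fillPoint]; exact hp'
    rw [lowerOp_div g hz]
    set L := fderiv ℝ g (fillPoint (x, t)) with hL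
    have hgL : HasFDerivAt g L (fillPoint (x, t)) := hg.hasFDerivAt hz
    have hLin : ∀ r : ℝ, L ((r : ℂ) * I) = r * L I := fun r => by
      have : (r : ℂ) * I = r • I := by rw [real_smul]
      rw [this, map_smul, real_smul]
    have hσ := hasDerivAt_circ hp
    -- derivative in the abscissa
    have hx1 : HasDerivAt (fun s : ℝ => fillPoint (s, t))
        (1 + (((1 - t) * (-x / circ x) : ℝ) : ℂ) * I) x := by
      have h1 : HasDerivAt (fun s : ℝ => fillHeight (s, t)) ((1 - t) * (-x / circ x)) x :=
        (hσ.const_mul (1 - t)).add_const (2 * t)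
      exact (HasDerivAt.ofReal_comp (hasDerivAt_id x)).add (h1.ofReal_comp.mul_const I)
    have hx2 : HasDerivAt (fun s : ℝ => g (fillPoint (s, t)))
        (L 1 + ((1 - t) * (-x / circ x) : ℝ) * L I) x := by
      have := hgL.comp_hasDerivAt x hx1
      rw [map_add, hLin] at this
      exact this
    have hx3 : HasDerivAt (fun s : ℝ => f (s, t))
        (-I * (L 1 + ((1 - t) * (-x / circ x) : ℝ) * L I) * (2 - circ x : ℝ) +
          -I * g (fillPoint (x, t)) * ((-(-x / circ x) : ℝ) : ℂ)) x :=
      (hx2.const_mul (-I)).mul (hσ.const_sub 2).ofReal_comp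
    have hx4 : HasDerivAt (fun s : ℝ => f (s, t)) (fderiv ℝ f (x, t) (1, 0)) x := by
      have h1 : HasDerivAt (fun s : ℝ => ((s, t) : ℝ × ℝ)) (1, 0) x :=
        (hasDerivAt_id x).prodMk (hasDerivAt_const x t)
      exact (hdf (x, t) hp hp').hasFDerivAt.comp_hasDerivAt x h1
    -- derivative in the parameter of the segment
    have ht1 : HasDerivAt (fun s : ℝ => fillPoint (x, s)) ((2 - circ x : ℝ) * I) t := by
      have h1 : HasDerivAt (fun s : ℝ => fillHeight (x, s)) (2 - circ x) t := by
        have := (((hasDerivAt_id t).const_sub 1).mul_const (circ x)).add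
          ((hasDerivAt_id t).const_mul 2)
        exact this.congr_deriv (by ring)
      exact (h1.ofReal_comp.mul_const I).const_add (x : ℂ)
    have ht2 : HasDerivAt (fun s : ℝ => g (fillPoint (x, s))) ((2 - circ x : ℝ) * L I) t := by
      have := hgL.comp_hasDerivAt t ht1
      rw [hLin] at this
      exact this
    have ht3 : HasDerivAt (fun s : ℝ => k (x, s))
        ((2 - circ x : ℝ) * L I * (1 + I * ((1 - t) * (-x / circ x) : ℝ)) +
          g (fillPoint (x, t)) * (I * ((-1 * (-x / circ x) : ℝ) : ℂ))) t := by
      have h1 : HasDerivAt (fun s : ℝ => (1 - s) * (-x / circ x)) (-1 * (-x / circ x)) t :=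
        ((hasDerivAt_id t).const_sub 1).mul_const _
      exact ht2.mul ((h1.ofReal_comp.const_mul I).const_add 1)
    have ht4 : HasDerivAt (fun s : ℝ => k (x, s)) (fderiv ℝ k (x, t) (0, 1)) t := by
      have h1 : HasDerivAt (fun s : ℝ => ((x, s) : ℝ × ℝ)) (0, 1) t :=
        (hasDerivAt_const t x).prodMk (hasDerivAt_id t)
      exact (hdk (x, t) hp hp').hasFDerivAt.comp_hasDerivAt t h1
    rw [hx4.unique hx3, ht4.unique ht3]
    push_cast
    ring
  have hbox : ∀ p ∈ Set.uIcc (-(1 / 2) : ℝ) (1 / 2) ×ˢ Set.uIcc (0 : ℝ) 1,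
      |p.1| < 1 ∧ 0 < fillHeight p := by
    rintro p ⟨h1, h2⟩
    rw [Set.uIcc_of_le (by norm_num)] at h1 h2
    have h3 : |p.1| < 1 := abs_lt.mpr ⟨by linarith [h1.1], by linarith [h1.2]⟩
    exact ⟨h3, fillHeight_pos h3 h2.1 h2.2⟩
  have hbox' : ∀ p ∈ Set.Ioo (min (-(1 / 2) : ℝ) (1 / 2)) (max (-(1 / 2)) (1 / 2)) ×ˢ
      Set.Ioo (min (0 : ℝ) 1) (max 0 1), |p.1| < 1 ∧ 0 < fillHeight p := fun p hp =>
    hbox p ⟨Set.Ioo_subset_Icc_self hp.1, Set.Ioo_subset_Icc_self hp.2⟩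
  have hcont : ContinuousOn (fun p : ℝ × ℝ => ((2 - circ p.1 : ℝ) : ℂ) *
      (lowerOp g (fillPoint p) / ((fillPoint p).im : ℂ) ^ 2))
      (Set.uIcc (-(1 / 2) : ℝ) (1 / 2) ×ˢ Set.uIcc (0 : ℝ) 1) := by
    have h1 : Continuous fun p : ℝ × ℝ => ((2 - circ p.1 : ℝ) : ℂ) := by
      unfold circ
      fun_prop
    refine h1.continuousOn.mul ((continuousOn_lowerOp_div hg).comp (f := fillPoint)
      (fun p hp => (hdfill p (hbox p hp).1).continuousAt.continuousWithinAt) fun p hp => ?_)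
    rw [Set.mem_ofPred_eq, im_fillPoint]
    exact (hbox p hp).2
  have hmain := integral2_divergence_prod_of_hasFDerivAt f k (fderiv ℝ f) (fderiv ℝ k)
    (-(1 / 2)) 0 (1 / 2) 1
    (fun p hp => (hdf p (hbox p hp).1 (hbox p hp).2).continuousAt.continuousWithinAt)
    (fun p hp => (hdk p (hbox p hp).1 (hbox p hp).2).continuousAt.continuousWithinAt)
    (fun p hp => (hdf p (hbox' p hp).1 (hbox' p hp).2).hasFDerivAt)
    (fun p hp => (hdk p (hbox' p hp).1 (hbox' p hp).2).hasFDerivAt)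
    ((hcont.integrableOn_compact (isCompact_uIcc.prod isCompact_uIcc)).congr_fun
      (fun p hp => (hdiv p (hbox p hp).1 (hbox p hp).2).symm)
      (measurableSet_uIcc.prod measurableSet_uIcc))
  rw [setIntegral_truncDomain_two (continuousOn_lowerOp_div hg)]
  have hleft : ∫ x in (-(1 / 2) : ℝ)..(1 / 2), ∫ y in (circ x)..2,
      lowerOp g ((x : ℂ) + (y : ℂ) * I) / ((((x : ℂ) + (y : ℂ) * I)).im : ℂ) ^ 2 =
      ∫ x in (-(1 / 2) : ℝ)..(1 / 2), ∫ t in (0 : ℝ)..1,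
        fderiv ℝ f (x, t) (1, 0) + fderiv ℝ k (x, t) (0, 1) := by
    refine intervalIntegral.integral_congr fun x hx => ?_
    have h1 : ∫ t in (0 : ℝ)..1, fderiv ℝ f (x, t) (1, 0) + fderiv ℝ k (x, t) (0, 1) =
        ∫ t in (0 : ℝ)..1, ((2 - circ x : ℝ) : ℂ) *
          (fun y : ℝ => lowerOp g ((x : ℂ) + (y : ℂ) * I) /
            ((((x : ℂ) + (y : ℂ) * I)).im : ℂ) ^ 2) ((2 - circ x) * t + circ x) := by
      refine intervalIntegral.integral_congr fun t ht => ?_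
      have hb := hbox (x, t) ⟨hx, ht⟩
      simp only
      rw [hdiv (x, t) hb.1 hb.2]
      have : fillPoint (x, t) = (x : ℂ) + (((2 - circ x) * t + circ x : ℝ) : ℂ) * I := by
        rw [fillPoint, fillHeight]
        push_cast
        ring
      rw [this]
    rw [h1, intervalIntegral.integral_const_mul]
    have h2 := intervalIntegral.smul_integral_comp_mul_add (a := 0) (b := 1)
      (fun y : ℝ => lowerOp g ((x : ℂ) + (y : ℂ) * I) /
            ((((x : ℂ) + (y : ℂ) * I)).im : ℂ) ^ 2) (2 - circ x) (circ x)
    rw [real_smul] at h2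
    rw [h2]
    congr 1 <;> ring
  rw [hleft, hmain]
  have hsides : ∫ t in (0 : ℝ)..1, f (1 / 2, t) = ∫ t in (0 : ℝ)..1, f (-(1 / 2), t) := by
    refine intervalIntegral.integral_congr fun t ht => ?_
    have hb := hbox (-(1 / 2), t) ⟨Set.left_mem_uIcc, ht⟩
    have h1 : circ (1 / 2) = circ (-(1 / 2)) := by simp [circ]
    have h2 : fillPoint (1 / 2, t) = fillPoint (-(1 / 2), t) + 1 := by
      simp only [fillPoint, fillHeight, h1]
      push_cast
      ring
    simp only [hf, h1, h2]
    rw [hg.periodic _ (by rw [im_fillPoint]; exact hb.2)]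
  have htop : ∫ x in (-(1 / 2) : ℝ)..(1 / 2), k (x, 1) = xMean g 2 := by
    have hper : Function.Periodic (fun x : ℝ => g ((x : ℂ) + ((2 : ℝ) : ℂ) * I)) 1 := fun x => by
      have := hg.periodic ((x : ℂ) + ((2 : ℝ) : ℂ) * I) (by rw [im_add_mul_I]; exact two_pos)
      simp only [ofReal_add, ofReal_one]
      rw [← this]
      congr 1
      ring
    have h1 := hper.intervalIntegral_add_eq (-(1 / 2)) 0
    have h2 : ∀ x : ℝ, k (x, 1) = g ((x : ℂ) + ((2 : ℝ) : ℂ) * I) := fun x => by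
      simp [hk, fillPoint, fillHeight]
    simp only [h2]
    rw [xMean]
    norm_num at h1 ⊢
    exact h1
  have hbot : ∫ x in (-(1 / 2) : ℝ)..(1 / 2), k (x, 0) = arcInt g := by
    rw [arcInt]
    refine intervalIntegral.integral_congr fun x _ => ?_
    simp only [hk, fillPoint, fillHeight]
    push_cast
    ring_nf
  rw [hsides, htop, hbot]
  ring

end Stokes

/-! ### Differentiation of the lifts under the integral -/

/-- The common factor `y ^ (m + 1) ⟨x, Z̄⟩ ^ m ⟨x, u⟩ e ^ (-2 π y ⟨x_Z, x_Z⟩)` to which the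
derivatives of the kernels of the two lifts reduce. -/
noncomputable def bdry (m : ℕ) (Z u : CplxSpace n) (x : RealSpace n) (y : ℝ) : ℂ :=
  (y : ℂ) ^ (m + 1) * M.bC (toCplx x) (cconj Z) ^ m * M.bC (toCplx x) u *
    cexp (-(2 * Real.pi * y * kap M x Z (cconj Z)))

/-- The derivative of `bdry` in `y`. -/
noncomputable def bdryDeriv (m : ℕ) (Z u : CplxSpace n) (x : RealSpace n) (y : ℝ) : ℂ :=
  (y : ℂ) ^ m * M.bC (toCplx x) (cconj Z) ^ m * M.bC (toCplx x) u *
    cexp (-(2 * Real.pi * y * kap M x Z (cconj Z))) *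
    ((m + 1 : ℕ) - 2 * Real.pi * y * kap M x Z (cconj Z))

theorem hasDerivAt_bdry (m : ℕ) (Z u : CplxSpace n) (x : RealSpace n) (y : ℝ) :
    HasDerivAt (bdry M m Z u x) (bdryDeriv M m Z u x y) y := by
  set κ := kap M x Z (cconj Z) with hκ
  have h0 : HasDerivAt (fun y : ℝ => (y : ℂ)) 1 y := ofRealCLM.hasDerivAt
  have h1 : HasDerivAt (fun y : ℝ => (y : ℂ) ^ (m + 1)) ((m + 1 : ℕ) * (y : ℂ) ^ m) y := by
    simpa using h0.fun_pow (m + 1)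
  have h2 : HasDerivAt (fun y : ℝ => cexp (-(2 * Real.pi * y * κ)))
      (cexp (-(2 * Real.pi * y * κ)) * (-(2 * Real.pi * κ))) y := by
    have h3 : HasDerivAt (fun y : ℝ => -(2 * Real.pi * (y : ℂ) * κ)) (-(2 * Real.pi * κ)) y := by
      have := ((h0.const_mul (2 * Real.pi : ℂ)).mul_const κ).fun_neg
      simpa using this
    exact h3.cexp
  have h4 := ((h1.mul_const (M.bC (toCplx x) (cconj Z) ^ m)).mul_const
    (M.bC (toCplx x) u)).fun_mul h2
  refine h4.congr_deriv ?_
  rw [bdryDeriv, ← hκ]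
  ring

/-- The derivative of the kernel of degree `m + 1` in the direction `u` of the second variable, where
`u` is orthogonal to `Z`, is the `y`-derivative of `bdry`. -/
theorem fderiv_kernReg_snd (m : ℕ) {Z u : CplxSpace n} (hZ : M.bC Z (cconj Z) ≠ 0)
    (hu : M.bC u Z = 0) (x : RealSpace n) {y : ℝ} (hy : 0 < y) :
    fderiv ℂ (kernReg M (m + 1) x y) (0, (Z, cconj Z)) (0, (0, u)) = bdryDeriv M m Z u x y := by
  have h := hasDerivAt_line (v := (0, (0, u)))
    (differentiableAt_kernReg M (j := m + 1) (x := x) hy (q := (0, (Z, cconj Z))) hZ)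
  refine h.unique ?_
  have hy' : (y : ℂ) ≠ 0 := by simpa using hy.ne'
  set a := M.bC (toCplx x) Z with ha
  set w := M.bC (toCplx x) (cconj Z) with hw
  set b := M.bC (toCplx x) u with hb
  set N := M.bC Z (cconj Z) with hN
  have hfun : (fun s : ℂ => kernReg M (m + 1) x y ((0, (Z, cconj Z)) + s • (0, (0, u)))) =
      fun s : ℂ => (y : ℂ) ^ m * ((w + s * b) ^ (m + 1) *
        cexp (-(2 * Real.pi * y * (2 * a * (w + s * b) / N)))) := by
    funext s
    have hu' : M.bC Z u = 0 := by rw [bC_comm, hu]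
    simp only [kernReg, kern, kap, Prod.fst_add, Prod.snd_add, Prod.smul_fst, Prod.smul_snd,
      bC_add_right, bC_smul_right, smul_zero, add_zero, hu', mul_zero, neg_zero, cpow_zero,
      mul_one, ← ha, ← hw, ← hb, ← hN]
    field_simp
    ring
  rw [hfun]
  have h1 : HasDerivAt (fun s : ℂ => w + s * b) b 0 := by
    simpa using ((hasDerivAt_id (0 : ℂ)).mul_const b).const_add w
  have h2 : HasDerivAt (fun s : ℂ => -(2 * Real.pi * y * (2 * a * (w + s * b) / N)))
      (-(2 * Real.pi * y * (2 * a * b / N))) 0 :=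
    (((h1.const_mul (2 * a)).div_const N).const_mul (2 * Real.pi * y : ℂ)).fun_neg
  refine (((h1.fun_pow (m + 1)).fun_mul h2.cexp).const_mul ((y : ℂ) ^ m)).congr_deriv ?_
  have hk : kap M x Z (cconj Z) = 2 * a * w / N := rfl
  rw [bdryDeriv, hk, ← hw, ← hb]
  simp only [zero_mul, add_zero, Nat.add_sub_cancel]
  field_simp
  ring

/-- The derivative of the kernel of degree `m` in the direction `v` of the first variable is a
multiple of `bdry` itself, for the component of `v` orthogonal to `Z̄`. -/
theorem fderiv_kernReg_fst (m : ℕ) {Z : CplxSpace n} (hZ : M.bC Z (cconj Z) ≠ 0)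
    (v : CplxSpace n) (x : RealSpace n) {y : ℝ} (hy : 0 < y) :
    fderiv ℂ (kernReg M m x y) (0, (Z, cconj Z)) (0, (v, 0)) =
      -(4 * Real.pi / M.bC Z (cconj Z)) *
        (bdry M (m + 1) Z (v - (M.bC v (cconj Z) / M.bC Z (cconj Z)) • Z) x y / (y : ℂ) ^ 2) := by
  have h := hasDerivAt_line (v := (0, (v, 0)))
    (differentiableAt_kernReg M (j := m) (x := x) hy (q := (0, (Z, cconj Z))) hZ)
  refine h.unique ?_
  have hy' : (y : ℂ) ≠ 0 := by simpa using hy.ne'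
  set a := M.bC (toCplx x) Z with ha
  set w := M.bC (toCplx x) (cconj Z) with hw
  set b := M.bC (toCplx x) v with hb
  set N := M.bC Z (cconj Z) with hN
  set d := M.bC v (cconj Z) with hd
  have hfun : (fun s : ℂ => kernReg M m x y ((0, (Z, cconj Z)) + s • (0, (v, 0)))) =
      fun s : ℂ => (y : ℂ) ^ (m + 1) * w ^ m / (y : ℂ) ^ 2 *
        cexp (-(2 * Real.pi * y * (2 * (a + s * b) * w / (N + s * d)))) := by
    funext s
    simp only [kernReg, kern, kap, Prod.fst_add, Prod.snd_add, Prod.smul_fst, Prod.smul_snd,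
      bC_add_right, bC_smul_right, bC_add_left, bC_smul_left, smul_zero, add_zero,
      neg_zero, cpow_zero, mul_one, ← ha, ← hw, ← hb, ← hN, ← hd]
    field_simp
  rw [hfun]
  have h1 : HasDerivAt (fun s : ℂ => a + s * b) b 0 := by
    simpa using ((hasDerivAt_id (0 : ℂ)).mul_const b).const_add a
  have h1' : HasDerivAt (fun s : ℂ => N + s * d) d 0 := by
    simpa using ((hasDerivAt_id (0 : ℂ)).mul_const d).const_add N
  have hN0 : N + 0 * d ≠ 0 := by simpa using hZ
  have h2 := ((((h1.const_mul 2).mul_const w).fun_div h1' hN0).const_mul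
    (2 * Real.pi * y : ℂ)).fun_neg
  refine (h2.cexp.const_mul ((y : ℂ) ^ (m + 1) * w ^ m / (y : ℂ) ^ 2)).congr_deriv ?_
  have hk : kap M x Z (cconj Z) = 2 * a * w / N := rfl
  rw [bdry, hk, bC_sub_right, bC_smul_right, ← hw, ← hb, ← ha]
  simp only [zero_mul, add_zero]
  field_simp
  ring

theorem contDiff_bdry (m : ℕ) (Z u : CplxSpace n) (x : RealSpace n) :
    ContDiff ℝ ∞ (bdry M m Z u x) := by
  have h : ContDiff ℝ ∞ (fun y : ℝ => (y : ℂ)) := ofRealCLM.contDiff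
  unfold bdry
  fun_prop

theorem continuous_bdryDeriv (m : ℕ) (Z u : CplxSpace n) (x : RealSpace n) :
    Continuous (bdryDeriv M m Z u x) := by
  unfold bdryDeriv
  fun_prop

theorem bdry_zero_left (m : ℕ) (Z u : CplxSpace n) (y : ℝ) : bdry M m Z u 0 y = 0 := by
  have : toCplx (0 : RealSpace n) = 0 := by ext i; simp [toCplx]
  rw [bdry, this, bC_zero_left M u, mul_zero, zero_mul]

section Local

variable {M} {F : ℍ → M.Disc → ℂ}

theorem isPeriodicSmooth_twist_mul_bdry (hF : LiftInput M F) (m : ℕ) (Z u : CplxSpace n)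
    (l : M.dual) : IsPeriodicSmooth fun z => twist M F l z * bdry M m Z u l z.im where
  smooth := (hF.periodic l).smooth.mul
    ((contDiff_bdry M m Z u l).comp imCLM.contDiff).contDiffOn
  periodic := fun z hz => by
    have h : (z + 1).im = z.im := by simp
    rw [(hF.periodic l).periodic z hz, h]

/-- The product rule that turns the sum of both integrands into a boundary term. -/
theorem lowerOp_twist_mul_bdry (hF : LiftInput M F) (m : ℕ) (Z u : CplxSpace n) (l : M.dual)
    {z : ℂ} (hz : 0 < z.im) :
    lowerOp (fun z => twist M F l z * bdry M m Z u l z.im) z / (z.im : ℂ) ^ 2 =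
      twist M F l z * bdryDeriv M m Z u l z.im +
        twist M (maassLower M F) l z * (bdry M m Z u l z.im / (z.im : ℂ) ^ 2) := by
  have h1 := (hF.periodic l).hasFDerivAt hz
  have h2 : HasFDerivAt (fun z : ℂ => bdry M m Z u l z.im)
      (imCLM.smulRight (bdryDeriv M m Z u l z.im)) z := by
    have := (hasDerivAt_bdry M m Z u l z.im).hasFDerivAt.comp z imCLM.hasFDerivAt
    refine this.congr_fderiv ?_
    ext w
    simp
  have h3 := (h1.fun_mul h2).fderiv
  rw [lowerOp_div _ hz, h3, twist_maassLower hF.smooth l hz, mul_div_assoc', ← div_mul_eq_mul_div,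
    lowerOp_div _ hz]
  simp
  ring

/-- The contribution of `F` and of the lowered form to the compact part is a boundary term. -/
theorem setIntegral_twist_mul_bdry (hF : LiftInput M F) (m : ℕ) (Z u : CplxSpace n) (l : M.dual) :
    ∫ z in truncDomain 2, (twist M F l z * bdryDeriv M m Z u l z.im +
        twist M (maassLower M F) l z * (bdry M m Z u l z.im / (z.im : ℂ) ^ 2)) =
      xMean (twist M F l) 2 * bdry M m Z u l 2 -
        arcInt fun z => twist M F l z * bdry M m Z u l z.im := by
  have h := stokes_truncDomain (isPeriodicSmooth_twist_mul_bdry hF m Z u l)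
  have h1 : xMean (fun z => twist M F l z * bdry M m Z u l z.im) 2 =
      xMean (twist M F l) 2 * bdry M m Z u l 2 := by
    rw [xMean, xMean, ← intervalIntegral.integral_mul_const]
    simp only [im_add_mul_I]
  rw [h1] at h
  rw [← h]
  refine setIntegral_congr_fun (isOpen_truncDomain 2).measurableSet fun z hz => ?_
  exact (lowerOp_twist_mul_bdry hF m Z u l (truncDomain_subset_uhp 2 hz)).symm

end Local

/-! ### Cancellation of the boundary terms -/

section Boundary

variable {M} {F : ℍ → M.Disc → ℂ}

/-- A singular hyperplane of the lift of the lowered form is one of the lift of `F`. -/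
theorem xMean_maassLower_eq_zero (hF : LiftInput M F) (l : M.dual)
    (h : ∀ y : ℝ, 0 < y → xMean (twist M F l) y = 0) {y : ℝ} (hy : 0 < y) :
    xMean (twist M (maassLower M F) l) y = 0 := by
  rw [xMean_congr (twist_maassLower hF.smooth l) hy]
  have h1 := (hF.periodic l).hasDerivAt_xMean hy
  have h2 : HasDerivAt (xMean (twist M F l)) 0 y :=
    (hasDerivAt_const y (0 : ℂ)).congr_of_eventuallyEq (by
      filter_upwards [lt_mem_nhds hy] with t ht using h t ht)
  have h3 := h1.unique h2
  have hy' : (y : ℂ) ^ 2 ≠ 0 := pow_ne_zero _ (by simpa using hy.ne')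
  simpa [hy'] using h3

theorem IsAdmissible.integrableOn_tail (hF : LiftInput M F) {j : ℕ}
    {V : Set (CplxSpace n × CplxSpace n)} (hV : IsAdmissible M F j V)
    {p : CplxSpace n × CplxSpace n} (hp : p ∈ V) {l : M.dual} (hl : l ≠ 0) (c d : ℂ) :
    IntegrableOn (fun y : ℝ => xMean (twist M F l) y * kernReg M j l y (0, p) * (c + d * y))
      (Set.Ioi 2) := by
  obtain ⟨u, δ, -, hδ, hu⟩ := hV.exists_tail_bound 1
  have hq : ((0 : ℂ), p) ∈ contDomain 1 V := ⟨by simp, hp⟩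
  obtain ⟨C, hC, hb⟩ := exists_pow_le_exp 1 (half_pos hδ)
  have hm : AEStronglyMeasurable (fun y : ℝ => xMean (twist M F l) y * kernReg M j l y (0, p) *
      (c + d * y)) (volume.restrict (Set.Ioi 2)) := by
    refine (aestronglyMeasurable_xMean_mul_kernReg hF j l (0, p)).mul ?_
    exact Continuous.aestronglyMeasurable (by fun_prop)
  refine Integrable.mono' (g := fun y : ℝ => |u l| * ((‖c‖ + ‖d‖) * C) * Real.exp (-(δ / 2) * y))
    ((integrableOn_exp_mul_Ioi (by linarith) 2).const_mul _) hm ?_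
  filter_upwards [ae_restrict_mem measurableSet_Ioi] with y hy
  have hy2 : (2 : ℝ) < y := hy
  have hy0 : 0 ≤ y := by linarith
  have h1 := hu l hl _ hq y hy2.le
  have h2 : ‖c + d * y‖ ≤ (‖c‖ + ‖d‖) * C * Real.exp (δ / 2 * y) := by
    have h3 := hb y hy0
    rw [pow_one] at h3
    refine (norm_add_le _ _).trans ?_
    rw [norm_mul, Complex.norm_real, Real.norm_eq_abs, abs_of_nonneg hy0, mul_assoc]
    nlinarith [norm_nonneg c, norm_nonneg d, mul_nonneg (norm_nonneg c) hy0,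
      mul_le_mul_of_nonneg_left h3 (add_nonneg (norm_nonneg c) (norm_nonneg d))]
  rw [norm_mul]
  calc _ ≤ (|u l| * Real.exp (-δ * y)) * ((‖c‖ + ‖d‖) * C * Real.exp (δ / 2 * y)) := by
        refine mul_le_mul (h1.trans ?_) h2 (norm_nonneg _) (by positivity)
        exact mul_le_mul_of_nonneg_right (le_abs_self _) (Real.exp_pos _).le
    _ = |u l| * ((‖c‖ + ‖d‖) * C) * (Real.exp (-δ * y) * Real.exp (δ / 2 * y)) := by ring
    _ = _ := by
        rw [← Real.exp_add]
        ring_nf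

theorem kernReg_at_zero (j : ℕ) (x : RealSpace n) (y : ℝ) (p : CplxSpace n × CplxSpace n) :
    kernReg M j x y (0, p) = kern M j x y p / (y : ℂ) ^ 2 := by
  simp [kernReg]

/-- In the part `Im τ > 2` of the fundamental domain the integrands of a vector `λ ≠ 0` add up to
the derivative of a function that decays at the cusp. -/
theorem IsAdmissible.integral_tail (hF : LiftInput M F) (hLF : LiftInput M (maassLower M F)) {m : ℕ}
    {V V' : Set (CplxSpace n × CplxSpace n)} (hV : IsAdmissible M F (m + 2) V)
    (hV' : IsAdmissible M (maassLower M F) m V') {Z : CplxSpace n}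
    (hZV : (Z, cconj Z) ∈ V) (hZV' : (Z, cconj Z) ∈ V')
    {l : M.dual} (hl : l ≠ 0) (hreg : M.bC (toCplx (l : RealSpace n)) Z = 0 →
      ∀ y : ℝ, 0 < y → xMean (twist M F l) y = 0) (u : CplxSpace n) :
    (∫ y in Set.Ioi (2 : ℝ), xMean (twist M F l) y * bdryDeriv M (m + 1) Z u l y) +
      (∫ y in Set.Ioi (2 : ℝ), xMean (twist M (maassLower M F) l) y *
        (bdry M (m + 1) Z u l y / (y : ℂ) ^ 2)) = -(xMean (twist M F l) 2 * bdry M (m + 1) Z u l 2) := by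
  by_cases hz : M.bC (toCplx (l : RealSpace n)) Z = 0
  · have h0 := hreg hz
    rw [h0 2 two_pos, setIntegral_eq_zero_of_forall_eq_zero, setIntegral_eq_zero_of_forall_eq_zero]
    · simp
    · intro y hy
      rw [xMean_maassLower_eq_zero hF l h0 (two_pos.trans hy), zero_mul]
    · intro y hy
      rw [h0 y (two_pos.trans hy), zero_mul]
  set w := M.bC (toCplx (l : RealSpace n)) (cconj Z) with hw
  -- both integrands are the dominated ones of the two lifts, up to a factor linear in `y`
  have hw0 : w ≠ 0 := by
    rw [hw, bC_cconj_right]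
    simpa using hz
  set b := M.bC (toCplx (l : RealSpace n)) u with hb
  set κ := kap M l Z (cconj Z) with hκ
  have e1 : ∀ y ∈ Set.Ioi (2 : ℝ), xMean (twist M F l) y * bdryDeriv M (m + 1) Z u l y =
      xMean (twist M F l) y * kernReg M (m + 2) l y (0, (Z, cconj Z)) *
        (b / w * (m + 2) + (-(b / w * (2 * Real.pi * κ))) * y) := by
    intro y hy
    have hy0 : (y : ℂ) ≠ 0 := by simpa using (two_pos.trans hy).ne'
    rw [kernReg_at_zero, bdryDeriv, kern, ← hw, ← hb, ← hκ]
    push_cast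
    field_simp
    ring
  have e2 : ∀ y ∈ Set.Ioi (2 : ℝ), xMean (twist M (maassLower M F) l) y *
      (bdry M (m + 1) Z u l y / (y : ℂ) ^ 2) =
      xMean (twist M (maassLower M F) l) y * kernReg M m l y (0, (Z, cconj Z)) *
        (0 + w * b * y) := by
    intro y hy
    have hy0 : (y : ℂ) ≠ 0 := by simpa using (two_pos.trans hy).ne'
    rw [kernReg_at_zero, bdry, kern, ← hw, ← hb, ← hκ]
    field_simp
    ring
  have i1 := (hV.integrableOn_tail hF hZV hl (b / w * (m + 2))
    (-(b / w * (2 * Real.pi * κ)))).congr_fun (fun y hy => (e1 y hy).symm) measurableSet_Ioi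
  have i2 := (hV'.integrableOn_tail hLF hZV' hl 0 (w * b)).congr_fun
    (fun y hy => (e2 y hy).symm) measurableSet_Ioi
  have hder : ∀ y : ℝ, 0 < y → HasDerivAt
      (fun y => xMean (twist M F l) y * bdry M (m + 1) Z u l y)
      (xMean (twist M F l) y * bdryDeriv M (m + 1) Z u l y +
        xMean (twist M (maassLower M F) l) y * (bdry M (m + 1) Z u l y / (y : ℂ) ^ 2)) y := by
    intro y hy
    refine (((hF.periodic l).hasDerivAt_xMean hy).fun_mul
      (hasDerivAt_bdry M (m + 1) Z u l y)).congr_deriv ?_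
    rw [xMean_congr (twist_maassLower hF.smooth l) hy]
    ring
  have hlim : Tendsto (fun y => xMean (twist M F l) y * bdry M (m + 1) Z u l y) atTop (𝓝 0) := by
    obtain ⟨C, δ, hC, hδ, h⟩ := hV.tail
    have hexp : Tendsto (fun y : ℝ => ‖b / w‖ * (C * Real.exp (-δ * nrm2 (l : RealSpace n))) *
        Real.exp (-δ * y)) atTop (𝓝 0) := by
      have h1 : Tendsto (fun y : ℝ => Real.exp (-δ * y)) atTop (𝓝 0) :=
        Real.tendsto_exp_atBot.comp (tendsto_id.const_mul_atTop_of_neg (neg_lt_zero.mpr hδ))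
      simpa using h1.const_mul (‖b / w‖ * (C * Real.exp (-δ * nrm2 (l : RealSpace n))))
    refine squeeze_zero_norm' ?_ hexp
    filter_upwards [eventually_ge_atTop 2] with y hy
    have hy0 : (y : ℂ) ≠ 0 := by
      have : y ≠ 0 := by linarith
      simpa using this
    have h1 : xMean (twist M F l) y * bdry M (m + 1) Z u l y =
        b / w * (xMean (twist M F l) y * kern M (m + 2) l y (Z, cconj Z)) * (y : ℂ)⁻¹ := by
      rw [bdry, kern, ← hw, ← hb, ← hκ]
      field_simp
      ring
    have h2 : ‖(y : ℂ)⁻¹‖ ≤ 1 := by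
      rw [norm_inv, Complex.norm_real, Real.norm_eq_abs, abs_of_nonneg (by linarith)]
      exact inv_le_one_of_one_le₀ (by linarith)
    rw [h1, norm_mul, norm_mul]
    refine (mul_le_of_le_one_right (by positivity) h2).trans ?_
    rw [mul_assoc ‖b / w‖]
    exact mul_le_mul_of_nonneg_left (h _ hZV l y hl hy) (norm_nonneg _)
  rw [← integral_add i1 i2, integral_Ioi_of_hasDerivAt_of_tendsto
    (hder 2 two_pos).continuousAt.continuousWithinAt
    (fun y hy => hder y (two_pos.trans hy)) (i1.add i2) hlim, zero_sub]

/-- The boundary terms are the summands of the theta series `thetaSum`. -/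
theorem twist_mul_bdry (m : ℕ) (Z u : CplxSpace n) (l : M.dual) (z : ℂ) :
    twist M F l z * bdry M m Z u l z.im =
      (z.im : ℂ) ^ (m + 1) * (F (ofComplex z) (M.cls l) * thetaFun M Z u m z l) := by
  have h : thetaFun M Z u m z l = M.bC (toCplx (l : RealSpace n)) (cconj Z) ^ m *
      M.bC (toCplx (l : RealSpace n)) u *
      (cexp (-(Real.pi * I * z * (M.bR (l : RealSpace n) l : ℝ))) *
        cexp (-(2 * Real.pi * z.im * kap M l Z (cconj Z)))) := by
    have hz : z - (starRingEnd ℂ) z = 2 * z.im * I := by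
      rw [Complex.sub_conj]; push_cast; ring
    rw [thetaFun, gaussExp, planeForm_toCplx, bC_toCplx, ← Complex.exp_add]
    congr 2
    have : Real.pi * I * (z * (kap M l Z (cconj Z) - (M.bR (l : RealSpace n) l : ℝ)) -
        (starRingEnd ℂ) z * kap M l Z (cconj Z)) =
        -(Real.pi * I * z * (M.bR (l : RealSpace n) l : ℝ)) +
          Real.pi * I * (z - (starRingEnd ℂ) z) * kap M l Z (cconj Z) := by ring
    rw [this, hz]
    have h2 : (Real.pi * I * (2 * z.im * I) * kap M l Z (cconj Z) : ℂ) =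
        (I ^ 2) * (2 * Real.pi * z.im * kap M l Z (cconj Z)) := by ring
    rw [h2, I_sq]
    ring
  rw [h, twist, bdry]
  ring

theorem arc_bounds {x : ℝ} (hx : |x| ≤ 1 / 2) :
    1 / 2 ≤ circ x ∧ circ x ≤ 1 ∧ ‖(1 : ℂ) - I * (x / circ x : ℝ)‖ ≤ 2 := by
  have hx1 : |x| < 1 := by linarith
  have h0 := circ_pos hx1
  have h1 := circ_sq hx1
  have h2 : x ^ 2 ≤ 1 / 4 := by
    rw [← sq_abs]
    nlinarith [abs_nonneg x]
  have h3 : 1 / 2 ≤ circ x := by nlinarith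
  refine ⟨h3, by nlinarith [sq_nonneg x], ?_⟩
  refine (norm_sub_le _ _).trans ?_
  rw [norm_one, norm_mul, norm_I, one_mul, Complex.norm_real, Real.norm_eq_abs, abs_div,
    abs_of_pos h0]
  have : |x| / circ x ≤ 1 := by
    rw [div_le_one h0]
    linarith
  linarith

/-- The boundary terms on the arc add up to the integral of an odd function: the theta series
transforms like a form of weight two under `z ↦ -1 / z`, which on the unit circle is the reflection
`z ↦ -z̄`. -/
theorem hasSum_arcInt {m : ℕ}
    (hF : IsAlmostHolModularForm M (2 * ((m + 1 : ℕ) : ℤ) + 2 - (n : ℤ)) F) {Z u : CplxSpace n}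
    (hZ : Z ∈ cone M) (hu : M.bC u Z = 0) (hu' : M.bC u (cconj Z) = 0) :
    HasSum (fun l : M.dual => arcInt fun z => twist M F l z * bdry M m Z u l z.im) 0 := by
  have hI := hF.liftInput
  set P : ℝ → ℂ := fun x => (x : ℂ) + (circ x : ℂ) * I with hP
  have him : ∀ x, (P x).im = circ x := fun x => im_add_mul_I _ _
  have hre : ∀ x, (P x).re = x := fun x => re_add_mul_I _ _
  have hcirc : Continuous circ := by unfold circ; fun_prop
  have hle : (-(1 / 2) : ℝ) ≤ 1 / 2 := by norm_num
  have hmem : ∀ x ∈ Set.uIcc (-(1 / 2) : ℝ) (1 / 2), |x| ≤ 1 / 2 := by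
    intro x hx
    rw [Set.uIcc_of_le hle] at hx
    exact abs_le.mpr hx
  obtain ⟨ε, hε, hmaj⟩ := eventually_majorant M hZ
  obtain ⟨K₁, hK₁, hb₁⟩ := exists_norm_bC_pow_le (M := M) (cconj Z) m
  obtain ⟨K₂, hK₂, hb₂⟩ := exists_norm_bC_pow_le (M := M) u 1
  obtain ⟨C, hC, hb⟩ := exists_compact_bound hI hε 1 (K₁ * K₂) (m + 1)
  set h : ℝ → ℂ := fun x =>
    (circ x : ℂ) ^ (m + 1) * thetaSum M F Z u m (P x) * (1 - I * (x / circ x : ℝ)) with hh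
  have hsum := intervalIntegral.hasSum_integral_of_dominated_convergence (μ := volume)
    (a := -(1 / 2)) (b := 1 / 2) (f := h)
    (F := fun (l : M.dual) (x : ℝ) => twist M F l (P x) * bdry M m Z u l (P x).im *
      (1 - I * (x / circ x : ℝ)))
    (fun l _ => C * Real.exp (-(ε / 2) * nrm2 (l : RealSpace n)) * 2) ?_ ?_ ?_ ?_ ?_
  · have hodd : ∫ x in (-(1 / 2) : ℝ)..(1 / 2), h x = 0 := by
      have h1 := intervalIntegral.integral_comp_neg (a := -(1 / 2)) (b := 1 / 2) h
      have h2 : ∫ x in (-(1 / 2) : ℝ)..(1 / 2), h (-x) =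
          ∫ x in (-(1 / 2) : ℝ)..(1 / 2), -h x := by
        refine intervalIntegral.integral_congr fun x hx => ?_
        have hx1 : |x| < 1 := by linarith [hmem x hx]
        have hc0 := circ_pos hx1
        have hc0' : (circ x : ℂ) ≠ 0 := by simpa using hc0.ne'
        have hz : 0 < (P x).im := by rw [him]; exact hc0
        have hz0 : P x ≠ 0 := fun h => by simp [h] at hz
        have hcneg : circ (-x) = circ x := by simp [circ]
        have hsq : (x : ℂ) ^ 2 + (circ x : ℂ) ^ 2 = 1 := by
          have := circ_sq hx1
          have h3 : x ^ 2 + circ x ^ 2 = 1 := by linarith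
          exact_mod_cast h3
        have hconj : (starRingEnd ℂ) (P x) = (x : ℂ) - (circ x : ℂ) * I := by
          simp only [hP, map_add, map_mul, conj_ofReal, conj_I]
          ring
        have hunit : (starRingEnd ℂ) (P x) * P x = 1 := by
          rw [hconj]
          simp only [hP]
          linear_combination hsq - (circ x : ℂ) ^ 2 * I_sq
        have hneg : P (-x) = -1 / P x := by
          rw [eq_div_iff hz0]
          have : P (-x) = -(starRingEnd ℂ) (P x) := by
            rw [hconj]
            simp only [hP, hcneg]
            push_cast
            ring
          rw [this, neg_mul, hunit]
        have htheta : thetaSum M F Z u m (P (-x)) = P x ^ 2 * thetaSum M F Z u m (P x) := by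
          rw [hneg, thetaSum_neg_one_div hF hZ hu hu' hz, pow_add (P x) (m + 1) 2, ← mul_assoc,
            ← mul_pow, hunit, one_pow, one_mul]
        have hfac : P x ^ 2 * (1 - I * ((-x : ℝ) / circ x : ℝ)) = -(1 - I * (x / circ x : ℝ)) := by
          have : P x * ((circ x : ℂ) + I * x) = I := by
            have : ((circ x : ℂ) + I * x) = I * (starRingEnd ℂ) (P x) := by
              rw [hconj]
              linear_combination (circ x : ℂ) * I_sq
            rw [this]
            linear_combination I * hunit
          push_cast
          field_simp
          simp only [hP] at this ⊢
          linear_combination ((x : ℂ) + (circ x : ℂ) * I) * this + (circ x : ℂ) * I_sq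
        simp only [hh, hcneg, htheta]
        linear_combination (circ x : ℂ) ^ (m + 1) * thetaSum M F Z u m (P x) * hfac
      rw [h2, intervalIntegral.integral_neg, neg_neg] at h1
      have h3 : (2 : ℂ) * ∫ x in (-(1 / 2) : ℝ)..(1 / 2), h x = 0 := by linear_combination -h1
      simpa using h3
    rw [hodd] at hsum
    exact hsum
  · intro l
    refine ContinuousOn.aestronglyMeasurable ?_ measurableSet_uIoc
    have hs : Set.uIoc (-(1 / 2) : ℝ) (1 / 2) ⊆ Set.uIcc (-(1 / 2)) (1 / 2) :=
      Set.uIoc_subset_uIcc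
    refine ContinuousOn.mono ?_ hs
    have hPc : Continuous P := by fun_prop
    have hne : ∀ x ∈ Set.uIcc (-(1 / 2) : ℝ) (1 / 2), 0 < circ x := fun x hx => by
      linarith [(arc_bounds (hmem x hx)).1]
    refine ((((hI.periodic l).smooth.continuousOn.comp hPc.continuousOn fun x hx => ?_).mul
      ((contDiff_bdry M m Z u l).continuous.comp
        (Complex.continuous_im.comp hPc)).continuousOn)).mul ?_
    · rw [Set.mem_ofPred_eq, him]
      exact hne x hx
    · refine continuousOn_const.sub (continuousOn_const.mul ?_)
      exact continuous_ofReal.comp_continuousOn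
        (continuousOn_id.div hcirc.continuousOn fun x hx => (hne x hx).ne')
  · intro l
    refine Eventually.of_forall fun x hx => ?_
    have hx' := hmem x (Set.uIoc_subset_uIcc hx)
    obtain ⟨h1, h2, h3⟩ := arc_bounds hx'
    rw [norm_mul]
    refine mul_le_mul ?_ h3 (norm_nonneg _) (by positivity)
    have h4 := hb (Z, cconj Z) l (P x) ((circ x : ℂ) ^ (m + 1) *
      M.bC (toCplx (l : RealSpace n)) (cconj Z) ^ m * M.bC (toCplx (l : RealSpace n)) u)
      (hmaj.self_of_nhds.2 l) (by rw [hre]; exact hx') (by rw [him]; exact h1)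
      (by rw [him]; exact h2) ?_
    · rw [him] at h4 ⊢
      exact h4
    · have h5 := hb₂ (l : RealSpace n)
      rw [pow_one] at h5
      have h6 : ‖(circ x : ℂ) ^ (m + 1)‖ ≤ 1 := by
        rw [norm_pow, Complex.norm_real, Real.norm_eq_abs, abs_of_nonneg (by linarith)]
        exact pow_le_one₀ (by linarith) h2
      have hr := nrm2_nonneg (l : RealSpace n)
      rw [norm_mul, norm_mul]
      calc _ ≤ 1 * (K₁ * (1 + nrm2 (l : RealSpace n)) ^ m) *
            (K₂ * (1 + nrm2 (l : RealSpace n)) ^ 1) := by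
            refine mul_le_mul (mul_le_mul h6 (hb₁ _) (norm_nonneg _) zero_le_one) h5
              (norm_nonneg _) (by positivity)
        _ = _ := by ring
  · exact Eventually.of_forall fun x _ => ((summable_dual M (half_pos hε)).mul_left C).mul_right 2
  · exact intervalIntegrable_const
  · refine Eventually.of_forall fun x hx => ?_
    have hx' := hmem x (Set.uIoc_subset_uIcc hx)
    have hz : 0 < (P x).im := by rw [him]; linarith [(arc_bounds hx').1]
    have hs : Summable fun l : M.dual => F (ofComplex (P x)) (M.cls l) * thetaFun M Z u m (P x) l := by
      refine Summable.of_norm_bounded ((summable_thetaFun M hZ u m hz).norm.mul_left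
        (∑ γ, ‖F (ofComplex (P x)) γ‖)) fun l => ?_
      rw [norm_mul]
      exact mul_le_mul_of_nonneg_right (Finset.single_le_sum
        (f := fun γ => ‖F (ofComplex (P x)) γ‖) (fun _ _ => norm_nonneg _) (Finset.mem_univ _))
        (norm_nonneg _)
    have h1 := (hs.hasSum.mul_left ((circ x : ℂ) ^ (m + 1))).mul_right (1 - I * (x / circ x : ℝ))
    have e : ∀ l : M.dual, twist M F l (P x) * bdry M m Z u l (P x).im =
        (circ x : ℂ) ^ (m + 1) * (F (ofComplex (P x)) (M.cls l) * thetaFun M Z u m (P x) l) :=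
      fun l => by rw [twist_mul_bdry, him]
    simp only [e]
    exact h1

end Boundary

/-! ### The derivatives of the two lifts -/

section Derivatives

variable {M} {F : ℍ → M.Disc → ℂ}

theorem bC_self_cconj_ne_zero {Z : CplxSpace n} (hZ : Z ∈ cone M) : M.bC Z (cconj Z) ≠ 0 := by
  intro h
  have := hZ.2
  rw [h] at this
  simp at this

/-- The antiholomorphic derivative of the lift of `F` and the holomorphic derivative of the lift of
the lowered form agree up to a factor: the difference consists of boundary terms. -/
theorem fderiv_liftSum_eq {m : ℕ}
    (hF : IsAlmostHolModularForm M (2 * ((m + 2 : ℕ) : ℤ) + 2 - (n : ℤ)) F) {Z v : CplxSpace n}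
    (hZ : Z ∈ cone M) {V V' : Set (CplxSpace n × CplxSpace n)} (hV : IsAdmissible M F (m + 2) V)
    (hV' : IsAdmissible M (maassLower M F) m V') (hZV : (Z, cconj Z) ∈ V)
    (hZV' : (Z, cconj Z) ∈ V')
    (hreg : ∀ l : M.dual, l ≠ 0 → M.bC (toCplx (l : RealSpace n)) Z = 0 →
      ∀ y : ℝ, 0 < y → xMean (twist M F l) y = 0) (hv : M.bC v Z = 0) :
    fderiv ℂ (liftSum M F (m + 2)) (0, (Z, cconj Z))
        (0, (0, v - (M.bC v (cconj Z) / M.bC Z (cconj Z)) • Z)) =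
      M.bC Z (cconj Z) / (4 * Real.pi) *
        fderiv ℂ (liftSum M (maassLower M F) m) (0, (Z, cconj Z)) (0, (v, 0)) := by
  have hI := hF.liftInput
  have hI' := hF.liftInput_lower
  have hN := bC_self_cconj_ne_zero hZ
  set u := v - (M.bC v (cconj Z) / M.bC Z (cconj Z)) • Z with hu_def
  have hu : M.bC u Z = 0 := by rw [hu_def, bC_sub_left, bC_smul_left, hv, hZ.1]; ring
  have hu' : M.bC u (cconj Z) = 0 := by
    rw [hu_def, bC_sub_left, bC_smul_left]
    field_simp
    ring
  have hq : ((0 : ℂ), (Z, cconj Z)) ∈ contDomain 1 V := ⟨by simp, hZV⟩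
  have hq' : ((0 : ℂ), (Z, cconj Z)) ∈ contDomain 1 V' := ⟨by simp, hZV'⟩
  have hpi : (Real.pi : ℂ) ≠ 0 := by simp [Real.pi_ne_zero]
  set N := M.bC Z (cconj Z) with hN_def
  have H1 := (hV.holomorphic_liftSum hI 1).2 _ hq (0, (0, u))
  have H2 := (hV'.holomorphic_liftSum hI' 1).2 _ hq' (0, (v, 0))
  have H3 := H1.add (H2.mul_left (-(N / (4 * Real.pi))))
  have H4 := (hasSum_arcInt (m := m + 1) hF hZ hu hu').neg
  have hc : -(N / (4 * Real.pi)) * -(4 * Real.pi / N) = 1 := by field_simp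
  have hterm : ∀ l : M.dual,
      (fderiv ℂ (cuspTerm M F (m + 2) l) (0, (Z, cconj Z)) (0, (0, u)) +
        fderiv ℂ (tailTerm M F (m + 2) l) (0, (Z, cconj Z)) (0, (0, u))) +
      -(N / (4 * Real.pi)) *
        (fderiv ℂ (cuspTerm M (maassLower M F) m l) (0, (Z, cconj Z)) (0, (v, 0)) +
          fderiv ℂ (tailTerm M (maassLower M F) m l) (0, (Z, cconj Z)) (0, (v, 0))) =
      -arcInt fun z => twist M F l z * bdry M (m + 1) Z u l z.im := by
    intro l
    have c1 : fderiv ℂ (cuspTerm M F (m + 2) l) (0, (Z, cconj Z)) (0, (0, u)) =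
        ∫ z in truncDomain 2, twist M F l z * bdryDeriv M (m + 1) Z u l z.im := by
      rw [(hV.holomorphic_cuspTerm hI 1 l).2 _ hq]
      refine setIntegral_congr_fun (isOpen_truncDomain 2).measurableSet fun z hz => ?_
      rw [fderiv_kernReg_snd M (m + 1) hN hu l (truncDomain_subset_uhp 2 hz)]
    have c2 : -(N / (4 * Real.pi)) *
        fderiv ℂ (cuspTerm M (maassLower M F) m l) (0, (Z, cconj Z)) (0, (v, 0)) =
        ∫ z in truncDomain 2, twist M (maassLower M F) l z *
          (bdry M (m + 1) Z u l z.im / (z.im : ℂ) ^ 2) := by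
      rw [(hV'.holomorphic_cuspTerm hI' 1 l).2 _ hq', ← integral_const_mul]
      refine setIntegral_congr_fun (isOpen_truncDomain 2).measurableSet fun z hz => ?_
      rw [fderiv_kernReg_fst M m hN v l (truncDomain_subset_uhp 2 hz)]
      linear_combination (twist M (maassLower M F) l z *
        (bdry M (m + 1) Z u l z.im / (z.im : ℂ) ^ 2)) * hc
    have hcusp := setIntegral_twist_mul_bdry hI (m + 1) Z u l
    rw [integral_add (integrableOn_of_continuousOn_uhp ?_ 2)
      (integrableOn_of_continuousOn_uhp ?_ 2), ← c1, ← c2] at hcusp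
    rotate_left
    · exact (hI.periodic l).smooth.continuousOn.mul
        ((continuous_bdryDeriv M (m + 1) Z u l).comp Complex.continuous_im).continuousOn
    · refine (hI'.periodic l).smooth.continuousOn.mul (ContinuousOn.div
        ((contDiff_bdry M (m + 1) Z u l).continuous.comp Complex.continuous_im).continuousOn
        (Continuous.continuousOn (by fun_prop)) fun z (hz : 0 < z.im) => ?_)
      exact pow_ne_zero _ (by simpa using hz.ne')
    have htail : fderiv ℂ (tailTerm M F (m + 2) l) (0, (Z, cconj Z)) (0, (0, u)) +
        -(N / (4 * Real.pi)) *
          fderiv ℂ (tailTerm M (maassLower M F) m l) (0, (Z, cconj Z)) (0, (v, 0)) =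
        -(xMean (twist M F l) 2 * bdry M (m + 1) Z u l 2) := by
      by_cases hl : l = 0
      · have t : ∀ (G : ℍ → M.Disc → ℂ) (j : ℕ), tailTerm M G j l = fun _ => 0 := by
          intro G j
          funext q
          rw [tailTerm, if_pos hl]
        rw [t, t, hl]
        have : ((0 : M.dual) : RealSpace n) = 0 := rfl
        rw [this, bdry_zero_left]
        simp
      · rw [← hV.integral_tail hI hI' hV' hZV hZV' hl (hreg l hl) u]
        congr 1
        · rw [(hV.holomorphic_tailTerm hI 1 l).2 hl _ hq]
          refine setIntegral_congr_fun measurableSet_Ioi fun y hy => ?_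
          rw [fderiv_kernReg_snd M (m + 1) hN hu l (two_pos.trans hy)]
        · rw [(hV'.holomorphic_tailTerm hI' 1 l).2 hl _ hq', ← integral_const_mul]
          refine setIntegral_congr_fun measurableSet_Ioi fun y hy => ?_
          rw [fderiv_kernReg_fst M m hN v l (two_pos.trans hy)]
          linear_combination (xMean (twist M (maassLower M F) l) y *
            (bdry M (m + 1) Z u l y / (y : ℂ) ^ 2)) * hc
    linear_combination hcusp + htail
  have H5 := H3.congr_fun (fun l => (hterm l).symm)
  have H6 := H5.unique H4
  linear_combination H6

end Derivatives

/-! ### Differentials of functions on the cone -/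

/-- Complex conjugation as a real-linear map. -/
noncomputable def cconjCLM : CplxSpace n →L[ℝ] CplxSpace n :=
  ContinuousLinearMap.pi fun i => (Complex.conjCLE : ℂ →L[ℝ] ℂ).comp (ContinuousLinearMap.proj i)

theorem hasFDerivAt_cconj (Z : CplxSpace n) :
    HasFDerivAt (cconj : CplxSpace n → CplxSpace n) cconjCLM Z :=
  (cconjCLM (n := n)).hasFDerivAt

/-- Every tangent vector of the cone is the velocity of a curve in the cone. -/
theorem exists_curve {Z v : CplxSpace n} (hZ : Z ∈ cone M) (hv : v ∈ tangent M Z) :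
    ∃ γ : ℝ → CplxSpace n, γ 0 = Z ∧ HasDerivAt γ v 0 ∧ ∀ᶠ t in 𝓝 0, γ t ∈ cone M := by
  set N := M.bC Z (cconj Z) with hN
  have hN0 : N ≠ 0 := bC_self_cconj_ne_zero hZ
  set d := M.bC v (cconj Z) with hd
  -- the quadratic equation `⟨γ t, γ t⟩ = 0` for `γ t = Z + t v + c t Z̄` is linear in `c t`
  set r : ℝ → ℂ := fun t => N + t * d with hr
  set c : ℝ → ℂ := fun t => -((t : ℂ) ^ 2 * M.bC v v) / (2 * r t) with hc
  have hZZ : M.bC (cconj Z) (cconj Z) = 0 := by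
    rw [← conj_bC, hZ.1, map_zero]
  have h0 : HasDerivAt (fun t : ℝ => (t : ℂ)) 1 0 := ofRealCLM.hasDerivAt
  have hr1 : HasDerivAt r d 0 := by
    exact ((h0.mul_const d).const_add N).congr_deriv (one_mul d)
  have hr0 : r 0 ≠ 0 := by simpa [hr] using hN0
  have hc0 : c 0 = 0 := by simp [hc]
  have hc1 : HasDerivAt c 0 0 := by
    have h1 := (((h0.fun_pow 2).mul_const (M.bC v v)).fun_neg).fun_div (hr1.const_mul 2)
      (mul_ne_zero two_ne_zero hr0)
    refine h1.congr_deriv ?_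
    simp
  have hγ : HasDerivAt (fun t : ℝ => Z + (t : ℂ) • v + c t • cconj Z) v 0 := by
    have h1 := ((h0.smul_const v).const_add Z).fun_add (hc1.smul_const (cconj Z))
    simpa using h1
  refine ⟨fun t : ℝ => Z + (t : ℂ) • v + c t • cconj Z, by simp [hc0], hγ, ?_⟩
  have hpos : ∀ᶠ t : ℝ in 𝓝 0, 0 < (M.bC (Z + (t : ℂ) • v + c t • cconj Z)
      (cconj (Z + (t : ℂ) • v + c t • cconj Z))).re := by
    have hcont : ContinuousAt (fun t : ℝ => (M.bC (Z + (t : ℂ) • v + c t • cconj Z)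
        (cconj (Z + (t : ℂ) • v + c t • cconj Z))).re) 0 := by
      have h1 : Continuous fun W : CplxSpace n => (M.bC W (cconj W)).re :=
        Complex.continuous_re.comp (continuous_bC_comp M continuous_id
          (cconjCLM (n := n)).continuous)
      exact h1.continuousAt.comp hγ.continuousAt
    refine hcont.eventually (lt_mem_nhds ?_)
    simpa [hc0] using hZ.2
  filter_upwards [hpos, hr1.continuousAt.eventually_ne hr0] with t ht hrt
  refine ⟨?_, ht⟩
  have hv' : M.bC v Z = 0 := hv
  have hv'' : M.bC Z v = 0 := by rw [bC_comm, hv']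
  have hZZ' : M.bC Z Z = 0 := hZ.1
  simp only [bC_add_left, bC_add_right, bC_smul_left, bC_smul_right, hv', hv'', hZZ', hZZ,
    bC_comm M (cconj Z) Z, bC_comm M (cconj Z) v, ← hN, ← hd]
  have h1 : c t * (2 * r t) = -((t : ℂ) ^ 2 * M.bC v v) :=
    div_mul_cancel₀ _ (mul_ne_zero two_ne_zero hrt)
  simp only [hr] at h1
  linear_combination h1

section Differentials

variable {M}

/-- The differential of a function on the cone that is given by a holomorphic function of `Z` and
`Z̄`. -/
theorem fderivWithin_cone {f : CplxSpace n → ℂ} {H : CplxSpace n × CplxSpace n → ℂ}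
    {Z v : CplxSpace n} (hZ : Z ∈ cone M) (hH : DifferentiableAt ℂ H (Z, cconj Z))
    (hf : f =ᶠ[𝓝[cone M] Z] fun Z' => H (Z', cconj Z')) (hv : v ∈ tangent M Z) :
    fderivWithin ℝ f (cone M) Z v = fderiv ℂ H (Z, cconj Z) (v, cconj v) := by
  have h1 : HasFDerivAt (fun Z' : CplxSpace n => H (Z', cconj Z'))
      (((fderiv ℂ H (Z, cconj Z)).restrictScalars ℝ).comp
        ((ContinuousLinearMap.id ℝ (CplxSpace n)).prod cconjCLM)) Z := by
    have h2 : HasFDerivAt H ((fderiv ℂ H (Z, cconj Z)).restrictScalars ℝ) (Z, cconj Z) :=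
      hH.hasFDerivAt.restrictScalars ℝ
    have h3 : HasFDerivAt (fun Z' : CplxSpace n => (Z', cconj Z'))
        ((ContinuousLinearMap.id ℝ (CplxSpace n)).prod cconjCLM) Z :=
      (hasFDerivAt_id Z).prodMk (hasFDerivAt_cconj Z)
    exact HasFDerivAt.comp (f := fun Z' : CplxSpace n => (Z', cconj Z')) Z h2 h3
  have h4 := h1.hasFDerivWithinAt (s := cone M) |>.congr_of_eventuallyEq hf
    (hf.self_of_nhdsWithin hZ)
  obtain ⟨γ, hγ0, hγ, hγc⟩ := exists_curve M hZ hv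
  have key : ∀ L : CplxSpace n →L[ℝ] ℂ, HasFDerivWithinAt f L (cone M) Z →
      HasDerivAt (fun t => f (γ t)) (L v) 0 := by
    intro L hL
    rw [← hγ0] at hL
    have h5 := hL.comp_hasDerivWithinAt (0 : ℝ) (hγ.hasDerivWithinAt (s := γ ⁻¹' cone M))
      (Set.mapsTo_preimage _ _)
    exact h5.hasDerivAt hγc
  exact (key _ h4.differentiableWithinAt.hasFDerivWithinAt).unique (key _ h4)

theorem smul_mem_tangent {Z v : CplxSpace n} (hv : v ∈ tangent M Z) (c : ℂ) :
    c • v ∈ tangent M Z := by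
  have : M.bC v Z = 0 := hv
  change M.bC (c • v) Z = 0
  rw [bC_smul_left, this, mul_zero]

theorem map_prod_split (L : CplxSpace n × CplxSpace n →L[ℂ] ℂ) (a b : ℂ) (v w : CplxSpace n) :
    L (a • v, b • w) = a * L (v, 0) + b * L (0, w) := by
  have : ((a • v, b • w) : CplxSpace n × CplxSpace n) = a • (v, 0) + b • (0, w) := by simp
  rw [this, map_add, map_smul, map_smul, smul_eq_mul, smul_eq_mul]

theorem del_eq {f : CplxSpace n → ℂ} {H : CplxSpace n × CplxSpace n → ℂ}
    {Z v : CplxSpace n} (hZ : Z ∈ cone M) (hH : DifferentiableAt ℂ H (Z, cconj Z))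
    (hf : f =ᶠ[𝓝[cone M] Z] fun Z' => H (Z', cconj Z')) (hv : v ∈ tangent M Z) :
    del M f Z v = fderiv ℂ H (Z, cconj Z) (v, 0) := by
  rw [del, fderivWithin_cone hZ hH hf hv, fderivWithin_cone hZ hH hf (smul_mem_tangent hv I),
    cconj_smul, map_prod_split, conj_I]
  have := map_prod_split (fderiv ℂ H (Z, cconj Z)) 1 1 v (cconj v)
  rw [one_smul, one_smul] at this
  rw [this]
  linear_combination (-(1 / 2) * fderiv ℂ H (Z, cconj Z) (v, 0) +
    (1 / 2) * fderiv ℂ H (Z, cconj Z) (0, cconj v)) * I_sq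

theorem delBar_eq {f : CplxSpace n → ℂ} {H : CplxSpace n × CplxSpace n → ℂ}
    {Z v : CplxSpace n} (hZ : Z ∈ cone M) (hH : DifferentiableAt ℂ H (Z, cconj Z))
    (hf : f =ᶠ[𝓝[cone M] Z] fun Z' => H (Z', cconj Z')) (hv : v ∈ tangent M Z) :
    delBar M f Z v = fderiv ℂ H (Z, cconj Z) (0, cconj v) := by
  rw [delBar, fderivWithin_cone hZ hH hf hv, fderivWithin_cone hZ hH hf (smul_mem_tangent hv I),
    cconj_smul, map_prod_split, conj_I]
  have := map_prod_split (fderiv ℂ H (Z, cconj Z)) 1 1 v (cconj v)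
  rw [one_smul, one_smul] at this
  rw [this]
  linear_combination ((1 / 2) * fderiv ℂ H (Z, cconj Z) (v, 0) -
    (1 / 2) * fderiv ℂ H (Z, cconj Z) (0, cconj v)) * I_sq

end Differentials

/-! ### The lifts as sections, and the lowering and raising operators -/

section Section

variable {M} {F : ℍ → M.Disc → ℂ}

theorem bC_smul_cconj_smul (c : ℂ) (Z : CplxSpace n) :
    M.bC (c • Z) (cconj (c • Z)) = (normSq c : ℂ) * M.bC Z (cconj Z) := by
  rw [cconj_smul, bC_smul_left, bC_smul_right, ← mul_assoc, Complex.mul_conj]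

theorem smul_mem_cone {Z : CplxSpace n} (hZ : Z ∈ cone M) {c : ℂ} (hc : c ≠ 0) :
    c • Z ∈ cone M := by
  have h1 : M.bC Z Z = 0 := hZ.1
  refine ⟨by rw [bC_smul_left, bC_smul_right, h1]; ring, ?_⟩
  rw [bC_smul_cconj_smul, re_ofReal_mul]
  exact mul_pos (normSq_pos.mpr hc) hZ.2

theorem projZ_smul (x : RealSpace n) (Z : CplxSpace n) {c : ℂ} (hc : c ≠ 0) :
    projZ M x (c • Z) = projZ M x Z := by
  have hc' : (starRingEnd ℂ) c ≠ 0 := by simpa using hc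
  rw [projZ, projZ, cconj_smul, bC_smul_left, bC_smul_right, bC_smul_right, bC_smul_right]
  simp only [smul_smul, smul_add]
  congr 2 <;> field_simp

/-- Only the factor `⟨λ, Z⟩ ^ j` of the theta kernel changes under scaling of `Z`. -/
theorem liftIntegrand_smul (j : ℕ) (G : ℍ → M.Disc → ℂ) (Z : CplxSpace n) {c : ℂ} (hc : c ≠ 0) :
    liftIntegrand M j G (c • Z) = fun τ => (starRingEnd ℂ) c ^ j * liftIntegrand M j G Z τ := by
  have h : ∀ τ γ, thetaKernel M j (c • Z) τ γ = c ^ j * thetaKernel M j Z τ γ := by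
    intro τ γ
    have h1 : ∀ l : {l : M.dual // M.cls l = γ},
        M.bC (toCplx ((l : M.dual) : RealSpace n)) (c • Z) ^ j =
          c ^ j * M.bC (toCplx ((l : M.dual) : RealSpace n)) Z ^ j := fun l => by
      rw [bC_smul_right, mul_pow]
    rw [thetaKernel, thetaKernel]
    simp only [projPerp, projZ_smul _ _ hc, h1, mul_assoc (c ^ j), tsum_mul_left]
    ring
  funext τ
  have h2 : ∑ γ, G τ γ * (starRingEnd ℂ) (thetaKernel M j (c • Z) τ γ) =
      (starRingEnd ℂ) c ^ j * ∑ γ, G τ γ * (starRingEnd ℂ) (thetaKernel M j Z τ γ) := by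
    rw [Finset.mul_sum]
    refine Finset.sum_congr rfl fun γ _ => ?_
    rw [h, map_mul, map_pow]
    ring
  rw [liftIntegrand, liftIntegrand, pairing, pairing, h2]
  ring

/-- The regularized integral in a neighbourhood of a point of the cone, as a holomorphic function
of `Z` and `Z̄`. -/
theorem exists_regIntegral_eq {G : ℍ → M.Disc → ℂ} (hG : LiftInput M G) (j : ℕ) :
    ∃ c : ℂ, ∀ (Z : CplxSpace n) (V : Set (CplxSpace n × CplxSpace n)), Z ∈ cone M →
      IsAdmissible M G j V → (Z, cconj Z) ∈ V →
      IsRegIntegral (liftIntegrand M j G Z) (liftSum M G j (0, (Z, cconj Z)) + c) ∧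
      regIntegral (liftIntegrand M j G Z) = liftSum M G j (0, (Z, cconj Z)) + c := by
  obtain ⟨c, -, h⟩ := isRegIntegral_liftIntegrand hG j
  exact ⟨c, fun Z V hZ hV hZV => ⟨h Z V hZ hV hZV, (h Z V hZ hV hZV).regIntegral_eq⟩⟩

theorem eventually_mem_admissible {V : Set (CplxSpace n × CplxSpace n)} (hV : IsOpen V)
    {Z : CplxSpace n} (hZV : (Z, cconj Z) ∈ V) (S : Set (CplxSpace n)) :
    ∀ᶠ Z' in 𝓝[S] Z, Z' ∈ S ∧ (Z', cconj Z') ∈ V := by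
  have hcont : Continuous fun Z' : CplxSpace n => (Z', cconj Z') :=
    continuous_id.prodMk (cconjCLM (n := n)).continuous
  filter_upwards [self_mem_nhdsWithin,
    mem_nhdsWithin_of_mem_nhds (hcont.continuousAt.preimage_mem_nhds (hV.mem_nhds hZV))]
    with Z' h1 h2 using ⟨h1, h2⟩

theorem IsAdmissible.differentiableOn_liftSum {G : ℍ → M.Disc → ℂ} (hG : LiftInput M G) {j : ℕ}
    {V : Set (CplxSpace n × CplxSpace n)} (hV : IsAdmissible M G j V) :
    DifferentiableOn ℂ (fun p => liftSum M G j (0, p)) V := by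
  have h : DifferentiableOn ℂ (fun p : CplxSpace n × CplxSpace n => ((0 : ℂ), p)) V := by
    fun_prop
  exact (hV.holomorphic_liftSum hG 1).1.comp h fun p hp => ⟨by simp, hp⟩

/-- Near each point the lift is the restriction of a holomorphic function of `Z` and `Z̄`. -/
theorem isSmoothSection_lift {G : ℍ → M.Disc → ℂ} (hG : LiftInput M G) (j : ℕ)
    {U : Set (CplxSpace n)} (hU : U ⊆ cone M) (hsmul : ∀ Z ∈ U, ∀ c : ℂ, c ≠ 0 → c • Z ∈ U)
    (hreg : ∀ Z ∈ U, ∀ l : M.dual, l ≠ 0 → M.bC (toCplx (l : RealSpace n)) Z = 0 →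
      ∀ y : ℝ, 0 < y → xMean (twist M G l) y = 0) :
    IsSmoothSection (j : ℤ) U (lift M j G) := by
  obtain ⟨c₀, hc₀⟩ := exists_regIntegral_eq hG j
  constructor
  · intro Z hZ
    obtain ⟨V, hZV, hV⟩ := exists_isAdmissible hG j (hU hZ) (hreg Z hZ)
    set H : CplxSpace n × CplxSpace n → ℂ := fun p =>
      (1 / 2) * (((I / 2) * M.bC p.1 p.2) ^ j)⁻¹ * (liftSum M G j (0, p) + c₀) with hH
    obtain ⟨ε, _, hV1⟩ := hV.majorant
    have hHd : DifferentiableOn ℂ H V := by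
      have h1 : DifferentiableOn ℂ (fun p : CplxSpace n × CplxSpace n =>
          (((I / 2) * M.bC p.1 p.2) ^ j)⁻¹) V := by
        intro p hp
        have h2 : DifferentiableAt ℂ (fun p : CplxSpace n × CplxSpace n => M.bC p.1 p.2) p :=
          differentiableAt_bC_comp M differentiableAt_fst differentiableAt_snd
        refine (((h2.const_mul (I / 2)).fun_pow j).fun_inv (pow_ne_zero _ ?_)).differentiableWithinAt
        exact mul_ne_zero (by simp) (hV1 p hp).1
      exact (h1.const_mul (1 / 2)).mul ((hV.differentiableOn_liftSum hG).add_const c₀)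
    have hHs : ContDiffAt ℝ ∞ H (Z, cconj Z) :=
      ((contDiffOn_of_differentiableOn hV.isOpen hHd).contDiffAt
        (hV.isOpen.mem_nhds hZV)).restrict_scalars ℝ
    have hc : ContDiff ℝ ∞ fun Z' : CplxSpace n => (Z', cconj Z') :=
      contDiff_id.prodMk (cconjCLM (n := n)).contDiff
    have hHc : ContDiffAt ℝ ∞ (fun Z' : CplxSpace n => H (Z', cconj Z')) Z :=
      ContDiffAt.comp (f := fun Z' : CplxSpace n => (Z', cconj Z')) Z hHs hc.contDiffAt
    refine hHc.contDiffWithinAt.congr_of_eventuallyEq_of_mem ?_ hZ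
    filter_upwards [eventually_mem_admissible hV.isOpen hZV U] with Z' hZ'
    rw [lift, (hc₀ Z' V (hU hZ'.1) hV hZ'.2).2]
  · intro Z hZ c hc
    refine ⟨hsmul Z hZ c hc, ?_⟩
    obtain ⟨V, hZV, hV⟩ := exists_isAdmissible hG j (hU hZ) (hreg Z hZ)
    obtain ⟨h1, h2⟩ := hc₀ Z V (hU hZ) hV hZV
    have h3 := h1.const_mul ((starRingEnd ℂ) c ^ j)
    rw [← liftIntegrand_smul j G Z hc] at h3
    have hc' : (starRingEnd ℂ) c ≠ 0 := by simpa using hc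
    rw [lift, lift, h3.regIntegral_eq, h2, bC_smul_cconj_smul, ← Complex.mul_conj, zpow_neg,
      zpow_natCast, mul_pow, mul_pow, mul_pow, mul_pow]
    field_simp

theorem smul_mem_regularSet {Z : CplxSpace n} (hZ : Z ∈ regularSet M F) {c : ℂ} (hc : c ≠ 0) :
    c • Z ∈ regularSet M F := by
  refine ⟨smul_mem_cone hZ.1 hc, fun l hl h => hZ.2 l hl ?_⟩
  rw [bC_smul_right] at h
  exact (mul_eq_zero.mp h).resolve_left hc

theorem xMean_eq_zero_of_mem_regularSet {Z : CplxSpace n} (hZ : Z ∈ regularSet M F) (l : M.dual)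
    (hl : l ≠ 0) (h : M.bC (toCplx (l : RealSpace n)) Z = 0) (y : ℝ) (hy : 0 < y) :
    xMean (twist M F l) y = 0 := by
  rw [xMean_twist, hZ.2 l hl h y hy, zero_mul]

theorem fderiv_liftSum_slice {G : ℍ → M.Disc → ℂ} (hG : LiftInput M G) {j : ℕ}
    {V : Set (CplxSpace n × CplxSpace n)} (hV : IsAdmissible M G j V)
    {p : CplxSpace n × CplxSpace n} (hp : p ∈ V) (w : CplxSpace n × CplxSpace n) :
    HasDerivAt (fun s : ℂ => liftSum M G j (0, p + s • w))
      (fderiv ℂ (liftSum M G j) (0, p) (0, w)) 0 := by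
  have hq : ((0 : ℂ), p) ∈ contDomain 1 V := ⟨by simp, hp⟩
  have h := hasDerivAt_line (v := (0, w)) ((hV.holomorphic_liftSum hG 1).1.differentiableAt
    ((isOpen_contDomain 1 hV.isOpen).mem_nhds hq))
  simpa using h

/-- The lowering operator sees the derivative of the lift in `Z̄` along a vector orthogonal to `Z`; the
normalizing factor is constant in this direction. -/
theorem lowering_lift {G : ℍ → M.Disc → ℂ} (hG : LiftInput M G) (j : ℕ)
    {V : Set (CplxSpace n × CplxSpace n)} (hV : IsAdmissible M G j V) {Z v : CplxSpace n}
    (hZ : Z ∈ cone M) (hZV : (Z, cconj Z) ∈ V) (hv : v ∈ tangent M Z) :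
    lowering M (lift M j G) Z v = (absSq M Z : ℂ) * ((1 / 2) * ((I * absSq M Z) ^ j)⁻¹ *
      fderiv ℂ (liftSum M G j) (0, (Z, cconj Z))
        (0, (0, v - (M.bC v (cconj Z) / M.bC Z (cconj Z)) • Z))) := by
  obtain ⟨c₀, hc₀⟩ := exists_regIntegral_eq hG j
  have hN := bC_self_cconj_ne_zero hZ
  set u := v - (M.bC v (cconj Z) / M.bC Z (cconj Z)) • Z with hu_def
  have hv' : M.bC v Z = 0 := hv
  have hu : M.bC u Z = 0 := by rw [hu_def, bC_sub_left, bC_smul_left, hv', hZ.1]; ring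
  have hu' : M.bC u (cconj Z) = 0 := by
    rw [hu_def, bC_sub_left, bC_smul_left]
    field_simp
    ring
  have hcu : cconj u ∈ tangent M Z := by
    have := conj_bC M u (cconj Z)
    rw [hu', map_zero, cconj_cconj] at this
    exact this.symm
  set H : CplxSpace n × CplxSpace n → ℂ := fun p =>
    (1 / 2) * (((I / 2) * M.bC p.1 p.2) ^ j)⁻¹ * (liftSum M G j (0, p) + c₀) with hH
  have hHd : DifferentiableAt ℂ H (Z, cconj Z) := by
    have h2 : DifferentiableAt ℂ (fun p : CplxSpace n × CplxSpace n => M.bC p.1 p.2)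
        (Z, cconj Z) := differentiableAt_bC_comp M differentiableAt_fst differentiableAt_snd
    have h3 := ((h2.const_mul (I / 2)).fun_pow j).fun_inv
      (pow_ne_zero _ (mul_ne_zero (by simp) hN))
    exact (h3.const_mul (1 / 2)).fun_mul (((hV.differentiableOn_liftSum hG).differentiableAt
      (hV.isOpen.mem_nhds hZV)).add_const c₀)
  have hf : lift M j G =ᶠ[𝓝[cone M] Z] fun Z' => H (Z', cconj Z') := by
    filter_upwards [eventually_mem_admissible hV.isOpen hZV (cone M)] with Z' hZ'
    rw [lift, (hc₀ Z' V hZ'.1 hV hZ'.2).2]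
  have hline := hasDerivAt_line (v := ((0, u) : CplxSpace n × CplxSpace n)) hHd
  have hderiv : fderiv ℂ H (Z, cconj Z) (0, u) = (1 / 2) * ((I * absSq M Z) ^ j)⁻¹ *
      fderiv ℂ (liftSum M G j) (0, (Z, cconj Z)) (0, (0, u)) := by
    refine hline.unique ?_
    have hb : M.bC Z u = 0 := by rw [bC_comm, hu]
    have hs := ((fderiv_liftSum_slice hG hV hZV (0, u)).add_const c₀).const_mul
      ((1 / 2) * ((I * absSq M Z) ^ j)⁻¹)
    refine hs.congr_of_eventuallyEq (Eventually.of_forall fun s => ?_)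
    have h4 : M.bC ((Z, cconj Z) + s • ((0, u) : CplxSpace n × CplxSpace n)).1
        ((Z, cconj Z) + s • ((0, u) : CplxSpace n × CplxSpace n)).2 = 2 * (absSq M Z : ℂ) := by
      simp only [Prod.fst_add, Prod.snd_add, Prod.smul_fst, Prod.smul_snd, smul_zero, add_zero,
        bC_add_right, bC_smul_right, hb, mul_zero, bC_self_cconj_eq]
    have h5 : I / 2 * (2 * (absSq M Z : ℂ)) = I * absSq M Z := by ring
    simp only [hH]
    rw [h4, h5]
  rw [lowering, phi, ← bC_self_cconj_eq, ← hu_def, delBar_eq hZ hHd hf hcu, cconj_cconj, hderiv]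

/-- The raising operator sees the derivative of the lift in `Z`; the power of `|Z|²` cancels the
normalizing factor of the lift. -/
theorem raising_lift {G : ℍ → M.Disc → ℂ} (hG : LiftInput M G) (j : ℕ)
    {V : Set (CplxSpace n × CplxSpace n)} (hV : IsAdmissible M G j V) {Z v : CplxSpace n}
    (hZ : Z ∈ cone M) (hZV : (Z, cconj Z) ∈ V) (hv : v ∈ tangent M Z) :
    raising M (j : ℤ) (lift M j G) Z v = ((absSq M Z : ℂ) ^ j)⁻¹ * ((1 / 2) * (I ^ j)⁻¹ *
      fderiv ℂ (liftSum M G j) (0, (Z, cconj Z)) (0, (v, 0))) := by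
  obtain ⟨c₀, hc₀⟩ := exists_regIntegral_eq hG j
  set H : CplxSpace n × CplxSpace n → ℂ := fun p =>
    (1 / 2) * (I ^ j)⁻¹ * (liftSum M G j (0, p) + c₀) with hH
  have hHd : DifferentiableAt ℂ H (Z, cconj Z) :=
    (((hV.differentiableOn_liftSum hG).differentiableAt
      (hV.isOpen.mem_nhds hZV)).add_const c₀).const_mul _
  have hf : (fun Z' => (absSq M Z' : ℂ) ^ (j : ℤ) * lift M j G Z') =ᶠ[𝓝[cone M] Z]
      fun Z' => H (Z', cconj Z') := by
    filter_upwards [eventually_mem_admissible hV.isOpen hZV (cone M)] with Z' hZ'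
    have h0 : (absSq M Z' : ℂ) ≠ 0 := by simpa using (absSq_pos M hZ'.1).ne'
    have h5 : I / 2 * (2 * (absSq M Z' : ℂ)) = I * absSq M Z' := by ring
    rw [lift, (hc₀ Z' V hZ'.1 hV hZ'.2).2, bC_self_cconj_eq, h5, zpow_natCast]
    simp only [hH]
    rw [mul_pow]
    field_simp
  have hline := hasDerivAt_line (v := ((v, 0) : CplxSpace n × CplxSpace n)) hHd
  have hderiv : fderiv ℂ H (Z, cconj Z) (v, 0) = (1 / 2) * (I ^ j)⁻¹ *
      fderiv ℂ (liftSum M G j) (0, (Z, cconj Z)) (0, (v, 0)) :=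
    hline.unique (((fderiv_liftSum_slice hG hV hZV (v, 0)).add_const c₀).const_mul _)
  rw [raising, del_eq hZ hHd hf hv, hderiv, zpow_neg, zpow_natCast]

theorem lowering_lift_eq_raising_lift {m : ℕ}
    (hF : IsAlmostHolModularForm M (2 * ((m + 2 : ℕ) : ℤ) + 2 - (n : ℤ)) F) {Z v : CplxSpace n}
    (hZ : Z ∈ regularSet M F) (hv : v ∈ tangent M Z) :
    lowering M (lift M (m + 2) F) Z v = -(1 / (2 * (Real.pi : ℂ))) *
      raising M (m : ℤ) (lift M m (maassLower M F)) Z v := by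
  have hI := hF.liftInput
  have hI' := hF.liftInput_lower
  have hreg := xMean_eq_zero_of_mem_regularSet hZ
  obtain ⟨V, hZV, hV⟩ := exists_isAdmissible hI (m + 2) hZ.1 hreg
  obtain ⟨V', hZV', hV'⟩ := exists_isAdmissible hI' m hZ.1 fun l hl h y hy =>
    xMean_maassLower_eq_zero hI l (hreg l hl h) hy
  rw [lowering_lift hI _ hV hZ.1 hZV hv, raising_lift hI' _ hV' hZ.1 hZV' hv,
    fderiv_liftSum_eq hF hZ.1 hV hV' hZV hZV' hreg hv, bC_self_cconj_eq]
  have h0 : (absSq M Z : ℂ) ≠ 0 := by simpa using (absSq_pos M hZ.1).ne'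
  have hpi : (Real.pi : ℂ) ≠ 0 := by simp [Real.pi_ne_zero]
  have hI2 : (I : ℂ) ^ (m + 2) = -I ^ m := by rw [pow_add, I_sq]; ring
  have hIm : (I : ℂ) ^ m ≠ 0 := pow_ne_zero _ I_ne_zero
  rw [mul_pow, hI2]
  field_simp
  ring

end Section

end ThetaLift

theorem mainTheorem2 {n : ℕ} (M : ThetaLift.EvenLattice n) (k : ℕ) (hk : 2 ≤ k)
    (F : UpperHalfPlane → M.Disc → ℂ)
    (hF : ThetaLift.IsAlmostHolModularForm M (2 * (k : ℤ) + 2 - (n : ℤ)) F) :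
    -- the regularized integrals that define both lifts exist
    (∀ Z ∈ ThetaLift.regularSet M F,
      (∃ c, ThetaLift.IsRegIntegral (ThetaLift.liftIntegrand M k F Z) c) ∧
      (∃ c, ThetaLift.IsRegIntegral
        (ThetaLift.liftIntegrand M (k - 2) (ThetaLift.maassLower M F) Z) c)) ∧
    -- both lifts are smooth sections of the line bundles on which the operators act
    ThetaLift.IsSmoothSection (k : ℤ) (ThetaLift.regularSet M F) (ThetaLift.lift M k F) ∧
    ThetaLift.IsSmoothSection ((k : ℤ) - 2) (ThetaLift.regularSet M F)
      (ThetaLift.lift M (k - 2) (ThetaLift.maassLower M F)) ∧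
    -- the identity of sections
    ∀ Z ∈ ThetaLift.regularSet M F, ∀ v ∈ ThetaLift.tangent M Z,
      ThetaLift.lowering M (ThetaLift.lift M k F) Z v =
        -(1 / (2 * (Real.pi : ℂ))) *
          ThetaLift.raising M ((k : ℤ) - 2)
            (ThetaLift.lift M (k - 2) (ThetaLift.maassLower M F)) Z v := by
  obtain ⟨m, rfl⟩ := Nat.exists_eq_add_of_le' hk
  have hI := hF.liftInput
  have hI' := hF.liftInput_lower
  have hreg := fun Z (hZ : Z ∈ ThetaLift.regularSet M F) =>
    ThetaLift.xMean_eq_zero_of_mem_regularSet hZ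
  have hreg' : ∀ Z ∈ ThetaLift.regularSet M F, ∀ l : M.dual, l ≠ 0 →
      M.bC (ThetaLift.toCplx (l : ThetaLift.RealSpace n)) Z = 0 → ∀ y : ℝ, 0 < y →
      ThetaLift.xMean (ThetaLift.twist M (ThetaLift.maassLower M F) l) y = 0 :=
    fun Z hZ l hl h y hy => ThetaLift.xMean_maassLower_eq_zero hI l (hreg Z hZ l hl h) hy
  have hcone : ThetaLift.regularSet M F ⊆ ThetaLift.cone M := fun Z hZ => hZ.1
  have hm : ((m + 2 : ℕ) : ℤ) - 2 = m := by push_cast; ring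
  rw [hm, Nat.add_sub_cancel]
  refine ⟨fun Z hZ => ⟨?_, ?_⟩,
    ThetaLift.isSmoothSection_lift hI (m + 2) hcone
      (fun Z hZ c hc => ThetaLift.smul_mem_regularSet hZ hc) hreg,
    ThetaLift.isSmoothSection_lift hI' m hcone
      (fun Z hZ c hc => ThetaLift.smul_mem_regularSet hZ hc) hreg',
    fun Z hZ v hv => ThetaLift.lowering_lift_eq_raising_lift hF hZ hv⟩
  · obtain ⟨V, hZV, hV⟩ := ThetaLift.exists_isAdmissible hI (m + 2) hZ.1 (hreg Z hZ)
    obtain ⟨c, hc⟩ := ThetaLift.exists_regIntegral_eq hI (m + 2)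
    exact ⟨_, (hc Z V hZ.1 hV hZV).1⟩
  · obtain ⟨V, hZV, hV⟩ := ThetaLift.exists_isAdmissible hI' m hZ.1 (hreg' Z hZ)
    obtain ⟨c, hc⟩ := ThetaLift.exists_regIntegral_eq hI' m
    exact ⟨_, (hc Z V hZ.1 hV hZV).1⟩
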